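/- **Setting.** $G$ is a simple undirected graph with vertex set $\{0,\dots,n-1\}$ and edge weights $wt:E(G)\to\mathbb R$. An insert-only stream $\mathcal S$ for $G$ lists every edge of $G$ exactly once, in arbitrary order, together with its weight. A $k$-matching is a set of exactly $k$ edges of $G$, no two of which share an endpoint; its weight is the sum of the weights of its edges, and a maximum weighted $k$-matching is a $k$-matching whose weight is largest among all $k$-matchings of $G$. Throughout, $k\ge 1$. **Reduced compact subgraph.** For an edge $e=[u,v]$ with $u<v$ let $\beta(e)=(wt(e),u,v)$; edges are compared ("heavier") by the lexicographic order of their $\beta$-values. Let $f:\{0,\dots,n-1\}\to\{0,\dots,4k^2-1\}$ and $V_i=f^{-1}(i)$. For a set $H$ of edges, let $\mathcal C_f(H)$ be the set of edges of $H$ that join two distinct classes $V_i,V_j$ and are the heaviest edge of $H$ between these two classes. Let $\mathcal R'_f(H)$ be the set of the edges of $\mathcal C_f(H)$ that are, for both of their classes, among the $2k$ heaviest edges of $\mathcal C_f(H)$ incident to that class, and let $\mathcal R_f(H)$ be the set of the $4k^2$ heaviest edges of $\mathcal R'_f(H)$ (all of them if there are fewer). **The algorithm w-Match$_{ins}$.**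 Let $t=\max(0,\lceil\log_2(1/\epsilon)\rceil)$. Pick $t$ hash functions independently and uniformly at random from a universal family of functions $\{0,\dots,n-1\}\to\{0,\dots,4k^2-1\}$ (a finite family such that, for any $x\ne y$, a random member $h$ has $h(x)=h(y)$ with probability at most $1/(4k^2)$). On a stream $e_1,e_2,\dots$ maintain for each of them, $f$, the graph given by $G^f_0=\emptyset$ and $G^f_s=\mathcal R_f\big(G^f_{\hat s}\cup\{e_{\hat s+1},\dots,e_s\}\big)$, where $\hat s$ is the largest multiple of $4k^2$ smaller than $s$. At the end of the stream (length $s$), construct for each $f$ a maximum weighted $k$-matching of $G^f_s$, if this graph has $k$-matchings; return one of largest weight among those constructed, or report that $G$ has no $k$-matching if none was constructed. **Machine model.** A randomized random access machine with a one-pass, read-only input stream and a write-only output. It has finitely many registers and an indirectly addressed memory, for words (natural numbers) and for edge weights (real numbers, which can be moved, added and compared). Reading the next edge, arithmetic on words, and drawing a uniformly random element of $\{0,\dots,m-1\}$ for a word $m$ each take one step. Every word stored is at most $(n+k+1)^{C}$, i.e. it has $O(\log(n+k))$ bits. Space is the number of registers plus memory cells, and update time is the number of steps between reading an edge and attempting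 to read the next one. **Theorem.** For every fixed $\epsilon>0$ there are a program for this machine, and a constant $C$, both depending only on $\epsilon$, such that for all $n$ and all $k\ge1$ there is a universal family $\mathcal H$ as above with the following properties for every weighted graph $G$ on $\{0,\dots,n-1\}$ and every insert-only stream $\mathcal S$ for $G$. Given $n$, $k$ and $\mathcal S$, the program always halts; its answer is distributed exactly as that of w-Match$_{ins}(\mathcal S,k)$ with hash functions from $\mathcal H$ (for some rule for breaking ties between matchings of equal weight); and, whatever the random choices are, it uses space at most $Ck^2$, has update time at most $C$, and stores only words that are at most $(n+k+1)^C$. Moreover, 1. if $G$ has $k$-matchings, then the program returns a maximum weighted $k$-matching of $G$ with probability at least $1-\epsilon$; 2. if $G$ has no $k$-matching, then the program always reports that there is none. -/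

import Mathlib

namespace KMatch

/-! ## Weighted graphs, matchings, insert-only streams -/

section Matchings

variable {V : Type*}

/-- `M` is a set of exactly `k` edges from `E`, no two of which share an endpoint. -/
def IsKMatching (E : Set (Sym2 V)) (k : ℕ) (M : Finset (Sym2 V)) : Prop :=
  (∀ e ∈ M, e ∈ E) ∧ (∀ e ∈ M, ∀ e' ∈ M, e ≠ e' → ∀ v : V, ¬ (v ∈ e ∧ v ∈ e')) ∧ M.card = k

/-- The weight of a set of edges. -/
def weight (wt : Sym2 V → ℝ) (M : Finset (Sym2 V)) : ℝ := ∑ e ∈ M, wt e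

/-- `M` is a `k`-matching in the edge set `E` of maximum weight among all `k`-matchings in `E`. -/
def IsMaxWeightedKMatching (E : Set (Sym2 V)) (wt : Sym2 V → ℝ) (k : ℕ) (M : Finset (Sym2 V)) :
    Prop :=
  IsKMatching E k M ∧ ∀ M', IsKMatching E k M' → weight wt M' ≤ weight wt M

/-- The answer to an instance: `some M` returns the edge set `M`, and
`none` reports that no `k`-matching exists. -/
abbrev Answer (V : Type*) := Option (Finset (Sym2 V))

end Matchings

/-- One element of an insert-only stream: insert the edge `[fst, snd]` with the given weight.
The two endpoints come in an arbitrary order. -/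
structure Insertion (n : ℕ) where
  fst : Fin n
  snd : Fin n
  weight : ℝ

/-- The (undirected) edge that is inserted. -/
def Insertion.edge {n : ℕ} (x : Insertion n) : Sym2 (Fin n) := s(x.fst, x.snd)

/-- `S` is an insert-only stream for the weighted graph `(G, wt)` with vertex set `{0, …, n-1}`:
it inserts every edge of `G` exactly once, together with its weight, and nothing else.
(Only the values of `wt` on the edges of `G` matter.) -/
structure IsInsertStream {n : ℕ} (S : List (Insertion n)) (G : SimpleGraph (Fin n))
    (wt : Sym2 (Fin n) → ℝ) : Prop where
  nodup : (S.map Insertion.edge).Nodup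
  mem_iff : ∀ e, e ∈ S.map Insertion.edge ↔ e ∈ G.edgeSet
  weight_eq : ∀ x ∈ S, x.weight = wt x.edge

/-! ## Universal hashing -/

/-- A finite family `H` of functions to `{0, …, r-1}` is universal: for distinct `x`, `y`, a
uniformly random member of the family satisfies `h x = h y` with probability at most `1 / r`. -/
def IsUniversal {ι U : Type*} [Fintype ι] {r : ℕ} (H : ι → U → Fin r) : Prop :=
  ∀ x y : U, x ≠ y →
    (Nat.card {i : ι // H i x = H i y} : ℝ) ≤ (Fintype.card ι : ℝ) / (r : ℝ)

/-! ## The algorithm `w-Match_ins` -/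

section Algorithm

open Classical

variable {n : ℕ}

/-- `β(e) = (wt(e), u, v)` for `e = [u, v]` with `u < v`; values are compared lexicographically. -/
noncomputable def beta (wt : Sym2 (Fin n) → ℝ) (e : Sym2 (Fin n)) : ℝ ×ₗ (Fin n ×ₗ Fin n) :=
  toLex (wt e, toLex (e.inf, e.sup))

/-- `e` is among the `m` heaviest edges of `E`: fewer than `m` edges of `E` have a larger
`β`-value. -/
def AmongHeaviest (wt : Sym2 (Fin n) → ℝ) (m : ℕ) (E : Finset (Sym2 (Fin n)))
    (e : Sym2 (Fin n)) : Prop :=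
  e ∈ E ∧ (E.filter fun e' => beta wt e < beta wt e').card < m

/-- The compact subgraph of `H` under the hash function `f`: the edges joining two distinct
classes of the partition given by `f` that have the largest `β`-value among all edges of `H`
between these two classes. The unordered pair of the classes of `e` is `e.map f`. -/
noncomputable def compactSubgraph {r : ℕ} (wt : Sym2 (Fin n) → ℝ) (f : Fin n → Fin r)
    (H : Finset (Sym2 (Fin n))) : Finset (Sym2 (Fin n)) :=
  H.filter fun e => ¬ (e.map f).IsDiag ∧
    ∀ e' ∈ H, e'.map f = e.map f → beta wt e' ≤ beta wt e

/-- First reduction: keep the edges of the compact subgraph that are, for both of their classes,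
among the `2k` heaviest edges of the compact subgraph incident to the class. -/
noncomputable def degreeReduced {r : ℕ} (wt : Sym2 (Fin n) → ℝ) (k : ℕ) (f : Fin n → Fin r)
    (H : Finset (Sym2 (Fin n))) : Finset (Sym2 (Fin n)) :=
  (compactSubgraph wt f H).filter fun e => ∀ i ∈ e.map f,
    AmongHeaviest wt (2 * k) ((compactSubgraph wt f H).filter fun e' => i ∈ e'.map f) e

/-- The reduced compact subgraph of `H` under `f`: keep the `4k²` heaviest of the edges that
survive the first reduction. -/
noncomputable def reducedCompact {r : ℕ} (wt : Sym2 (Fin n) → ℝ) (k : ℕ) (f : Fin n → Fin r)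
    (H : Finset (Sym2 (Fin n))) : Finset (Sym2 (Fin n)) :=
  (degreeReduced wt k f H).filter fun e =>
    AmongHeaviest wt (4 * k ^ 2) (degreeReduced wt k f H) e

/-- The largest multiple of `4k²` that is strictly smaller than `s` (for `s > 0`). -/
def lastBatch (k s : ℕ) : ℕ := 4 * k ^ 2 * ((s - 1) / (4 * k ^ 2))

theorem lastBatch_lt {k s : ℕ} (hs : s ≠ 0) : lastBatch k s < s := by
  have := Nat.mul_div_le (s - 1) (4 * k ^ 2)
  unfold lastBatch
  omega

/-- The graph that the algorithm maintains for the hash function `f`, after the first `s` edges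
`e₁, …, eₛ` of the stream: the empty graph for `s = 0`, and otherwise the reduced compact subgraph
of the union of the graph kept at the last batch end `ŝ` and the edges `e_{ŝ+1}, …, eₛ`. -/
noncomputable def sketch {r : ℕ} (wt : Sym2 (Fin n) → ℝ) (k : ℕ) (f : Fin n → Fin r)
    (es : List (Sym2 (Fin n))) (s : ℕ) : Finset (Sym2 (Fin n)) :=
  if _hs : s = 0 then ∅
  else
    reducedCompact wt k f
      (sketch wt k f es (lastBatch k s) ∪ ((es.take s).drop (lastBatch k s)).toFinset)
  termination_by s
  decreasing_by exact lastBatch_lt _hs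

/-- `w-Match_ins`, run on the stream `S` with the hash functions `fs`, may return `a`.
For each hash function, it constructs a maximum weighted `k`-matching (if there is a `k`-matching)
in the graph maintained at the end of the stream, and it returns one of largest weight among those
constructed, or reports that there is none if none was constructed. (Ties are broken
arbitrarily.) -/
def WMatchInsReturns {t r : ℕ} (wt : Sym2 (Fin n) → ℝ) (k : ℕ) (S : List (Insertion n))
    (fs : Fin t → Fin n → Fin r) : Answer (Fin n) → Prop
  | none => ∀ i M, ¬ IsKMatching
      (sketch wt k (fs i) (S.map Insertion.edge) S.length : Set (Sym2 (Fin n))) k M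
  | some M =>
      (∃ i, IsMaxWeightedKMatching
        (sketch wt k (fs i) (S.map Insertion.edge) S.length : Set (Sym2 (Fin n))) wt k M) ∧
      ∀ i M', IsMaxWeightedKMatching
        (sketch wt k (fs i) (S.map Insertion.edge) S.length : Set (Sym2 (Fin n))) wt k M' →
        weight wt M' ≤ weight wt M

/-- The number `⌈log₂ (1/ε)⌉` of hash functions. -/
noncomputable def numHash (ε : ℝ) : ℕ := ⌈Real.logb 2 (1 / ε)⌉₊

end Algorithm

/-! ## The machine model: a randomized random access machine reading a stream

The machine has finitely many word registers and weight registers, a word memory and a weight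
memory, both with indirect addressing. Words are natural numbers, weights are real numbers; weights
can only be moved, added and compared. The edges of the stream can be read only one after another
and only once, and the output is write-only. Every instruction costs one step. -/

/-- Arithmetic on words. -/
inductive Arith
  | add
  | sub
  | mul
  | div
  | mod

/-- The value of an arithmetic operation (subtraction is truncated). -/
def Arith.eval : Arith → ℕ → ℕ → ℕ
  | .add, x, y => x + y
  | .sub, x, y => x - y
  | .mul, x, y => x * y
  | .div, x, y => x / y
  | .mod, x, y => x % y

/-- Instructions, over control labels `L`, word registers `R` and weight registers `W`. The
trailing labels say where the control goes next. -/
inductive Instr (L R W : Type)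
  /-- `d := a` for a fixed number `a`. -/
  | const (d : R) (a : ℕ) (next : L)
  /-- `d := x`. -/
  | move (d x : R) (next : L)
  /-- `d := x op y`. -/
  | arith (op : Arith) (d x y : R) (next : L)
  /-- `d := memory[x]`. -/
  | load (d x : R) (next : L)
  /-- `memory[x] := y`. -/
  | store (x y : R) (next : L)
  /-- Branch on `x < y`. -/
  | branchLT (x y : R) (yes no : L)
  /-- `d := x` for weights. -/
  | wmove (d x : W) (next : L)
  /-- `d := x + y` for weights. -/
  | wadd (d x y : W) (next : L)
  /-- `d := weightMemory[x]`. -/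
  | wload (d : W) (x : R) (next : L)
  /-- `weightMemory[x] := y`. -/
  | wstore (x : R) (y : W) (next : L)
  /-- Branch on `x < y` for weights. -/
  | wbranchLT (x y : W) (yes no : L)
  /-- `d :=` a uniformly random element of `{0, …, x-1}` (and `0` if `x = 0`). -/
  | random (d x : R) (next : L)
  /-- Read the next edge of the stream into `u`, `v`, `w`, or go to `atEnd` if there is none. -/
  | read (u v : R) (w : W) (next atEnd : L)
  /-- Add the edge `[u, v]` to the output. -/
  | emit (u v : R) (next : L)
  /-- Halt, returning the set of edges in the output. -/
  | halt
  /-- Halt, reporting that there is no `k`-matching. -/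
  | haltNone

/-- A program: finitely many labelled instructions over finitely many registers. The numbers `n`
(of vertices) and `k` are given in two of the word registers. -/
structure Program where
  Label : Type
  Reg : Type
  WReg : Type
  [labelFintype : Fintype Label]
  [regFintype : Fintype Reg]
  [wregFintype : Fintype WReg]
  [regDecEq : DecidableEq Reg]
  [wregDecEq : DecidableEq WReg]
  code : Label → Instr Label Reg WReg
  entry : Label
  nReg : Reg
  kReg : Reg

attribute [instance] Program.labelFintype Program.regFintype Program.wregFintype
  Program.regDecEq Program.wregDecEq

namespace Program

variable (P : Program)

/-- A configuration of the machine. The component `timer` cannot be accessed by the program; it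
is `some t` when at least one edge has been read, the end of the stream has not yet been
encountered, and `t` steps have been performed since the last edge was read. -/
structure Config where
  pc : P.Label
  reg : P.Reg → ℕ
  wreg : P.WReg → ℝ
  mem : ℕ → ℕ
  wmem : ℕ → ℝ
  stream : List (ℕ × ℕ × ℝ)
  output : Finset (Sym2 ℕ)
  timer : Option ℕ

variable {P}

/-- One more step has been performed, and the control goes to the label `l`. -/
def Config.goto (c : P.Config) (l : P.Label) : P.Config :=
  { c with pc := l, timer := c.timer.map (· + 1) }

/-- Write a word register. -/
def Config.setReg (c : P.Config) (d : P.Reg) (x : ℕ) : P.Config :=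
  { c with reg := Function.update c.reg d x }

/-- Write a weight register. -/
def Config.setWReg (c : P.Config) (d : P.WReg) (x : ℝ) : P.Config :=
  { c with wreg := Function.update c.wreg d x }

/-- Uniform distribution on `{0, …, m-1}` (the point mass at `0` if `m = 0`). -/
noncomputable def uniformBelow : ℕ → PMF ℕ
  | 0 => PMF.pure 0
  | m + 1 => (PMF.uniformOfFintype (Fin (m + 1))).map Fin.val

/-- Reading from the stream. -/
def Config.readStream (c : P.Config) (u v : P.Reg) (w : P.WReg) (next atEnd : P.Label) :
    P.Config :=
  match c.stream with
  | [] => { c with pc := atEnd, timer := none }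
  | (a, b, x) :: rest =>
      { ((c.setReg u a).setReg v b).setWReg w x with
        pc := next, stream := rest, timer := some 0 }

open Classical in
/-- The distribution of the next configuration; halted configurations do not change. -/
noncomputable def step (c : P.Config) : PMF P.Config :=
  match P.code c.pc with
  | .const d a l => PMF.pure ((c.setReg d a).goto l)
  | .move d x l => PMF.pure ((c.setReg d (c.reg x)).goto l)
  | .arith op d x y l => PMF.pure ((c.setReg d (op.eval (c.reg x) (c.reg y))).goto l)
  | .load d x l => PMF.pure ((c.setReg d (c.mem (c.reg x))).goto l)
  | .store x y l =>
      PMF.pure (Config.goto { c with mem := Function.update c.mem (c.reg x) (c.reg y) } l)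
  | .branchLT x y yes no => PMF.pure (c.goto (if c.reg x < c.reg y then yes else no))
  | .wmove d x l => PMF.pure ((c.setWReg d (c.wreg x)).goto l)
  | .wadd d x y l => PMF.pure ((c.setWReg d (c.wreg x + c.wreg y)).goto l)
  | .wload d x l => PMF.pure ((c.setWReg d (c.wmem (c.reg x))).goto l)
  | .wstore x y l =>
      PMF.pure (Config.goto { c with wmem := Function.update c.wmem (c.reg x) (c.wreg y) } l)
  | .wbranchLT x y yes no => PMF.pure (c.goto (if c.wreg x < c.wreg y then yes else no))
  | .random d x l => (uniformBelow (c.reg x)).map fun a => (c.setReg d a).goto l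
  | .read u v w next atEnd => PMF.pure (c.readStream u v w next atEnd)
  | .emit u v l =>
      PMF.pure (Config.goto { c with output := insert s(c.reg u, c.reg v) c.output } l)
  | .halt => PMF.pure c
  | .haltNone => PMF.pure c

/-- The answer of a halted configuration; `none` if the machine has not halted. -/
def Config.answer (c : P.Config) : Option (Answer ℕ) :=
  match P.code c.pc with
  | .halt => some (some c.output)
  | .haltNone => some none
  | _ => none

variable (P)

/-- The initial configuration: all registers and all of the memory are zero, except for the two
registers that hold `n` and `k`. -/
def init {n : ℕ} (k : ℕ) (S : List (Insertion n)) : P.Config where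
  pc := P.entry
  reg := Function.update (Function.update (fun _ => 0) P.nReg n) P.kReg k
  wreg := fun _ => 0
  mem := fun _ => 0
  wmem := fun _ => 0
  stream := S.map fun x => (x.fst.val, x.snd.val, x.weight)
  output := ∅
  timer := none

/-- The distribution of the configuration after `T` steps. -/
noncomputable def run {n : ℕ} (k : ℕ) (S : List (Insertion n)) : ℕ → PMF P.Config
  | 0 => PMF.pure (P.init k S)
  | T + 1 => (run k S T).bind step

/-- The configurations that occur, for some outcome of the random choices, at any time. -/
def Reachable {n : ℕ} (k : ℕ) (S : List (Insertion n)) (c : P.Config) : Prop :=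
  ∃ T, c ∈ (P.run k S T).support

variable {P}

/-- The cell of the word memory accessed by the next instruction, if any. -/
def Config.wordCell (c : P.Config) : Option ℕ :=
  match P.code c.pc with
  | .load _ x _ => some (c.reg x)
  | .store x _ _ => some (c.reg x)
  | _ => none

/-- The cell of the weight memory accessed by the next instruction, if any. -/
def Config.weightCell (c : P.Config) : Option ℕ :=
  match P.code c.pc with
  | .wload _ x _ => some (c.reg x)
  | .wstore x _ _ => some (c.reg x)
  | _ => none

variable (P)

/-- Whatever the random choices are, the program uses at most `s` units of space: registers, plus
initial segments of the two memories containing all accessed cells. -/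
def SpaceAtMost {n : ℕ} (k : ℕ) (S : List (Insertion n)) (s : ℕ) : Prop :=
  ∃ m m' : ℕ, Fintype.card P.Reg + Fintype.card P.WReg + m + m' ≤ s ∧
    ∀ c, P.Reachable k S c →
      (∀ a ∈ c.wordCell, a < m) ∧ (∀ a ∈ c.weightCell, a < m')

/-- Whatever the random choices are, all words are at most `B` at any time. -/
def WordsAtMost {n : ℕ} (k : ℕ) (S : List (Insertion n)) (B : ℕ) : Prop :=
  ∀ c, P.Reachable k S c → (∀ r, c.reg r ≤ B) ∧ ∀ a, c.mem a ≤ B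

/-- Whatever the random choices are, after reading an edge the program always performs at most
`t` steps before it attempts to read the next edge (or halts). -/
def UpdateTimeAtMost {n : ℕ} (k : ℕ) (S : List (Insertion n)) (t : ℕ) : Prop :=
  ∀ c, P.Reachable k S c → ∀ a ∈ c.timer, a ≤ t

/-- Whatever the random choices are, the program halts, and `μ` is the distribution of its
answer. -/
def HasAnswerLaw {n : ℕ} (k : ℕ) (S : List (Insertion n)) (μ : PMF (Answer (Fin n))) : Prop :=
  ∃ T, (P.run k S T).map Config.answer =
    μ.map fun a => some (a.map fun M => M.image (Sym2.map Fin.val))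

end Program

end KMatch

open KMatch

set_option linter.constructorNameAsVariable false

namespace KMatch

/-! ## A structured language with arrays, a checked semantics and step counts -/

/-! Why the answer is right. Fix a maximum weighted `k`-matching. It has at most `2k` endpoints,
hence at most `2k²` unordered pairs of endpoints, and a random member of the family identifies a
given pair with probability at most `1/(4k²)`. So one hash function separates all endpoints with
probability at least `1/2`, and all `t` independent ones fail with probability at most `2⁻ᵗ ≤ ε`
(`two_mul_card_bad_le`, `uniform_ge`). The family consists of the maps `x ↦ ((a x + b) mod p) mod
4k²` with `0 < a < p` and `b < p`, for a prime `p > n` (`card_collisions_le`).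

If a function separates the endpoints, the matching is rainbow: no class meets two of its edges. A
rainbow matching is carried through the stream by exchange (`exists_reducedCompact`,
`Rainbow.exchange`). An edge lost in a reduction is replaced by the heaviest edge of the compact
subgraph that avoids the at most `2k - 2` classes of the other edges. Every edge heavier than the
replacement meets one of these classes. Hence, at each of its own classes, fewer than `2k` edges are
heavier; and at most `(2k - 2) * 2k < 4k²` survivors of the first reduction are heavier. So the
replacement survives both reductions, and the final graph contains a `k`-matching that is at least
as heavy as the original. All kept graphs are subgraphs of `G`, so nothing heavier can be returned,
and nothing at all if `G` has no `k`-matching.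

Why the machine is fast. A batch of `4k²` edges is reduced for all `t` functions in `O(t k²)` steps:
incidence lists for the classes, a table for the heaviest edge between two classes, and
deterministic linear-time selection of the heaviest elements (`wp_selectC`, `wp_reduceC`,
`wp_batchC`). To bound the update time in the worst case, this work is spread over the next batch.
There are two buffers; one is filled while the other is reduced, a constant number of steps per edge
(`steps_slice`, `steps_store`, `steps_round`). The interleaving is harmless because the reduction
accesses neither the registers of the reader nor the buffer being filled (`Steps.agree`). The prime
is found before the first edge, and the exhaustive search for a matching comes after the last one;
neither counts as update time.

The parts are written in a small structured language and verified by weakest preconditions that also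
track steps, word sizes and indices. They are then turned into control flow graphs (`Ev.steps`) and
compiled with at most 15 machine instructions for each instruction of the graph (`Steps.sim`). All
randomness is a single word below `(p (p - 1))ᵗ`, whose `t` digits in base `p (p - 1)` are the
indices of the hash functions. The law of the answer is therefore the image of the uniform
distribution on the tuples of indices (`law_of_paths`, `uniformBelow_eq`). -/

/-- Word registers. -/
inductive V
  | n | k | r | k2 | tt | pp | nn | z
  | ru | rv | rc | cnt | bn
  | h | zr | zh | ha | hb | goff | gc | ne | i | e | c | ca | cb | x | nd | ns | m
  | sn | sm | fin | pv | g | si | sj | se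
  | len | run | dl | gs | gb | gi | go | q | y | ye | yn | rk | f0 | f1
  deriving DecidableEq

/-- The constructor index is injective into `Fin 100`; the number 100 is only some bound on the
number of constructors. -/
noncomputable instance : Fintype V :=
  @Fintype.ofFinite V (Finite.of_injective (fun v : V => (⟨v.ctorIdx, by cases v <;> decide⟩ : Fin 100))
    fun a b h => by
      have h' : a.ctorIdx = b.ctorIdx := congrArg Fin.val h
      rw [← V.ofNat_ctorIdx a, h', V.ofNat_ctorIdx])

/-- Weight registers. -/
inductive W
  | rw | w | sum | best | zero
  deriving DecidableEq

instance : Fintype W :=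
  ⟨{.rw, .w, .sum, .best, .zero}, fun x => by cases x <;> decide⟩

/-- Arrays; each has a word component and a weight component. -/
inductive Ar
  | buf (p : Bool) | G | gc | E | ca | cb | ct | hd | nx | S | best | A | T | U | sel | res
  deriving DecidableEq, Fintype

/-- The data that a program works on. -/
structure St where
  reg : V → ℕ
  wreg : W → ℝ
  arr : Ar → ℕ → ℕ
  warr : Ar → ℕ → ℝ
  out : Finset (Sym2 ℕ)

namespace St

def setR (s : St) (d : V) (x : ℕ) : St := { s with reg := Function.update s.reg d x }
def setW (s : St) (d : W) (x : ℝ) : St := { s with wreg := Function.update s.wreg d x }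
def setA (s : St) (a : Ar) (i x : ℕ) : St :=
  { s with arr := Function.update s.arr a (Function.update (s.arr a) i x) }
def setWA (s : St) (a : Ar) (i : ℕ) (x : ℝ) : St :=
  { s with warr := Function.update s.warr a (Function.update (s.warr a) i x) }

variable (s : St)

@[simp] theorem setR_reg (d : V) (x : ℕ) (y : V) :
    (s.setR d x).reg y = if y = d then x else s.reg y := by simp [setR, Function.update_apply]
@[simp] theorem setR_wreg (d : V) (x : ℕ) : (s.setR d x).wreg = s.wreg := rfl
@[simp] theorem setR_arr (d : V) (x : ℕ) : (s.setR d x).arr = s.arr := rfl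
@[simp] theorem setR_warr (d : V) (x : ℕ) : (s.setR d x).warr = s.warr := rfl
@[simp] theorem setR_out (d : V) (x : ℕ) : (s.setR d x).out = s.out := rfl
@[simp] theorem setW_reg (d : W) (x : ℝ) : (s.setW d x).reg = s.reg := rfl
@[simp] theorem setW_wreg (d : W) (x : ℝ) (y : W) :
    (s.setW d x).wreg y = if y = d then x else s.wreg y := by simp [setW, Function.update_apply]
@[simp] theorem setW_arr (d : W) (x : ℝ) : (s.setW d x).arr = s.arr := rfl
@[simp] theorem setW_warr (d : W) (x : ℝ) : (s.setW d x).warr = s.warr := rfl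
@[simp] theorem setW_out (d : W) (x : ℝ) : (s.setW d x).out = s.out := rfl
@[simp] theorem setA_reg (a : Ar) (i x : ℕ) : (s.setA a i x).reg = s.reg := rfl
@[simp] theorem setA_wreg (a : Ar) (i x : ℕ) : (s.setA a i x).wreg = s.wreg := rfl
@[simp] theorem setA_arr (a : Ar) (i x : ℕ) (b : Ar) :
    (s.setA a i x).arr b = if b = a then Function.update (s.arr a) i x else s.arr b := by
  by_cases h : b = a
  · subst h; simp [setA]
  · simp [setA, h]
@[simp] theorem setA_warr (a : Ar) (i x : ℕ) : (s.setA a i x).warr = s.warr := rfl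
@[simp] theorem setA_out (a : Ar) (i x : ℕ) : (s.setA a i x).out = s.out := rfl
@[simp] theorem setWA_reg (a : Ar) (i : ℕ) (x : ℝ) : (s.setWA a i x).reg = s.reg := rfl
@[simp] theorem setWA_wreg (a : Ar) (i : ℕ) (x : ℝ) : (s.setWA a i x).wreg = s.wreg := rfl
@[simp] theorem setWA_arr (a : Ar) (i : ℕ) (x : ℝ) : (s.setWA a i x).arr = s.arr := rfl
@[simp] theorem setWA_warr (a : Ar) (i : ℕ) (x : ℝ) (b : Ar) :
    (s.setWA a i x).warr b = if b = a then Function.update (s.warr a) i x else s.warr b := by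
  by_cases h : b = a
  · subst h; simp [setWA]
  · simp [setWA, h]
@[simp] theorem setWA_out (a : Ar) (i : ℕ) (x : ℝ) : (s.setWA a i x).out = s.out := rfl

/-- The key of the edge stored at index `i` of the array `E`. -/
def key (i : ℕ) : ℝ ×ₗ ℕ := toLex (s.warr .E i, s.arr .E i)

@[simp] theorem setR_key (d : V) (x : ℕ) : (s.setR d x).key = s.key := rfl

end St

/-- Operands: a register or a small constant. -/
inductive Opd
  | r (x : V)
  | c (a : Fin 16)

def Opd.val (s : St) : Opd → ℕ
  | .r x => s.reg x
  | .c a => a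

@[simp] theorem Opd.val_r (s : St) (x : V) : (Opd.r x).val s = s.reg x := rfl
@[simp] theorem Opd.val_c (s : St) (a : Fin 16) : (Opd.c a).val s = a := rfl

/-- Operations. -/
inductive Op
  | set (d : V) (x : Opd)
  | big (d : V) (a : ℕ)
  | ar (op : Arith) (d : V) (x y : Opd)
  | ld (d : V) (a : Ar) (x : V)
  | st (a : Ar) (x : V) (y : Opd)
  | wset (d x : W)
  | wadd (d x y : W)
  | wld (d : W) (a : Ar) (x : V)
  | wst (a : Ar) (x : V) (y : W)
  | emit (u v : V)

/-- The effect of an operation. -/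
@[simp] def Op.eff : Op → St → St
  | .set d x, s => s.setR d (x.val s)
  | .big d a, s => s.setR d a
  | .ar op d x y, s => s.setR d (op.eval (x.val s) (y.val s))
  | .ld d a x, s => s.setR d (s.arr a (s.reg x))
  | .st a x y, s => s.setA a (s.reg x) (y.val s)
  | .wset d x, s => s.setW d (s.wreg x)
  | .wadd d x y, s => s.setW d (s.wreg x + s.wreg y)
  | .wld d a x, s => s.setW d (s.warr a (s.reg x))
  | .wst a x y, s => s.setWA a (s.reg x) (s.wreg y)
  | .emit u v, s => { s with out := insert s(s.reg u, s.reg v) s.out }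

/-- The condition under which an operation respects the bound `B` on words and the bound `M` on
indices. -/
@[simp] def Op.ok (B M : ℕ) : Op → St → Prop
  | .big _ a, _ => a ≤ B
  | .ar .add _ x y, s => x.val s + y.val s ≤ B
  | .ar .mul _ x y, s => x.val s * y.val s ≤ B
  | .ld _ _ x, s => s.reg x < M
  | .st _ x _, s => s.reg x < M
  | .wld _ _ x, s => s.reg x < M
  | .wst _ x _, s => s.reg x < M
  | _, _ => True

/-- Tests. -/
inductive Test
  | lt (x y : Opd)
  | eq (x y : Opd)
  | wlt (x y : W)
  | key (x y : V)
  | kle (x y : V)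

@[simp] def Test.holds : Test → St → Prop
  | .lt x y, s => x.val s < y.val s
  | .eq x y, s => x.val s = y.val s
  | .wlt x y, s => s.wreg x < s.wreg y
  | .key x y, s => s.key (s.reg x) < s.key (s.reg y)
  | .kle x y, s => s.key (s.reg x) ≤ s.key (s.reg y)

@[simp] def Test.ok (M : ℕ) : Test → St → Prop
  | .key x y, s | .kle x y, s => s.reg x < M ∧ s.reg y < M
  | _, _ => True

/-- Commands. -/
inductive Cmd
  | skip
  | op (o : Op)
  | seq (a b : Cmd)
  | ite (b : Test) (a c : Cmd)
  | loop (b : Test) (a : Cmd)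

/-- `Ev B M c s t s'`: the command `c`, started in `s`, ends in `s'` after `t` steps, without
violating the bounds `B` on words and `M` on indices. -/
inductive Ev (B M : ℕ) : Cmd → St → ℕ → St → Prop
  | skip (s) : Ev B M .skip s 0 s
  | op (o s) : o.ok B M s → Ev B M (.op o) s 1 (o.eff s)
  | seq {a b s t s' t' s''} : Ev B M a s t s' → Ev B M b s' t' s'' →
      Ev B M (.seq a b) s (t + t') s''
  | iteT {b a c s t s'} : b.ok M s → b.holds s → Ev B M a s t s' →
      Ev B M (.ite b a c) s (t + 1) s'
  | iteF {b a c s t s'} : b.ok M s → ¬ b.holds s → Ev B M c s t s' →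
      Ev B M (.ite b a c) s (t + 1) s'
  | loopF {b a s} : b.ok M s → ¬ b.holds s → Ev B M (.loop b a) s 1 s
  | loopT {b a s t s' t' s''} : b.ok M s → b.holds s → Ev B M a s t s' →
      Ev B M (.loop b a) s' t' s'' → Ev B M (.loop b a) s (t + t' + 1) s''

/-! ### Frames -/

namespace Op

/-- The write sets are Boolean functions, so that for a concrete command the claim that it leaves a
register or an array alone is settled by `rfl`. -/
def wr : Op → V → Bool
  | .set d _, v | .big d _, v | .ar _ d _ _, v | .ld d _ _, v => decide (v = d)
  | _, _ => false
def ww : Op → W → Bool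
  | .wset d _, v | .wadd d _ _, v | .wld d _ _, v => decide (v = d)
  | _, _ => false
def wa : Op → Ar → Bool
  | .st a _ _, b => decide (b = a)
  | _, _ => false
def wwa : Op → Ar → Bool
  | .wst a _ _, b => decide (b = a)
  | _, _ => false
def we : Op → Bool
  | .emit _ _ => true
  | _ => false

end Op

namespace Cmd

def wr : Cmd → V → Bool
  | .skip, _ => false
  | .op o, v => o.wr v
  | .seq a b, v | .ite _ a b, v => a.wr v || b.wr v
  | .loop _ a, v => a.wr v
def ww : Cmd → W → Bool
  | .skip, _ => false
  | .op o, v => o.ww v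
  | .seq a b, v | .ite _ a b, v => a.ww v || b.ww v
  | .loop _ a, v => a.ww v
def wa : Cmd → Ar → Bool
  | .skip, _ => false
  | .op o, v => o.wa v
  | .seq a b, v | .ite _ a b, v => a.wa v || b.wa v
  | .loop _ a, v => a.wa v
def wwa : Cmd → Ar → Bool
  | .skip, _ => false
  | .op o, v => o.wwa v
  | .seq a b, v | .ite _ a b, v => a.wwa v || b.wwa v
  | .loop _ a, v => a.wwa v
def we : Cmd → Bool
  | .skip => false
  | .op o => o.we
  | .seq a b | .ite _ a b => a.we || b.we
  | .loop _ a => a.we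

/-- Sequential composition of a list of commands. -/
def block : List Cmd → Cmd
  | [] => .skip
  | [c] => c
  | c :: l => .seq c (block l)

/-- `for i < n do body`. -/
def forLt (i : V) (n : Opd) (body : Cmd) : Cmd :=
  .seq (.op (.set i (.c 0)))
    (.loop (.lt (.r i) n) (.seq body (.op (.ar .add i (.r i) (.c 1)))))

end Cmd

/-- What the command `c` cannot write is the same in `s` and `s'`. -/
structure Fr (c : Cmd) (s s' : St) : Prop where
  reg : ∀ x, c.wr x = false → s'.reg x = s.reg x
  wreg : ∀ x, c.ww x = false → s'.wreg x = s.wreg x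
  arr : ∀ x, c.wa x = false → s'.arr x = s.arr x
  warr : ∀ x, c.wwa x = false → s'.warr x = s.warr x
  out : c.we = false → s'.out = s.out

namespace Fr

theorem refl (c : Cmd) (s : St) : Fr c s s := by constructor <;> intros <;> rfl

theorem trans {c : Cmd} {s s' s'' : St} (h : Fr c s s') (h' : Fr c s' s'') : Fr c s s'' where
  reg x hx := (h'.reg x hx).trans (h.reg x hx)
  wreg x hx := (h'.wreg x hx).trans (h.wreg x hx)
  arr x hx := (h'.arr x hx).trans (h.arr x hx)
  warr x hx := (h'.warr x hx).trans (h.warr x hx)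
  out hx := (h'.out hx).trans (h.out hx)

theorem mono {c c' : Cmd} {s s' : St} (h : Fr c s s') (h1 : ∀ x, c'.wr x = false → c.wr x = false)
    (h2 : ∀ x, c'.ww x = false → c.ww x = false) (h3 : ∀ x, c'.wa x = false → c.wa x = false)
    (h4 : ∀ x, c'.wwa x = false → c.wwa x = false) (h5 : c'.we = false → c.we = false) :
    Fr c' s s' :=
  ⟨fun x hx => h.reg x (h1 x hx), fun x hx => h.wreg x (h2 x hx), fun x hx => h.arr x (h3 x hx),
    fun x hx => h.warr x (h4 x hx), fun hx => h.out (h5 hx)⟩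

theorem seq_left {a b : Cmd} {s s' : St} (h : Fr a s s') : Fr (.seq a b) s s' := by
  apply h.mono <;> simp +contextual [Cmd.wr, Cmd.ww, Cmd.wa, Cmd.wwa, Cmd.we]
theorem seq_right {a b : Cmd} {s s' : St} (h : Fr b s s') : Fr (.seq a b) s s' := by
  apply h.mono <;> simp +contextual [Cmd.wr, Cmd.ww, Cmd.wa, Cmd.wwa, Cmd.we]
theorem ite_left {b : Test} {a c : Cmd} {s s' : St} (h : Fr a s s') : Fr (.ite b a c) s s' := by
  apply h.mono <;> simp +contextual [Cmd.wr, Cmd.ww, Cmd.wa, Cmd.wwa, Cmd.we]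
theorem ite_right {b : Test} {a c : Cmd} {s s' : St} (h : Fr c s s') : Fr (.ite b a c) s s' := by
  apply h.mono <;> simp +contextual [Cmd.wr, Cmd.ww, Cmd.wa, Cmd.wwa, Cmd.we]
theorem loop {b : Test} {a : Cmd} {s s' : St} (h : Fr a s s') : Fr (.loop b a) s s' := by
  apply h.mono <;> simp +contextual [Cmd.wr, Cmd.ww, Cmd.wa, Cmd.wwa, Cmd.we]

end Fr

theorem Op.frame (o : Op) (s : St) : Fr (.op o) s (o.eff s) := by
  constructor <;> intros <;> cases o <;>
    simp_all [Cmd.wr, Cmd.ww, Cmd.wa, Cmd.wwa, Cmd.we, Op.wr, Op.ww, Op.wa, Op.wwa, Op.we]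

/-- Since this holds for every run, the specifications below describe only what changes; whatever a
command cannot write is recovered from the frame. -/
theorem Ev.frame {B M : ℕ} {c : Cmd} {s s' : St} {t : ℕ} (h : Ev B M c s t s') : Fr c s s' := by
  induction h with
  | skip s => exact .refl _ _
  | op o s h => exact o.frame s
  | seq _ _ h1 h2 => exact h1.seq_left.trans h2.seq_right
  | iteT _ _ _ h => exact h.ite_left
  | iteF _ _ _ h => exact h.ite_right
  | loopF _ _ => exact .refl _ _
  | loopT _ _ _ _ h1 h2 => exact h1.loop.trans h2

/-! ### Weakest preconditions -/

/-- The command `c`, started in `s`, respects the bounds `B` and `M` and ends after `t` steps in a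
state `s'` with `Q t s'`. -/
def wp (B M : ℕ) (c : Cmd) (s : St) (Q : ℕ → St → Prop) : Prop := ∃ t s', Ev B M c s t s' ∧ Q t s'

section wp

variable {B M : ℕ} {s : St} {Q : ℕ → St → Prop}

/-- The frame is supplied to the new postcondition, so it never has to be part of an invariant. -/
theorem wp_mono {c : Cmd} {Q' : ℕ → St → Prop} (h : wp B M c s Q)
    (hQ : ∀ t s', Fr c s s' → Q t s' → Q' t s') : wp B M c s Q' := by
  obtain ⟨t, s', h, hq⟩ := h
  exact ⟨t, s', h, hQ _ _ h.frame hq⟩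

theorem wp_skip (h : Q 0 s) : wp B M .skip s Q := ⟨_, _, .skip s, h⟩

theorem wp_op {o : Op} (ho : o.ok B M s) (h : Q 1 (o.eff s)) : wp B M (.op o) s Q :=
  ⟨_, _, .op o s ho, h⟩

theorem wp_seq {a b : Cmd} (h : wp B M a s fun t s' => wp B M b s' fun t' s'' => Q (t + t') s'') :
    wp B M (.seq a b) s Q := by
  obtain ⟨t, s', h, t', s'', h', hq⟩ := h
  exact ⟨_, _, .seq h h', hq⟩

theorem wp_ite {b : Test} {a c : Cmd} (hb : b.ok M s)
    (h : b.holds s → wp B M a s fun t s' => Q (t + 1) s')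
    (h' : ¬ b.holds s → wp B M c s fun t s' => Q (t + 1) s') : wp B M (.ite b a c) s Q := by
  by_cases hs : b.holds s
  · obtain ⟨t, s', h, hq⟩ := h hs
    exact ⟨_, _, .iteT hb hs h, hq⟩
  · obtain ⟨t, s', h, hq⟩ := h' hs
    exact ⟨_, _, .iteF hb hs h, hq⟩

/-- In the form of equivalences these rules let `simp` compute the weakest precondition of loop-free
code. -/
theorem wp_skip_iff : wp B M .skip s Q ↔ Q 0 s :=
  ⟨fun ⟨_, _, h, hq⟩ => by cases h; exact hq, wp_skip⟩

theorem wp_op_iff {o : Op} : wp B M (.op o) s Q ↔ o.ok B M s ∧ Q 1 (o.eff s) :=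
  ⟨fun ⟨_, _, h, hq⟩ => by cases h with | op _ _ ho => exact ⟨ho, hq⟩, fun h => wp_op h.1 h.2⟩

theorem wp_seq_iff {a b : Cmd} :
    wp B M (.seq a b) s Q ↔ wp B M a s fun t s' => wp B M b s' fun t' s'' => Q (t + t') s'' :=
  ⟨fun ⟨_, _, h, hq⟩ => by cases h with | seq h1 h2 => exact ⟨_, _, h1, _, _, h2, hq⟩, wp_seq⟩

theorem wp_ite_iff {b : Test} {a c : Cmd} : wp B M (.ite b a c) s Q ↔ b.ok M s ∧
    (b.holds s → wp B M a s fun t s' => Q (t + 1) s') ∧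
    (¬ b.holds s → wp B M c s fun t s' => Q (t + 1) s') := by
  refine ⟨fun ⟨_, _, h, hq⟩ => ?_, fun h => wp_ite h.1 h.2.1 h.2.2⟩
  cases h with
  | iteT h1 h2 h3 => exact ⟨h1, fun _ => ⟨_, _, h3, hq⟩, fun h => absurd h2 h⟩
  | iteF h1 h2 h3 => exact ⟨h1, fun h => absurd h h2, fun _ => ⟨_, _, h3, hq⟩⟩

/-- Rule for loops with an invariant `I` and a potential `Φ` that pays for the steps. -/
theorem wp_loop {b : Test} {a : Cmd} (I : St → Prop) (Φ : St → ℕ) (hI : I s)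
    (hstep : ∀ s', Fr (.loop b a) s s' → I s' → b.ok M s' ∧
      (b.holds s' → wp B M a s' fun t s'' => I s'' ∧ Φ s'' + t + 1 ≤ Φ s'))
    (hQ : ∀ s' t, Fr (.loop b a) s s' → I s' → ¬ b.holds s' → t + Φ s' ≤ Φ s + 1 → Q t s') :
    wp B M (.loop b a) s Q := by
  -- The potential drops by at least one in each round, which gives termination as well. The extra
  -- `1` is the last, failing test.
  have key : ∀ N s', Φ s' = N → Fr (.loop b a) s s' → I s' → ∃ t s'', Ev B M (.loop b a) s' t s'' ∧
      Fr (.loop b a) s s'' ∧ I s'' ∧ ¬ b.holds s'' ∧ t + Φ s'' ≤ N + 1 := by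
    intro N
    induction N using Nat.strong_induction_on with
    | _ N ih =>
      intro s' hN hf hi
      obtain ⟨hok, hw⟩ := hstep s' hf hi
      by_cases hb : b.holds s'
      · obtain ⟨t, s'', hev, hi', ht⟩ := hw hb
        obtain ⟨t', s3, hev', hf', hi3, hb3, ht'⟩ := ih (Φ s'') (by omega) s'' rfl
          (hf.trans hev.frame.loop) hi'
        exact ⟨_, _, .loopT hok hb hev hev', hf', hi3, hb3, by omega⟩
      · exact ⟨_, _, .loopF hok hb, hf, hi, hb, by omega⟩
  obtain ⟨t, s', hev, hf, hi, hb, ht⟩ := key _ s rfl (.refl _ _) hI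
  exact ⟨t, s', hev, hQ s' t hf hi hb ht⟩

/-- Rule for `for` loops: `J j` holds before the `j`-th round, which takes at most `T j` steps. -/
theorem wp_forLt {i : V} {n : Opd} {body : Cmd} (N : ℕ) (J : ℕ → St → Prop) (T : ℕ → ℕ)
    (hi : body.wr i = false)
    (hn : ∀ x, n = .r x → x ≠ i ∧ body.wr x = false) (hN : n.val s = N) (hB : N ≤ B)
    (h0 : J 0 (s.setR i 0))
    (hstep : ∀ j s', j < N → s'.reg i = j → Fr (.forLt i n body) s s' → J j s' →
      wp B M body s' fun t s'' => t ≤ T j ∧ J (j + 1) (s''.setR i (j + 1)))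
    (hQ : ∀ s' t, J N s' → s'.reg i = N → Fr (.forLt i n body) s s' →
      t ≤ ∑ j ∈ Finset.range N, (T j + 2) + 2 → Q t s') :
    wp B M (.forLt i n body) s Q := by
  refine wp_seq (wp_op trivial ?_)
  have hfr0 : Fr (.forLt i n body) s (s.setR i 0) := (Op.frame (.set i (.c 0)) s).seq_left
  have hnn : ∀ s', Fr (.forLt i n body) s s' → n.val s' = N := by
    intro s' hf
    cases n with
    | c a => simpa using hN
    | r x =>
      have h1 := hn x rfl
      have h2 := hf.reg x (by simp [Cmd.forLt, Cmd.wr, Op.wr, h1.1, h1.2])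
      simpa [h2] using hN
  -- The potential is the cost of the rounds to come; the `2` in each summand is the test and the
  -- increment.
  refine wp_loop (fun s' => s'.reg i ≤ N ∧ J (s'.reg i) s')
    (fun s' => ∑ j ∈ Finset.Ico (s'.reg i) N, (T j + 2)) ⟨by simp, by simpa using h0⟩ ?_ ?_
  · rintro s' hf ⟨hle, hJ⟩
    refine ⟨trivial, fun hb => ?_⟩
    have hf' := hfr0.trans (hf.seq_right (a := .op (.set i (.c 0))))
    have hlt : s'.reg i < N := by
      have h : s'.reg i < n.val s' := hb
      rwa [hnn s' hf'] at h
    refine wp_seq (wp_mono (hstep _ s' hlt rfl hf' hJ) ?_)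
    rintro t s'' hfb ⟨ht, hJ'⟩
    have hi' : s''.reg i = s'.reg i := hfb.reg i hi
    refine wp_op ?_ ?_
    · simp [hi']; omega
    · have e : (Op.ar .add i (.r i) (.c 1)).eff s'' = s''.setR i (s'.reg i + 1) := by
        simp [Arith.eval, hi']
      rw [e]
      refine ⟨⟨by simpa using hlt, by simpa using hJ'⟩, ?_⟩
      rw [Finset.sum_eq_sum_Ico_succ_bot hlt]
      simp only [St.setR_reg, if_true]
      omega
  · rintro s' t hf ⟨hle, hJ⟩ hb ht
    have hf' := hfr0.trans (hf.seq_right (a := .op (.set i (.c 0))))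
    have hge : s'.reg i = N := by
      have h : ¬ s'.reg i < n.val s' := hb
      rw [hnn s' hf'] at h
      omega
    refine hQ s' _ (hge ▸ hJ) hge hf' ?_
    have : ∑ j ∈ Finset.Ico ((s.setR i 0).reg i) N, (T j + 2) = ∑ j ∈ Finset.range N, (T j + 2) := by
      simp only [St.setR_reg, if_true, ← Finset.range_eq_Ico]
    rw [← this]
    have h2 : (Op.set i (.c 0)).eff s = s.setR i 0 := rfl
    rw [h2] at ht
    omega

end wp


/-! ### Lists stored in arrays: copying and filtering -/

/-- The array `a` starts with the list `l`. -/
def Holds (a : ℕ → ℕ) (l : List ℕ) : Prop := ∀ i (h : i < l.length), a i = l[i]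

theorem Holds.nil (a : ℕ → ℕ) : Holds a [] := fun i h => by simp at h

theorem Holds.concat {a : ℕ → ℕ} {l : List ℕ} (h : Holds a l) {j : ℕ} (hj : j = l.length) (v : ℕ) :
    Holds (Function.update a j v) (l ++ [v]) := by
  intro i hi
  subst hj
  rcases Nat.lt_or_ge i l.length with h1 | h1
  · rw [List.getElem_append_left h1, Function.update_of_ne (by omega), h i h1]
  · have : i = l.length := by simp at hi; omega
    subst this
    simp

theorem Holds.take {a : ℕ → ℕ} {l : List ℕ} (h : Holds a l) (j : ℕ) : Holds a (l.take j) := by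
  intro i hi
  simp at hi
  rw [h i hi.2]
  simp

theorem Holds.take_succ {a : ℕ → ℕ} {l : List ℕ} (h : Holds a l) {j : ℕ} (hj : j < l.length) :
    l.take (j + 1) = l.take j ++ [a j] := by
  rw [h j hj, List.take_succ_eq_append_getElem hj]

theorem sum_const_range (N c : ℕ) : ∑ _j ∈ Finset.range N, c = N * c := by simp

open Cmd

/-- Copy the first `n` words of `src` to `dst`. -/
def cpy (src dst : Ar) (n : Opd) : Cmd :=
  forLt .f0 n (block [.op (.ld .f1 src .f0), .op (.st dst .f0 (.r .f1))])

section
variable {B M : ℕ} {s : St} {Q : ℕ → St → Prop}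

theorem wp_cpy {src dst : Ar} {n : Opd} {l : List ℕ} (hne : dst ≠ src) (hn : ∀ x, n = .r x → x ≠ .f0 ∧ x ≠ .f1)
    (hl : Holds (s.arr src) l) (hlen : n.val s = l.length) (hB : l.length ≤ B) (hM : l.length ≤ M)
    (hQ : ∀ s' t, Fr (cpy src dst n) s s' → Holds (s'.arr dst) l → t ≤ 4 * l.length + 2 → Q t s') :
    wp B M (cpy src dst n) s Q := by
  refine wp_forLt l.length (fun j s' => Holds (s'.arr dst) (l.take j)) (fun _ => 2) (by rfl) ?_
    hlen hB (by simpa using Holds.nil _) ?_ ?_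
  · intro x hx
    have := hn x hx
    exact ⟨this.1, by simp [block, Cmd.wr, Op.wr, this.2]⟩
  · intro j s' hj hi hf hJ
    have e1 : s'.arr src = s.arr src := hf.arr src (by simp [forLt, block, Cmd.wa, Op.wa, hne.symm])
    simp only [block, wp_seq_iff, wp_op_iff, Op.ok, Op.eff]
    simp [hi]
    refine ⟨by omega, ?_⟩
    rw [e1, hl.take_succ hj]
    exact hJ.concat (by simp; omega) _
  · intro s' t hJ hi hf ht
    rw [sum_const_range] at ht
    exact hQ s' t hf (by simpa using hJ) (by omega)

/-- Keep the elements of the list in `a` that pass the test, which is prepared by `pre`. -/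
def filterC (a : Ar) (n : V) (pre : Cmd) (b : Test) : Cmd := block [
  .op (.set .sj (.c 0)),
  forLt .si (.r n) (block [
    .op (.ld .se a .si),
    pre,
    .ite b (block [.op (.st a .sj (.r .se)), .op (.ar .add .sj (.r .sj) (.c 1))]) .skip]),
  .op (.set n (.r .sj))]

/-- Filtering in place works because the write position never overtakes the read position: the
unread part of the array is still the original one. The test need only be correct in states that
agree with the initial one off the array and off the registers used here. -/
theorem wp_filterC {a : Ar} {n : V} {pre : Cmd} {b : Test} {l : List ℕ} {P : ℕ → Prop}
    [DecidablePred P] {T : ℕ}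
    (hn : n ≠ .si ∧ n ≠ .sj ∧ n ≠ .se) (hp1 : pre.wr n = false) (hp2 : pre.wr .si = false)
    (hp3 : pre.wr .sj = false) (hp4 : pre.wr .se = false) (hp5 : ∀ x, pre.wa x = false)
    (hp6 : ∀ x, pre.wwa x = false)
    (hl : Holds (s.arr a) l) (hlen : s.reg n = l.length) (hB : l.length ≤ B) (hM : l.length ≤ M)
    (hb : ∀ s', (∀ x, x ≠ .si → x ≠ .sj → x ≠ .se → pre.wr x = false → s'.reg x = s.reg x) →
      (∀ x, x ≠ a → s'.arr x = s.arr x) → s'.warr = s.warr → s'.reg .se ∈ l →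
      wp B M pre s' fun t s'' => t ≤ T ∧ b.ok M s'' ∧ (b.holds s'' ↔ P (s'.reg .se)))
    (hQ : ∀ s' t, Fr (filterC a n pre b) s s' → Holds (s'.arr a) (l.filter P) →
      s'.reg n = (l.filter P).length → t ≤ (T + 6) * l.length + 4 → Q t s') :
    wp B M (filterC a n pre b) s Q := by
  refine wp_mono (Q := fun t s' => Holds (s'.arr a) (l.filter P) ∧ 
      s'.reg n = (l.filter P).length ∧ t ≤ (T + 6) * l.length + 4) ?_
      (fun t s' hf h => hQ s' t hf h.1 h.2.1 h.2.2)
  refine wp_seq (wp_op trivial (wp_seq (wp_forLt l.length 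
    (fun j s' => Holds (s'.arr a) ((l.take j).filter P) ∧ s'.reg .sj = ((l.take j).filter P).length ∧
      ∀ i, j ≤ i → s'.arr a i = s.arr a i) (fun _ => T + 4) 
      ?_ ?_ ?_ hB ?_ ?_ ?_)))
  · simp [block, Cmd.wr, Op.wr, hp2]
  · rintro x ⟨⟩
    simp [block, Cmd.wr, Op.wr, hn, hp1]
  · simpa [hn] using hlen
  · simpa using Holds.nil _
  · rintro j s' hj hi hf ⟨h1, h2, h3⟩
    have hle : ((l.take j).filter P).length ≤ j :=
      (List.length_filter_le _ _).trans (by simp)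
    have e1 : ∀ x, x ≠ V.si → x ≠ .sj → x ≠ .se → pre.wr x = false → s'.reg x = s.reg x := by
      intro x hx1 hx2 hx3 hx4
      rw [hf.reg x (by simp [forLt, block, Cmd.wr, Op.wr, *])]
      simp [hx2]
    have e2 : ∀ x, x ≠ a → s'.arr x = s.arr x := by
      intro x hx1
      rw [hf.arr x (by simp [forLt, block, Cmd.wa, Op.wa, *])]
      simp
    have e3 : s'.warr = s.warr := funext fun x => by
      rw [hf.warr x (by simp [forLt, block, Cmd.wwa, Op.wwa, hp6])]
      simp
    have hv : s'.arr a j = l[j] := (h3 j le_rfl).trans (hl j hj)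
    have hw := hb (s'.setR .se l[j]) (fun x hx1 hx2 hx3 hx4 => by simp [hx3, e1 x hx1 hx2 hx3 hx4])
      (by simpa using e2) (by simpa using e3) (by simp)
    simp only [block, wp_seq_iff, wp_op_iff, Op.ok, Op.eff, hi, hv]
    refine ⟨by omega, wp_mono hw ?_⟩
    rintro t s2 hf2 ⟨ht, hok, hh⟩
    have g1 : s2.reg .sj = s'.reg .sj := by rw [hf2.reg _ hp3]; simp
    have g2 : s2.reg .se = l[j] := by rw [hf2.reg _ hp4]; simp
    have g3 : s2.arr a = s'.arr a := by rw [hf2.arr _ (hp5 _)]; simp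
    simp only [wp_seq_iff, wp_op_iff, wp_ite_iff, wp_skip_iff, Op.ok, Op.eff]
    refine ⟨hok, fun hbt => ?_, fun hbf => ?_⟩
    · rw [hh] at hbt
      simp at hbt
      have htk : (l.take (j + 1)).filter P = (l.take j).filter P ++ [l[j]] := by
        rw [List.take_succ_eq_append_getElem hj, List.filter_append]
        simp [hbt]
      simp [h2, htk, Arith.eval, g1, g2, g3]
      refine ⟨by omega, by omega, by omega, h1.concat rfl _, ?_⟩
      intro i hi
      rw [Function.update_of_ne (by omega)]
      exact h3 i (by omega)
    · rw [hh] at hbf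
      simp at hbf
      have htk : (l.take (j + 1)).filter P = (l.take j).filter P := by
        rw [List.take_succ_eq_append_getElem hj, List.filter_append]
        simp [hbf]
      simp [h2, htk, g1, g3]
      exact ⟨by omega, h1, fun i hi => h3 i (by omega)⟩
  · rintro s' t ⟨h1, h2, h3⟩ hi hf ht
    rw [sum_const_range] at ht
    refine wp_op trivial ?_
    simp at h1 h2
    simp [h2]
    refine ⟨h1, ?_⟩
    have : l.length * (T + 4 + 2) = (T + 6) * l.length := by ring
    omega

end

/-! ## Sampling a list to find a pivot -/

section Sampling

variable {α : Type*} [LinearOrder α] (key : ℕ → α)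

/-- The number of elements of the list with key at least `v`. -/
def geCount (v : α) (l : List ℕ) : ℕ := l.countP fun y => decide (v ≤ key y)
/-- The number of elements of the list with key less than `v`. -/
def ltCount (v : α) (l : List ℕ) : ℕ := l.countP fun y => decide (key y < v)
/-- The number of elements of the list with key greater than `v`. -/
def gtCount (v : α) (l : List ℕ) : ℕ := l.countP fun y => decide (v < key y)

variable {key}

theorem geCount_append (v : α) (l l' : List ℕ) :
    geCount key v (l ++ l') = geCount key v l + geCount key v l' := List.countP_append

theorem ltCount_append (v : α) (l l' : List ℕ) :
    ltCount key v (l ++ l') = ltCount key v l + ltCount key v l' := List.countP_append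

theorem geCount_add_ltCount (v : α) (l : List ℕ) : geCount key v l + ltCount key v l = l.length := by
  rw [List.length_eq_countP_add_countP (fun y => decide (v ≤ key y)), geCount, ltCount]
  simp [not_le]

theorem countP_eq_card {l : List ℕ} (hl : l.Nodup) (p : ℕ → Prop) [DecidablePred p] :
    l.countP (fun y => decide (p y)) = (l.toFinset.filter p).card := by
  rw [List.countP_eq_length_filter, ← List.toFinset_card_of_nodup (hl.filter _), List.toFinset_filter]
  simp

theorem gtCount_lt {l : List ℕ} {x : ℕ} (hx : x ∈ l) {v : α} (hv : v ≤ key x) :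
    gtCount key (key x) l < geCount key v l := by
  induction l with
  | nil => simp at hx
  | cons y l ih =>
    have mono : gtCount key (key x) l ≤ geCount key v l :=
      List.countP_mono_left fun z _ hz => by simp at hz ⊢; exact hv.trans hz.le
    simp only [gtCount, geCount, List.countP_cons] at *
    rcases List.mem_cons.1 hx with rfl | hx
    · simp [hv]; omega
    · have := ih hx
      by_cases h : key x < key y
      · simp [h, hv.trans h.le]; omega
      · simp [h]; omega

theorem gtCount_le_length (v : α) (l : List ℕ) : gtCount key v l ≤ l.length := List.countP_le_length

theorem geCount_le_length (v : α) (l : List ℕ) : geCount key v l ≤ l.length := List.countP_le_length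

theorem gtCount_lt_of_lt {l : List ℕ} {x y : ℕ} (hy : y ∈ l) (h : key x < key y) :
    gtCount key (key y) l < gtCount key (key x) l := by
  have h1 := gtCount_lt (key := key) hy le_rfl
  refine h1.trans_le (List.countP_mono_left fun z _ hz => ?_)
  simp at hz ⊢
  exact h.trans_le hz

theorem gtCount_injOn {l : List ℕ} (hinj : ∀ x ∈ l, ∀ y ∈ l, key x = key y → x = y) :
    ∀ x ∈ l, ∀ y ∈ l, gtCount key (key x) l = gtCount key (key y) l → x = y := by
  intro x hx y hy h
  rcases lt_trichotomy (key x) (key y) with h1 | h1 | h1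
  · exact absurd h (gtCount_lt_of_lt hy h1).ne'
  · exact hinj x hx y hy h1
  · exact absurd h (gtCount_lt_of_lt hx h1).ne

/-- The ranks of the elements with key at least `v` are the smallest ones. -/
theorem image_gtCount {l : List ℕ} (hl : l.Nodup)
    (hinj : ∀ x ∈ l, ∀ y ∈ l, key x = key y → x = y) (v : α) :
    (l.toFinset.filter fun x => v ≤ key x).image (fun x => gtCount key (key x) l) =
      Finset.range (geCount key v l) := by
  refine Finset.eq_of_subset_of_card_le ?_ ?_
  · intro r hr
    simp only [Finset.mem_image, Finset.mem_filter, List.mem_toFinset, Finset.mem_range] at hr ⊢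
    obtain ⟨x, ⟨hx, hv⟩, rfl⟩ := hr
    exact gtCount_lt hx hv
  · rw [Finset.card_image_of_injOn, Finset.card_range, geCount, countP_eq_card hl]
    intro x hx y hy h
    simp at hx hy
    exact gtCount_injOn hinj x hx.1 y hy.1 h

/-- A rank `r` with `4 ∣ r + 1` closes a complete block of four ranks. Only complete blocks are
counted, so a sampled element always stands for four elements that are at least as large. -/
theorem card_range_filter (n : ℕ) :
    ((Finset.range n).filter fun r => (r + 1) % 4 = 0).card = n / 4 := by
  induction n with
  | zero => simp
  | succ n ih =>
    rw [Finset.range_add_one, Finset.filter_insert]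
    split_ifs with h
    · rw [Finset.card_insert_of_notMem (by simp), ih]; omega
    · rw [ih]; omega

/-- Take the smallest key as the threshold in `image_gtCount`: the ranks then fill the whole range.
-/
theorem exists_rank {l : List ℕ} (hl : l.Nodup)
    (hinj : ∀ x ∈ l, ∀ y ∈ l, key x = key y → x = y) {q : ℕ} (hq : q < l.length) :
    ∃ x ∈ l, gtCount key (key x) l = q := by
  obtain ⟨x0, hx0, hmin⟩ : ∃ x ∈ l, ∀ y ∈ l, key x ≤ key y := by
    have hne : l.toFinset.Nonempty := ⟨l[q], by simp⟩
    obtain ⟨x, hx, h⟩ := l.toFinset.exists_min_image key hne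
    exact ⟨x, by simpa using hx, fun y hy => h y (by simpa using hy)⟩
  have h := image_gtCount hl hinj (key x0)
  have hlen : geCount key (key x0) l = l.length := by
    rw [geCount, List.countP_eq_length]
    simpa using hmin
  rw [hlen] at h
  have : q ∈ Finset.range l.length := by simpa using hq
  rw [← h] at this
  simp only [Finset.mem_image, Finset.mem_filter, List.mem_toFinset] at this
  obtain ⟨x, ⟨hx, -⟩, hq⟩ := this
  exact ⟨x, hx, hq⟩

variable (key) in
/-- Every fourth element of the list, in the order of the keys. -/
def sampleP (l : List ℕ) (x : ℕ) : Prop := (gtCount key (key x) l + 1) % 4 = 0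

instance (l : List ℕ) : DecidablePred (sampleP key l) := fun _ => by unfold sampleP; infer_instance

/-- By `image_gtCount` the elements with key at least `v` carry precisely the smallest ranks, and
the sample contains one of them for each complete block of four. Rounding therefore never hurts the
count from above; the whole error falls on the elements below `v`. -/
theorem geCount_sample {l : List ℕ} (hl : l.Nodup)
    (hinj : ∀ x ∈ l, ∀ y ∈ l, key x = key y → x = y) (v : α) :
    geCount key v (l.filter (sampleP key l)) = geCount key v l / 4 := by
  have e : geCount key v (l.filter (sampleP key l)) =
      ((l.toFinset.filter fun x => v ≤ key x).filter (sampleP key l)).card := by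
    rw [geCount, countP_eq_card (hl.filter _)]
    congr 1
    ext x
    simp
    tauto
  rw [e, ← card_range_filter, ← image_gtCount hl hinj v, Finset.filter_image,
    Finset.card_image_of_injOn]
  · rfl
  · intro x hx y hy h
    simp at hx hy
    exact gtCount_injOn hinj x hx.1.1 y hy.1.1 h

/-- This is `geCount_sample` with the smallest key as threshold. -/
theorem length_sample {l : List ℕ} (hl : l.Nodup)
    (hinj : ∀ x ∈ l, ∀ y ∈ l, key x = key y → x = y) :
    (l.filter (sampleP key l)).length = l.length / 4 := by
  rcases l.eq_nil_or_concat with rfl | ⟨l', a, h⟩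
  · simp
  obtain ⟨x0, hx0, hmin⟩ : ∃ x ∈ l, ∀ y ∈ l, key x ≤ key y := by
    have hne : l.toFinset.Nonempty := ⟨a, by simp [h]⟩
    obtain ⟨x, hx, h⟩ := l.toFinset.exists_min_image key hne
    exact ⟨x, by simpa using hx, fun y hy => h y (by simpa using hy)⟩
  have h := geCount_sample hl hinj (key x0)
  have hlen : geCount key (key x0) l = l.length := by
    rw [geCount, List.countP_eq_length]
    simpa using hmin
  have hlen' : geCount key (key x0) (l.filter (sampleP key l)) = (l.filter (sampleP key l)).length := by
    rw [geCount, List.countP_eq_length]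
    intro y hy
    simpa using hmin y (List.mem_of_mem_filter hy)
  rw [← hlen, ← hlen', h]

theorem geCount_eq_gtCount {l : List ℕ} (hl : l.Nodup)
    (hinj : ∀ x ∈ l, ∀ y ∈ l, key x = key y → x = y) {x : ℕ} (hx : x ∈ l) :
    geCount key (key x) l = gtCount key (key x) l + 1 := by
  rw [geCount, gtCount, countP_eq_card hl, countP_eq_card hl]
  have : (l.toFinset.filter fun y => key x ≤ key y) =
      insert x (l.toFinset.filter fun y => key x < key y) := by
    ext y
    simp only [Finset.mem_filter, List.mem_toFinset, Finset.mem_insert]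
    constructor
    · rintro ⟨hy, h⟩
      rcases h.eq_or_lt with h | h
      · exact .inl (hinj y hy x hx h.symm)
      · exact .inr ⟨hy, h⟩
    · rintro (rfl | ⟨hy, h⟩)
      · exact ⟨hx, le_rfl⟩
      · exact ⟨hy, h.le⟩
  rw [this, Finset.card_insert_of_notMem (by simp)]

/-- A sample `l` of `l₀`, where each element stands for `w` elements, gives a good pivot. -/
theorem pivot_quality {l l₀ lA : List ℕ} {L w len : ℕ} (hl : l.Nodup)
    (hinj : ∀ x ∈ l, ∀ y ∈ l, key x = key y → x = y)
    (hA : ∀ v, geCount key v l₀ ≤ geCount key v lA ∧ ltCount key v l₀ ≤ ltCount key v lA)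
    (hL : l.length = L) (hlen : L * w = len) (hlenA : lA.length < 8 * len)
    (hge : ∀ v, w * geCount key v l ≤ geCount key v l₀)
    (hlt : ∀ v, 4 * L * w * ltCount key v l + 3 * len ≤ 4 * L * ltCount key v l₀ + 3 * len * L)
    {p : ℕ} (hp : p ∈ l) (hpr : gtCount key (key p) l = L / 8) (hw : w = L * L) :
    lA.length ≤ 512 * geCount key (key p) lA ∧ lA.length ≤ 512 * (ltCount key (key p) lA + 1) := by
  have h1 := geCount_eq_gtCount hl hinj hp
  have h2 := geCount_add_ltCount (key := key) (key p) l
  obtain ⟨h3, h4⟩ := hA (key p)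
  have h5 := hge (key p)
  have h6 := hlt (key p)
  set a := geCount key (key p) lA
  set b := ltCount key (key p) lA
  set a₀ := geCount key (key p) l₀
  set b₀ := ltCount key (key p) l₀
  set c := ltCount key (key p) l
  rw [h1, hpr] at h2 h5
  rw [hL] at h2
  have hL0 : 0 < L := by omega
  constructor
  -- The pivot and the sampled elements above it are more than an eighth of the sample, and each
  -- stands for `w` elements that are at least as large. Since the whole list is shorter than `8 *
  -- len`, the factor 64 would do on this side.
  · have : L * w ≤ 8 * (w * (L / 8 + 1)) := by
      have : L ≤ 8 * (L / 8 + 1) := by omega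
      nlinarith
    omega
  -- This is `hlt` divided by `L`. About `7/8` of the weight of the sample lies below the pivot, and
  -- the accumulated rounding accounts for at most `3/4` of `len`; an eighth remains, up to terms of
  -- the order of `w`.
  · have h7 : 4 * w * c + 3 * w ≤ 4 * b₀ + 3 * w * L := by
      refine Nat.le_of_mul_le_mul_left (c := L) ?_ hL0
      rw [← hlen] at h6
      nlinarith
    have hc : 8 * c + 8 + L ≥ 8 * L := by omega
    -- For `L < 4` the list has fewer than `8 * 27` elements, and the summand `1` in the claim
    -- suffices. Otherwise `w ≤ len / 4`, and at least `len / 16` elements lie below the pivot.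
    rcases Nat.lt_or_ge L 4 with hL4 | hL4
    · have : len ≤ 27 := by
        rw [← hlen, hw]
        interval_cases L <;> simp
      omega
    · have h8 : w * (8 * L) ≤ w * (8 * c + 8 + L) := Nat.mul_le_mul_left _ hc
      have h9 : w * 4 ≤ w * L := Nat.mul_le_mul_left _ hL4
      have : w * L = len := by rw [mul_comm]; exact hlen
      nlinarith

end Sampling

/-! ### Programs for ranking, sampling and finding a pivot -/

open Cmd

/-- Count the elements among `a[base], …, a[base + n - 1]` with a key larger than that of `x`. -/
def rankC (a : Ar) (base n : Opd) (x : V) : Cmd := block [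
  .op (.set .rk (.c 0)),
  forLt .y n (block [
    .op (.ar .add .yn base (.r .y)),
    .op (.ld .ye a .yn),
    .ite (.key x .ye) (.op (.ar .add .rk (.r .rk) (.c 1))) .skip])]

def Opd.noR : Opd → List V → Prop
  | .r x, l => x ∉ l
  | .c _, _ => True

section
variable {B M : ℕ} {s : St} {Q : ℕ → St → Prop}

theorem Opd.noR.val_eq {o : Opd} {l : List V} (h : o.noR l) {s s' : St}
    (hs : ∀ x ∉ l, s'.reg x = s.reg x) : o.val s' = o.val s := by
  cases o with
  | c a => rfl
  | r x => exact hs x h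

theorem wp_rankC {a : Ar} {base n : Opd} {x : V} {X : List ℕ}
    (hb : base.noR [.rk, .y, .yn, .ye]) (hn : n.noR [.rk, .y, .yn, .ye])
    (hx : x ∉ [V.rk, .y, .yn, .ye])
    (hX : Holds (fun i => s.arr a (base.val s + i)) X) (hlen : n.val s = X.length)
    (hM : base.val s + X.length ≤ M) (hMB : M ≤ B)
    (hXM : ∀ y ∈ X, y < M) (hxM : s.reg x < M)
    (hQ : ∀ s' t, Fr (rankC a base n x) s s' → s'.reg .rk = gtCount s.key (s.key (s.reg x)) X →
      t ≤ 7 * X.length + 3 → Q t s') :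
    wp B M (rankC a base n x) s Q := by
  refine wp_mono (Q := fun t s' => s'.reg .rk = gtCount s.key (s.key (s.reg x)) X ∧
    t ≤ 7 * X.length + 3) ?_ (fun t s' hf h => hQ s' t hf h.1 h.2)
  refine wp_seq (wp_op trivial (wp_forLt X.length
    (fun j s' => s'.reg .rk = gtCount s.key (s.key (s.reg x)) (X.take j)) (fun _ => 5)
      (by rfl) ?_ ?_ (by omega) (by simp [gtCount]) ?_ ?_))
  · rintro x ⟨⟩
    simp [Opd.noR] at hn
    simp [block, Cmd.wr, Op.wr, hn]
  · rw [← hlen]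
    exact hn.val_eq (fun x hx => by simp at hx; simp [hx])
  · intro j s' hj hi hf hJ
    have e1 : ∀ v ∉ [V.rk, .y, .yn, .ye], s'.reg v = s.reg v := by
      intro v hv
      simp at hv
      rw [hf.reg v (by simp [forLt, block, Cmd.wr, Op.wr, hv])]
      simp [hv]
    have e2 : s'.arr = s.arr := funext fun v => hf.arr v rfl
    have e3 : s'.warr = s.warr := funext fun v => hf.warr v rfl
    have ek : s'.key = s.key := by funext v; simp [St.key, e2, e3]
    have eb := hb.val_eq e1
    have hv : s.arr a (base.val s + j) = X[j] := hX j hj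
    have hm := hXM _ (List.getElem_mem hj)
    simp only [block, wp_seq_iff, wp_op_iff, wp_ite_iff, wp_skip_iff, Op.ok, Op.eff]
    simp only [List.mem_cons, not_or, List.not_mem_nil, not_false_eq_true] at hx
    have hx' := e1 x (by simpa using hx)
    simp [hi, eb, e2, hv, hx, hx', Arith.eval, ek, hJ, List.take_succ_eq_append_getElem hj,
      gtCount, -List.take_append_getElem]
    have hle := gtCount_le_length (key := s.key) (s.key (s.reg x)) (X.take j)
    simp [gtCount] at hle
    exact ⟨by omega, by omega, ⟨by omega, by omega⟩, fun h => ⟨by omega, h⟩⟩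
  · intro s' t hJ hi hf ht
    rw [sum_const_range] at ht
    exact ⟨by simpa using hJ, by omega⟩

/-- Append the sample of the group `T[gb], …, T[gb + gs - 1]` to `U`. -/
def groupC : Cmd := forLt .gi (.r .gs) (block [
      .op (.ar .add .x (.r .gb) (.r .gi)),
      .op (.ld .x .T .x),
      rankC .T (.r .gb) (.r .gs) .x,
      .op (.ar .add .rk (.r .rk) (.c 1)),
      .op (.ar .mod .rk (.r .rk) (.c 4)),
      .ite (.eq (.r .rk) (.c 0))
        (block [.op (.st .U .go (.r .x)), .op (.ar .add .go (.r .go) (.c 1))]) .skip])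

theorem wp_groupC {X O : List ℕ}
    (hX : Holds (fun i => s.arr .T (s.reg .gb + i)) X) (hlen : s.reg .gs = X.length)
    (hM : s.reg .gb + X.length ≤ M) (hMB : M < B)
    (hXM : ∀ y ∈ X, y < M) (hO : Holds (s.arr .U) O) (hgo : s.reg .go = O.length)
    (hOM : O.length + X.length ≤ M)
    (hQ : ∀ s' t, Fr groupC s s' → Holds (s'.arr .U) (O ++ X.filter (sampleP s.key X)) →
      s'.reg .go = (O ++ X.filter (sampleP s.key X)).length →
      t ≤ X.length * (7 * X.length + 12) + 2 → Q t s') :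
    wp B M groupC s Q := by
  refine wp_forLt X.length
    (fun j s' => Holds (s'.arr .U) (O ++ (X.take j).filter (sampleP s.key X)) ∧
      s'.reg .go = (O ++ (X.take j).filter (sampleP s.key X)).length) 
    (fun _ => 7 * X.length + 10)
    (by rfl) ?_ ?_ (by omega) (by simpa using ⟨hO, hgo⟩) ?_ ?_
  · rintro x ⟨⟩
    exact ⟨by decide, rfl⟩
  · exact hlen
  · rintro j s' hj hi hf ⟨hJ1, hJ2⟩
    have e1 : s'.reg .gb = s.reg .gb := hf.reg _ rfl
    have e2 : s'.reg .gs = s.reg .gs := hf.reg _ rfl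
    have e3 : s'.arr .T = s.arr .T := hf.arr _ rfl
    have ek : s'.key = s.key := by
      funext v
      simp [St.key, hf.arr .E rfl, hf.warr .E rfl]
    have hv : s.arr .T (s.reg .gb + j) = X[j] := hX j hj
    have hm := hXM _ (List.getElem_mem hj)
    have hle : ((X.take j).filter (sampleP s.key X)).length ≤ j :=
      (List.length_filter_le _ _).trans (by simp)
    simp only [block, wp_seq_iff, wp_op_iff, Op.ok, Op.eff]
    simp only [Opd.val_r, Opd.val_c, St.setR_reg, reduceCtorEq, if_true, if_false, e1, hi, Arith.eval,
      St.setR_arr, e3, hv]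
    refine ⟨by omega, by omega, ?_⟩
    refine wp_rankC (X := X) (by simp [Opd.noR]) (by simp [Opd.noR]) (by simp) (by simpa [e1, e3] using hX)
      (by simp [e2, hlen]) (by simp [e1]; omega) (by omega) hXM (by simp; omega) ?_
    intro s2 t hf2 hrk ht
    have f1 : s2.reg .go = s'.reg .go := by rw [hf2.reg _ rfl]; simp
    have f2 : s2.arr .U = s'.arr .U := by rw [hf2.arr _ rfl]; simp
    have f3 : s2.reg .x = X[j] := by rw [hf2.reg _ rfl]; simp
    simp only [St.setR_key, ek, St.setR_reg, if_true] at hrk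
    have hrk' := gtCount_le_length (key := s.key) (s.key X[j]) X
    have hsam : sampleP s.key X X[j] ↔ (gtCount s.key (s.key X[j]) X + 1) % 4 = 0 := Iff.rfl
    rw [List.take_succ_eq_append_getElem hj, List.filter_append]
    simp [wp_seq_iff, wp_op_iff, wp_ite_iff, wp_skip_iff, hrk, Arith.eval, f1, f2, f3, hJ2]
    refine ⟨by omega, fun h => ?_, fun h => ?_⟩
    · rw [← hsam] at h
      simp [h]
      refine ⟨by omega, by omega, by omega, ?_⟩
      rw [← List.append_assoc]
      refine ⟨hJ1.concat ?_ _, by omega⟩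
      simp
    · rw [← hsam] at h
      simp [h]
      exact ⟨by omega, hJ1⟩
  · rintro s' t ⟨h1, h2⟩ hi hf ht
    rw [sum_const_range] at ht
    refine hQ s' t hf (by simpa using h1) (by simpa using h2) ?_
    simpa using ht

/-- Replace the sample in `T`, consisting of `dl` elements, by a sparser one. -/
def stageC : Cmd := block [
  .op (.ar .mul .gs (.r .run) (.c 8)),
  .op (.set .go (.c 0)),
  .op (.set .gb (.c 0)),
  .loop (.lt (.r .gb) (.r .dl)) (block [
    groupC,
    .op (.ar .add .gb (.r .gb) (.r .gs))]),
  cpy .U .T (.r .go),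
  .op (.set .dl (.r .go)),
  .op (.ar .add .run (.r .run) (.r .run))]

/-- `l'` results from `l` by sampling a quarter of each group of `g` elements. -/
structure Thinned {α : Type*} [LinearOrder α] (key : ℕ → α) (g : ℕ) (l l' : List ℕ) : Prop where
  sub : l'.Sublist l
  length : 4 * l'.length = l.length
  ge : ∀ v, 4 * geCount key v l' ≤ geCount key v l
  lt : ∀ v, g * (4 * ltCount key v l') ≤ g * ltCount key v l + 3 * l.length

/-- Rounding in one group costs at most three elements below `v`. After multiplication by `g` this
is paid by the `g` elements that the group adds to the length. -/
theorem Thinned.append {α : Type*} [LinearOrder α] {key : ℕ → α} {g : ℕ} {l l' X : List ℕ}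
    (h : Thinned key g l l') (hX : X.Nodup) (hinj : ∀ x ∈ X, ∀ y ∈ X, key x = key y → x = y)
    (hg : X.length = g) (h4 : g % 4 = 0) :
    Thinned key g (l ++ X) (l' ++ X.filter (sampleP key X)) where
  sub := h.sub.append List.filter_sublist
  length := by
    have := length_sample hX hinj
    have := h.length
    simp only [List.length_append]
    omega
  ge v := by
    have h1 := geCount_sample hX hinj v
    have h2 := h.ge v
    rw [geCount_append, geCount_append]
    omega
  lt v := by
    have h0 := length_sample hX hinj
    have h1 := geCount_sample hX hinj v
    have h2 := h.lt v
    have h3 := geCount_add_ltCount (key := key) v X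
    have h4 := geCount_add_ltCount (key := key) v (X.filter (sampleP key X))
    rw [ltCount_append, ltCount_append, List.length_append]
    have h5 : 4 * ltCount key v (X.filter (sampleP key X)) ≤ ltCount key v X + 3 := by omega
    have h6 := Nat.mul_le_mul_left g h5
    rw [hg]
    nlinarith

theorem wp_stageC {l : List ℕ} {D run : ℕ} (hl : l.Nodup)
    (hinj : ∀ x ∈ l, ∀ y ∈ l, s.key x = s.key y → x = y)
    (hT : Holds (s.arr .T) l) (hlen : s.reg .dl = l.length) (hrun : s.reg .run = run)
    (hD : l.length = 8 * run * D) (hr0 : 0 < run) (hlM : l.length ≤ M) (hMB : 8 * M < B)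
    (hD0 : 0 < D) (hXM : ∀ y ∈ l, y < M)
    (hQ : ∀ s' t l', Fr stageC s s' → Thinned s.key (8 * run) l l' → Holds (s'.arr .T) l' →
      s'.reg .dl = l'.length → s'.reg .run = 2 * run → t ≤ 50 * (8 * run) * l.length → Q t s') :
    wp B M stageC s Q := by
  have hrl : 8 * run ≤ l.length := by rw [hD]; exact Nat.le_mul_of_pos_right _ hD0
  refine wp_mono (Q := fun t s' => ∃ l', Thinned s.key (8 * run) l l' ∧ Holds (s'.arr .T) l' ∧
      s'.reg .dl = l'.length ∧ s'.reg .run = 2 * run ∧ t ≤ 50 * (8 * run) * l.length) ?_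
      (fun t s' hf ⟨l', h1, h2, h3, h4, h5⟩ => hQ s' t l' hf h1 h2 h3 h4 h5)
  unfold stageC
  refine wp_seq (wp_op (by simp; omega) (wp_seq (wp_op trivial (wp_seq (wp_op trivial
    (wp_seq ?_))))))
  simp only [Op.eff, Opd.val_r, Opd.val_c, hrun, Arith.eval]
  have e8 : ((8 : Fin 16) : ℕ) = 8 := rfl
  -- Ranking an element inside its group is linear in the group size, so every element not yet
  -- reached carries the potential `23 * (8 * run)`.
  refine wp_loop (fun s' => ∃ d O, d ≤ D ∧ s'.reg .gb = 8 * run * d ∧ Holds (s'.arr .U) O ∧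
      s'.reg .go = O.length ∧ Thinned s.key (8 * run) (l.take (8 * run * d)) O)
    (fun s' => (l.length - s'.reg .gb) * (23 * (8 * run))) ?_ ?_ ?_
  · refine ⟨0, [], Nat.zero_le _, by simp, Holds.nil _, by simp, ?_⟩
    constructor <;> simp [geCount, ltCount]
  · rintro s' hf ⟨d, O, hd, hgb, hO, hgo, hth⟩
    refine ⟨trivial, fun hlt => ?_⟩
    have e1 : s'.reg .gs = 8 * run := by rw [hf.reg _ rfl]; simp [mul_comm]
    have e2 : s'.reg .dl = l.length := by rw [hf.reg _ rfl]; simp [hlen]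
    have e3 : s'.arr .T = s.arr .T := by rw [hf.arr _ rfl]; simp
    have ek : s'.key = s.key := by
      funext v
      simp [St.key, hf.arr .E rfl, hf.warr .E rfl]
    simp only [Test.holds, Opd.val_r, e2, hgb] at hlt
    have hdD : d < D := by
      rw [hD] at hlt
      exact Nat.lt_of_mul_lt_mul_left hlt
    have hle : 8 * run * d + 8 * run ≤ l.length := by
      rw [hD]
      calc 8 * run * d + 8 * run = 8 * run * (d + 1) := by ring
        _ ≤ _ := Nat.mul_le_mul_left _ hdD
    set X := (l.drop (8 * run * d)).take (8 * run) with hXdef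
    have hXlen : X.length = 8 * run := by simp [hXdef]; omega
    have hXl : X.Sublist l := (List.take_sublist _ _).trans (List.drop_sublist _ _)
    have htake : l.take (8 * run * (d + 1)) = l.take (8 * run * d) ++ X := by
      rw [show 8 * run * (d + 1) = 8 * run * d + 8 * run by ring, List.take_add]
    have hOl : 4 * O.length = 8 * run * d := by
      rw [hth.length, List.length_take]; omega
    refine wp_seq (wp_groupC (X := X) (O := O) ?_ (by rw [e1, hXlen]) (by rw [hgb, hXlen]; omega)
      (by omega) (fun y hy => hXM y (hXl.subset hy)) hO hgo (by omega) ?_)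
    · intro i hi
      rw [hXlen] at hi
      simp only [e3, hgb]
      rw [hT _ (by omega)]
      simp [hXdef]
    · intro s2 t hf2 h1 h2 ht
      have e4 : s2.reg .gb = 8 * run * d := by rw [hf2.reg _ rfl, hgb]
      have e5 : s2.reg .gs = 8 * run := by rw [hf2.reg _ rfl, e1]
      rw [hXlen] at ht
      refine wp_op (by simp [e4, e5]; omega) ?_
      have hmul : 8 * run * (d + 1) = 8 * run * d + 8 * run := by ring
      refine ⟨⟨d + 1, _, hdD, by simp [Arith.eval, e4, e5, hmul], by simpa [ek] using h1,
        by simpa [ek] using h2, ?_⟩, ?_⟩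
      · rw [htake]
        exact hth.append (hl.sublist hXl) (fun x hx y hy => hinj x (hXl.subset hx) y (hXl.subset hy))
          hXlen (by omega)
      · simp only [Op.eff, St.setR_reg, if_true, Arith.eval, Opd.val_r, e4, e5, hgb]
        have : l.length - 8 * run * d = (l.length - (8 * run * d + 8 * run)) + 8 * run := by omega
        rw [this, Nat.add_mul]
        have h8 : 8 ≤ 8 * run := by omega
        generalize 8 * run = w at *
        nlinarith
  · rintro s' t hf ⟨d, O, hd, hgb, hO, hgo, hth⟩ hnlt ht
    have e2 : s'.reg .dl = l.length := by rw [hf.reg _ rfl]; simp [hlen]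
    have e3 : s'.reg .run = run := by rw [hf.reg _ rfl]; simp [hrun]
    simp only [Test.holds, Opd.val_r, e2, hgb, not_lt] at hnlt
    have hdD : d = D := by
      rw [hD] at hnlt
      have := Nat.le_of_mul_le_mul_left hnlt (by omega)
      omega
    subst hdD
    rw [← hD, List.take_length] at hth
    have hOl := hth.length
    refine wp_seq (wp_cpy (l := O) (by decide) (by rintro x ⟨⟩; decide) hO hgo (by omega) (by omega) ?_)
    intro s2 t2 hf2 hO2 ht2
    have e4 : s2.reg .go = O.length := by rw [hf2.reg _ rfl, hgo]
    have e5 : s2.reg .run = run := by rw [hf2.reg _ rfl, e3]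
    refine wp_seq (wp_op trivial (wp_op (by simp [e5]; omega) ⟨O, hth, by simpa using hO2,
      by simp [e4], by simp [e5, Arith.eval]; omega, ?_⟩))
    have ht' : t ≤ (l.length - 0) * (23 * (8 * run)) + 1 := le_trans (Nat.le_add_right _ _) ht
    rw [Nat.sub_zero] at ht'
    have h8 : 8 ≤ 8 * run := by omega
    have : 1 ≤ l.length := by omega
    generalize 8 * run = w at *
    nlinarith

end
open Cmd

/-- Find a pivot in the list `A[0], …, A[sn - 1]`. -/
def pivotC : Cmd := block [
  .op (.ar .add .x (.r .sn) (.c 1)),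
  .op (.set .len (.c 1)),
  .op (.set .gs (.c 8)),
  .loop (.lt (.r .gs) (.r .x)) (block [
    .op (.set .len (.r .gs)),
    .op (.ar .mul .gs (.r .gs) (.c 8))]),
  cpy .A .T (.r .len),
  .op (.set .dl (.r .len)),
  .op (.set .run (.c 1)),
  .loop (.lt (.r .run) (.r .dl)) stageC,
  .op (.ar .div .q (.r .run) (.c 8)),
  forLt .gi (.r .run) (block [
    .op (.ld .x .T .gi),
    rankC .T (.c 0) (.r .run) .x,
    .ite (.eq (.r .rk) (.r .q)) (.op (.set .pv (.r .x))) .skip])]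

section
variable {B M : ℕ} {s : St} {Q : ℕ → St → Prop}

theorem key_eq_of_fr {c : Cmd} {s s' : St} (h : Fr c s s') (h1 : c.wa .E = false)
    (h2 : c.wwa .E = false) : s'.key = s.key := by
  funext v
  simp [St.key, h.arr .E h1, h.warr .E h2]

/-- The invariant of the loop that thins out the sample. -/
structure SampleInv (key : ℕ → ℝ ×ₗ ℕ) (lA : List ℕ) (len : ℕ) (s : St) (l : List ℕ) (run r w : ℕ) :
    Prop where
  sub : l.Sublist lA
  holds : Holds (s.arr .T) l
  dl : s.reg .dl = l.length
  run_eq : s.reg .run = run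
  length : l.length = run * 8 ^ r
  run_pos : 0 < run
  wt : l.length * w = len
  wt_eq : w = run * run
  ge : ∀ v, w * geCount key v l ≤ geCount key v (lA.take len)
  lt : ∀ v, 4 * run * w * ltCount key v l + 3 * len ≤
    4 * run * ltCount key v (lA.take len) + 3 * len * run

/-- A stage quarters the sample and doubles `run`, so `run * 8 ^ r` loses one factor 8 and the
weight of an element, a square, grows by the factor 4. In terms of original elements the stage adds
the error `3 * len / (8 * run)`. With `run` doubling, the errors form a geometric series whose
partial sums are `(3/4) * len * (1 - 1/run)`, which is what the invariant records. -/
theorem SampleInv.step {key : ℕ → ℝ ×ₗ ℕ} {lA : List ℕ} {len : ℕ} {s s' : St} {l l' : List ℕ}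
    {run r w : ℕ} (h : SampleInv key lA len s l run (r + 1) w) (ht : Thinned key (8 * run) l l')
    (hT : Holds (s'.arr .T) l') (hdl : s'.reg .dl = l'.length) (hrun : s'.reg .run = 2 * run) :
    SampleInv key lA len s' l' (2 * run) r (4 * w) where
  sub := ht.sub.trans h.sub
  holds := hT
  dl := hdl
  run_eq := hrun
  length := by
    have h1 := ht.length
    have h2 := h.length
    rw [pow_succ] at h2
    have : 4 * l'.length = 4 * (2 * run * 8 ^ r) := by rw [h1, h2]; ring
    omega
  run_pos := by have := h.run_pos; omega
  wt := by rw [← h.wt, ← ht.length]; ring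
  wt_eq := by rw [h.wt_eq]; ring
  ge v := by
    have h1 := ht.ge v
    have h2 := h.ge v
    calc 4 * w * geCount key v l' = w * (4 * geCount key v l') := by ring
      _ ≤ w * geCount key v l := Nat.mul_le_mul_left _ h1
      _ ≤ _ := h2
  lt v := by
    have h1 := ht.lt v
    have h2 := h.lt v
    have h3 := h.wt
    have h4 := Nat.mul_le_mul_left w h1
    have h5 : w * (8 * run * (4 * ltCount key v l')) ≤
        8 * run * w * ltCount key v l + 3 * len := by
      calc _ ≤ _ := h4
        _ = _ := by rw [← h3]; ring
    have e : 4 * (2 * run) * (4 * w) * ltCount key v l' = w * (8 * run * (4 * ltCount key v l')) := by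
      ring
    rw [e]
    linarith

theorem wp_pivotC {lA : List ℕ} (hl : lA.Nodup)
    (hinj : ∀ x ∈ lA, ∀ y ∈ lA, s.key x = s.key y → x = y)
    (hA : Holds (s.arr .A) lA) (hlen : s.reg .sn = lA.length) (hne : 0 < lA.length)
    (hlM : lA.length ≤ M) (hMB : 8 * M + 8 ≤ B) (hXM : ∀ y ∈ lA, y < M)
    (hQ : ∀ s' t p, Fr pivotC s s' → s'.reg .pv = p → p ∈ lA →
      lA.length ≤ 512 * geCount s.key (s.key p) lA →
      lA.length ≤ 512 * (ltCount s.key (s.key p) lA + 1) → t ≤ 1000 * lA.length → Q t s') :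
    wp B M pivotC s Q := by
  refine wp_mono (Q := fun t s' => ∃ p, s'.reg .pv = p ∧ p ∈ lA ∧
      lA.length ≤ 512 * geCount s.key (s.key p) lA ∧
      lA.length ≤ 512 * (ltCount s.key (s.key p) lA + 1) ∧ t ≤ 1000 * lA.length) ?_
      (fun t s' hf ⟨p, h1, h2, h3, h4, h5⟩ => hQ s' t p hf h1 h2 h3 h4 h5)
  unfold pivotC
  refine wp_seq (wp_op (by simp [hlen]; omega) (wp_seq (wp_op trivial (wp_seq (wp_op trivial
    (wp_seq ?_))))))
  simp only [Op.eff, Opd.val_r, Opd.val_c, Arith.eval, hlen]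
  have e8 : ((8 : Fin 16) : ℕ) = 8 := rfl
  have e1 : ((1 : Fin 16) : ℕ) = 1 := rfl
  -- This finds the largest power of 8 that is at most the length of the list; the sample starts
  -- with a prefix of that length. The register `x` holds the length plus one, which turns the
  -- strict test into `≤`.
  refine wp_loop (fun s' => ∃ j, s'.reg .len = 8 ^ j ∧ s'.reg .gs = 8 * 8 ^ j ∧ 8 ^ j ≤ lA.length)
    (fun s' => 3 * (lA.length - s'.reg .len)) ⟨0, by simp; omega⟩ ?_ ?_
  · rintro s' hf ⟨j, h1, h2, h3⟩
    have e3 : s'.reg .x = lA.length + 1 := by rw [hf.reg _ rfl]; simp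
    refine ⟨trivial, fun hlt => ?_⟩
    simp only [Test.holds, Opd.val_r, h2, e3] at hlt
    simp only [block, wp_seq_iff, wp_op_iff, Op.ok, Op.eff]
    have hpos : 0 < 8 ^ j := by positivity
    simp [h2, h1, Arith.eval]
    refine ⟨by omega, ⟨j + 1, by ring, by ring, by rw [pow_succ]; omega⟩, by omega⟩
  rintro s1 t1 hf1 ⟨J, hJ1, hJ2, hJ3⟩ hnlt ht1
  have e3 : s1.reg .x = lA.length + 1 := by rw [hf1.reg _ rfl]; simp
  simp only [Test.holds, Opd.val_r, hJ2, e3, not_lt] at hnlt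
  have ht1' : t1 ≤ 3 * lA.length + 1 := by
    have : t1 ≤ 3 * (lA.length - 1) + 1 := le_trans (Nat.le_add_right _ _) ht1
    omega
  have k1 : s1.key = s.key := by rw [key_eq_of_fr hf1 rfl rfl]; simp
  have hA1 : s1.arr .A = s.arr .A := by rw [hf1.arr _ rfl]; simp
  have hpos : 0 < 8 ^ J := by positivity
  clear hf1 ht1
  set len := 8 ^ J with hlendef
  have hP0 : (lA.take len).length = len := by simp; omega
  refine wp_seq (wp_cpy (l := lA.take len) (by decide) (by rintro x ⟨⟩; decide)
    (hA1 ▸ hA.take _) (by simp [hJ1]; omega) (by omega) (by omega) ?_)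
  intro s2 t2 hf2 hT2 ht2
  have e4 : s2.reg .len = len := by rw [hf2.reg _ rfl, hJ1]
  have k2 : s2.key = s.key := by rw [key_eq_of_fr hf2 rfl rfl, k1]
  clear hf2
  refine wp_seq (wp_op trivial (wp_seq (wp_op trivial (wp_seq ?_))))
  simp only [Op.eff, Opd.val_r, Opd.val_c, e4]
  -- A stage costs at most `400 * (dl * run)` steps and halves `dl * run`, as `dl` is quartered and
  -- `run` doubled. The total is a geometric series, linear in `len`.
  refine wp_loop (fun s' => ∃ l run r w, SampleInv s.key lA len s' l run r w)
    (fun s' => 900 * (s'.reg .dl * s'.reg .run)) ?_ ?_ ?_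
  · refine ⟨lA.take len, 1, J, 1, ?_⟩
    constructor
    · exact List.take_sublist _ _
    · simpa using hT2
    · simp; omega
    · simp
    · rw [hP0, one_mul]
    · simp
    · simp [hP0]
    · simp
    · simp
    · intro v; simp
  · rintro s' hf ⟨l, run, r, w, h⟩
    have ks : s'.key = s.key := by rw [key_eq_of_fr hf rfl rfl]; simp [k2]
    refine ⟨trivial, fun hlt => ?_⟩
    simp only [Test.holds, Opd.val_r, h.dl, h.run_eq, h.length] at hlt
    obtain ⟨r, rfl⟩ : ∃ r', r = r' + 1 := by
      cases r with
      | zero => simp at hlt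
      | succ r => exact ⟨r, rfl⟩
    have hsub := h.sub.subset
    refine wp_stageC (l := l) (run := run) (D := 8 ^ r) (hl.sublist h.sub)
      (fun x hx y hy => by rw [ks]; exact hinj x (hsub hx) y (hsub hy)) h.holds h.dl h.run_eq
      (by rw [h.length, pow_succ]; ring) h.run_pos (h.sub.length_le.trans hlM) (by omega)
      (by positivity) (fun y hy => hXM y (hsub hy)) ?_
    intro s'' t l' hf' hth hT hdl hrun ht
    rw [ks] at hth
    refine ⟨⟨l', 2 * run, r, 4 * w, h.step hth hT hdl hrun⟩, ?_⟩
    rw [hdl, hrun, h.dl, h.run_eq, ← hth.length]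
    rw [← hth.length] at ht
    have h8 : 1 ≤ l'.length * run := by
      have h9 := hth.length
      have h10 := h.length
      have : 0 < 8 ^ (r + 1) := by positivity
      have : 0 < run * 8 ^ (r + 1) := Nat.mul_pos h.run_pos this
      exact Nat.mul_pos (by omega) h.run_pos
    have e9 : 50 * (8 * run) * (4 * l'.length) = 1600 * (l'.length * run) := by ring
    have e10 : l'.length * (2 * run) = 2 * (l'.length * run) := by ring
    have e11 : 4 * l'.length * run = 4 * (l'.length * run) := by ring
    rw [e9] at ht
    rw [e10, e11]
    omega
  rintro s3 t3 hf3 ⟨l, run, r, w, h⟩ hnlt3 ht3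
  have k3 : s3.key = s.key := by rw [key_eq_of_fr hf3 rfl rfl]; simp [k2]
  clear hf3
  simp only [Test.holds, Opd.val_r, h.dl, h.run_eq, not_lt] at hnlt3
  have hll : l.length = run := by
    refine le_antisymm hnlt3 ?_
    rw [h.length]
    exact Nat.le_mul_of_pos_right _ (by positivity)
  have ht3' : t3 ≤ 900 * len + 1 := by
    have : t3 ≤ 900 * (len * 1) + 1 := le_trans (Nat.le_add_right _ _) ht3
    omega
  have hsub := h.sub.subset
  have hinjl : ∀ x ∈ l, ∀ y ∈ l, s.key x = s.key y → x = y := fun x hx y hy =>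
    hinj x (hsub hx) y (hsub hy)
  have hlnd := hl.sublist h.sub
  have hrunM : run ≤ M := by have := h.sub.length_le; omega
  have hrp := h.run_pos
  refine wp_seq (wp_op trivial ?_)
  simp only [Op.eff, Opd.val_r, Opd.val_c, Arith.eval, h.run_eq]
  -- The final sample has `run` elements of weight `run * run` each, so `len` is the cube of `run`,
  -- and ranking all of the sample in quadratic time is affordable.
  have hrr : run * run ≤ len := by
    rw [← h.wt, h.wt_eq, hll]
    exact Nat.mul_le_mul_left _ (Nat.le_mul_of_pos_left _ hrp)
  refine wp_forLt run (fun j s' => (∀ x ∈ l.take j, gtCount s.key (s.key x) l ≠ run / 8) ∨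
    (s'.reg .pv ∈ l ∧ gtCount s.key (s.key (s'.reg .pv)) l = run / 8)) (fun _ => 7 * run + 6) (by rfl)
    ?_ (by simp [h.run_eq]) (by omega) (by simp) ?_ ?_
  · rintro x ⟨⟩
    exact ⟨by decide, rfl⟩
  · intro j s' hj hi hf hJ
    have f1 : s'.arr .T = s3.arr .T := by rw [hf.arr _ rfl]; simp
    have f2 : s'.reg .run = run := by rw [hf.reg _ rfl]; simp [h.run_eq]
    have f3 : s'.reg .q = run / 8 := by rw [hf.reg _ rfl]; simp
    have ks : s'.key = s.key := by rw [key_eq_of_fr hf rfl rfl]; simp [k3]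
    have hv : s3.arr .T j = l[j] := h.holds j (by omega)
    refine wp_seq (wp_op (by simp [hi]; omega) (wp_seq ?_))
    simp only [Op.eff, hi, f1, hv]
    refine wp_rankC (X := l) (by simp [Opd.noR]) (by simp [Opd.noR]) (by simp)
      (by simpa [f1] using h.holds) (by simp [f2, hll]) (by simp; omega) (by omega)
      (fun y hy => hXM y (hsub hy)) (by simp; exact hXM _ (hsub (List.getElem_mem _))) ?_
    intro s4 t4 hf4 hrk ht4
    have g1 : s4.reg .q = run / 8 := by rw [hf4.reg _ rfl]; simp [f3]
    have g2 : s4.reg .x = l[j] := by rw [hf4.reg _ rfl]; simp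
    have g3 : s4.reg .pv = s'.reg .pv := by rw [hf4.reg _ rfl]; simp
    simp only [St.setR_key, ks, St.setR_reg, if_true] at hrk
    simp only [block, wp_ite_iff, wp_op_iff, wp_skip_iff, Op.ok, Op.eff, Test.ok, Test.holds, Opd.val_r,
      hrk, g1, g2]
    refine ⟨trivial, fun heq => ⟨trivial, by omega, .inr (by simp [heq])⟩, fun hne => ⟨by omega, ?_⟩⟩
    have g4 : (s4.setR .gi (j + 1)).reg .pv = s'.reg .pv := by simp [g3]
    rw [g4]
    rcases hJ with hJ | hJ
    · left
      intro x hx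
      rw [List.take_succ_eq_append_getElem (by omega), List.mem_append, List.mem_singleton] at hx
      rcases hx with hx | rfl
      · exact hJ x hx
      · exact hne
    · exact .inr hJ
  · intro s5 t5 hJ hi hf ht5
    rw [sum_const_range] at ht5
    have hpv : s5.reg .pv ∈ l ∧ gtCount s.key (s.key (s5.reg .pv)) l = run / 8 := by
      rcases hJ with hJ | hJ
      · obtain ⟨x, hx, hxr⟩ := exists_rank hlnd hinjl (q := run / 8) (by omega)
        rw [← hll, List.take_length] at hJ
        rw [hll] at hJ
        exact absurd hxr (hJ x hx)
      · exact hJ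
    -- The sample is drawn from a prefix only; the remaining elements can only increase the counts
    -- on both sides of the pivot.
    have hsubl : ∀ p : ℕ → Bool, (lA.take len).countP p ≤ lA.countP p := fun p =>
      (List.take_sublist len lA).countP_le
    obtain ⟨q1, q2⟩ := pivot_quality (key := s.key) (l₀ := lA.take len) (lA := lA) (L := run) (w := w)
      (len := len) hlnd hinjl (fun v => ⟨hsubl _, hsubl _⟩) hll (by rw [← hll]; exact h.wt) (by omega)
      h.ge h.lt hpv.1 hpv.2 h.wt_eq
    refine ⟨_, rfl, hsub hpv.1, q1, q2, ?_⟩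
    have : run ≤ len := le_trans (Nat.le_mul_of_pos_left _ hrp) hrr
    rw [hP0] at ht2
    have h7 : run * (7 * run + 6 + 2) ≤ 15 * len := by
      have : run * (7 * run + 6 + 2) = 7 * (run * run) + 8 * run := by ring
      omega
    omega

end
-- Selection of the heaviest elements in linear time
open Cmd

/-- One round of the selection. -/
def roundC : Cmd := block [
  pivotC,
  rankC .A (.c 0) (.r .sn) .pv,
  .ite (.lt (.r .rk) (.r .sm))
    (block [
      .op (.ar .add .g (.r .rk) (.c 1)),
      .ite (.eq (.r .g) (.r .sm))
        (.op (.set .fin (.c 1)))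
        (block [
          filterC .A .sn .skip (.key .se .pv),
          .op (.ar .sub .sm (.r .sm) (.r .g))])])
    (filterC .A .sn .skip (.key .pv .se))]

/-- Keep the `m` elements with the largest keys in the list `S`. -/
def selectC : Cmd := .ite (.lt (.r .m) (.r .ns))
  (block [
    cpy .S .A (.r .ns),
    .op (.set .sn (.r .ns)),
    .op (.set .sm (.r .m)),
    .op (.set .fin (.c 0)),
    .loop (.eq (.r .fin) (.c 0)) roundC,
    filterC .S .ns .skip (.kle .pv .se)]) .skip

section
variable {B M : ℕ} {s : St} {Q : ℕ → St → Prop}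

theorem gtCount_filter_gt {key : ℕ → ℝ ×ₗ ℕ} (l : List ℕ) (p x : ℕ) (h : key p < key x) :
    gtCount key (key x) (l.filter fun y => decide (key p < key y)) = gtCount key (key x) l := by
  rw [gtCount, gtCount, List.countP_filter]
  refine List.countP_congr fun y _ => ?_
  simp
  exact fun h' => h.trans h'

theorem gtCount_filter_lt {key : ℕ → ℝ ×ₗ ℕ} (l : List ℕ) (p x : ℕ) (h : key x < key p) :
    gtCount key (key x) l =
      gtCount key (key x) (l.filter fun y => decide (key y < key p)) + geCount key (key p) l := by
  induction l with
  | nil => simp [gtCount, geCount]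
  | cons y l ih =>
    simp only [gtCount, geCount, List.countP_cons, List.filter_cons] at *
    rcases lt_or_ge (key y) (key p) with h1 | h1
    · simp [h1, not_le.2 h1, ih, List.countP_cons]; omega
    · simp [h1, not_lt.2 h1, ih, h.trans_le h1]; omega

theorem length_filter_lt_key {key : ℕ → ℝ ×ₗ ℕ} (l : List ℕ) (v : ℝ ×ₗ ℕ) :
    (l.filter fun y => decide (key y < v)).length = ltCount key v l := by
  rw [ltCount, List.countP_eq_length_filter]

/-- The invariant of the selection: it remains to find the element of rank `sm` in `lA`. -/
structure SelInv (key : ℕ → ℝ ×ₗ ℕ) (l : List ℕ) (m : ℕ) (s : St) (lA : List ℕ) (mm : ℕ) : Prop where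
  sub : lA.Sublist l
  holds : Holds (s.arr .A) lA
  sn : s.reg .sn = lA.length
  sm : s.reg .sm = mm
  pos : 1 ≤ mm
  le : mm ≤ lA.length
  le' : mm ≤ m
  count : ∀ x ∈ lA, gtCount key (key x) l + mm = gtCount key (key x) lA + m

/-- Whichever side of the pivot is discarded, at least one element in 512 goes. When the lower side
is discarded the pivot goes with it; this is the `1` in the second bound on the pivot. When the
upper side and the pivot go, the rank sought drops by their number. -/
theorem wp_roundC {l lA : List ℕ} {m mm : ℕ} (hl : l.Nodup)
    (hinj : ∀ x ∈ l, ∀ y ∈ l, s.key x = s.key y → x = y)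
    (h : SelInv s.key l m s lA mm) (hfin : s.reg .fin = 0)
    (hlM : l.length ≤ M) (hMB : 8 * M + 8 ≤ B) (hXM : ∀ y ∈ l, y < M)
    (hQ : ∀ s' t, Fr roundC s s' → t ≤ 1030 * lA.length →
      (s'.reg .fin = 1 ∧ s'.reg .pv ∈ l ∧ gtCount s.key (s.key (s'.reg .pv)) l + 1 = m) ∨
      (s'.reg .fin = 0 ∧ ∃ lA' mm', SelInv s.key l m s' lA' mm' ∧
        lA.length + 512 * lA'.length ≤ 512 * lA.length) → Q t s') :
    wp B M roundC s Q := by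
  have hsub := h.sub.subset
  have hlA := hl.sublist h.sub
  have hAM : lA.length ≤ M := h.sub.length_le.trans hlM
  have hpos : 1 ≤ lA.length := h.pos.trans h.le
  have hinjA : ∀ x ∈ lA, ∀ y ∈ lA, s.key x = s.key y → x = y := fun x hx y hy =>
    hinj x (hsub hx) y (hsub hy)
  refine wp_mono (Q := fun t s' => t ≤ 1030 * lA.length ∧
      ((s'.reg .fin = 1 ∧ s'.reg .pv ∈ l ∧ gtCount s.key (s.key (s'.reg .pv)) l + 1 = m) ∨
      (s'.reg .fin = 0 ∧ ∃ lA' mm', SelInv s.key l m s' lA' mm' ∧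
        lA.length + 512 * lA'.length ≤ 512 * lA.length))) ?_
      (fun t s' hf h => hQ s' t hf h.1 h.2)
  refine wp_seq (wp_pivotC hlA hinjA h.holds h.sn hpos hAM hMB (fun y hy => hXM y (hsub hy)) ?_)
  intro s1 t1 p hf1 hp hpA hq1 hq2 ht1
  have k1 : s1.key = s.key := key_eq_of_fr hf1 rfl rfl
  have a1 : s1.arr .A = s.arr .A := hf1.arr _ rfl
  have b1 : s1.reg .sn = lA.length := (hf1.reg _ rfl).trans h.sn
  have b2 : s1.reg .sm = mm := (hf1.reg _ rfl).trans h.sm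
  have b3 : s1.reg .fin = 0 := (hf1.reg _ rfl).trans hfin
  have hpM := hXM p (hsub hpA)
  refine wp_seq (wp_rankC (X := lA) (by simp [Opd.noR]) (by simp [Opd.noR]) (by simp)
    (by simpa [a1] using h.holds) (by simpa using b1) (by simpa using hAM) (by omega)
    (fun y hy => hXM y (hsub hy)) (by omega) ?_)
  intro s2 t2 hf2 hrk ht2
  rw [k1, hp] at hrk
  have k2 : s2.key = s.key := (key_eq_of_fr hf2 rfl rfl).trans k1
  have a2 : s2.arr .A = s.arr .A := (hf2.arr _ rfl).trans a1
  have c1 : s2.reg .sn = lA.length := (hf2.reg _ rfl).trans b1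
  have c2 : s2.reg .sm = mm := (hf2.reg _ rfl).trans b2
  have c3 : s2.reg .fin = 0 := (hf2.reg _ rfl).trans b3
  have c4 : s2.reg .pv = p := (hf2.reg _ rfl).trans hp
  clear hf1 hf2
  have hgl := gtCount_le_length (key := s.key) (s.key p) lA
  have hge := geCount_eq_gtCount hlA hinjA hpA
  have hsum := geCount_add_ltCount (key := s.key) (s.key p) lA
  have hle := h.le
  have hle' := h.le'
  refine wp_ite trivial (fun hlt => ?_) (fun hlt => ?_)
  · simp only [Test.holds, Opd.val_r, hrk, c2] at hlt
    refine wp_seq (wp_op (by simp [hrk]; omega) (wp_ite trivial (fun heq => ?_) (fun hne => ?_)))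
    · simp [hrk, c2, Arith.eval] at heq
      refine wp_op trivial ⟨by omega, .inl ?_⟩
      simp [c4]
      refine ⟨hsub hpA, ?_⟩
      have := h.count p hpA
      omega
    · simp [hrk, c2, Arith.eval] at hne
      refine wp_seq (wp_filterC (T := 0) (l := lA) (P := fun y => s.key y < s.key p) (by simp) rfl rfl rfl rfl (fun _ => rfl)
        (fun _ => rfl) (by simpa [a2] using h.holds) (by simpa using c1) (by omega) hAM ?_ ?_)
      · intro s' hr ha hw hmem
        have e1 : s'.reg .pv = p := by rw [hr .pv (by simp) (by simp) (by simp) rfl]; simp [c4]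
        have ks : s'.key = s.key := by
          rw [← k2]
          funext v
          simp [St.key, ha .E (by simp), hw]
        exact wp_skip (by simp [ks, e1, hpM, hXM _ (hsub hmem)])
      · intro s3 t3 hf3 hA3 hn3 ht3
        have d1 : s3.reg .sm = mm := by rw [hf3.reg _ rfl]; simp [c2]
        have d2 : s3.reg .g = gtCount s.key (s.key p) lA + 1 := by
          rw [hf3.reg _ rfl]; simp [hrk, Arith.eval]
        have d3 : s3.reg .fin = 0 := by rw [hf3.reg _ rfl]; simp [c3]
        refine wp_op trivial ⟨by omega, .inr ⟨by simp [d3], 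
          lA.filter (fun y => decide (s.key y < s.key p)), mm - (gtCount s.key (s.key p) lA + 1), ?_, ?_⟩⟩
        · constructor
          · exact List.filter_sublist.trans h.sub
          · simpa using hA3
          · simpa using hn3
          · simp [d1, d2, Arith.eval]
          · omega
          · rw [length_filter_lt_key]; omega
          · omega
          · intro x hx
            simp only [List.mem_filter, decide_eq_true_eq] at hx
            have h1 := h.count x hx.1
            rw [gtCount_filter_lt lA p x hx.2, hge] at h1
            omega
        · rw [length_filter_lt_key]; omega
  · simp only [Test.holds, Opd.val_r, hrk, c2, not_lt] at hlt
    refine wp_filterC (T := 0) (l := lA) (P := fun y => s.key p < s.key y) (by simp) rfl rfl rfl rfl (fun _ => rfl)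
      (fun _ => rfl) (by simpa [a2] using h.holds) (by simpa using c1) (by omega) hAM ?_ ?_
    · intro s' hr ha hw hmem
      have e1 : s'.reg .pv = p := by rw [hr .pv (by simp) (by simp) (by simp) rfl]; simp [c4]
      have ks : s'.key = s.key := by
        rw [← k2]
        funext v
        simp [St.key, ha .E (by simp), hw]
      exact wp_skip (by simp [ks, e1, hpM, hXM _ (hsub hmem)])
    · intro s3 t3 hf3 hA3 hn3 ht3
      have d1 : s3.reg .sm = mm := by rw [hf3.reg _ rfl]; simp [c2]
      have d3 : s3.reg .fin = 0 := by rw [hf3.reg _ rfl]; simp [c3]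
      have hfl : (lA.filter fun y => decide (s.key p < s.key y)).length = gtCount s.key (s.key p) lA := by
        rw [gtCount, List.countP_eq_length_filter]
      refine ⟨by omega, .inr ⟨d3, lA.filter (fun y => decide (s.key p < s.key y)), mm, ?_, ?_⟩⟩
      · constructor
        · exact List.filter_sublist.trans h.sub
        · exact hA3
        · exact hn3
        · exact d1
        · exact h.pos
        · rw [hfl]; exact hlt
        · exact hle'
        · intro x hx
          simp only [List.mem_filter, decide_eq_true_eq] at hx
          rw [gtCount_filter_gt lA p x hx.2]
          exact h.count x hx.1
      · rw [hfl]; omega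

theorem wp_selectC {l : List ℕ} {m : ℕ} (hl : l.Nodup)
    (hinj : ∀ x ∈ l, ∀ y ∈ l, s.key x = s.key y → x = y)
    (hS : Holds (s.arr .S) l) (hns : s.reg .ns = l.length) (hm : s.reg .m = m) (hm0 : 1 ≤ m)
    (hlM : l.length ≤ M) (hMB : 8 * M + 8 ≤ B) (hXM : ∀ y ∈ l, y < M)
    (hQ : ∀ s' t l', Fr selectC s s' → l' = l.filter (fun x => decide (gtCount s.key (s.key x) l < m)) →
      Holds (s'.arr .S) l' → s'.reg .ns = l'.length → t ≤ 600000 * l.length + 20 → Q t s') :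
    wp B M selectC s Q := by
  refine wp_mono (Q := fun t s' => ∃ l', l' = l.filter (fun x => decide (gtCount s.key (s.key x) l < m)) ∧
      Holds (s'.arr .S) l' ∧ s'.reg .ns = l'.length ∧ t ≤ 600000 * l.length + 20) ?_
      (fun t s' hf ⟨l', h1, h2, h3, h4⟩ => hQ s' t l' hf h1 h2 h3 h4)
  refine wp_ite trivial (fun hlt => ?_) (fun hlt => ?_)
  · simp only [Test.holds, Opd.val_r, hm, hns] at hlt
    refine wp_seq (wp_cpy (l := l) (by decide) (by rintro x ⟨⟩; decide) hS (by simpa using hns)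
      (by omega) hlM ?_)
    intro s1 t1 hf1 hA ht1
    have k1 : s1.key = s.key := key_eq_of_fr hf1 rfl rfl
    have a1 : s1.arr .S = s.arr .S := hf1.arr _ rfl
    have b1 : s1.reg .ns = l.length := (hf1.reg _ rfl).trans hns
    have b2 : s1.reg .m = m := (hf1.reg _ rfl).trans hm
    clear hf1
    refine wp_seq (wp_op trivial (wp_seq (wp_op trivial (wp_seq (wp_op trivial (wp_seq ?_))))))
    -- A round costs at most `1030 * sn` steps and lowers `sn` by at least `sn / 512`, so `1031 *
    -- 512 * sn` pays for it.
    refine wp_loop (fun s' => (s'.reg .fin = 1 ∧ s'.reg .pv ∈ l ∧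
        gtCount s.key (s.key (s'.reg .pv)) l + 1 = m) ∨
      (s'.reg .fin = 0 ∧ ∃ lA mm, SelInv s.key l m s' lA mm))
      (fun s' => if s'.reg .fin = 0 then 1031 * 512 * s'.reg .sn + 1 else 0) ?_ ?_ ?_
    · refine .inr ⟨by simp, l, m, ?_⟩
      constructor
      · exact List.Sublist.refl _
      · simpa using hA
      · simpa using b1
      · simpa using b2
      · exact hm0
      · omega
      · exact le_rfl
      · intros; rfl
    · intro s' hf hI
      refine ⟨trivial, fun hb => ?_⟩
      simp at hb
      obtain ⟨lA, mm, h⟩ : ∃ lA mm, SelInv s.key l m s' lA mm := by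
        rcases hI with hI | hI
        · omega
        · exact hI.2
      have ks : s'.key = s.key := by rw [key_eq_of_fr hf rfl rfl]; simp [k1]
      refine wp_roundC hl (by rw [ks]; exact hinj) (by rw [ks]; exact h) hb hlM hMB hXM ?_
      rw [ks]
      rintro s2 t2 hf2 ht2 hcase
      have hpos := h.pos.trans h.le
      rcases hcase with h1 | ⟨h1, lA', mm', h2, h3⟩
      · refine ⟨.inl h1, ?_⟩
        simp [h1.1, hb, h.sn]
        omega
      · refine ⟨.inr ⟨h1, lA', mm', h2⟩, ?_⟩
        simp [h1, hb, h.sn, h2.sn]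
        omega
    · intro s2 t2 hf hI hb ht2
      simp at hb
      obtain ⟨h1, h2, h3⟩ : s2.reg .fin = 1 ∧ s2.reg .pv ∈ l ∧
          gtCount s.key (s.key (s2.reg .pv)) l + 1 = m := by
        rcases hI with hI | hI
        · exact hI
        · exact absurd hI.1 hb
      have ks : s2.key = s.key := by rw [key_eq_of_fr hf rfl rfl]; simp [k1]
      have a2 : s2.arr .S = s.arr .S := by rw [hf.arr _ rfl]; simp [a1]
      have b2 : s2.reg .ns = l.length := by rw [hf.reg _ rfl]; simp [b1]
      -- The pivot found has rank `m - 1`, so the elements of rank below `m` are those with a key at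
      -- least that of the pivot, and one comparison per element decides.
      have hflt : l.filter (fun x => decide (gtCount s.key (s.key x) l < m)) =
          l.filter (fun y => decide (s.key (s2.reg .pv) ≤ s.key y)) := by
        refine List.filter_congr fun x hx => ?_
        congr 1
        rw [eq_iff_iff]
        constructor
        · intro h
          by_contra hlt
          have := gtCount_lt_of_lt (key := s.key) h2 (not_le.1 hlt)
          omega
        · intro h
          rcases h.eq_or_lt with h | h
          · have := hinj _ h2 _ hx h
            rw [← this]
            omega
          · have := gtCount_lt_of_lt (key := s.key) hx h
            omega
      simp only [hflt, exists_eq_left]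
      simp [b1] at ht2
      refine wp_filterC (T := 0) (l := l) (P := fun y => s.key (s2.reg .pv) ≤ s.key y) (by simp) rfl rfl rfl rfl (fun _ => rfl)
        (fun _ => rfl) (by simpa [a2] using hS) b2 (by omega) hlM ?_ ?_
      · intro s' hr ha hw hmem
        have e1 : s'.reg .pv = s2.reg .pv := hr .pv (by simp) (by simp) (by simp) rfl
        have ks' : s'.key = s.key := by
          rw [← ks]
          funext v
          simp [St.key, ha .E (by simp), hw]
        exact wp_skip (by simp [ks', e1, hXM _ h2, hXM _ hmem])
      · intro s3 t3 hf3 hA3 hn3 ht3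
        refine ⟨hA3, hn3, ?_⟩
        omega
  · simp only [Test.holds, Opd.val_r, hm, hns, not_lt] at hlt
    have hall : l.filter (fun x => decide (gtCount s.key (s.key x) l < m)) = l := by
      rw [List.filter_eq_self]
      intro x hx
      have h1 := gtCount_lt (key := s.key) hx le_rfl
      have h2 := geCount_le_length (key := s.key) (s.key x) l
      simp
      omega
    exact wp_skip ⟨l, hall.symm, hS, hns, by omega⟩

end
open Cmd

/-! ## The reduction of a graph with given classes -/

/-- A linked list with the links `nx`; the pointer to the cell `x` is `x + 1`. -/
def Chain (nx : ℕ → ℕ) : ℕ → List ℕ → Prop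
  | h, [] => h = 0
  | h, x :: l => h = x + 1 ∧ Chain nx (nx x) l

theorem Chain.congr {nx nx' : ℕ → ℕ} {h : ℕ} {l : List ℕ} (hc : Chain nx h l)
    (hx : ∀ x ∈ l, nx' x = nx x) : Chain nx' h l := by
  induction l generalizing h with
  | nil => exact hc
  | cons x l ih =>
    refine ⟨hc.1, ?_⟩
    rw [hx x (by simp)]
    exact ih hc.2 fun y hy => hx y (by simp [hy])

section Pure

variable (ca cb : ℕ → ℕ)

/-- The cells for the edges `< N` incident to the class `c`: `2e` if `c` is the first class of `e`,
and `2e + 1` if it is the second one. -/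
def incNodes : ℕ → ℕ → List ℕ
  | 0, _ => []
  | e + 1, c =>
    if ca e = cb e then incNodes e c
    else if c = ca e then 2 * e :: incNodes e c
    else if c = cb e then (2 * e + 1) :: incNodes e c
    else incNodes e c

/-- The edges `< N` incident to the class `c`. -/
def incEdges (N c : ℕ) : List ℕ := (incNodes ca cb N c).map (· / 2)

variable {ca cb}

theorem incNodes_lt {N c x : ℕ} (h : x ∈ incNodes ca cb N c) : x < 2 * N := by
  induction N with
  | zero => simp [incNodes] at h
  | succ e ih =>
    simp only [incNodes] at h
    split_ifs at h
    · have := ih h; omega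
    · rcases List.mem_cons.1 h with h | h
      · omega
      · have := ih h; omega
    · rcases List.mem_cons.1 h with h | h
      · omega
      · have := ih h; omega
    · have := ih h; omega

theorem mem_incEdges {N c e : ℕ} :
    e ∈ incEdges ca cb N c ↔ e < N ∧ ca e ≠ cb e ∧ (ca e = c ∨ cb e = c) := by
  induction N with
  | zero => simp [incEdges, incNodes]
  | succ N ih =>
    have ih' : (∃ x ∈ incNodes ca cb N c, x / 2 = e) ↔ e < N ∧ ca e ≠ cb e ∧ (ca e = c ∨ cb e = c) := by
      rw [← ih]; simp [incEdges]
    have h2 : e < N + 1 ↔ e = N ∨ e < N := by omega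
    have h3 : (2 * N + 1) / 2 = N := by omega
    simp only [incEdges, incNodes]
    split_ifs with h h' h'' <;>
      simp only [List.map_cons, List.mem_cons, List.mem_map, ih', h2,
        Nat.mul_div_cancel_left N (by norm_num : 0 < 2), h3]
    · constructor
      · rintro ⟨a, b⟩; exact ⟨.inr a, b⟩
      · rintro ⟨rfl | a, b⟩
        · exact absurd h b.1
        · exact ⟨a, b⟩
    · constructor
      · rintro (rfl | ⟨a, b⟩)
        · exact ⟨.inl rfl, h, .inl h'.symm⟩
        · exact ⟨.inr a, b⟩
      · rintro ⟨rfl | a, b⟩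
        · exact .inl rfl
        · exact .inr ⟨a, b⟩
    · constructor
      · rintro (rfl | ⟨a, b⟩)
        · exact ⟨.inl rfl, h, .inr h''.symm⟩
        · exact ⟨.inr a, b⟩
      · rintro ⟨rfl | a, b⟩
        · exact .inl rfl
        · exact .inr ⟨a, b⟩
    · constructor
      · rintro ⟨a, b⟩; exact ⟨.inr a, b⟩
      · rintro ⟨rfl | a, b⟩
        · exact absurd b.2 (by simp [Ne.symm h', Ne.symm h''])
        · exact ⟨a, b⟩

theorem nodup_incEdges (N c : ℕ) : (incEdges ca cb N c).Nodup := by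
  induction N with
  | zero => simp [incEdges, incNodes]
  | succ N ih =>
    have hN : N ∉ incEdges ca cb N c := fun h => by simp [mem_incEdges] at h
    have h3 : (2 * N + 1) / 2 = N := by omega
    simp only [incEdges, incNodes] at *
    split_ifs <;> try simp only [List.map_cons, List.nodup_cons, h3,
        Nat.mul_div_cancel_left N (by norm_num : 0 < 2)]
    · exact ih
    · exact ⟨hN, ih⟩
    · exact ⟨hN, ih⟩
    · exact ih

theorem length_incEdges (N c : ℕ) : (incEdges ca cb N c).length = (incNodes ca cb N c).length := by
  simp [incEdges]

/-- An edge owns at most two cells, one for each of its classes. This makes work that is linear in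
the number of incident edges of each class linear in total. -/
theorem sum_length_incNodes (N r : ℕ) :
    ∑ c ∈ Finset.range r, (incNodes ca cb N c).length ≤ 2 * N := by
  induction N with
  | zero => simp [incNodes]
  | succ N ih =>
    have h : ∀ c, (incNodes ca cb (N + 1) c).length ≤ (incNodes ca cb N c).length +
        ((if c = ca N then 1 else 0) + (if c = cb N then 1 else 0)) := by
      intro c
      simp only [incNodes]
      split_ifs <;> simp
    calc _ ≤ ∑ c ∈ Finset.range r, ((incNodes ca cb N c).length +
        ((if c = ca N then 1 else 0) + (if c = cb N then 1 else 0))) :=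
          Finset.sum_le_sum fun c _ => h c
      _ ≤ 2 * N + (1 + 1) := by
        rw [Finset.sum_add_distrib, Finset.sum_add_distrib]
        refine Nat.add_le_add ih (Nat.add_le_add ?_ ?_) <;>
        · rw [Finset.sum_ite_eq']
          split_ifs <;> simp
      _ = _ := by ring

variable (ca cb) in
/-- The class other than `c` of an edge. -/
def oth (c e : ℕ) : ℕ := ca e + cb e - c

variable (key : ℕ → ℝ ×ₗ ℕ)

variable (ca cb) in
/-- `e` has the largest key among the edges in `l` with the same other class. -/
def BestP (l : List ℕ) (c e : ℕ) : Prop :=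
  ∀ e' ∈ l, oth ca cb c e' = oth ca cb c e → key e' ≤ key e

noncomputable instance (l : List ℕ) (c : ℕ) : DecidablePred (BestP ca cb key l c) :=
  fun _ => by unfold BestP; infer_instance

/-- The `m` elements of the list with the largest keys. -/
noncomputable def topL (m : ℕ) (l : List ℕ) : List ℕ :=
  l.filter fun x => decide (gtCount key (key x) l < m)

variable (ca cb) in
/-- The edges selected for the class `c`. -/
noncomputable def selL (N k2 c : ℕ) : List ℕ :=
  topL key k2 ((incEdges ca cb N c).filter (BestP ca cb key (incEdges ca cb N c) c))

variable {key} in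
theorem mem_selL_inc {N k2 c e : ℕ} (h : e ∈ selL ca cb key N k2 c) : e ∈ incEdges ca cb N c := by
  simp only [selL, topL, List.mem_filter] at h
  exact h.1.1

end Pure

/-- Put the edges incident to the class `c` into `S`. -/
def gatherC : Cmd := block [
  .op (.set .ns (.c 0)),
  .op (.ld .nd .hd .c),
  .loop (.lt (.c 0) (.r .nd)) (block [
    .op (.ar .sub .nd (.r .nd) (.c 1)),
    .op (.ar .div .e (.r .nd) (.c 2)),
    .op (.st .S .ns (.r .e)),
    .op (.ar .add .ns (.r .ns) (.c 1)),
    .op (.ld .nd .nx .nd)])]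

/-- Compute the class other than `c` of the edge `e`. -/
def othC (e : V) : Cmd := block [
  .op (.ld .x .ca e),
  .op (.ld .f0 .cb e),
  .op (.ar .add .x (.r .x) (.r .f0)),
  .op (.ar .sub .x (.r .x) (.r .c))]

section
variable {B M : ℕ} {s : St} {Q : ℕ → St → Prop}

theorem wp_gatherC {L : List ℕ} (hc : s.reg .c < M) (hL : Chain (s.arr .nx) (s.arr .hd (s.reg .c)) L)
    (hLM : ∀ x ∈ L, x < M) (hlen : L.length < M) (hMB : M ≤ B)
    (hQ : ∀ s' t, Fr gatherC s s' → Holds (s'.arr .S) (L.map (· / 2)) → s'.reg .ns = L.length →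
      t ≤ 7 * L.length + 3 → Q t s') : wp B M gatherC s Q := by
  refine wp_mono (Q := fun t s' => Holds (s'.arr .S) (L.map (· / 2)) ∧ s'.reg .ns = L.length ∧
      t ≤ 7 * L.length + 3) ?_ (fun t s' hf h => hQ s' t hf h.1 h.2.1 h.2.2)
  refine wp_seq (wp_op trivial (wp_seq (wp_op (by simpa using hc) ?_)))
  refine wp_loop (fun s' => ∃ l1 l2, L = l1 ++ l2 ∧ Chain (s.arr .nx) (s'.reg .nd) l2 ∧
    Holds (s'.arr .S) (l1.map (· / 2)) ∧ s'.reg .ns = l1.length)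
    (fun s' => 6 * (L.length - s'.reg .ns)) ⟨[], L, rfl, by simpa using hL, by simpa using Holds.nil _,
      by simp⟩ ?_ ?_
  · rintro s' hf ⟨l1, l2, h1, h2, h3, h4⟩
    refine ⟨trivial, fun hb => ?_⟩
    simp at hb
    have e1 : s'.arr .nx = s.arr .nx := by rw [hf.arr _ rfl]; simp
    cases l2 with
    | nil => simp only [Chain] at h2; omega
    | cons x l2 =>
      obtain ⟨h2, h5⟩ := h2
      have hx := hLM x (by simp [h1])
      simp only [block, wp_seq_iff, wp_op_iff, Op.ok, Op.eff]
      simp [h2, h4, Arith.eval, e1, h1] at *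
      refine ⟨by omega, by omega, hx, ⟨l1 ++ [x], l2, by simp, h5, ?_, by simp⟩, by omega⟩
      rw [List.map_append]
      exact h3.concat (by simp) _
  · rintro s' t hf ⟨l1, l2, h1, h2, h3, h4⟩ hb ht
    simp at hb
    cases l2 with
    | nil =>
      simp at h1
      subst h1
      refine ⟨h3, h4, ?_⟩
      have : t ≤ 6 * (L.length - 0) + 1 := le_trans (Nat.le_add_right _ _) ht
      omega
    | cons x l2 => have := h2.1; omega

theorem wp_othC {e : V} (he : e ≠ .x ∧ e ≠ .f0) (heM : s.reg e < M)
    (hB : s.arr .ca (s.reg e) + s.arr .cb (s.reg e) ≤ B)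
    (hQ : ∀ s', Fr (othC e) s s' → s'.reg .x = oth (s.arr .ca) (s.arr .cb) (s.reg .c) (s.reg e) →
      Q 4 s') : wp B M (othC e) s Q := by
  refine wp_mono (Q := fun t s' => s'.reg .x = oth (s.arr .ca) (s.arr .cb) (s.reg .c) (s.reg e) ∧ t = 4)
    ?_ (fun t s' hf h => h.2 ▸ hQ s' hf h.1)
  simp only [othC, block, wp_seq_iff, wp_op_iff, Op.ok, Op.eff]
  simp [he, heM, Arith.eval, hB, oth]

/-- For the class `c`, keep in `S` the edges that are best for their other class. -/
def bestC : Cmd := block [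
  forLt .i (.r .ns) (block [
    .op (.ld .e .S .i), othC .e, .op (.st .best .x (.r .e))]),
  forLt .i (.r .ns) (block [
    .op (.ld .e .S .i), othC .e, .op (.ld .f1 .best .x),
    .ite (.key .f1 .e) (.op (.st .best .x (.r .e))) .skip]),
  filterC .S .ns (block [othC .se, .op (.ld .f1 .best .x)]) (.eq (.r .f1) (.r .se))]

/-- The table `best` is indexed by the other class and never cleared, since clearing it for each
class would be too slow. The first pass writes some edge of `l` into every entry that matters; the
second raises the entries to the heaviest edge; the third keeps the edges that won. So the cost
depends on `l` alone and not on the number of classes. -/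
theorem wp_bestC {l : List ℕ}
    (hinj : ∀ x ∈ l, ∀ y ∈ l, s.key x = s.key y → x = y)
    (hS : Holds (s.arr .S) l) (hns : s.reg .ns = l.length) (hlM : l.length ≤ M)
    (hMB : 2 * M ≤ B) (hXM : ∀ y ∈ l, y < M)
    (hcl : ∀ y ∈ l, s.arr .ca y + s.arr .cb y ≤ B ∧
      oth (s.arr .ca) (s.arr .cb) (s.reg .c) y < M)
    (hQ : ∀ s' t, Fr bestC s s' →
      Holds (s'.arr .S) (l.filter (BestP (s.arr .ca) (s.arr .cb) s.key l (s.reg .c))) →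
      s'.reg .ns = (l.filter (BestP (s.arr .ca) (s.arr .cb) s.key l (s.reg .c))).length →
      t ≤ 40 * l.length + 10 → Q t s') : wp B M bestC s Q := by
  set o := oth (s.arr .ca) (s.arr .cb) (s.reg .c) with ho
  refine wp_mono (Q := fun t s' =>
    Holds (s'.arr .S) (l.filter (BestP (s.arr .ca) (s.arr .cb) s.key l (s.reg .c))) ∧
      s'.reg .ns = (l.filter (BestP (s.arr .ca) (s.arr .cb) s.key l (s.reg .c))).length ∧
      t ≤ 40 * l.length + 10) ?_ (fun t s' hf h => hQ s' t hf h.1 h.2.1 h.2.2)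
  refine wp_seq (wp_forLt l.length (fun j s' => ∀ y ∈ l.take j, s'.arr .best (o y) ∈ l ∧
    o (s'.arr .best (o y)) = o y) (fun _ => 6) (by rfl) (by rintro x ⟨⟩; exact ⟨by decide, rfl⟩)
    (by simpa using hns) (by omega) (by simp) ?_ ?_)
  · intro j s' hj hi hf hJ
    have e1 : s'.arr .S = s.arr .S := hf.arr _ rfl
    have e2 : s'.arr .ca = s.arr .ca := hf.arr _ rfl
    have e3 : s'.arr .cb = s.arr .cb := hf.arr _ rfl
    have e4 : s'.reg .c = s.reg .c := hf.reg _ rfl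
    have hmem : l[j] ∈ l := List.getElem_mem hj
    have hv : s.arr .S j = l[j] := hS j hj
    obtain ⟨q1, q2⟩ := hcl _ hmem
    refine wp_seq (wp_op (by simp [hi]; omega) (wp_seq ?_))
    simp only [Op.eff, hi, e1, hv]
    refine wp_othC (by simp) (by simpa using hXM _ hmem) (by simpa [e2, e3] using q1) ?_
    intro s2 hf2 hx
    simp only [St.setR_arr, St.setR_reg, reduceCtorEq, if_false, if_true, e2, e3, e4, ← ho] at hx
    have g1 : s2.reg .e = l[j] := by rw [hf2.reg _ rfl]; simp
    have g2 : s2.arr .best = s'.arr .best := by rw [hf2.arr _ rfl]; simp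
    refine wp_op (by simpa [hx] using q2) ⟨by omega, ?_⟩
    intro y hy
    rw [List.take_succ_eq_append_getElem hj, List.mem_append, List.mem_singleton] at hy
    simp only [Op.eff, St.setR_arr, St.setA_arr, if_true, hx, Opd.val_r, g1, g2]
    by_cases hoy : o y = o l[j]
    · simp [hoy]
    · rw [Function.update_of_ne hoy]
      rcases hy with hy | rfl
      · exact hJ y hy
      · exact absurd rfl hoy
  intro s1 t1 hJ1 hi1 hf1 ht1
  rw [sum_const_range] at ht1
  rw [List.take_length] at hJ1
  have a1 : s1.arr .S = s.arr .S := hf1.arr _ rfl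
  have a2 : s1.arr .ca = s.arr .ca := hf1.arr _ rfl
  have a3 : s1.arr .cb = s.arr .cb := hf1.arr _ rfl
  have a4 : s1.reg .c = s.reg .c := hf1.reg _ rfl
  have a5 : s1.reg .ns = l.length := (hf1.reg _ rfl).trans hns
  have a6 : s1.key = s.key := key_eq_of_fr hf1 rfl rfl
  clear hf1
  refine wp_seq (wp_forLt l.length (fun j s' => (∀ y ∈ l, s'.arr .best (o y) ∈ l ∧
    o (s'.arr .best (o y)) = o y) ∧ ∀ y ∈ l.take j, s.key y ≤ s.key (s'.arr .best (o y)))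
    (fun _ => 8) (by rfl) (by rintro x ⟨⟩; exact ⟨by decide, rfl⟩)
    (by simpa using a5) (by omega) (by simpa using hJ1) ?_ ?_)
  · rintro j s' hj hi hf ⟨hJ, hJ'⟩
    have e1 : s'.arr .S = s.arr .S := (hf.arr _ rfl).trans a1
    have e2 : s'.arr .ca = s.arr .ca := (hf.arr _ rfl).trans a2
    have e3 : s'.arr .cb = s.arr .cb := (hf.arr _ rfl).trans a3
    have e4 : s'.reg .c = s.reg .c := (hf.reg _ rfl).trans a4
    have e6 : s'.key = s.key := (key_eq_of_fr hf rfl rfl).trans a6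
    have hmem : l[j] ∈ l := List.getElem_mem hj
    have hv : s.arr .S j = l[j] := hS j hj
    obtain ⟨q1, q2⟩ := hcl _ hmem
    refine wp_seq (wp_op (by simp [hi]; omega) (wp_seq ?_))
    simp only [Op.eff, hi, e1, hv]
    refine wp_othC (by simp) (by simpa using hXM _ hmem) (by simpa [e2, e3] using q1) ?_
    intro s2 hf2 hx
    simp only [St.setR_arr, St.setR_reg, reduceCtorEq, if_false, if_true, e2, e3, e4, ← ho] at hx
    have g1 : s2.reg .e = l[j] := by rw [hf2.reg _ rfl]; simp
    have g2 : s2.arr .best = s'.arr .best := by rw [hf2.arr _ rfl]; simp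
    have g3 : s2.key = s.key := by rw [key_eq_of_fr hf2 rfl rfl]; simp [e6]
    obtain ⟨p1, p2⟩ := hJ _ hmem
    simp only [block, wp_seq_iff, wp_op_iff, wp_ite_iff, wp_skip_iff, Op.ok, Op.eff, Test.ok,
      Test.holds, St.setR_key, St.setR_reg, St.setR_arr, hx, g1, g2, g3, Opd.val_r, reduceCtorEq,
      if_true, if_false]
    refine ⟨q2, ⟨hXM _ p1, hXM _ hmem⟩, fun hlt => ⟨q2, by omega, ?_⟩, fun hge => ⟨by omega, ?_⟩⟩
    · simp only [St.setR_arr, St.setA_arr, if_true, g2]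
      constructor
      · intro y hy
        by_cases hoy : o y = o l[j]
        · simp [hoy]
        · rw [Function.update_of_ne hoy]
          exact hJ y hy
      · intro y hy
        rw [List.take_succ_eq_append_getElem hj, List.mem_append, List.mem_singleton] at hy
        by_cases hoy : o y = o l[j]
        · rw [hoy, Function.update_self]
          rcases hy with hy | rfl
          · have := hJ' y hy
            rw [hoy] at this
            exact this.trans hlt.le
          · exact le_rfl
        · rw [Function.update_of_ne hoy]
          rcases hy with hy | rfl
          · exact hJ' y hy
          · exact absurd rfl hoy
    · refine ⟨hJ, fun y hy => ?_⟩
      rw [List.take_succ_eq_append_getElem hj, List.mem_append, List.mem_singleton] at hy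
      rcases hy with hy | rfl
      · exact hJ' y hy
      · exact not_lt.1 hge
  rintro s2 t2 ⟨hJ2, hJ2'⟩ hi2 hf2 ht2
  rw [sum_const_range] at ht2
  rw [List.take_length] at hJ2'
  have b1 : s2.arr .S = s.arr .S := (hf2.arr _ rfl).trans a1
  have b2 : s2.arr .ca = s.arr .ca := (hf2.arr _ rfl).trans a2
  have b3 : s2.arr .cb = s.arr .cb := (hf2.arr _ rfl).trans a3
  have b4 : s2.reg .c = s.reg .c := (hf2.reg _ rfl).trans a4
  have b5 : s2.reg .ns = l.length := (hf2.reg _ rfl).trans a5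
  clear hf2
  refine wp_filterC (T := 5) (l := l) (P := BestP (s.arr .ca) (s.arr .cb) s.key l (s.reg .c))
    (by simp) rfl rfl rfl rfl (fun x => rfl) (fun x => rfl) (b1 ▸ hS) b5 (by omega) hlM ?_ ?_
  · intro s' hr ha hw hmem
    obtain ⟨q1, q2⟩ := hcl _ hmem
    have e2 : s'.arr .ca = s.arr .ca := (ha _ (by simp)).trans b2
    have e3 : s'.arr .cb = s.arr .cb := (ha _ (by simp)).trans b3
    have e4 : s'.reg .c = s.reg .c := (hr _ (by simp) (by simp) (by simp) rfl).trans b4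
    have e5 : s'.arr .best = s2.arr .best := ha _ (by simp)
    refine wp_seq (wp_othC (by simp) (hXM _ hmem) (by rw [e2, e3]; exact q1) ?_)
    intro s3 hf3 hx
    rw [e2, e3, e4, ← ho] at hx
    have g1 : s3.reg .se = s'.reg .se := hf3.reg _ rfl
    have g2 : s3.arr .best = s2.arr .best := (hf3.arr _ rfl).trans e5
    refine wp_op (by simpa [hx] using q2) ⟨by omega, trivial, ?_⟩
    simp [hx, g1, g2]
    obtain ⟨p1, p2⟩ := hJ2 _ hmem
    have hk := hJ2' _ hmem
    constructor
    · intro heq e' he' hoe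
      have := hJ2' e' he'
      rw [← ho] at hoe
      rw [hoe, heq] at this
      exact this
    · intro hbest
      -- The entry of the table and the edge bound each other's keys, and keys are distinct, so they
      -- are the same edge.
      exact hinj _ p1 _ hmem (le_antisymm (hbest _ p1 p2) hk)
  · intro s3 t3 hf3 hA3 hn3 ht3
    exact ⟨hA3, hn3, by omega⟩

/-- Process the class `c`. -/
def classC : Cmd := block [
  gatherC, bestC, .op (.set .m (.r .k2)), selectC,
  forLt .i (.r .ns) (block [
    .op (.ld .e .S .i), .op (.ld .x .ct .e), .op (.ar .add .x (.r .x) (.c 1)),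
    .op (.st .ct .e (.r .x))])]

theorem wp_classC {N k2 c r : ℕ} (hc : s.reg .c = c) (hk2 : s.reg .k2 = k2) (hk0 : 1 ≤ k2)
    (hinj : ∀ x < N, ∀ y < N, s.key x = s.key y → x = y)
    (hch : Chain (s.arr .nx) (s.arr .hd c) (incNodes (s.arr .ca) (s.arr .cb) N c))
    (hcr : c < r) (hrM : r ≤ M) (hNM : 2 * N < M) (hMB : 8 * M + 8 ≤ B)
    (hca : ∀ e < N, s.arr .ca e < r) (hcb : ∀ e < N, s.arr .cb e < r)
    (hct : ∀ e < N, s.arr .ct e ≤ 2)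
    (hQ : ∀ s' t, Fr classC s s' →
      (∀ e < N, s'.arr .ct e = s.arr .ct e +
        if e ∈ selL (s.arr .ca) (s.arr .cb) s.key N k2 c then 1 else 0) →
      t ≤ 600100 * (incNodes (s.arr .ca) (s.arr .cb) N c).length + 100 → Q t s') :
    wp B M classC s Q := by
  set L := incNodes (s.arr .ca) (s.arr .cb) N c with hL
  set E := incEdges (s.arr .ca) (s.arr .cb) N c with hE
  have hEL : E.length = L.length := length_incEdges _ _
  have hEnd : E.Nodup := nodup_incEdges _ _
  have hEmem : ∀ e ∈ E, e < N ∧ s.arr .ca e ≠ s.arr .cb e ∧ (s.arr .ca e = c ∨ s.arr .cb e = c) :=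
    fun e he => mem_incEdges.1 he
  have hElen : E.length ≤ N := by
    have : E.toFinset ⊆ Finset.range N := fun e he => by
      simpa using (hEmem e (by simpa using he)).1
    have := Finset.card_le_card this
    rwa [List.toFinset_card_of_nodup hEnd, Finset.card_range] at this
  refine wp_mono (Q := fun t s' => (∀ e < N, s'.arr .ct e = s.arr .ct e +
        if e ∈ selL (s.arr .ca) (s.arr .cb) s.key N k2 c then 1 else 0) ∧
      t ≤ 600100 * L.length + 100) ?_ (fun t s' hf h => hQ s' t hf h.1 h.2)
  refine wp_seq (wp_gatherC (L := L) (by omega) (by rw [hc]; exact hch)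
    (fun x hx => (incNodes_lt hx).trans hNM) (by omega) (by omega) ?_)
  intro s1 t1 hf1 hS1 hn1 ht1
  have a1 : s1.arr .ca = s.arr .ca := hf1.arr _ rfl
  have a2 : s1.arr .cb = s.arr .cb := hf1.arr _ rfl
  have a3 : s1.reg .c = c := (hf1.reg _ rfl).trans hc
  have a4 : s1.key = s.key := key_eq_of_fr hf1 rfl rfl
  have a5 : s1.arr .ct = s.arr .ct := hf1.arr _ rfl
  have a6 : s1.reg .k2 = k2 := (hf1.reg _ rfl).trans hk2
  clear hf1
  refine wp_seq (wp_bestC (l := E) ?_ hS1 (by omega) (by omega) (by omega)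
    (fun y hy => by have := (hEmem y hy).1; omega) ?_ ?_)
  · intro x hx y hy
    rw [a4]
    exact hinj x (hEmem x hx).1 y (hEmem y hy).1
  · intro y hy
    obtain ⟨h1, h2, h3⟩ := hEmem y hy
    have h4 := hca y h1
    have h5 := hcb y h1
    rw [a1, a2, a3, oth]
    omega
  intro s2 t2 hf2 hS2 hn2 ht2
  rw [a1, a2, a3, a4] at hS2 hn2
  set F := E.filter (BestP (s.arr .ca) (s.arr .cb) s.key E c) with hF
  have hFE : F.Sublist E := List.filter_sublist
  have b4 : s2.key = s.key := (key_eq_of_fr hf2 rfl rfl).trans a4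
  have b5 : s2.arr .ct = s.arr .ct := (hf2.arr _ rfl).trans a5
  have b6 : s2.reg .k2 = k2 := (hf2.reg _ rfl).trans a6
  clear hf2
  have hFlen := hFE.length_le
  refine wp_seq (wp_op trivial (wp_seq (wp_selectC (l := F) (m := k2) (hEnd.sublist hFE) ?_
    (by simpa using hS2) (by simpa using hn2) (by simp [b6]) hk0 (by omega) (by omega)
    (fun y hy => by have := (hEmem y (hFE.subset hy)).1; omega) ?_)))
  · intro x hx y hy
    simp only [Op.eff, St.setR_key, b4]
    exact hinj x (hEmem x (hFE.subset hx)).1 y (hEmem y (hFE.subset hy)).1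
  intro s3 t3 l' hf3 hl' hS3 hn3 ht3
  simp only [Op.eff, St.setR_key, b4] at hl'
  have hsel : l' = selL (s.arr .ca) (s.arr .cb) s.key N k2 c := hl'
  have c5 : s3.arr .ct = s.arr .ct := by rw [hf3.arr _ rfl]; simp [b5]
  clear hf3
  have hl'F : l'.Sublist F := by rw [hl']; exact List.filter_sublist
  have hl'len := hl'F.length_le
  have hl'N : ∀ e ∈ l', e < N := fun e he => (hEmem e (hFE.subset (hl'F.subset he))).1
  have hl'nd := hEnd.sublist (hl'F.trans hFE)
  rw [← hsel]
  refine wp_forLt l'.length (fun j s' => ∀ e < N, s'.arr .ct e = s.arr .ct e +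
        if e ∈ l'.take j then 1 else 0) (fun _ => 4) (by rfl)
    (by rintro x ⟨⟩; exact ⟨by decide, rfl⟩) hn3 (by omega) (by simp [c5]) ?_ ?_
  · intro j s' hj hi hf hJ
    have e1 : s'.arr .S = s3.arr .S := hf.arr _ rfl
    have hmem : l'[j] ∈ l' := List.getElem_mem hj
    have hv : s3.arr .S j = l'[j] := hS3 j hj
    have hN := hl'N _ hmem
    have hnot : l'[j] ∉ l'.take j := by
      intro h
      rw [List.mem_take_iff_getElem] at h
      obtain ⟨i, hi, h⟩ := h
      have := (hl'nd.getElem_inj_iff (hi := by omega) (hj := hj)).1 h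
      omega
    have hcur := hJ _ hN
    rw [if_neg hnot] at hcur
    have h2 := hct _ hN
    simp only [block, wp_seq_iff, wp_op_iff, Op.ok, Op.eff]
    simp [hi, e1, hv, hcur, Arith.eval]
    refine ⟨by omega, by omega, by omega, by omega, ?_⟩
    intro e he
    have hm : e ∈ l'.take (j + 1) ↔ e ∈ l'.take j ∨ e = l'[j] := by
      rw [List.take_succ_eq_append_getElem hj, List.mem_append, List.mem_singleton]
    simp only [Function.update_apply, hm]
    by_cases h : e = l'[j]
    · subst h; simp
    · simp [h, hJ e he]
  · intro s4 t4 hJ hi hf ht4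
    rw [sum_const_range] at ht4
    rw [List.take_length] at hJ
    exact ⟨hJ, by omega⟩

end
-- Reducing a whole graph
open Cmd

section Pure

variable (ca cb : ℕ → ℕ) (key : ℕ → ℝ ×ₗ ℕ)

/-- The edges that are selected for both of their classes. -/
noncomputable def degL (N k2 : ℕ) : List ℕ :=
  (List.range N).filter fun e => decide (ca e ≠ cb e ∧ e ∈ selL ca cb key N k2 (ca e) ∧
    e ∈ selL ca cb key N k2 (cb e))

/-- The edges that survive the reduction. -/
noncomputable def finL (N k2 r : ℕ) : List ℕ := topL key r (degL ca cb key N k2)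

variable {key}

/-- Ranks are injective on the list, and the selected elements have ranks below `m`. -/
theorem length_topL_le {m : ℕ} {l : List ℕ} (hl : l.Nodup)
    (hinj : ∀ x ∈ l, ∀ y ∈ l, key x = key y → x = y) : (topL key m l).length ≤ m := by
  have hnd : (topL key m l).Nodup := hl.sublist List.filter_sublist
  rw [← List.toFinset_card_of_nodup hnd, ← Finset.card_range m]
  refine Finset.card_le_card_of_injOn (fun x => gtCount key (key x) l) ?_ ?_
  · intro x hx
    simp [topL] at hx
    simp [hx.2]
  · intro x hx y hy h
    simp [topL] at hx hy
    exact gtCount_injOn hinj x hx.1 y hy.1 h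

end Pure

/-- Build the lists of the edges incident to the classes. -/
def buildC : Cmd := block [
  forLt .i (.r .r) (.op (.st .hd .i (.c 0))),
  forLt .e (.r .ne) (block [
    .op (.ld .ca .ca .e), .op (.ld .cb .cb .e),
    .ite (.eq (.r .ca) (.r .cb)) .skip (block [
      .op (.ar .mul .nd (.r .e) (.c 2)),
      .op (.ld .f0 .hd .ca), .op (.st .nx .nd (.r .f0)),
      .op (.ar .add .nd (.r .nd) (.c 1)), .op (.st .hd .ca (.r .nd)),
      .op (.ld .f0 .hd .cb), .op (.st .nx .nd (.r .f0)),
      .op (.ar .add .nd (.r .nd) (.c 1)), .op (.st .hd .cb (.r .nd))])])]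

/-- Compute the list `S` of the edges that survive the reduction. -/
def reduceC : Cmd := block [
  buildC,
  forLt .c (.r .r) classC,
  forLt .i (.r .ne) (.op (.st .S .i (.r .i))),
  .op (.set .ns (.r .ne)),
  filterC .S .ns (.op (.ld .f1 .ct .se)) (.eq (.r .f1) (.c 2)),
  .op (.set .m (.r .r)),
  selectC]

section
variable {B M : ℕ} {s : St} {Q : ℕ → St → Prop}

theorem wp_buildC {N r : ℕ} (hr : s.reg .r = r) (hN : s.reg .ne = N)
    (hrM : r ≤ M) (hNM : 2 * N < M) (hMB : 2 * M ≤ B)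
    (hca : ∀ e < N, s.arr .ca e < r) (hcb : ∀ e < N, s.arr .cb e < r)
    (hQ : ∀ s' t, Fr buildC s s' →
      (∀ c < r, Chain (s'.arr .nx) (s'.arr .hd c) (incNodes (s.arr .ca) (s.arr .cb) N c)) →
      t ≤ 3 * r + 14 * N + 4 → Q t s') : wp B M buildC s Q := by
  refine wp_mono (Q := fun t s' => (∀ c < r, Chain (s'.arr .nx) (s'.arr .hd c)
      (incNodes (s.arr .ca) (s.arr .cb) N c)) ∧ t ≤ 3 * r + 14 * N + 4) ?_
      (fun t s' hf h => hQ s' t hf h.1 h.2)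
  refine wp_seq (wp_forLt r (fun j s' => ∀ c < j, s'.arr .hd c = 0) (fun _ => 1) (by rfl)
    (by rintro x ⟨⟩; exact ⟨by decide, rfl⟩) hr (by omega) (by simp) ?_ ?_)
  · intro j s' hj hi hf hJ
    refine wp_op (by simp [hi]; omega) ⟨le_rfl, ?_⟩
    intro c hc
    simp [hi, Function.update_apply]
    intro h
    exact hJ c (by omega)
  intro s1 t1 hJ1 hi1 hf1 ht1
  rw [sum_const_range] at ht1
  have a1 : s1.arr .ca = s.arr .ca := hf1.arr _ rfl
  have a2 : s1.arr .cb = s.arr .cb := hf1.arr _ rfl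
  have a3 : s1.reg .ne = N := (hf1.reg _ rfl).trans hN
  clear hf1
  refine wp_forLt N (fun j s' => ∀ c < r, Chain (s'.arr .nx) (s'.arr .hd c)
    (incNodes (s.arr .ca) (s.arr .cb) j c)) (fun _ => 12) (by rfl)
    (by rintro x ⟨⟩; exact ⟨by decide, rfl⟩) a3 (by omega) ?_ ?_ ?_
  · intro c hc
    simpa [incNodes, Chain] using hJ1 c hc
  · intro j s' hj hi hf hJ
    have e1 : s'.arr .ca = s.arr .ca := (hf.arr _ rfl).trans a1
    have e2 : s'.arr .cb = s.arr .cb := (hf.arr _ rfl).trans a2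
    have h1 := hca j hj
    have h2 := hcb j hj
    have e3 : ((2 : Fin 16) : ℕ) = 2 := rfl
    have e4 : ((1 : Fin 16) : ℕ) = 1 := rfl
    simp only [block, wp_seq_iff, wp_op_iff, wp_ite_iff, wp_skip_iff, Op.ok, Op.eff, Test.ok,
      Test.holds, St.setR_reg, St.setR_arr, St.setA_reg, St.setA_arr, Opd.val_r, Opd.val_c,
      reduceCtorEq, if_true, if_false, hi, e1, e2, Arith.eval, e3, e4]
    refine ⟨by omega, by omega, trivial, fun heq => ⟨by omega, ?_⟩, fun hne => ?_⟩
    · intro c hc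
      simpa only [incNodes, if_pos heq] using hJ c hc
    refine ⟨by omega, by omega, by omega, by omega, by omega, by omega, by omega, by omega, by omega,
      by omega, ?_⟩
    intro c hc
    have hlt : ∀ x ∈ incNodes (s.arr .ca) (s.arr .cb) j c, x < 2 * j := fun x hx => incNodes_lt hx
    have hch := hJ c hc
    simp only [incNodes, if_neg hne]
    -- The cells written in this round are `2j` and `2j + 1`, while all cells in the lists so far
    -- lie below `2j`; the old chains are untouched.
    have hcong : ∀ a b, ∀ x ∈ incNodes (s.arr .ca) (s.arr .cb) j c,
        Function.update (Function.update (s'.arr .nx) (j * 2) a) (j * 2 + 1) b x = s'.arr .nx x := by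
      intro a b x hx
      have := hlt x hx
      rw [Function.update_of_ne (by omega), Function.update_of_ne (by omega)]
    rw [Function.update_of_ne (a := s.arr .cb j) (Ne.symm hne)]
    by_cases h1 : c = s.arr .ca j
    · rw [if_pos h1]
      rw [Function.update_of_ne (by rw [h1]; exact hne), h1, Function.update_self]
      refine ⟨by omega, ?_⟩
      rw [Function.update_of_ne (by omega), show 2 * j = j * 2 by ring, Function.update_self, ← h1]
      exact hch.congr (hcong _ _)
    · rw [if_neg h1]
      by_cases h2 : c = s.arr .cb j
      · rw [if_pos h2, h2, Function.update_self]
        refine ⟨by omega, ?_⟩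
        rw [show 2 * j + 1 = j * 2 + 1 by ring, Function.update_self, ← h2]
        exact hch.congr (hcong _ _)
      · rw [if_neg h2, Function.update_of_ne h2, Function.update_of_ne h1]
        exact hch.congr (hcong _ _)
  · intro s' t hJ hi hf ht
    rw [sum_const_range] at ht
    exact ⟨hJ, by omega⟩

/-- The counter `ct` of an edge records for how many of its classes the edge was selected, so the
first reduction keeps the edges with counter 2. An edge inside one class is in no incidence list and
keeps the counter 0. The work for the classes adds up to a linear bound by `sum_length_incNodes`. -/
theorem wp_reduceC {N k2 r : ℕ} (hr : s.reg .r = r) (hN : s.reg .ne = N) (hk2 : s.reg .k2 = k2)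
    (hk0 : 1 ≤ k2) (hr0 : 1 ≤ r) (hinj : ∀ x < N, ∀ y < N, s.key x = s.key y → x = y)
    (hrM : r ≤ M) (hNM : 2 * N < M) (hMB : 8 * M + 8 ≤ B)
    (hca : ∀ e < N, s.arr .ca e < r) (hcb : ∀ e < N, s.arr .cb e < r)
    (hct : ∀ e < N, s.arr .ct e = 0)
    (hQ : ∀ s' t l, Fr reduceC s s' → l = finL (s.arr .ca) (s.arr .cb) s.key N k2 r →
      Holds (s'.arr .S) l → s'.reg .ns = l.length → t ≤ 2000000 * (N + r + 1) → Q t s') :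
    wp B M reduceC s Q := by
  refine wp_mono (Q := fun t s' => ∃ l, l = finL (s.arr .ca) (s.arr .cb) s.key N k2 r ∧
      Holds (s'.arr .S) l ∧ s'.reg .ns = l.length ∧ t ≤ 2000000 * (N + r + 1)) ?_
      (fun t s' hf ⟨l, h1, h2, h3, h4⟩ => hQ s' t l hf h1 h2 h3 h4)
  refine wp_seq (wp_buildC hr hN hrM hNM (by omega) hca hcb ?_)
  intro s1 t1 hf1 hch ht1
  have a1 : s1.arr .ca = s.arr .ca := hf1.arr _ rfl
  have a2 : s1.arr .cb = s.arr .cb := hf1.arr _ rfl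
  have a3 : s1.key = s.key := key_eq_of_fr hf1 rfl rfl
  have a4 : s1.arr .ct = s.arr .ct := hf1.arr _ rfl
  have a5 : s1.reg .r = r := (hf1.reg _ rfl).trans hr
  have a6 : s1.reg .ne = N := (hf1.reg _ rfl).trans hN
  have a7 : s1.reg .k2 = k2 := (hf1.reg _ rfl).trans hk2
  clear hf1
  refine wp_seq (wp_forLt r (fun j s' => ∀ e < N, s'.arr .ct e =
    (if s.arr .ca e < j ∧ e ∈ selL (s.arr .ca) (s.arr .cb) s.key N k2 (s.arr .ca e) then 1 else 0) +
    (if s.arr .cb e < j ∧ e ∈ selL (s.arr .ca) (s.arr .cb) s.key N k2 (s.arr .cb e) then 1 else 0))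
    (fun j => 600100 * (incNodes (s.arr .ca) (s.arr .cb) N j).length + 100) (by rfl)
    (by rintro x ⟨⟩; exact ⟨by decide, rfl⟩) a5 (by omega) ?_ ?_ ?_)
  · intro e he
    simp [a4, hct e he]
  · intro j s' hj hi hf hJ
    have e1 : s'.arr .ca = s.arr .ca := (hf.arr _ rfl).trans a1
    have e2 : s'.arr .cb = s.arr .cb := (hf.arr _ rfl).trans a2
    have e3 : s'.key = s.key := (key_eq_of_fr hf rfl rfl).trans a3
    have e4 : s'.arr .nx = s1.arr .nx := hf.arr _ rfl
    have e5 : s'.arr .hd = s1.arr .hd := hf.arr _ rfl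
    have e6 : s'.reg .k2 = k2 := (hf.reg _ rfl).trans a7
    refine wp_classC (N := N) (k2 := k2) (c := j) (r := r) hi e6 hk0 (by rw [e3]; exact hinj)
      (by rw [e1, e2, e4, e5]; exact hch j hj) hj hrM hNM hMB (by rw [e1]; exact hca)
      (by rw [e2]; exact hcb) ?_ ?_
    · intro e he
      rw [hJ e he]
      split_ifs <;> simp
    · intro s2 t2 hf2 hct2 ht2
      rw [e1, e2] at ht2
      refine ⟨ht2, fun e he => ?_⟩
      have h := hct2 e he
      rw [e1, e2, e3, hJ e he] at h
      simp only [St.setR_arr, h]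
      have hinc : e ∈ selL (s.arr .ca) (s.arr .cb) s.key N k2 j →
          s.arr .ca e ≠ s.arr .cb e ∧ (s.arr .ca e = j ∨ s.arr .cb e = j) := fun h =>
        (mem_incEdges.1 (mem_selL_inc h)).2
      by_cases hca' : s.arr .ca e = j
      · by_cases hcb' : s.arr .cb e = j
        · have : e ∉ selL (s.arr .ca) (s.arr .cb) s.key N k2 j := fun h =>
            (hinc h).1 (hca'.trans hcb'.symm)
          simp [hca', hcb', this]
        · have : s.arr .cb e < j + 1 ↔ s.arr .cb e < j := by omega
          simp [hca', this]
          omega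
      · have h1 : s.arr .ca e < j + 1 ↔ s.arr .ca e < j := by omega
        by_cases hcb' : s.arr .cb e = j
        · simp [h1, hcb']
        · have h2 : s.arr .cb e < j + 1 ↔ s.arr .cb e < j := by omega
          have : e ∉ selL (s.arr .ca) (s.arr .cb) s.key N k2 j := fun h => by
            rcases (hinc h).2 with h | h
            · exact hca' h
            · exact hcb' h
          simp [h1, h2, this]
  intro s2 t2 hJ2 hi2 hf2 ht2
  have hsum : ∑ j ∈ Finset.range r,
      (600100 * (incNodes (s.arr .ca) (s.arr .cb) N j).length + 100 + 2) ≤ 1200200 * N + 102 * r := by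
    have h1 := sum_length_incNodes (ca := s.arr .ca) (cb := s.arr .cb) N r
    have h2 : ∑ j ∈ Finset.range r, (600100 * (incNodes (s.arr .ca) (s.arr .cb) N j).length + 100 + 2) =
        600100 * ∑ j ∈ Finset.range r, (incNodes (s.arr .ca) (s.arr .cb) N j).length + 102 * r := by
      simp only [Finset.sum_add_distrib, Finset.mul_sum, sum_const_range]
      ring
    omega
  have b3 : s2.key = s.key := (key_eq_of_fr hf2 rfl rfl).trans a3
  have b5 : s2.reg .r = r := (hf2.reg _ rfl).trans a5
  have b6 : s2.reg .ne = N := (hf2.reg _ rfl).trans a6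
  clear hf2
  refine wp_seq (wp_forLt N (fun j s' => Holds (s'.arr .S) (List.range j)) (fun _ => 1) (by rfl)
    (by rintro x ⟨⟩; exact ⟨by decide, rfl⟩) b6 (by omega) (Holds.nil _) ?_ ?_)
  · intro j s' hj hi hf hJ
    refine wp_op (by simp [hi]; omega) ⟨le_rfl, ?_⟩
    rw [List.range_succ]
    simpa [hi] using hJ.concat (j := j) (by simp) j
  intro s3 t3 hS3 hi3 hf3 ht3
  rw [sum_const_range] at ht3
  have c3 : s3.key = s.key := (key_eq_of_fr hf3 rfl rfl).trans b3
  have c4 : s3.arr .ct = s2.arr .ct := hf3.arr _ rfl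
  have c5 : s3.reg .r = r := (hf3.reg _ rfl).trans b5
  have c6 : s3.reg .ne = N := (hf3.reg _ rfl).trans b6
  clear hf3
  have hdeg : (List.range N).filter (fun e => decide (s2.arr .ct e = 2)) =
      degL (s.arr .ca) (s.arr .cb) s.key N k2 := by
    refine List.filter_congr fun e he => ?_
    rw [List.mem_range] at he
    congr 1
    rw [hJ2 e he, eq_iff_iff]
    simp only [hca e he, hcb e he, true_and]
    constructor
    · intro h
      have h1 : e ∈ selL (s.arr .ca) (s.arr .cb) s.key N k2 (s.arr .ca e) := by
        by_contra hn
        rw [if_neg hn] at h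
        split_ifs at h <;> omega
      have h2 : e ∈ selL (s.arr .ca) (s.arr .cb) s.key N k2 (s.arr .cb e) := by
        by_contra hn
        rw [if_neg hn] at h
        split_ifs at h <;> omega
      exact ⟨(mem_incEdges.1 (mem_selL_inc h1)).2.1, h1, h2⟩
    · rintro ⟨-, h1, h2⟩
      simp [h1, h2]
  refine wp_seq (wp_op trivial (wp_seq (wp_filterC (T := 1) (l := List.range N)
    (P := fun e => s2.arr .ct e = 2) (by simp) rfl rfl rfl rfl (fun _ => rfl)
    (fun _ => rfl) (by simpa using hS3) (by simp [c6]) (by simp; omega) (by simp; omega) ?_ ?_)))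
  · intro s' hr ha hw hmem
    have e4 : s'.arr .ct = s2.arr .ct := (ha _ (by simp)).trans (by simp [c4])
    refine wp_op (by simp at hmem; simp; omega) ⟨le_rfl, trivial, ?_⟩
    simp [e4]
  intro s4 t4 hf4 hS4 hn4 ht4
  rw [hdeg] at hS4 hn4
  rw [List.length_range] at ht4
  have d3 : s4.key = s.key := by rw [key_eq_of_fr hf4 rfl rfl]; simp [c3]
  have d5 : s4.reg .r = r := by rw [hf4.reg _ rfl]; simp [c5]
  clear hf4
  set D := degL (s.arr .ca) (s.arr .cb) s.key N k2 with hD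
  have hDs : D.Sublist (List.range N) := List.filter_sublist
  have hDN : ∀ x ∈ D, x < N := fun x hx => by simpa using hDs.subset hx
  have hDl : D.length ≤ N := by simpa using hDs.length_le
  refine wp_seq (wp_op trivial (wp_selectC (l := D) (m := r) (List.nodup_range.sublist hDs) ?_
    (by simpa using hS4) (by simpa using hn4) (by simp [d5]) hr0 (by omega) hMB
    (fun y hy => by have := hDN y hy; omega) ?_))
  · intro x hx y hy
    simp only [Op.eff, St.setR_key, d3]
    exact hinj x (hDN x hx) y (hDN y hy)
  intro s5 t5 l' hf5 hl' hS5 hn5 ht5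
  simp only [Op.eff, St.setR_key, d3] at hl'
  refine ⟨l', hl', hS5, hn5, ?_⟩
  omega

end
-- Loading edges and computing their classes
open Cmd

/-- The hash function with the parameters `a` and `b`. -/
def hashFn (p r a b x : ℕ) : ℕ := (a * x + b) % p % r

/-- The records `rs` (pairs of a word and a weight) are stored in the array `a` from `off` on. -/
def Recs (s : St) (a : Ar) (off : ℕ) (rs : List (ℕ × ℝ)) : Prop :=
  ∀ i (h : i < rs.length), s.arr a (off + i) = rs[i].1 ∧ s.warr a (off + i) = rs[i].2

/-- The edges `rs` and their classes under `f` are stored in the working arrays. -/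
structure Loaded (s : St) (n : ℕ) (f : ℕ → ℕ) (rs : List (ℕ × ℝ)) : Prop where
  ne : s.reg .ne = rs.length
  recs : Recs s .E 0 rs
  ca : ∀ i (h : i < rs.length), s.arr .ca i = f (rs[i].1 / n)
  cb : ∀ i (h : i < rs.length), s.arr .cb i = f (rs[i].1 % n)
  ct : ∀ i < rs.length, s.arr .ct i = 0

/-- `rs'` consists of the edges of `rs` that survive the reduction. -/
def IsRed (n k2 r : ℕ) (f : ℕ → ℕ) (rs rs' : List (ℕ × ℝ)) : Prop :=
  ∃ (ca cb : ℕ → ℕ) (key : ℕ → ℝ ×ₗ ℕ),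
    (∀ i (h : i < rs.length), ca i = f (rs[i].1 / n) ∧ cb i = f (rs[i].1 % n) ∧
      key i = toLex (rs[i].2, rs[i].1)) ∧
    rs' = (finL ca cb key rs.length k2 r).map fun i => rs.getD i default

/-- `d := hash of x`. -/
def hashC (d x : V) : Cmd := block [
  .op (.ar .mul d (.r .ha) (.r x)),
  .op (.ar .add d (.r d) (.r .hb)),
  .op (.ar .mod d (.r d) (.r .pp)),
  .op (.ar .mod d (.r d) (.r .r))]

/-- Append the edge with code `x` and weight `w` to the working arrays. -/
def addC : Cmd := block [
  .op (.st .E .ne (.r .x)),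
  .op (.wst .E .ne .w),
  .op (.ar .div .f0 (.r .x) (.r .n)),
  hashC .ca .f0,
  .op (.ar .mod .f0 (.r .x) (.r .n)),
  hashC .cb .f0,
  .op (.st .ca .ne (.r .ca)),
  .op (.st .cb .ne (.r .cb)),
  .op (.st .ct .ne (.c 0)),
  .op (.ar .add .ne (.r .ne) (.c 1))]

/-- Append the records in the array `a` to the working arrays. -/
def fillC (a : Ar) (off cnt : Opd) : Cmd := forLt .i cnt (block [
  .op (.ar .add .x off (.r .i)),
  .op (.wld .w a .x),
  .op (.ld .x a .x),
  addC])

section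
variable {B M : ℕ} {s : St} {Q : ℕ → St → Prop}

theorem Recs.key_eq {rs : List (ℕ × ℝ)} (h : Recs s .E 0 rs) {i : ℕ} (hi : i < rs.length) :
    s.key i = toLex (rs[i].2, rs[i].1) := by
  have := h i hi
  rw [Nat.zero_add] at this
  rw [St.key, this.1, this.2]

theorem Recs.concat {a : Ar} {off : ℕ} {rs : List (ℕ × ℝ)} (h : Recs s a off rs) {s' : St} {x : ℕ}
    {w : ℝ} (h1 : s'.arr a = Function.update (s.arr a) (off + rs.length) x)
    (h2 : s'.warr a = Function.update (s.warr a) (off + rs.length) w) :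
    Recs s' a off (rs ++ [(x, w)]) := by
  intro i hi
  simp only [List.length_append, List.length_cons, List.length_nil] at hi
  rw [h1, h2]
  rcases Nat.lt_or_ge i rs.length with h3 | h3
  · rw [List.getElem_append_left h3, Function.update_of_ne (by omega),
      Function.update_of_ne (by omega)]
    exact h i h3
  · have : i = rs.length := by omega
    subst this
    simp

theorem wp_fillC {a : Ar} {off cnt : Opd} {n p r ha hb : ℕ} {rs rs' : List (ℕ × ℝ)}
    (hoff : off.noR [.i, .x, .f0, .ca, .cb, .ne]) (hcnt : cnt.noR [.i, .x, .f0, .ca, .cb, .ne])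
    (haE : a ∉ [Ar.E, .ca, .cb, .ct])
    (hn : s.reg .n = n) (hp : s.reg .pp = p) (hr : s.reg .r = r) (hha : s.reg .ha = ha)
    (hhb : s.reg .hb = hb) (hL : Loaded s n (hashFn p r ha hb) rs)
    (hrs' : Recs s a (off.val s) rs') (hlen : cnt.val s = rs'.length)
    (hcode : ∀ x ∈ rs', x.1 < n * n)
    (hB : ha * n + hb ≤ B) (hM1 : off.val s + rs'.length ≤ M) (hM2 : rs.length + rs'.length ≤ M)
    (hMB : M < B)
    (hQ : ∀ s' t, Fr (fillC a off cnt) s s' → Loaded s' n (hashFn p r ha hb) (rs ++ rs') →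
      t ≤ 25 * rs'.length + 2 → Q t s') :
    wp B M (fillC a off cnt) s Q := by
  refine wp_forLt rs'.length (fun j s' => Loaded s' n (hashFn p r ha hb) (rs ++ rs'.take j))
    (fun _ => 20) (by rfl) ?_ hlen (by omega) ?_ ?_ ?_
  · rintro x rfl
    simp [Opd.noR] at hcnt
    simp [block, hashC, addC, Cmd.wr, Op.wr, hcnt]
  · simp only [List.take_zero, List.append_nil]
    exact ⟨by simpa using hL.ne, hL.recs, hL.ca, hL.cb, hL.ct⟩
  · intro j s' hj hi hf hJ
    have e1 : s'.arr a = s.arr a := by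
      refine hf.arr a ?_
      simp at haE
      simp [forLt, block, hashC, addC, Cmd.wa, Op.wa, haE]
    have e2 : s'.warr a = s.warr a := by
      refine hf.warr a ?_
      simp at haE
      simp [forLt, block, hashC, addC, Cmd.wwa, Op.wwa, haE]
    have e3 : off.val s' = off.val s := hoff.val_eq fun x hx => by
      simp at hx
      exact hf.reg x (by simp [forLt, block, hashC, addC, Cmd.wr, Op.wr, hx])
    have e4 : s'.reg .n = n := (hf.reg _ rfl).trans hn
    have e5 : s'.reg .pp = p := (hf.reg _ rfl).trans hp
    have e6 : s'.reg .r = r := (hf.reg _ rfl).trans hr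
    have e7 : s'.reg .ha = ha := (hf.reg _ rfl).trans hha
    have e8 : s'.reg .hb = hb := (hf.reg _ rfl).trans hhb
    have hne := hJ.ne
    have hlen' : (rs ++ rs'.take j).length = rs.length + j := by simp; omega
    rw [hlen'] at hne
    obtain ⟨h1, h2⟩ := hrs' j hj
    have hc := hcode rs'[j] (List.getElem_mem hj)
    -- A code below `n * n` encodes endpoints below `n`, so the words that occur while hashing stay
    -- below `ha * n + hb`.
    have hd1 : rs'[j].1 / n < n := Nat.div_lt_of_lt_mul hc
    have hd2 : rs'[j].1 % n < n := Nat.mod_lt _ (by rcases n.eq_zero_or_pos with rfl | h <;> omega)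
    have hm1 : ha * (rs'[j].1 / n) ≤ ha * n := Nat.mul_le_mul_left _ hd1.le
    have hm2 : ha * (rs'[j].1 % n) ≤ ha * n := Nat.mul_le_mul_left _ hd2.le
    have f1 : ((1 : Fin 16) : ℕ) = 1 := rfl
    have f0 : ((0 : Fin 16) : ℕ) = 0 := rfl
    simp only [block, addC, hashC, wp_seq_iff, wp_op_iff, Op.ok, Op.eff, St.setR_reg, St.setR_arr,
      St.setR_warr, St.setW_reg, St.setW_arr, St.setA_reg, St.setWA_reg, Opd.val_r, Opd.val_c, reduceCtorEq, if_true, if_false, hi, e1, e2,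
      e3, e4, e5, e6, e7, e8, hne, h1, h2, Arith.eval, f0, f1]
    refine ⟨by omega, by omega, by omega, by omega, by omega, trivial, by omega, by omega, trivial,
      trivial, trivial, by omega, by omega, trivial, trivial, by omega, by omega, by omega, by omega,
      by omega, ?_⟩
    have htk : rs ++ rs'.take (j + 1) = (rs ++ rs'.take j) ++ [rs'[j]] := by
      rw [List.take_succ_eq_append_getElem hj, List.append_assoc]
    rw [htk]
    constructor
    · simp; omega
    · refine hJ.recs.concat (x := rs'[j].1) (w := rs'[j].2) ?_ ?_
      · simp [hlen']
      · simp [hlen']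
    · intro i hi'
      rw [List.length_append, hlen', List.length_singleton] at hi'
      simp only [St.setR_arr, St.setW_arr, St.setA_arr, St.setWA_arr, reduceCtorEq, if_true, if_false]
      rcases Nat.lt_or_ge i (rs.length + j) with h3 | h3
      · rw [Function.update_of_ne (by omega), hJ.ca i (by omega),
          List.getElem_append_left (bs := [rs'[j]]) (show i < (rs ++ rs'.take j).length by omega)]
      · have : i = rs.length + j := by omega
        subst this
        rw [List.getElem_append_right (by omega)]
        simp [hashFn]
    · intro i hi'
      rw [List.length_append, hlen', List.length_singleton] at hi'
      simp only [St.setR_arr, St.setW_arr, St.setA_arr, St.setWA_arr, reduceCtorEq, if_true, if_false]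
      rcases Nat.lt_or_ge i (rs.length + j) with h3 | h3
      · rw [Function.update_of_ne (by omega), hJ.cb i (by omega),
          List.getElem_append_left (bs := [rs'[j]]) (show i < (rs ++ rs'.take j).length by omega)]
      · have : i = rs.length + j := by omega
        subst this
        rw [List.getElem_append_right (by omega)]
        simp [hashFn]
    · intro i hi'
      rw [List.length_append, hlen', List.length_singleton] at hi'
      simp only [St.setR_arr, St.setW_arr, St.setA_arr, St.setWA_arr, reduceCtorEq, if_true, if_false]
      rcases Nat.lt_or_ge i (rs.length + j) with h3 | h3
      · rw [Function.update_of_ne (by omega), hJ.ct i (by omega)]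
      · have : i = rs.length + j := by omega
        subst this
        simp
  · intro s' t hJ hi hf ht
    rw [sum_const_range] at ht
    rw [List.take_length] at hJ
    exact hQ s' t hf hJ (by omega)

end
-- Processing a batch for all hash functions
open Cmd

/-- Reduce the graph of the current hash function together with the batch in the buffer `p`. -/
def oneC (p : Bool) : Cmd := block [
  .op (.set .ne (.c 0)),
  .op (.ld .gc .gc .h),
  fillC .G (.r .goff) (.r .gc),
  fillC (.buf p) (.c 0) (.r .bn),
  reduceC,
  forLt .i (.r .ns) (block [
    .op (.ar .add .x (.r .goff) (.r .i)),
    .op (.ld .e .S .i),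
    .op (.wld .w .E .e),
    .op (.ld .e .E .e),
    .op (.st .G .x (.r .e)),
    .op (.wst .G .x .w)]),
  .op (.st .gc .h (.r .ns))]

/-- Reduce the graphs of all hash functions together with the batch in the buffer `p`. -/
def batchC (p : Bool) : Cmd := block [
  .op (.set .zr (.r .z)),
  .op (.set .goff (.c 0)),
  forLt .h (.r .tt) (block [
    .op (.ar .mod .zh (.r .zr) (.r .nn)),
    .op (.ar .div .zr (.r .zr) (.r .nn)),
    .op (.ar .div .ha (.r .zh) (.r .pp)),
    .op (.ar .add .ha (.r .ha) (.c 1)),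
    .op (.ar .mod .hb (.r .zh) (.r .pp)),
    oneC p,
    .op (.ar .add .goff (.r .goff) (.r .r))])]

/-- The records of the graphs kept for the hash functions `h < t`. -/
def Graphs (s : St) (t r : ℕ) (L : ℕ → List (ℕ × ℝ)) : Prop :=
  ∀ h < t, s.arr .gc h = (L h).length ∧ Recs s .G (h * r) (L h) ∧ (L h).length ≤ r

/-- The hash function with index `z`, where the `h`-th digit of `z` in base `p * (p - 1)` counts. -/
def digitFn (p r z h : ℕ) : ℕ → ℕ :=
  hashFn p r (z / (p * (p - 1)) ^ h % (p * (p - 1)) / p + 1) (z / (p * (p - 1)) ^ h % (p * (p - 1)) % p)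

section
variable {B M : ℕ} {s : St} {Q : ℕ → St → Prop}

theorem Recs.congr {a : Ar} {off : ℕ} {rs : List (ℕ × ℝ)} (h : Recs s a off rs) {s' : St}
    (h1 : ∀ i, off ≤ i → i < off + rs.length → s'.arr a i = s.arr a i)
    (h2 : ∀ i, off ≤ i → i < off + rs.length → s'.warr a i = s.warr a i) : Recs s' a off rs := by
  intro i hi
  rw [h1 _ (by omega) (by omega), h2 _ (by omega) (by omega)]
  exact h i hi

theorem hashFn_lt {p r a b x : ℕ} (hr : 1 ≤ r) : hashFn p r a b x < r := Nat.mod_lt _ hr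

theorem wp_oneC {p : Bool} {n pp r k2 h ha hb : ℕ} {rs rs' : List (ℕ × ℝ)}
    (hn : s.reg .n = n) (hp : s.reg .pp = pp) (hr : s.reg .r = r) (hk2 : s.reg .k2 = k2)
    (hh : s.reg .h = h) (hha : s.reg .ha = ha) (hhb : s.reg .hb = hb) (hgoff : s.reg .goff = h * r)
    (hbn : s.reg .bn = rs'.length) (hgc : s.arr .gc h = rs.length)
    (hG : Recs s .G (h * r) rs) (hbuf : Recs s (.buf p) 0 rs')
    (hl : rs.length ≤ r) (hl' : rs'.length ≤ r)
    (hk0 : 1 ≤ k2) (hr0 : 1 ≤ r)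
    (hcode : ∀ x ∈ rs ++ rs', x.1 < n * n) (hnd : ((rs ++ rs').map Prod.fst).Nodup)
    (hB : ha * n + hb ≤ B) (hM : h * r + r ≤ M) (hhM : h < M) (hrM : 4 * r < M) (hMB : 8 * M + 8 ≤ B)
    (hQ : ∀ s' t L, Fr (oneC p) s s' → IsRed n k2 r (hashFn pp r ha hb) (rs ++ rs') L →
      L.length ≤ r → Recs s' .G (h * r) L → s'.arr .gc = Function.update (s.arr .gc) h L.length →
      (∀ i, ¬ (h * r ≤ i ∧ i < h * r + r) → s'.arr .G i = s.arr .G i ∧ s'.warr .G i = s.warr .G i) →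
      t ≤ 9000000 * r → Q t s') :
    wp B M (oneC p) s Q := by
  refine wp_mono (Q := fun t s' => ∃ L, IsRed n k2 r (hashFn pp r ha hb) (rs ++ rs') L ∧
      L.length ≤ r ∧ Recs s' .G (h * r) L ∧ s'.arr .gc = Function.update (s.arr .gc) h L.length ∧
      (∀ i, ¬ (h * r ≤ i ∧ i < h * r + r) → s'.arr .G i = s.arr .G i ∧ s'.warr .G i = s.warr .G i) ∧
      t ≤ 9000000 * r) ?_
      (fun t s' hf ⟨L, h1, h2, h3, h4, h5, h6⟩ => hQ s' t L hf h1 h2 h3 h4 h5 h6)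
  simp only [List.mem_append] at hcode
  refine wp_seq (wp_op trivial (wp_seq (wp_op (by simpa [hh] using hhM) (wp_seq
    (wp_fillC (n := n) (p := pp) (r := r) (ha := ha) (hb := hb) (rs := []) (rs' := rs)
      (by simp [Opd.noR]) (by simp [Opd.noR]) (by simp) (by simpa using hn) (by simpa using hp)
      (by simpa using hr) (by simpa using hha) (by simpa using hhb) ?_ ?_ ?_
      (fun x hx => hcode x (.inl hx)) hB ?_ ?_ (by omega) ?_)))))
  · constructor <;> simp [Recs]
  · simpa [hgoff, Recs] using hG
  · simpa [hh] using hgc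
  · simp [hgoff]; omega
  · simp; omega
  intro s1 t1 hf1 hL1 ht1
  have a1 : s1.reg .n = n := by rw [hf1.reg _ rfl]; simpa using hn
  have a2 : s1.reg .pp = pp := by rw [hf1.reg _ rfl]; simpa using hp
  have a3 : s1.reg .r = r := by rw [hf1.reg _ rfl]; simpa using hr
  have a4 : s1.reg .k2 = k2 := by rw [hf1.reg _ rfl]; simpa using hk2
  have a5 : s1.reg .h = h := by rw [hf1.reg _ rfl]; simpa using hh
  have a6 : s1.reg .ha = ha := by rw [hf1.reg _ rfl]; simpa using hha
  have a7 : s1.reg .hb = hb := by rw [hf1.reg _ rfl]; simpa using hhb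
  have a8 : s1.reg .goff = h * r := by rw [hf1.reg _ rfl]; simpa using hgoff
  have a9 : s1.reg .bn = rs'.length := by rw [hf1.reg _ rfl]; simpa using hbn
  have a10 : s1.arr .gc = s.arr .gc := hf1.arr _ rfl
  have a11 : s1.arr .G = s.arr .G := hf1.arr _ rfl
  have a12 : s1.warr .G = s.warr .G := hf1.warr _ rfl
  have a13 : s1.arr (.buf p) = s.arr (.buf p) := hf1.arr _ rfl
  have a14 : s1.warr (.buf p) = s.warr (.buf p) := hf1.warr _ rfl
  clear hf1
  rw [List.nil_append] at hL1
  refine wp_seq (wp_fillC (n := n) (p := pp) (r := r) (ha := ha) (hb := hb) (rs := rs) (rs' := rs')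
      (by simp [Opd.noR]) (by simp [Opd.noR]) (by simp) a1 a2 a3 a6 a7 hL1 ?_ a9
      (fun x hx => hcode x (.inr hx)) hB ?_ (by omega) (by omega) ?_)
  · exact hbuf.congr (fun i _ _ => by rw [a13]) (fun i _ _ => by rw [a14])
  · simp; omega
  intro s2 t2 hf2 hL2 ht2
  have b1 : s2.reg .r = r := (hf2.reg _ rfl).trans a3
  have b2 : s2.reg .k2 = k2 := (hf2.reg _ rfl).trans a4
  have b3 : s2.reg .h = h := (hf2.reg _ rfl).trans a5
  have b4 : s2.reg .goff = h * r := (hf2.reg _ rfl).trans a8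
  have b5 : s2.arr .gc = s.arr .gc := (hf2.arr _ rfl).trans a10
  have b6 : s2.arr .G = s.arr .G := (hf2.arr _ rfl).trans a11
  have b7 : s2.warr .G = s.warr .G := (hf2.warr _ rfl).trans a12
  clear hf2 a1 a2 a3 a4 a5 a6 a7 a8 a9 a10 a11 a12 a13 a14 hL1
  have hlen : (rs ++ rs').length = rs.length + rs'.length := by simp
  set R := rs ++ rs' with hR
  -- Weights may tie, but a key ends with the code of its edge, and the codes are distinct.
  have hinj : ∀ x < R.length, ∀ y < R.length, s2.key x = s2.key y → x = y := by
    intro x hx y hy hxy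
    rw [hL2.recs.key_eq hx, hL2.recs.key_eq hy] at hxy
    have h1 : R[x].1 = R[y].1 := by
      have := congrArg (fun u => (ofLex u).2) hxy
      simpa using this
    have h2 : (R.map Prod.fst)[x]'(by simpa using hx) = (R.map Prod.fst)[y]'(by simpa using hy) := by
      simpa using h1
    exact (hnd.getElem_inj_iff).1 h2
  refine wp_seq (wp_reduceC (N := R.length) b1 hL2.ne b2 hk0 hr0 hinj (by omega) (by omega) hMB
    (fun e he => by rw [hL2.ca e he]; exact hashFn_lt hr0)
    (fun e he => by rw [hL2.cb e he]; exact hashFn_lt hr0) hL2.ct ?_)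
  intro s3 t3 l hf3 hl3 hS3 hns3 ht3
  have c1 : s3.reg .h = h := (hf3.reg _ rfl).trans b3
  have c2 : s3.reg .goff = h * r := (hf3.reg _ rfl).trans b4
  have c3 : s3.arr .gc = s.arr .gc := (hf3.arr _ rfl).trans b5
  have c4 : s3.arr .G = s.arr .G := (hf3.arr _ rfl).trans b6
  have c5 : s3.warr .G = s.warr .G := (hf3.warr _ rfl).trans b7
  have c6 : s3.arr .E = s2.arr .E := hf3.arr _ rfl
  have c7 : s3.warr .E = s2.warr .E := hf3.warr _ rfl
  clear hf3
  set L : List (ℕ × ℝ) := l.map fun i => R.getD i default with hLdef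
  -- At most `r` edges survive, so the result fits into the block of `r` cells reserved for this
  -- hash function and does not run into the next graph.
  have hlr : l.length ≤ r := by
    rw [hl3]
    refine length_topL_le (List.nodup_range.sublist List.filter_sublist) fun x hx y hy => ?_
    simp [degL] at hx hy
    exact hinj x hx.1 y hy.1
  have hlN : ∀ x ∈ l, x < R.length := by
    intro x hx
    rw [hl3] at hx
    simp [finL, topL, degL] at hx
    exact hx.1
  have hLl : L.length = l.length := by simp [hLdef]
  have hLi : ∀ i (hi : i < l.length), L[i]'(by omega) = R[l[i]]'(hlN _ (List.getElem_mem hi)) := by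
    intro i hi
    simp [hLdef, hlN _ (List.getElem_mem hi)]
  refine wp_seq (wp_forLt l.length (fun j s' => Recs s' .G (h * r) (L.take j) ∧
      (∀ i, ¬ (h * r ≤ i ∧ i < h * r + r) → s'.arr .G i = s.arr .G i ∧ s'.warr .G i = s.warr .G i))
      (fun _ => 6) (by rfl)
      (by rintro x ⟨⟩; exact ⟨by decide, rfl⟩) hns3 (by omega) ?_ ?_ ?_)
  · refine ⟨fun i hi => by simp at hi, ?_⟩
    intro i _
    simp [c4, c5]
  · rintro j s' hj hi hf ⟨h1, h2⟩
    have e1 : s'.reg .goff = h * r := (hf.reg _ rfl).trans c2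
    have e2 : s'.arr .S = s3.arr .S := hf.arr _ rfl
    have e3 : s'.arr .E = s2.arr .E := (hf.arr _ rfl).trans c6
    have e4 : s'.warr .E = s2.warr .E := (hf.warr _ rfl).trans c7
    have hlj : l[j] < R.length := hlN _ (List.getElem_mem hj)
    have e5 := hL2.recs l[j] hlj
    rw [Nat.zero_add, ← hLi j hj] at e5
    simp only [block, wp_seq_iff, wp_op_iff, Op.ok, Op.eff, St.setR_reg, St.setR_arr, St.setW_reg,
      St.setW_arr, St.setA_reg, St.setR_warr,
      Opd.val_r, reduceCtorEq, if_true, if_false, hi, e1, e2, e3, e4, hS3 j hj, Arith.eval, e5.1, e5.2]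
    refine ⟨by omega, by omega, by omega, by omega, by omega, by omega, le_rfl, ?_, ?_⟩
    · rw [List.take_succ_eq_append_getElem (by omega)]
      refine h1.concat ?_ ?_
      · have : j ⊓ L.length = j := by omega
        simp [this]
      · have : j ⊓ L.length = j := by omega
        simp [this, St.setA, St.setW, St.setR]
    · intro i hi'
      have hne : i ≠ h * r + j := by omega
      have := h2 i hi'
      simpa [hne, St.setA, St.setW, St.setR, St.setWA] using this
  intro s4 t4 hJ hi4 hf4 ht4
  rw [sum_const_range] at ht4
  have d1 : s4.reg .h = h := (hf4.reg _ rfl).trans c1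
  have d2 : s4.arr .gc = s.arr .gc := (hf4.arr _ rfl).trans c3
  have d3 : s4.reg .ns = l.length := (hf4.reg _ rfl).trans hns3
  rw [List.take_of_length_le (by omega)] at hJ
  refine wp_op (by simpa [d1] using hhM) ⟨L, ⟨s2.arr .ca, s2.arr .cb, s2.key, ?_, ?_⟩, by omega, ?_, ?_, ?_, ?_⟩
  · exact fun i hi => ⟨hL2.ca i hi, hL2.cb i hi, hL2.recs.key_eq hi⟩
  · rw [hLdef, hl3]
  · refine hJ.1.congr ?_ ?_ <;> simp
  · simp [d1, d2, d3, hLl]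
  · simpa using hJ.2
  · omega

-- The parameters of the hash functions are recomputed from `z` by repeated division, digit after
-- digit, so none of them is stored. Graph `h` lives in the cells from `h * r` on, and each round
-- leaves the other blocks alone. The step bound is what `r` slices, one for each edge of the
-- following batch, can absorb.
set_option maxHeartbeats 1600000 in
theorem wp_batchC {p : Bool} {n pp r k2 t z : ℕ} {L : ℕ → List (ℕ × ℝ)} {rs : List (ℕ × ℝ)}
    (hn : s.reg .n = n) (hp : s.reg .pp = pp) (hr : s.reg .r = r) (hk2 : s.reg .k2 = k2)
    (ht : s.reg .tt = t) (hz : s.reg .z = z) (hnn : s.reg .nn = pp * (pp - 1))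
    (hbn : s.reg .bn = rs.length) (hG : Graphs s t r L) (hbuf : Recs s (.buf p) 0 rs)
    (hl : rs.length ≤ r) (hk0 : 1 ≤ k2) (hr0 : 1 ≤ r) (hpp : 2 ≤ pp)
    (hcode : ∀ h < t, ∀ x ∈ L h ++ rs, x.1 < n * n)
    (hnd : ∀ h < t, ((L h ++ rs).map Prod.fst).Nodup)
    (hB : pp * n + pp ≤ B) (hM : (t + 5) * r ≤ M) (hMB : 8 * M + 8 ≤ B)
    (hQ : ∀ s' t' L', Fr (batchC p) s s' → Graphs s' t r L' →
      (∀ h < t, IsRed n k2 r (digitFn pp r z h) (L h ++ rs) (L' h)) →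
      t' ≤ 10000000 * (t + 1) * r → Q t' s') :
    wp B M (batchC p) s Q := by
  refine wp_mono (Q := fun t' s' => ∃ L', Graphs s' t r L' ∧
      (∀ h < t, IsRed n k2 r (digitFn pp r z h) (L h ++ rs) (L' h)) ∧
      t' ≤ 10000000 * (t + 1) * r) ?_
      (fun t s' hf ⟨L, h1, h2, h3⟩ => hQ s' t L hf h1 h2 h3)
  have hM5 : t * r + 5 * r ≤ M := by linarith [hM, Nat.add_mul t 5 r]
  have htr : t ≤ t * r := Nat.le_mul_of_pos_right _ hr0
  refine wp_seq (wp_op trivial (wp_seq (wp_op trivial (wp_forLt t (fun j s' =>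
      s'.reg .zr = z / (pp * (pp - 1)) ^ j ∧ s'.reg .goff = j * r ∧ ∃ L', Graphs s' t r L' ∧
        (∀ h < j, IsRed n k2 r (digitFn pp r z h) (L h ++ rs) (L' h)) ∧ ∀ h, j ≤ h → L' h = L h)
      (fun _ => 9000010 * r) (by cases p <;> rfl) ?_ ?_ ?_ ?_ ?_ ?_))))
  · rintro x ⟨⟩; exact ⟨by decide, by cases p <;> rfl⟩
  · simpa using ht
  · omega
  · refine ⟨by simp [hz], by simp, L, hG, by simp, by simp⟩
  · rintro j s' hj hi hf ⟨hzr, hgoff, L', hG', hred, hsame⟩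
    have hwr : ∀ x : V, (forLt .h (.r .tt) (block [.op (.ar .mod .zh (.r .zr) (.r .nn)),
      .op (.ar .div .zr (.r .zr) (.r .nn)), .op (.ar .div .ha (.r .zh) (.r .pp)),
      .op (.ar .add .ha (.r .ha) (.c 1)), .op (.ar .mod .hb (.r .zh) (.r .pp)), oneC p,
      .op (.ar .add .goff (.r .goff) (.r .r))])).wr x = false → x ≠ .zr → x ≠ .goff →
      s'.reg x = s.reg x := by
      intro x hx h1 h2
      rw [hf.reg x hx]
      simp [h1, h2]
    have e1 : s'.reg .n = n := (hwr _ (by cases p <;> rfl) (by decide) (by decide)).trans hn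
    have e2 : s'.reg .pp = pp := (hwr _ (by cases p <;> rfl) (by decide) (by decide)).trans hp
    have e3 : s'.reg .r = r := (hwr _ (by cases p <;> rfl) (by decide) (by decide)).trans hr
    have e4 : s'.reg .k2 = k2 := (hwr _ (by cases p <;> rfl) (by decide) (by decide)).trans hk2
    have e5 : s'.reg .nn = pp * (pp - 1) :=
      (hwr _ (by cases p <;> rfl) (by decide) (by decide)).trans hnn
    have e6 : s'.reg .bn = rs.length :=
      (hwr _ (by cases p <;> rfl) (by decide) (by decide)).trans hbn
    have e7 : s'.arr (.buf p) = s.arr (.buf p) := by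
      rw [hf.arr _ (by cases p <;> rfl)]; simp
    have e8 : s'.warr (.buf p) = s.warr (.buf p) := by
      rw [hf.warr _ (by cases p <;> rfl)]; simp
    have hnn0 : 0 < pp * (pp - 1) := Nat.mul_pos (by omega) (by omega)
    set d := z / (pp * (pp - 1)) ^ j % (pp * (pp - 1)) with hd
    have hd1 : d < pp * (pp - 1) := Nat.mod_lt _ hnn0
    have hd2 : d / pp < pp - 1 := Nat.div_lt_of_lt_mul hd1
    have hd3 : d % pp < pp := Nat.mod_lt _ (by omega)
    have f1 : ((1 : Fin 16) : ℕ) = 1 := rfl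
    have hzz : z / (pp * (pp - 1)) ^ j / (pp * (pp - 1)) = z / (pp * (pp - 1)) ^ (j + 1) := by
      rw [Nat.div_div_eq_div_mul, pow_succ]
    simp only [block, wp_seq_iff, wp_op_iff, Op.ok, Op.eff, St.setR_reg,
      Opd.val_r, Opd.val_c, reduceCtorEq, if_true, if_false, hzr, e2, e5, Arith.eval, f1, ← hd, hzz]
    have hpB : pp ≤ B := (Nat.le_add_left _ _).trans hB
    refine ⟨trivial, trivial, trivial, by omega, trivial, ?_⟩
    obtain ⟨g1, g2, g3⟩ := hG' j hj
    have hjr : j * r + r ≤ t * r := by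
      have := Nat.mul_le_mul_right r (show j + 1 ≤ t by omega)
      linarith [Nat.add_mul j 1 r]
    refine wp_oneC (n := n) (pp := pp) (r := r) (k2 := k2) (h := j) (ha := d / pp + 1) (hb := d % pp)
      (rs := L' j) (rs' := rs) (by simp [e1]) (by simp [e2]) (by simp [e3]) (by simp [e4])
      (by simp [hi]) (by simp) (by simp) (by simp [hgoff]) (by simp [e6]) (by simpa using g1)
      (g2.congr (by simp) (by simp)) (hbuf.congr (by simp [e7]) (by simp [e8])) g3 hl hk0 hr0
      (by rw [hsame j le_rfl]; exact hcode j hj) (by rw [hsame j le_rfl]; exact hnd j hj) ?_ (by omega)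
      (by omega) (by omega) hMB ?_
    · have : (d / pp + 1) * n ≤ pp * n := Nat.mul_le_mul_right _ (by omega)
      omega
    intro s2 t2 R hf2 hR hRl hRG hgc hoth ht2
    have q1 : s2.reg .goff = j * r := by rw [hf2.reg _ (by cases p <;> rfl)]; simp [hgoff]
    have q2 : s2.reg .r = r := by rw [hf2.reg _ (by cases p <;> rfl)]; simp [e3]
    have q3 : s2.reg .zr = z / (pp * (pp - 1)) ^ (j + 1) := by
      rw [hf2.reg _ (by cases p <;> rfl)]; simp
    refine ⟨by omega, by omega, q3, ?_, Function.update L' j R, ?_, ?_, ?_⟩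
    · rw [q1, q2]; ring
    · intro h hh
      obtain ⟨w1, w2, w3⟩ := hG' h hh
      by_cases hhj : h = j
      · subst hhj
        simp only [Function.update_self]
        exact ⟨by simp [hgc], hRG.congr (by simp) (by simp), hRl⟩
      · rw [Function.update_of_ne hhj]
        refine ⟨by simpa [hgc, hhj] using w1, w2.congr ?_ ?_, w3⟩
        all_goals
          intro i hi1 hi2
          -- Blocks with different numbers are disjoint.
          have hout : ¬ (j * r ≤ i ∧ i < j * r + r) := by
            rintro ⟨u1, u2⟩
            rcases Nat.lt_or_gt_of_ne hhj with h3 | h3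
            · have := Nat.mul_le_mul_right r (show h + 1 ≤ j by omega)
              have := Nat.add_mul h 1 r
              omega
            · have := Nat.mul_le_mul_right r (show j + 1 ≤ h by omega)
              have := Nat.add_mul j 1 r
              omega
          have := hoth i hout
          simp [this]
    · intro h hh
      by_cases hhj : h = j
      · subst hhj
        rw [Function.update_self, ← hsame h le_rfl]
        exact hR
      · rw [Function.update_of_ne hhj]
        exact hred h (by omega)
    · intro h hh
      rw [Function.update_of_ne (by omega)]
      exact hsame h (by omega)
  · rintro s' t' ⟨-, -, L', h1, h2, -⟩ hi hf ht'
    rw [sum_const_range] at ht'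
    refine ⟨L', h1, h2, ?_⟩
    have : 1 + (1 + t') ≤ t * (9000010 * r + 2) + 4 := by omega
    have h3 : t * (9000010 * r + 2) + 4 ≤ 10000000 * (t + 1) * r := by
      have : t * (9000010 * r + 2) = 9000010 * (t * r) + 2 * t := by ring
      have : 10000000 * (t + 1) * r = 10000000 * (t * r) + 10000000 * r := by ring
      omega
    omega

end

/-! ## Control flow graphs -/

/-- Instructions over control labels `X`. -/
inductive MI (X : Type)
  | op (o : Op) (next : X)
  | test (b : Test) (yes no : X)
  | random (next : X)
  | read (next atEnd : X)
  | halt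
  | haltNone

def MI.map {X Y : Type} (φ : X → Y) : MI X → MI Y
  | .op o x => .op o (φ x)
  | .test b x y => .test b (φ x) (φ y)
  | .random x => .random (φ x)
  | .read x y => .read (φ x) (φ y)
  | .halt => .halt
  | .haltNone => .haltNone

/-- `n` steps of operations and tests. -/
inductive Steps {X : Type} (B M : ℕ) (code : X → MI X) : ℕ → X → St → X → St → Prop
  | refl (x s) : Steps B M code 0 x s x s
  | op {n x s o y z s'} : code x = .op o y → o.ok B M s → Steps B M code n y (o.eff s) z s' →
      Steps B M code (n + 1) x s z s'
  | yes {n x s b y y' z s'} : code x = .test b y y' → b.ok M s → b.holds s →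
      Steps B M code n y s z s' → Steps B M code (n + 1) x s z s'
  | no {n x s b y y' z s'} : code x = .test b y y' → b.ok M s → ¬ b.holds s →
      Steps B M code n y' s z s' → Steps B M code (n + 1) x s z s'

section Steps

variable {X Y : Type} {B M : ℕ} {code : X → MI X}

theorem Steps.trans {n m : ℕ} {x y z : X} {s s' s'' : St} (h : Steps B M code n x s y s')
    (h' : Steps B M code m y s' z s'') : Steps B M code (n + m) x s z s'' := by
  induction h with
  | refl => simpa using h'
  | op h1 h2 _ ih => rw [Nat.add_right_comm]; exact .op h1 h2 (ih h')
  | yes h1 h2 h3 _ ih => rw [Nat.add_right_comm]; exact .yes h1 h2 h3 (ih h')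
  | no h1 h2 h3 _ ih => rw [Nat.add_right_comm]; exact .no h1 h2 h3 (ih h')

/-- This embeds the graph of a part into the graph of the whole. Nothing is required at `halt`, the
exit of a part, because `φ` sends it to the place where the whole goes on. -/
theorem Steps.map {code' : Y → MI Y} (φ : X → Y)
    (hφ : ∀ x, code x ≠ .halt → code' (φ x) = (code x).map φ) {n : ℕ} {x z : X}
    {s s' : St} (h : Steps B M code n x s z s') : Steps B M code' n (φ x) s (φ z) s' := by
  induction h with
  | refl => exact .refl _ _
  | op h1 h2 _ ih => exact .op (by rw [hφ _ (by rw [h1]; nofun), h1]; rfl) h2 ih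
  | yes h1 h2 h3 _ ih => exact .yes (by rw [hφ _ (by rw [h1]; nofun), h1]; rfl) h2 h3 ih
  | no h1 h2 h3 _ ih => exact .no (by rw [hφ _ (by rw [h1]; nofun), h1]; rfl) h2 h3 ih

end Steps

namespace Cmd

/-- The control positions in a command. -/
def Pos : Cmd → Type
  | .skip => Empty
  | .op _ => Unit
  | .seq a b => a.Pos ⊕ b.Pos
  | .ite _ a b => Unit ⊕ (a.Pos ⊕ b.Pos)
  | .loop _ a => Unit ⊕ a.Pos

theorem finite_pos : (c : Cmd) → Finite c.Pos
  | .skip => inferInstanceAs (Finite Empty)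
  | .op _ => inferInstanceAs (Finite Unit)
  | .seq a b =>
    have := finite_pos a
    have := finite_pos b
    inferInstanceAs (Finite (a.Pos ⊕ b.Pos))
  | .ite _ a b =>
    have := finite_pos a
    have := finite_pos b
    inferInstanceAs (Finite (Unit ⊕ (a.Pos ⊕ b.Pos)))
  | .loop _ a =>
    have := finite_pos a
    inferInstanceAs (Finite (Unit ⊕ a.Pos))

instance (c : Cmd) : Finite c.Pos := finite_pos c

/-- The first position; `none` stands for the end of the command. -/
def entry : (c : Cmd) → Option c.Pos
  | .skip => none
  | .op _ => some ()
  | .seq a b => (a.entry).elim ((b.entry).map Sum.inr) fun p => some (Sum.inl p)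
  | .ite _ _ _ => some (Sum.inl ())
  | .loop _ _ => some (Sum.inl ())

/-- The instructions at the positions of a command. -/
def at' : (c : Cmd) → c.Pos → MI (Option c.Pos)
  | .skip, p => p.elim
  | .op o, _ => .op o none
  | .seq a b, p =>
    p.elim (fun p => (a.at' p).map fun q => q.elim ((b.entry).map Sum.inr) fun p => some (Sum.inl p))
      fun p => (b.at' p).map (Option.map Sum.inr)
  | .ite b a c, p =>
    p.elim (fun _ => .test b ((a.entry).map fun p => Sum.inr (Sum.inl p))
      ((c.entry).map fun p => Sum.inr (Sum.inr p)))
      fun p => p.elim (fun p => (a.at' p).map (Option.map fun p => Sum.inr (Sum.inl p)))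
        fun p => (c.at' p).map (Option.map fun p => Sum.inr (Sum.inr p))
  | .loop b a, p =>
    p.elim (fun _ => .test b ((a.entry).elim (some (Sum.inl ())) fun p => some (Sum.inr p)) none)
      fun p => (a.at' p).map fun q => q.elim (some (Sum.inl ())) fun p => some (Sum.inr p)

/-- The control flow graph of a command. -/
def code (c : Cmd) : Option c.Pos → MI (Option c.Pos)
  | none => .halt
  | some p => c.at' p

end Cmd

/-- The number of steps is preserved exactly: the exit of a subcommand is identified with the entry
of what follows, so sequencing needs no jumps of its own. -/
theorem Ev.steps {B M : ℕ} {c : Cmd} {s s' : St} {t : ℕ} (h : Ev B M c s t s') :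
    Steps B M c.code t c.entry s none s' := by
  induction h with
  | skip s => exact .refl _ _
  | op o s h => exact .op (x := some ()) (y := none) rfl h (.refl _ _)
  | @seq a b s t s' t' s'' _ _ h1 h2 =>
    refine .trans (y := (b.entry).map Sum.inr)
      (Steps.map (code' := (Cmd.seq a b).code) (fun q : Option a.Pos => (q.elim ((b.entry).map Sum.inr)
        fun p => some (Sum.inl p) : Option (a.Pos ⊕ b.Pos))) ?_ h1)
      (Steps.map (code' := (Cmd.seq a b).code) (Option.map Sum.inr : Option b.Pos → Option (a.Pos ⊕ b.Pos))
         ?_ h2)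
    · rintro (_ | p) h
      · exact absurd rfl h
      · rfl
    · rintro (_ | p) h
      · exact absurd rfl h
      · rfl
  | @iteT b a c s t s' h1 h2 _ h3 =>
    refine .yes (x := some (Sum.inl ())) (b := b) rfl h1 h2
      (Steps.map (code' := (Cmd.ite b a c).code)
        (Option.map fun p => Sum.inr (Sum.inl p) : Option a.Pos → Option (Unit ⊕ (a.Pos ⊕ c.Pos)))
        ?_ h3)
    rintro (_ | p) h
    · exact absurd rfl h
    · rfl
  | @iteF b a c s t s' h1 h2 _ h3 =>
    refine .no (x := some (Sum.inl ())) (b := b) rfl h1 h2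
      (Steps.map (code' := (Cmd.ite b a c).code)
        (Option.map fun p => Sum.inr (Sum.inr p) : Option c.Pos → Option (Unit ⊕ (a.Pos ⊕ c.Pos)))
        ?_ h3)
    rintro (_ | p) h
    · exact absurd rfl h
    · rfl
  | @loopF b a s h1 h2 => exact .no (x := some (Sum.inl ())) (b := b) rfl h1 h2 (.refl _ _)
  | @loopT b a s t s' t' s'' h1 h2 _ _ h3 h4 =>
    refine .yes (x := some (Sum.inl ())) (b := b) rfl h1 h2 (.trans
      (Steps.map (code' := (Cmd.loop b a).code) (fun q : Option a.Pos => (q.elim (some (Sum.inl ()))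
        fun p => some (Sum.inr p) : Option (Unit ⊕ a.Pos))) ?_ h3) h4)
    rintro (_ | p) h
    · exact absurd rfl h
    · rfl

/-! ### Commands that do not see the data of the reader -/

/-- The registers of the reader. -/
def V.isReader : V → Bool
  | .ru | .rv | .rc | .cnt => true
  | _ => false

/-- The states agree except for the registers of the reader and the buffer `p`. -/
structure Agree (p : Bool) (s s' : St) : Prop where
  reg : ∀ x, x.isReader = false → s'.reg x = s.reg x
  wreg : ∀ x, x ≠ .rw → s'.wreg x = s.wreg x
  arr : ∀ x, x ≠ .buf p → s'.arr x = s.arr x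
  warr : ∀ x, x ≠ .buf p → s'.warr x = s.warr x
  out : s'.out = s.out

def Opd.blind : Opd → Bool
  | .r x => !x.isReader
  | .c _ => true

def Op.blind (p : Bool) : Op → Bool
  | .set d x => !d.isReader && x.blind
  | .big d _ => !d.isReader
  | .ar _ d x y => !d.isReader && x.blind && y.blind
  | .ld d a x => !d.isReader && decide (a ≠ .buf p) && !x.isReader
  | .st a x y => decide (a ≠ .buf p) && !x.isReader && y.blind
  | .wset d x => decide (d ≠ .rw) && decide (x ≠ .rw)
  | .wadd d x y => decide (d ≠ .rw) && decide (x ≠ .rw) && decide (y ≠ .rw)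
  | .wld d a x => decide (d ≠ .rw) && decide (a ≠ .buf p) && !x.isReader
  | .wst a x y => decide (a ≠ .buf p) && !x.isReader && decide (y ≠ .rw)
  | .emit u v => !u.isReader && !v.isReader

def Test.blind : Test → Bool
  | .lt x y | .eq x y => x.blind && y.blind
  | .wlt x y => decide (x ≠ .rw) && decide (y ≠ .rw)
  | .key x y | .kle x y => !x.isReader && !y.isReader

/-- The command does not access the registers of the reader and the buffer `p`. -/
def Cmd.blind (p : Bool) : Cmd → Bool
  | .skip => true
  | .op o => o.blind p
  | .seq a b => a.blind p && b.blind p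
  | .ite b a c => b.blind && a.blind p && c.blind p
  | .loop b a => b.blind && a.blind p

section Blind

variable {p : Bool} {s s' : St} {B M : ℕ}

theorem Agree.opd (h : Agree p s s') {x : Opd} (hx : x.blind) : x.val s' = x.val s := by
  cases x with
  | r x => exact h.reg x (by simpa [Opd.blind] using hx)
  | c a => rfl

theorem Agree.op (h : Agree p s s') {o : Op} (ho : o.blind p) (hok : o.ok B M s) :
    o.ok B M s' ∧ Agree p (o.eff s) (o.eff s') := by
  cases o with
  | set d x =>
    simp [Op.blind] at ho
    refine ⟨trivial, ⟨fun y hy => ?_, h.wreg, h.arr, h.warr, h.out⟩⟩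
    simp [h.opd ho.2, h.reg y hy]
  | big d x =>
    simp [Op.blind] at ho
    refine ⟨hok, ⟨fun y hy => ?_, h.wreg, h.arr, h.warr, h.out⟩⟩
    simp [h.reg y hy]
  | ar op d x y =>
    simp [Op.blind] at ho
    refine ⟨?_, ⟨fun y hy => ?_, h.wreg, h.arr, h.warr, h.out⟩⟩
    · cases op <;> simpa [h.opd ho.2, h.opd ho.1.2] using hok
    · simp [h.opd ho.2, h.opd ho.1.2, h.reg y hy]
  | ld d a x =>
    simp [Op.blind] at ho
    refine ⟨by simpa [h.reg x ho.2] using hok, ⟨fun y hy => ?_, h.wreg, h.arr, h.warr, h.out⟩⟩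
    simp [h.reg y hy, h.reg x ho.2, h.arr a ho.1.2]
  | st a x y =>
    simp [Op.blind] at ho
    refine ⟨by simpa [h.reg x ho.1.2] using hok, ⟨h.reg, h.wreg, fun y hy => ?_, h.warr, h.out⟩⟩
    simp [h.reg x ho.1.2, h.opd ho.2, h.arr y hy, h.arr a ho.1.1]
  | wset d x =>
    simp [Op.blind] at ho
    refine ⟨trivial, ⟨h.reg, fun y hy => ?_, h.arr, h.warr, h.out⟩⟩
    simp [h.wreg y hy, h.wreg x ho.2]
  | wadd d x y =>
    simp [Op.blind] at ho
    refine ⟨trivial, ⟨h.reg, fun y hy => ?_, h.arr, h.warr, h.out⟩⟩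
    simp [h.wreg _ hy, h.wreg _ ho.2, h.wreg _ ho.1.2]
  | wld d a x =>
    simp [Op.blind] at ho
    refine ⟨by simpa [h.reg x ho.2] using hok, ⟨h.reg, fun y hy => ?_, h.arr, h.warr, h.out⟩⟩
    simp [h.wreg y hy, h.reg x ho.2, h.warr a ho.1.2]
  | wst a x y =>
    simp [Op.blind] at ho
    refine ⟨by simpa [h.reg x ho.1.2] using hok, ⟨h.reg, h.wreg, h.arr, fun y hy => ?_, h.out⟩⟩
    simp [h.reg x ho.1.2, h.wreg _ ho.2, h.warr y hy, h.warr a ho.1.1]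
  | emit u v =>
    simp [Op.blind] at ho
    refine ⟨trivial, ⟨h.reg, h.wreg, h.arr, h.warr, ?_⟩⟩
    simp [h.reg u ho.1, h.reg v ho.2, h.out]

theorem Agree.key (h : Agree p s s') (i : ℕ) : s'.key i = s.key i := by
  simp [St.key, h.arr .E nofun, h.warr .E nofun]

theorem Agree.test (h : Agree p s s') {b : Test} (hb : b.blind) :
    (b.ok M s ↔ b.ok M s') ∧ (b.holds s ↔ b.holds s') := by
  cases b with
  | lt x y | eq x y =>
    simp [Test.blind] at hb
    simp [h.opd hb.1, h.opd hb.2]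
  | wlt x y =>
    simp [Test.blind] at hb
    simp [h.wreg _ hb.1, h.wreg _ hb.2]
  | key x y | kle x y =>
    simp [Test.blind] at hb
    simp [h.reg _ hb.1, h.reg _ hb.2, h.key]

theorem Cmd.blind_at {p : Bool} : (c : Cmd) → c.blind p → (q : c.Pos) →
    (∃ o x, c.at' q = .op o x ∧ o.blind p) ∨ ∃ b x y, c.at' q = .test b x y ∧ b.blind
  | .op o, h, _ => .inl ⟨o, none, rfl, h⟩
  | .seq a b, h, .inl q => by
    simp [Cmd.blind] at h
    rcases blind_at a h.1 q with ⟨o, x, h1, h2⟩ | ⟨o, x, y, h1, h2⟩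
    · exact .inl ⟨o, _, (congrArg (MI.map _) h1 :), h2⟩
    · exact .inr ⟨o, _, _, (congrArg (MI.map _) h1 :), h2⟩
  | .seq a b, h, .inr q => by
    simp [Cmd.blind] at h
    rcases blind_at b h.2 q with ⟨o, x, h1, h2⟩ | ⟨o, x, y, h1, h2⟩
    · exact .inl ⟨o, _, (congrArg (MI.map _) h1 :), h2⟩
    · exact .inr ⟨o, _, _, (congrArg (MI.map _) h1 :), h2⟩
  | .ite t a b, h, .inl _ => .inr ⟨t, _, _, rfl, by simp [Cmd.blind] at h; exact h.1.1⟩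
  | .ite t a b, h, .inr (.inl q) => by
    simp [Cmd.blind] at h
    rcases blind_at a h.1.2 q with ⟨o, x, h1, h2⟩ | ⟨o, x, y, h1, h2⟩
    · exact .inl ⟨o, _, (congrArg (MI.map _) h1 :), h2⟩
    · exact .inr ⟨o, _, _, (congrArg (MI.map _) h1 :), h2⟩
  | .ite t a b, h, .inr (.inr q) => by
    simp [Cmd.blind] at h
    rcases blind_at b h.2 q with ⟨o, x, h1, h2⟩ | ⟨o, x, y, h1, h2⟩
    · exact .inl ⟨o, _, (congrArg (MI.map _) h1 :), h2⟩
    · exact .inr ⟨o, _, _, (congrArg (MI.map _) h1 :), h2⟩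
  | .loop t a, h, .inl _ => .inr ⟨t, _, _, rfl, by simp [Cmd.blind] at h; exact h.1⟩
  | .loop t a, h, .inr q => by
    simp [Cmd.blind] at h
    rcases blind_at a h.2 q with ⟨o, x, h1, h2⟩ | ⟨o, x, y, h1, h2⟩
    · exact .inl ⟨o, _, (congrArg (MI.map _) h1 :), h2⟩
    · exact .inr ⟨o, _, _, (congrArg (MI.map _) h1 :), h2⟩

/-- A reduction that is interrupted while the reader stores an edge can go on as predicted: the
remaining run is replayed label by label from the changed state, with the same number of steps. -/
theorem Steps.agree {c : Cmd} (hc : c.blind p) {n : ℕ} {x y : Option c.Pos} {s1 s2 : St}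
    (h : Steps B M c.code n x s1 y s2) {s' : St} (ha : Agree p s1 s') :
    ∃ s'', Steps B M c.code n x s' y s'' ∧ Agree p s2 s'' := by
  induction h generalizing s' with
  | refl => exact ⟨s', .refl _ _, ha⟩
  | @op n x s o y z s' h1 h2 _ ih =>
    cases x with
    | none => cases h1
    | some q =>
      have h1' : c.at' q = .op o y := h1
      rcases c.blind_at hc q with ⟨o', _, h3, h4⟩ | ⟨_, _, _, h3, _⟩
      · rw [h1'] at h3
        cases h3
        obtain ⟨h5, h6⟩ := ha.op h4 h2
        obtain ⟨s'', h7, h8⟩ := ih h6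
        exact ⟨s'', .op h1 h5 h7, h8⟩
      · rw [h1'] at h3; cases h3
  | @yes n x s b y y' z s' h1 h2 hb _ ih =>
    cases x with
    | none => cases h1
    | some q =>
      have h1' : c.at' q = .test b y y' := h1
      rcases c.blind_at hc q with ⟨_, _, h3, _⟩ | ⟨_, _, _, h3, h4⟩
      · rw [h1'] at h3; cases h3
      · rw [h1'] at h3
        cases h3
        obtain ⟨s'', h7, h8⟩ := ih ha
        have := ha.test (M := M) h4
        exact ⟨s'', .yes h1 (this.1.1 h2) (this.2.1 hb) h7, h8⟩
  | @no n x s b y y' z s' h1 h2 hb _ ih =>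
    cases x with
    | none => cases h1
    | some q =>
      have h1' : c.at' q = .test b y y' := h1
      rcases c.blind_at hc q with ⟨_, _, h3, _⟩ | ⟨_, _, _, h3, h4⟩
      · rw [h1'] at h3; cases h3
      · rw [h1'] at h3
        cases h3
        obtain ⟨s'', h7, h8⟩ := ih ha
        have := ha.test (M := M) h4
        exact ⟨s'', .no h1 (this.1.1 h2) (fun h => hb (this.2.2 h)) h7, h8⟩

end Blind


/-! ## Compilation of control flow graphs to programs -/

/-- The position of an array in the interleaved memory. -/
def Ar.idx : Ar → Fin 17
  | .buf false => 0 | .buf true => 1 | .G => 2 | .gc => 3 | .E => 4 | .ca => 5 | .cb => 6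
  | .ct => 7 | .hd => 8 | .nx => 9 | .S => 10 | .best => 11 | .A => 12 | .T => 13 | .U => 14
  | .sel => 15 | .res => 16

theorem Ar.idx_bijective : Function.Bijective Ar.idx := by
  constructor
  · decide
  · decide

noncomputable def Ar.ofIdx (i : Fin 17) : Ar := (Ar.idx_bijective.2 i).choose

theorem Ar.idx_ofIdx (i : Fin 17) : (Ar.ofIdx i).idx = i := (Ar.idx_bijective.2 i).choose_spec
theorem Ar.ofIdx_idx (a : Ar) : Ar.ofIdx a.idx = a := Ar.idx_bijective.1 (Ar.idx_ofIdx _)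

/-- Interleave the arrays. -/
noncomputable def interleave {α : Type} (f : Ar → ℕ → α) (m : ℕ) : α :=
  f (Ar.ofIdx ⟨m % 17, Nat.mod_lt _ (by norm_num)⟩) (m / 17)

theorem interleave_cell {α : Type} (f : Ar → ℕ → α) (a : Ar) (i : ℕ) :
    interleave f (i * 17 + a.idx) = f a i := by
  have h1 : (i * 17 + a.idx) / 17 = i := by have := a.idx.2; omega
  have h2 : (⟨(i * 17 + a.idx) % 17, Nat.mod_lt _ (by norm_num)⟩ : Fin 17) = a.idx := by
    ext; simp
  rw [interleave, h1, h2, Ar.ofIdx_idx]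

theorem interleave_update {α : Type} (f : Ar → ℕ → α) (a : Ar) (i : ℕ) (x : α) :
    Function.update (interleave f) (i * 17 + a.idx) x =
      interleave (Function.update f a (Function.update (f a) i x)) := by
  funext m
  have hm : m = m / 17 * 17 + (Ar.ofIdx ⟨m % 17, Nat.mod_lt _ (by norm_num)⟩).idx := by
    rw [Ar.idx_ofIdx]; simp; omega
  generalize m / 17 = j at hm
  generalize (Ar.ofIdx ⟨m % 17, Nat.mod_lt _ (by norm_num)⟩) = b at hm
  subst hm
  rw [interleave_cell]
  by_cases hab : b = a
  · subst hab
    by_cases hij : j = i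
    · subst hij; simp
    · rw [Function.update_of_ne (by omega), interleave_cell, Function.update_self,
        Function.update_of_ne hij]
  · have : j * 17 + (b.idx : ℕ) ≠ i * 17 + a.idx := by
      intro h
      have h1 := a.idx.2
      have h2 := b.idx.2
      exact hab (Ar.idx_bijective.1 (Fin.ext (by omega)))
    rw [Function.update_of_ne this, interleave_cell, Function.update_of_ne hab]

section Compile

variable {X : Type}

abbrev LInstr (X : Type) := Instr (X × Fin 16) (V ⊕ Fin 3) (W ⊕ Bool)

def opdI (d : Fin 3) (a : Opd) (l : X × Fin 16) : LInstr X :=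
  match a with
  | .r v => .move (.inr d) (.inl v) l
  | .c a => .const (.inr d) a l

/-- The computation of the address of a cell. -/
def addrI (x : X) (d : Fin 3) (a : Ar) (v : V) (o : Fin 16) : ℕ → LInstr X
  | 0 => .const (.inr 2) 17 (x, o + 1)
  | 1 => .arith .mul (.inr d) (.inl v) (.inr 2) (x, o + 2)
  | 2 => .const (.inr 2) a.idx (x, o + 3)
  | _ => .arith .add (.inr d) (.inr d) (.inr 2) (x, o + 4)

/-- The comparison of two keys. -/
def keyI (x : X) (u v : V) (y n : X) : ℕ → LInstr X
  | 0 => addrI x 0 .E u 0 0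
  | 1 => addrI x 0 .E u 0 1
  | 2 => addrI x 0 .E u 0 2
  | 3 => addrI x 0 .E u 0 3
  | 4 => addrI x 1 .E v 4 0
  | 5 => addrI x 1 .E v 4 1
  | 6 => addrI x 1 .E v 4 2
  | 7 => addrI x 1 .E v 4 3
  | 8 => .wload (.inr false) (.inr 0) (x, 9)
  | 9 => .wload (.inr true) (.inr 1) (x, 10)
  | 10 => .wbranchLT (.inr false) (.inr true) (y, 0) (x, 11)
  | 11 => .wbranchLT (.inr true) (.inr false) (n, 0) (x, 12)
  | 12 => .load (.inr 0) (.inr 0) (x, 13)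
  | 13 => .load (.inr 1) (.inr 1) (x, 14)
  | _ => .branchLT (.inr 0) (.inr 1) (y, 0) (n, 0)

/-- The instructions that implement an instruction of a control flow graph. -/
def micro (x : X) : MI X → ℕ → LInstr X
  | .op (.set d (.r v)) y, _ => .move (.inl d) (.inl v) (y, 0)
  | .op (.set d (.c a)) y, _ => .const (.inl d) a (y, 0)
  | .op (.big d a) y, _ => .const (.inl d) a (y, 0)
  | .op (.ar _ _ a _) _, 0 => opdI 0 a (x, 1)
  | .op (.ar _ _ _ b) _, 1 => opdI 1 b (x, 2)
  | .op (.ar o d _ _) y, _ => .arith o (.inl d) (.inr 0) (.inr 1) (y, 0)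
  | .op (.ld d _ _) y, 4 => .load (.inl d) (.inr 0) (y, 0)
  | .op (.ld _ a v) _, i => addrI x 0 a v 0 i
  | .op (.st _ _ b) _, 4 => opdI 1 b (x, 5)
  | .op (.st _ _ _) y, 5 => .store (.inr 0) (.inr 1) (y, 0)
  | .op (.st a v _) _, i => addrI x 0 a v 0 i
  | .op (.wset d v) y, _ => .wmove (.inl d) (.inl v) (y, 0)
  | .op (.wadd d u v) y, _ => .wadd (.inl d) (.inl u) (.inl v) (y, 0)
  | .op (.wld d _ _) y, 4 => .wload (.inl d) (.inr 0) (y, 0)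
  | .op (.wld _ a v) _, i => addrI x 0 a v 0 i
  | .op (.wst _ _ w) y, 4 => .wstore (.inr 0) (.inl w) (y, 0)
  | .op (.wst a v _) _, i => addrI x 0 a v 0 i
  | .op (.emit u v) y, _ => .emit (.inl u) (.inl v) (y, 0)
  | .test (.lt a _) _ _, 0 => opdI 0 a (x, 1)
  | .test (.lt _ b) _ _, 1 => opdI 1 b (x, 2)
  | .test (.lt _ _) y n, _ => .branchLT (.inr 0) (.inr 1) (y, 0) (n, 0)
  | .test (.eq a _) _ _, 0 => opdI 0 a (x, 1)
  | .test (.eq _ b) _ _, 1 => opdI 1 b (x, 2)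
  | .test (.eq _ _) _ n, 2 => .branchLT (.inr 0) (.inr 1) (n, 0) (x, 3)
  | .test (.eq _ _) y n, _ => .branchLT (.inr 1) (.inr 0) (n, 0) (y, 0)
  | .test (.wlt u v) y n, _ => .wbranchLT (.inl u) (.inl v) (y, 0) (n, 0)
  | .test (.key u v) y n, i => keyI x u v y n i
  | .test (.kle u v) y n, i => keyI x v u n y i
  | .random y, _ => .random (.inl .z) (.inl .zr) (y, 0)
  | .read y e, _ => .read (.inl .ru) (.inl .rv) (.inl .rw) (y, 0) (e, 0)
  | .halt, _ => .halt
  | .haltNone, _ => .haltNone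

variable [Fintype X]

/-- The program with the control flow graph `code`. -/
noncomputable def flat (code : X → MI X) (x0 : X) : Program where
  Label := X × Fin 16
  Reg := V ⊕ Fin 3
  WReg := W ⊕ Bool
  code l := micro l.1 (code l.1) l.2
  entry := (x0, 0)
  nReg := .inl .n
  kReg := .inl .k

/-- The next step respects the bounds on words and addresses. -/
structure Good {P : Program} (B M : ℕ) (c : P.Config) : Prop where
  reg : ∀ r, c.reg r ≤ B
  mem : ∀ a, c.mem a ≤ B
  wordCell : ∀ a ∈ c.wordCell, a < M
  weightCell : ∀ a ∈ c.weightCell, a < M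

/-- `n` steps that neither read nor draw random elements. -/
inductive LPath {P : Program} (B M : ℕ) : ℕ → P.Config → P.Config → Prop
  | refl (c) : LPath B M 0 c c
  | head {n c c' c''} : Good B M c → Program.step c = PMF.pure c' → c'.timer = c.timer.map (· + 1) →
      LPath B M n c' c'' → LPath B M (n + 1) c c''

theorem LPath.trans {P : Program} {B M n m : ℕ} {a b c : P.Config} (h : LPath B M n a b)
    (h' : LPath B M m b c) : LPath B M (n + m) a c := by
  induction h with
  | refl => simpa using h'
  | head h1 h2 h3 _ ih => rw [Nat.add_right_comm]; exact .head h1 h2 h3 (ih h')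

theorem LPath.single {P : Program} {B M : ℕ} {a b : P.Config} (h1 : Good B M a)
    (h2 : Program.step a = PMF.pure b) (h3 : b.timer = a.timer.map (· + 1)) : LPath B M 1 a b :=
  .head h1 h2 h3 (.refl _)

variable {code : X → MI X} {x0 : X}

/-- The configuration with the data `s` and the temporary registers `τ` and `ω`. -/
noncomputable def conf (code : X → MI X) (x0 : X) (l : X × Fin 16) (s : St) (τ : Fin 3 → ℕ)
    (ω : Bool → ℝ) (inp : List (ℕ × ℕ × ℝ)) (tm : Option ℕ) : (flat code x0).Config where
  pc := l
  reg := Sum.elim s.reg τ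
  wreg := Sum.elim s.wreg ω
  mem := interleave s.arr
  wmem := interleave s.warr
  stream := inp
  output := s.out
  timer := tm

/-- All words are at most `B`. -/
structure Bdd (B : ℕ) (s : St) : Prop where
  reg : ∀ v, s.reg v ≤ B
  arr : ∀ a i, s.arr a i ≤ B

theorem Bdd.setR {B : ℕ} {s : St} (h : Bdd B s) {d : V} {x : ℕ} (hx : x ≤ B) : Bdd B (s.setR d x) :=
  ⟨fun v => by rw [St.setR_reg]; split_ifs; exacts [hx, h.reg v], h.arr⟩

theorem Bdd.setA {B : ℕ} {s : St} (h : Bdd B s) {a : Ar} {i x : ℕ} (hx : x ≤ B) :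
    Bdd B (s.setA a i x) := by
  refine ⟨h.reg, fun b j => ?_⟩
  rw [St.setA_arr]
  split_ifs
  · rw [Function.update_apply]; split_ifs; exacts [hx, h.arr a j]
  · exact h.arr b j

theorem Bdd.opd {B : ℕ} {s : St} (h : Bdd B s) (hB : 20 ≤ B) (x : Opd) : x.val s ≤ B := by
  cases x with
  | r v => exact h.reg v
  | c a => have := a.2; simp; omega

theorem Bdd.eff {B M : ℕ} {s : St} (h : Bdd B s) (hB : 20 ≤ B) {o : Op} (ho : o.ok B M s) :
    Bdd B (o.eff s) := by
  cases o with
  | set d x => exact h.setR (h.opd hB x)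
  | big d a => exact h.setR ho
  | ar op d x y =>
    refine h.setR ?_
    cases op with
    | add => exact ho
    | mul => exact ho
    | sub => exact (Nat.sub_le _ _).trans (h.opd hB x)
    | div => exact (Nat.div_le_self _ _).trans (h.opd hB x)
    | mod => exact (Nat.mod_le _ _).trans (h.opd hB x)
  | ld d a x => exact h.setR (h.arr _ _)
  | st a x y => exact h.setA (h.opd hB y)
  | wset d x => exact ⟨h.reg, h.arr⟩
  | wadd d x y => exact ⟨h.reg, h.arr⟩
  | wld d a x => exact ⟨h.reg, h.arr⟩
  | wst a x y => exact ⟨h.reg, h.arr⟩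
  | emit u v => exact ⟨h.reg, h.arr⟩

section Sim

variable {B M : ℕ} {s : St} {τ : Fin 3 → ℕ} {ω : Bool → ℝ} {inp : List (ℕ × ℕ × ℝ)} {tm : Option ℕ}
  {l l' : X × Fin 16}

theorem good_conf (hs : Bdd B s) (hτ : ∀ i, τ i ≤ B)
    (h1 : ∀ a ∈ (conf code x0 l s τ ω inp tm).wordCell, a < M)
    (h2 : ∀ a ∈ (conf code x0 l s τ ω inp tm).weightCell, a < M) :
    Good B M (conf code x0 l s τ ω inp tm) where
  reg r := by
    cases r with
    | inl v => exact hs.reg v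
    | inr i => exact hτ i
  mem a := hs.arr _ _
  wordCell := h1
  weightCell := h2

theorem conf_setReg_inl (d : V) (x : ℕ) : (conf code x0 l s τ ω inp tm).setReg (.inl d) x =
    conf code x0 l (s.setR d x) τ ω inp tm := by
  unfold Program.Config.setReg conf
  congr 1
  exact Sum.update_elim_inl

theorem conf_setReg_inr (d : Fin 3) (x : ℕ) : (conf code x0 l s τ ω inp tm).setReg (.inr d) x =
    conf code x0 l s (Function.update τ d x) ω inp tm := by
  unfold Program.Config.setReg conf
  congr 1
  exact Sum.update_elim_inr

theorem conf_setWReg_inl (d : W) (x : ℝ) : (conf code x0 l s τ ω inp tm).setWReg (.inl d) x =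
    conf code x0 l (s.setW d x) τ ω inp tm := by
  unfold Program.Config.setWReg conf
  congr 1
  exact Sum.update_elim_inl

theorem conf_setWReg_inr (d : Bool) (x : ℝ) : (conf code x0 l s τ ω inp tm).setWReg (.inr d) x =
    conf code x0 l s τ (Function.update ω d x) inp tm := by
  unfold Program.Config.setWReg conf
  congr 1
  exact Sum.update_elim_inr

theorem conf_goto : (conf code x0 l s τ ω inp tm).goto l' =
    conf code x0 l' s τ ω inp (tm.map (· + 1)) := rfl

theorem path_one (hs : Bdd B s) (hτ : ∀ i, τ i ≤ B)
    (h1 : ∀ a ∈ (conf code x0 l s τ ω inp tm).wordCell, a < M)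
    (h2 : ∀ a ∈ (conf code x0 l s τ ω inp tm).weightCell, a < M) {s' : St} {τ' : Fin 3 → ℕ}
    {ω' : Bool → ℝ} (h : Program.step (conf code x0 l s τ ω inp tm) =
      PMF.pure (conf code x0 l' s' τ' ω' inp (tm.map (· + 1)))) :
    LPath B M 1 (conf code x0 l s τ ω inp tm) (conf code x0 l' s' τ' ω' inp (tm.map (· + 1))) :=
  .single (good_conf hs hτ h1 h2) h rfl

theorem update_le {τ : Fin 3 → ℕ} (hτ : ∀ i, τ i ≤ B) {d : Fin 3} {x : ℕ} (hx : x ≤ B) (i : Fin 3) :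
    Function.update τ d x i ≤ B := by
  rw [Function.update_apply]; split_ifs; exacts [hx, hτ i]

theorem path_opd {d : Fin 3} {a : Opd} (h : (flat code x0).code l = opdI d a l') (hs : Bdd B s)
    (hτ : ∀ i, τ i ≤ B) : LPath B M 1 (conf code x0 l s τ ω inp tm)
      (conf code x0 l' s (Function.update τ d (a.val s)) ω inp (tm.map (· + 1))) := by
  have hpc : (flat code x0).code (conf code x0 l s τ ω inp tm).pc = opdI d a l' := h
  cases a <;> refine path_one hs hτ ?_ ?_ ?_
  all_goals first
    | simp [Program.Config.wordCell, hpc, opdI]; done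
    | simp [Program.Config.weightCell, hpc, opdI]; done
    | simp only [Program.step, hpc, opdI]
      rw [conf_setReg_inr, conf_goto]
      rfl

theorem path_const {d : Fin 3} {a : ℕ} (h : (flat code x0).code l = .const (.inr d) a l')
    (hs : Bdd B s) (hτ : ∀ i, τ i ≤ B) : LPath B M 1 (conf code x0 l s τ ω inp tm)
      (conf code x0 l' s (Function.update τ d a) ω inp (tm.map (· + 1))) := by
  have hpc : (flat code x0).code (conf code x0 l s τ ω inp tm).pc = .const (.inr d) a l' := h
  refine path_one hs hτ (by simp [Program.Config.wordCell, hpc])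
    (by simp [Program.Config.weightCell, hpc]) ?_
  simp only [Program.step, hpc]
  rw [conf_setReg_inr, conf_goto]

theorem path_arith {d : Fin 3} {o : Arith} {u v : V ⊕ Fin 3}
    (h : (flat code x0).code l = .arith o (.inr d) u v l')
    (hs : Bdd B s) (hτ : ∀ i, τ i ≤ B) : LPath B M 1 (conf code x0 l s τ ω inp tm)
      (conf code x0 l' s (Function.update τ d
        (o.eval (Sum.elim s.reg τ u) (Sum.elim s.reg τ v))) ω inp (tm.map (· + 1))) := by
  have hpc : (flat code x0).code (conf code x0 l s τ ω inp tm).pc = .arith o (.inr d) u v l' := h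
  refine path_one hs hτ (by simp [Program.Config.wordCell, hpc])
    (by simp [Program.Config.weightCell, hpc]) ?_
  simp only [Program.step, hpc]
  rw [conf_setReg_inr, conf_goto]
  rfl

/-- Cell `i` of an array has the address `i * 17 + a.idx` in the interleaved memory, so the bound
`M` on indices becomes `17 * M` on addresses. The third temporary register only holds constants. -/
theorem path_addr {x : X} {d : Fin 3} {a : Ar} {v : V} {o : Fin 16}
    (h0 : (flat code x0).code (x, o) = addrI x d a v o 0)
    (h1 : (flat code x0).code (x, o + 1) = addrI x d a v o 1)
    (h2 : (flat code x0).code (x, o + 2) = addrI x d a v o 2)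
    (h3 : (flat code x0).code (x, o + 3) = addrI x d a v o 3)
    (hd : d ≠ 2) (hs : Bdd B s) (hτ : ∀ i, τ i ≤ B) (hv : s.reg v < M) (hB : 17 * M ≤ B) :
    ∃ τ' tm', LPath B (17 * M) 4 (conf code x0 (x, o) s τ ω inp tm)
      (conf code x0 (x, o + 4) s τ' ω inp tm') ∧ (∀ i, τ' i ≤ B) ∧ τ' d = s.reg v * 17 + a.idx ∧
      ∀ i, i ≠ d → i ≠ 2 → τ' i = τ i := by
  have hi := a.idx.2
  have b0 : ∀ i, Function.update τ 2 17 i ≤ B := update_le hτ (by omega)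
  have e1 : Arith.mul.eval (s.reg v) (Function.update τ 2 17 2) = s.reg v * 17 := by
    simp [Arith.eval]
  have b1 := update_le b0 (d := d) (x := s.reg v * 17) (by omega)
  have b2 := update_le b1 (d := 2) (x := a.idx) (by omega)
  refine ⟨_, _, .trans (path_const h0 hs hτ) (.trans (path_arith h1 hs b0)
    (.trans (path_const h2 hs ?_) (path_arith h3 hs ?_))), ?_, ?_, ?_⟩
  · simpa only [Sum.elim_inl, Sum.elim_inr, e1] using b1
  · simpa only [Sum.elim_inl, Sum.elim_inr, e1] using b2
  · refine update_le ?_ ?_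
    · simpa only [Sum.elim_inl, Sum.elim_inr, e1] using b2
    · simp [Arith.eval, hd]
      omega
  · simp [Arith.eval, hd]
  · intro i h1 h2
    simp [h1, h2]

/-- The bounds of `Good` hold and the temporary registers respect `B`. -/
theorem sim_op {x y : X} {o : Op} (hx : code x = .op o y) (ho : o.ok B M s) (hs : Bdd B s)
    (hτ : ∀ i, τ i ≤ B) (hB : 17 * M ≤ B) (hB' : 20 ≤ B) :
    ∃ n τ' ω' tm', n ≤ 15 ∧ LPath B (17 * M) n (conf code x0 (x, 0) s τ ω inp tm)
      (conf code x0 (y, 0) (o.eff s) τ' ω' inp tm') ∧ (∀ i, τ' i ≤ B) := by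
  have hc : ∀ i, (flat code x0).code (x, i) = micro x (.op o y) i := by
    intro i
    change micro x (code x) i = _
    rw [hx]
  have hv := hs.opd hB'
  cases o with
  | set d a =>
    refine ⟨1, τ, ω, _, by omega, path_one hs hτ ?_ ?_ ?_ , hτ⟩ <;>
    · have hpc := hc 0
      change (flat code x0).code (conf code x0 (x, 0) s τ ω inp tm).pc = _ at hpc
      cases a <;> simp only [Program.step, Program.Config.wordCell, Program.Config.weightCell, hpc, micro]
      all_goals first
        | rintro _ ⟨⟩; done
        | rw [conf_setReg_inl, conf_goto]; rfl
  | big d a =>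
    refine ⟨1, τ, ω, _, by omega, path_one hs hτ ?_ ?_ ?_ , hτ⟩ <;>
    · have hpc := hc 0
      change (flat code x0).code (conf code x0 (x, 0) s τ ω inp tm).pc = _ at hpc
      simp only [Program.step, Program.Config.wordCell, Program.Config.weightCell, hpc, micro]
      first
        | rintro _ ⟨⟩; done
        | rw [conf_setReg_inl, conf_goto]; rfl
  | ar op d u v =>
    have t1 := update_le hτ (d := 0) (hv u)
    have t2 := update_le t1 (d := 1) (hv v)
    refine ⟨1 + (1 + 1), _, ω, _, by omega, .trans (path_opd (hc 0) hs hτ) (.trans (path_opd (hc 1) hs t1)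
      (path_one hs t2 ?_ ?_ ?_)) , t2⟩ <;>
    · have hpc := hc 2
      generalize Option.map (· + 1) (Option.map (· + 1) tm) = tm2
      change (flat code x0).code (conf code x0 (x, 2) s (Function.update (Function.update τ 0 (u.val s)) 1 (v.val s)) ω inp tm2).pc = _ at hpc
      simp only [Program.step, Program.Config.wordCell, Program.Config.weightCell, hpc, micro]
      first
        | rintro _ ⟨⟩; done
        | rw [conf_setReg_inl, conf_goto]; rfl
  | ld d a v =>
    obtain ⟨τ', tm', p1, p2, p3, p4⟩ := path_addr (tm := tm) (inp := inp) (ω := ω) (o := 0) (hc 0) (hc 1) (hc 2) (hc 3) (by decide) hs hτ ho hB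
    have hi := a.idx.2
    simp only [Op.ok] at ho
    refine ⟨4 + 1, τ', ω, _, by omega, .trans p1 (path_one hs p2 ?_ ?_ ?_), p2⟩ <;>
    · have hpc : (flat code x0).code (x, 4) = .load (.inl d) (.inr 0) (y, 0) := hc 4
      change (flat code x0).code (conf code x0 (x, 0 + 4) s τ' ω inp tm').pc = _ at hpc
      simp only [Program.step, Program.Config.wordCell, Program.Config.weightCell, hpc]
      first
        | rintro _ ⟨⟩; done
        | rintro _ ⟨⟩; change τ' 0 < _; rw [p3]; omega
        | rw [conf_setReg_inl, conf_goto]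
          change PMF.pure (conf code x0 (y, 0) (s.setR d (interleave s.arr (τ' 0))) τ' ω inp _) = _
          rw [p3, interleave_cell]; rfl
  | st a v b =>
    obtain ⟨τ', tm', p1, p2, p3, p4⟩ := path_addr (tm := tm) (inp := inp) (ω := ω) (o := 0) (hc 0) (hc 1) (hc 2) (hc 3) (by decide) hs hτ ho hB
    have hi := a.idx.2
    simp only [Op.ok] at ho
    have t2 := update_le p2 (d := 1) (hv b)
    refine ⟨4 + (1 + 1), _, ω, _, by omega, .trans p1 (.trans (path_opd (hc 4) hs p2)
      (path_one hs t2 ?_ ?_ ?_)), t2⟩ <;>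
    · have hpc : (flat code x0).code (x, 5) = .store (.inr 0) (.inr 1) (y, 0) := hc 5
      generalize Option.map (· + 1) tm' = tm2
      change (flat code x0).code (conf code x0 (x, 5) s (Function.update τ' 1 (b.val s)) ω inp tm2).pc = _ at hpc
      simp only [Program.step, Program.Config.wordCell, Program.Config.weightCell, hpc]
      first
        | rintro _ ⟨⟩; done
        | rintro _ ⟨⟩; change τ' 0 < _; rw [p3]; omega
        | rw [← conf_goto]
          congr 2
          unfold conf
          congr 1
          change Function.update (interleave s.arr) (τ' 0) (b.val s) = _
          rw [p3, interleave_update]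
          rfl
  | wset d v =>
    refine ⟨1, τ, ω, _, by omega, path_one hs hτ ?_ ?_ ?_ , hτ⟩ <;>
    · have hpc := hc 0
      change (flat code x0).code (conf code x0 (x, 0) s τ ω inp tm).pc = _ at hpc
      simp only [Program.step, Program.Config.wordCell, Program.Config.weightCell, hpc, micro]
      first
        | rintro _ ⟨⟩; done
        | rw [conf_setWReg_inl, conf_goto]; rfl
  | wadd d u v =>
    refine ⟨1, τ, ω, _, by omega, path_one hs hτ ?_ ?_ ?_ , hτ⟩ <;>
    · have hpc := hc 0
      change (flat code x0).code (conf code x0 (x, 0) s τ ω inp tm).pc = _ at hpc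
      simp only [Program.step, Program.Config.wordCell, Program.Config.weightCell, hpc, micro]
      first
        | rintro _ ⟨⟩; done
        | rw [conf_setWReg_inl, conf_goto]; rfl
  | wld d a v =>
    obtain ⟨τ', tm', p1, p2, p3, p4⟩ := path_addr (tm := tm) (inp := inp) (ω := ω) (o := 0) (hc 0) (hc 1) (hc 2) (hc 3) (by decide) hs hτ ho hB
    have hi := a.idx.2
    simp only [Op.ok] at ho
    refine ⟨4 + 1, τ', ω, _, by omega, .trans p1 (path_one hs p2 ?_ ?_ ?_), p2⟩ <;>
    · have hpc : (flat code x0).code (x, 4) = .wload (.inl d) (.inr 0) (y, 0) := hc 4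
      change (flat code x0).code (conf code x0 (x, 0 + 4) s τ' ω inp tm').pc = _ at hpc
      simp only [Program.step, Program.Config.wordCell, Program.Config.weightCell, hpc]
      first
        | rintro _ ⟨⟩; done
        | rintro _ ⟨⟩; change τ' 0 < _; rw [p3]; omega
        | rw [conf_setWReg_inl, conf_goto]
          change PMF.pure (conf code x0 (y, 0) (s.setW d (interleave s.warr (τ' 0))) τ' ω inp _) = _
          rw [p3, interleave_cell]; rfl
  | wst a v w =>
    obtain ⟨τ', tm', p1, p2, p3, p4⟩ := path_addr (tm := tm) (inp := inp) (ω := ω) (o := 0) (hc 0) (hc 1) (hc 2) (hc 3) (by decide) hs hτ ho hB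
    have hi := a.idx.2
    simp only [Op.ok] at ho
    refine ⟨4 + 1, τ', ω, _, by omega, .trans p1 (path_one hs p2 ?_ ?_ ?_), p2⟩ <;>
    · have hpc : (flat code x0).code (x, 4) = .wstore (.inr 0) (.inl w) (y, 0) := hc 4
      change (flat code x0).code (conf code x0 (x, 0 + 4) s τ' ω inp tm').pc = _ at hpc
      simp only [Program.step, Program.Config.wordCell, Program.Config.weightCell, hpc]
      first
        | rintro _ ⟨⟩; done
        | rintro _ ⟨⟩; change τ' 0 < _; rw [p3]; omega
        | rw [← conf_goto]
          congr 2
          unfold conf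
          congr 1
          change Function.update (interleave s.warr) (τ' 0) (s.wreg w) = _
          rw [p3, interleave_update]
          rfl
  | emit u v =>
    refine ⟨1, τ, ω, _, by omega, path_one hs hτ ?_ ?_ ?_ , hτ⟩ <;>
    · have hpc := hc 0
      change (flat code x0).code (conf code x0 (x, 0) s τ ω inp tm).pc = _ at hpc
      simp only [Program.step, Program.Config.wordCell, Program.Config.weightCell, hpc, micro]
      first
        | rintro _ ⟨⟩; done
        | rfl

end Sim
end Compile

/-! ### Simulation of tests and of runs -/

section

variable {X : Type} [Fintype X] {code : X → MI X} {x0 : X}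
variable {B M : ℕ} {s : St} {τ : Fin 3 → ℕ} {ω : Bool → ℝ} {inp : List (ℕ × ℕ × ℝ)} {tm : Option ℕ}
  {l yes no : X × Fin 16}

theorem path_branch {u v : V ⊕ Fin 3} (h : (flat code x0).code l = .branchLT u v yes no)
    (hs : Bdd B s) (hτ : ∀ i, τ i ≤ B) : LPath B M 1 (conf code x0 l s τ ω inp tm)
      (conf code x0 (if Sum.elim s.reg τ u < Sum.elim s.reg τ v then yes else no) s τ ω inp
        (tm.map (· + 1))) := by
  classical
  have hpc : (flat code x0).code (conf code x0 l s τ ω inp tm).pc = .branchLT u v yes no := h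
  refine path_one hs hτ (by simp [Program.Config.wordCell, hpc])
    (by simp [Program.Config.weightCell, hpc]) ?_
  simp only [Program.step, hpc]
  change PMF.pure (conf code x0 (@ite _ (Sum.elim s.reg τ u < Sum.elim s.reg τ v) _ yes no) s τ ω inp
    (tm.map (· + 1))) = _
  congr

theorem path_wbranch {u v : W ⊕ Bool} (h : (flat code x0).code l = .wbranchLT u v yes no)
    (hs : Bdd B s) (hτ : ∀ i, τ i ≤ B) [Decidable (Sum.elim s.wreg ω u < Sum.elim s.wreg ω v)] :
    LPath B M 1 (conf code x0 l s τ ω inp tm)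
      (conf code x0 (if Sum.elim s.wreg ω u < Sum.elim s.wreg ω v then yes else no) s τ ω inp
        (tm.map (· + 1))) := by
  have hpc : (flat code x0).code (conf code x0 l s τ ω inp tm).pc = .wbranchLT u v yes no := h
  refine path_one hs hτ (by simp [Program.Config.wordCell, hpc])
    (by simp [Program.Config.weightCell, hpc]) ?_
  simp only [Program.step, hpc]
  refine congrArg PMF.pure ?_
  unfold Program.Config.goto conf
  congr 1
  exact ite_congr rfl (fun _ => rfl) (fun _ => rfl)

theorem path_load {d : Fin 3} {u : Fin 3} {a : Ar} {i : ℕ}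
    (h : (flat code x0).code l = .load (.inr d) (.inr u) yes)
    (hs : Bdd B s) (hτ : ∀ i, τ i ≤ B) (hu : τ u = i * 17 + a.idx) (hi : i < M) :
    LPath B (17 * M) 1 (conf code x0 l s τ ω inp tm)
      (conf code x0 yes s (Function.update τ d (s.arr a i)) ω inp (tm.map (· + 1))) := by
  have hpc : (flat code x0).code (conf code x0 l s τ ω inp tm).pc = .load (.inr d) (.inr u) yes := h
  have := a.idx.2
  refine path_one hs hτ ?_ (by simp [Program.Config.weightCell, hpc]) ?_
  · simp only [Program.Config.wordCell, hpc]
    rintro _ ⟨⟩; change τ u < _; omega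
  simp only [Program.step, hpc]
  rw [conf_setReg_inr, conf_goto]
  change PMF.pure (conf code x0 yes s (Function.update τ d (interleave s.arr (τ u))) ω inp _) = _
  rw [hu, interleave_cell]

theorem path_wload {d : Bool} {u : Fin 3} {a : Ar} {i : ℕ}
    (h : (flat code x0).code l = .wload (.inr d) (.inr u) yes)
    (hs : Bdd B s) (hτ : ∀ i, τ i ≤ B) (hu : τ u = i * 17 + a.idx) (hi : i < M) :
    LPath B (17 * M) 1 (conf code x0 l s τ ω inp tm)
      (conf code x0 yes s τ (Function.update ω d (s.warr a i)) inp (tm.map (· + 1))) := by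
  have hpc : (flat code x0).code (conf code x0 l s τ ω inp tm).pc = .wload (.inr d) (.inr u) yes := h
  have := a.idx.2
  refine path_one hs hτ (by simp [Program.Config.wordCell, hpc]) ?_ ?_
  · simp only [Program.Config.weightCell, hpc]
    rintro _ ⟨⟩; change τ u < _; omega
  simp only [Program.step, hpc]
  rw [conf_setWReg_inr, conf_goto]
  change PMF.pure (conf code x0 yes s τ (Function.update ω d (interleave s.warr (τ u))) inp _) = _
  rw [hu, interleave_cell]

open Classical in
theorem sim_key {x y n : X} {u v : V} (hc : ∀ i, (flat code x0).code (x, i) = keyI x u v y n i)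
    (hu : s.reg u < M) (hv : s.reg v < M) (hs : Bdd B s)
    (hτ : ∀ i, τ i ≤ B) (hB : 17 * M ≤ B) :
    ∃ m τ' ω' tm', m ≤ 15 ∧ LPath B (17 * M) m (conf code x0 (x, 0) s τ ω inp tm)
      (conf code x0 (if s.key (s.reg u) < s.key (s.reg v) then y else n, 0) s τ' ω' inp tm') ∧
      (∀ i, τ' i ≤ B) := by
  obtain ⟨τ1, tm1, p1, p2, p3, -⟩ := path_addr (tm := tm) (inp := inp) (ω := ω) (o := 0) (hc 0) (hc 1)
    (hc 2) (hc 3) (by decide) hs hτ hu hB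
  obtain ⟨τ2, tm2, q1, q2, q3, q4⟩ := path_addr (tm := tm1) (inp := inp) (ω := ω) (o := 4) (hc 4)
    (hc 5) (hc 6) (hc 7) (by decide) hs p2 hv hB
  have q5 : τ2 0 = s.reg u * 17 + Ar.E.idx := (q4 0 (by decide) (by decide)).trans p3
  have w1 := path_wload (tm := tm2) (inp := inp) (ω := ω) (hc 8) hs q2 q5 hu
  set ω1 := Function.update ω false (s.warr .E (s.reg u)) with hω1
  have w2 := path_wload (tm := tm2.map (· + 1)) (inp := inp) (ω := ω1) (hc 9) hs q2 q3 hv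
  set ω2 := Function.update ω1 true (s.warr .E (s.reg v)) with hω2
  have r1 : ω2 false = s.warr .E (s.reg u) := by simp [hω2, hω1]
  have r2 : ω2 true = s.warr .E (s.reg v) := by simp [hω2]
  have hp := ((p1.trans q1).trans w1).trans w2
  clear_value ω2
  generalize Option.map (· + 1) (tm2.map (· + 1)) = tm4 at hp w2
  have w3 := path_wbranch (M := 17 * M) (ω := ω2) (inp := inp) (tm := tm4) (hc 10) hs q2
  simp only [Sum.elim_inr, r1, r2] at w3
  by_cases h1 : s.warr .E (s.reg u) < s.warr .E (s.reg v)
  · have : s.key (s.reg u) < s.key (s.reg v) := by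
      rw [St.key, St.key, Prod.Lex.toLex_lt_toLex]; exact .inl h1
    rw [if_pos h1] at w3
    rw [if_pos this]
    exact ⟨_, τ2, ω2, _, by norm_num, hp.trans w3, q2⟩
  rw [if_neg h1] at w3
  have hp := hp.trans w3
  generalize Option.map (· + 1) tm4 = tm5 at hp
  have w4 := path_wbranch (M := 17 * M) (ω := ω2) (inp := inp) (tm := tm5) (hc 11) hs q2
  simp only [Sum.elim_inr, r1, r2] at w4
  by_cases h2 : s.warr .E (s.reg v) < s.warr .E (s.reg u)
  · have : ¬ s.key (s.reg u) < s.key (s.reg v) := by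
      rw [St.key, St.key, Prod.Lex.toLex_lt_toLex]
      rintro (h | h)
      · exact h1 h
      · exact absurd h.1 h2.ne'
    rw [if_pos h2] at w4
    rw [if_neg this]
    exact ⟨_, τ2, ω2, _, by norm_num, hp.trans w4, q2⟩
  rw [if_neg h2] at w4
  have hp := hp.trans w4
  generalize Option.map (· + 1) tm5 = tm6 at hp
  have heq : s.warr .E (s.reg u) = s.warr .E (s.reg v) := le_antisymm (not_lt.1 h2) (not_lt.1 h1)
  have w5 := path_load (tm := tm6) (inp := inp) (ω := ω2) (hc 12) hs q2 q5 hu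
  set τ3 := Function.update τ2 0 (s.arr .E (s.reg u)) with hτ3
  have q6 : ∀ i, τ3 i ≤ B := update_le q2 (hs.arr _ _)
  have q7 : τ3 1 = s.reg v * 17 + Ar.E.idx := by simpa [hτ3] using q3
  have w6 := path_load (tm := tm6.map (· + 1)) (inp := inp) (ω := ω2) (hc 13) hs q6 q7 hv
  set τ4 := Function.update τ3 1 (s.arr .E (s.reg v)) with hτ4
  have q8 : ∀ i, τ4 i ≤ B := update_le q6 (hs.arr _ _)
  have r3 : τ4 0 = s.arr .E (s.reg u) := by simp [hτ4, hτ3]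
  have r4 : τ4 1 = s.arr .E (s.reg v) := by simp [hτ4]
  have hp := (hp.trans w5).trans w6
  clear_value τ4
  generalize Option.map (· + 1) (tm6.map (· + 1)) = tm7 at hp
  have w7 := path_branch (M := 17 * M) (ω := ω2) (inp := inp) (tm := tm7) (hc 14) hs q8
  simp only [Sum.elim_inr, r3, r4] at w7
  have hk : s.key (s.reg u) < s.key (s.reg v) ↔ s.arr .E (s.reg u) < s.arr .E (s.reg v) := by
    rw [St.key, St.key, Prod.Lex.toLex_lt_toLex, heq]
    simp
  have hif : ((if s.key (s.reg u) < s.key (s.reg v) then y else n), (0 : Fin 16)) =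
      if s.arr .E (s.reg u) < s.arr .E (s.reg v) then (y, 0) else (n, 0) := by
    by_cases h : s.arr .E (s.reg u) < s.arr .E (s.reg v)
    · rw [if_pos (hk.2 h), if_pos h]
    · rw [if_neg (fun h' => h (hk.1 h')), if_neg h]
  rw [hif]
  exact ⟨_, τ4, ω2, _, by norm_num, hp.trans w7, q8⟩

open Classical in
theorem sim_test {x y n : X} {b : Test} (hx : code x = .test b y n) (hb : b.ok M s) (hs : Bdd B s)
    (hτ : ∀ i, τ i ≤ B) (hB : 17 * M ≤ B) (hB' : 20 ≤ B) :
    ∃ m τ' ω' tm', m ≤ 15 ∧ LPath B (17 * M) m (conf code x0 (x, 0) s τ ω inp tm)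
      (conf code x0 (if b.holds s then y else n, 0) s τ' ω' inp tm') ∧ (∀ i, τ' i ≤ B) := by
  have hc : ∀ i, (flat code x0).code (x, i) = micro x (.test b y n) i := by
    intro i
    change micro x (code x) i = _
    rw [hx]
  have hv := hs.opd hB'
  cases b with
  | lt u v =>
    have t1 := update_le hτ (d := 0) (hv u)
    have t2 := update_le t1 (d := 1) (hv v)
    have w := path_branch (M := 17 * M) (ω := ω) (inp := inp) (tm := (tm.map (· + 1)).map (· + 1))
      (hc 2) hs t2
    have hif : ∀ p : Prop, ((if p then y else n), (0 : Fin 16)) = if p then (y, 0) else (n, 0) :=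
      fun p => by split_ifs <;> rfl
    rw [hif]
    have hp : LPath B (17 * M) (1 + (1 + 1)) (conf code x0 (x, 0) s τ ω inp tm) _ :=
      .trans (path_opd (hc 0) hs hτ) (.trans (path_opd (hc 1) hs t1) w)
    refine ⟨1 + (1 + 1), _, ω, ((tm.map (· + 1)).map (· + 1)).map (· + 1), by norm_num, ?_, t2⟩
    · convert hp using 2
      by_cases h : u.val s < v.val s <;> simp [h]
  | eq u v =>
    have t1 := update_le hτ (d := 0) (hv u)
    have t2 := update_le t1 (d := 1) (hv v)
    have w := path_branch (M := 17 * M) (ω := ω) (inp := inp) (tm := (tm.map (· + 1)).map (· + 1))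
      (hc 2) hs t2
    have hp : LPath B (17 * M) (1 + (1 + 1)) (conf code x0 (x, 0) s τ ω inp tm) _ :=
      .trans (path_opd (hc 0) hs hτ) (.trans (path_opd (hc 1) hs t1) w)
    have e0 : Function.update (Function.update τ 0 (u.val s)) 1 (v.val s) 0 = u.val s := by simp
    have e1 : Function.update (Function.update τ 0 (u.val s)) 1 (v.val s) 1 = v.val s := by simp
    simp only [Sum.elim_inr, e0, e1] at hp
    generalize Function.update (Function.update τ 0 (u.val s)) 1 (v.val s) = τ' at *
    by_cases h1 : u.val s < v.val s
    · rw [if_pos h1] at hp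
      rw [if_neg (by simp; omega)]
      exact ⟨_, τ', ω, _, by norm_num, hp, t2⟩
    rw [if_neg h1] at hp
    generalize Option.map (· + 1) ((tm.map (· + 1)).map (· + 1)) = tm3 at hp
    have w := path_branch (M := 17 * M) (ω := ω) (inp := inp) (tm := tm3) (hc 3) hs t2
    simp only [Sum.elim_inr, e0, e1] at w
    have hp := hp.trans w
    by_cases h2 : v.val s < u.val s
    · rw [if_pos h2] at hp
      rw [if_neg (by simp; omega)]
      exact ⟨_, τ', ω, _, by norm_num, hp, t2⟩
    · rw [if_neg h2] at hp
      rw [if_pos (by simp; omega)]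
      exact ⟨_, τ', ω, _, by norm_num, hp, t2⟩
  | wlt u v =>
    have w := path_wbranch (M := 17 * M) (ω := ω) (inp := inp) (tm := tm) (hc 0) hs hτ
    have hif : ∀ p : Prop, ((if p then y else n), (0 : Fin 16)) = if p then (y, 0) else (n, 0) :=
      fun p => by split_ifs <;> rfl
    rw [hif]
    exact ⟨1, _, ω, _, by omega, w, hτ⟩
  | key u v =>
    obtain ⟨m, τ', ω', tm', h1, h2, h3⟩ := sim_key (tm := tm) (inp := inp) (ω := ω) hc hb.1 hb.2 hs hτ hB
    refine ⟨m, τ', ω', tm', h1, ?_, h3⟩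
    convert h2 using 3
    by_cases h : s.key (s.reg u) < s.key (s.reg v)
    · rw [if_pos h, if_pos (by simpa using h)]
    · rw [if_neg h, if_neg (by simpa using h)]
  | kle u v =>
    obtain ⟨m, τ', ω', tm', h1, h2, h3⟩ := sim_key (tm := tm) (inp := inp) (ω := ω) hc hb.2 hb.1 hs hτ hB
    refine ⟨m, τ', ω', tm', h1, ?_, h3⟩
    convert h2 using 3
    by_cases h : s.key (s.reg v) < s.key (s.reg u)
    · rw [if_pos h, if_neg (by simpa using h)]
    · rw [if_neg h, if_pos (by simpa using h)]

/-- The temporary registers are arbitrary between two instructions of the graph, which is why their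
contents are quantified existentially afterwards and only bounded by `B`. -/
theorem Steps.sim {n : ℕ} {x y : X} {s' : St} (h : Steps B M code n x s y s') (hs : Bdd B s)
    (hτ : ∀ i, τ i ≤ B) (hB : 17 * M ≤ B) (hB' : 20 ≤ B) :
    ∃ m τ' ω' tm', m ≤ 15 * n ∧ LPath B (17 * M) m (conf code x0 (x, 0) s τ ω inp tm)
      (conf code x0 (y, 0) s' τ' ω' inp tm') ∧ (∀ i, τ' i ≤ B) ∧ Bdd B s' := by
  induction h generalizing τ ω tm with
  | refl => exact ⟨0, τ, ω, tm, le_rfl, .refl _, hτ, hs⟩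
  | op h1 h2 _ ih =>
    obtain ⟨m, τ1, ω1, tm1, a1, a2, a3⟩ := sim_op (x0 := x0) (tm := tm) (inp := inp) (ω := ω) h1 h2 hs hτ hB hB'
    obtain ⟨m', τ2, ω2, tm2, b1, b2, b3⟩ := ih (tm := tm1) (ω := ω1) (hs.eff hB' h2) a3
    exact ⟨m + m', τ2, ω2, tm2, by omega, a2.trans b2, b3⟩
  | yes h1 h2 h3 _ ih =>
    obtain ⟨m, τ1, ω1, tm1, a1, a2, a3⟩ := sim_test (x0 := x0) (tm := tm) (inp := inp) (ω := ω) h1 h2 hs hτ hB hB'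
    rw [if_pos h3] at a2
    obtain ⟨m', τ2, ω2, tm2, b1, b2, b3⟩ := ih (tm := tm1) (ω := ω1) hs a3
    exact ⟨m + m', τ2, ω2, tm2, by omega, a2.trans b2, b3⟩
  | no h1 h2 h3 _ ih =>
    obtain ⟨m, τ1, ω1, tm1, a1, a2, a3⟩ := sim_test (x0 := x0) (tm := tm) (inp := inp) (ω := ω) h1 h2 hs hτ hB hB'
    rw [if_neg h3] at a2
    obtain ⟨m', τ2, ω2, tm2, b1, b2, b3⟩ := ih (tm := tm1) (ω := ω1) hs a3
    exact ⟨m + m', τ2, ω2, tm2, by omega, a2.trans b2, b3⟩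

end

/-! ### The distribution of the answer -/

section Law

variable {P : Program} {B M TT : ℕ}

/-- `n` deterministic steps that respect the bounds. -/
inductive GPath (B M TT : ℕ) : ℕ → P.Config → P.Config → Prop
  | refl (c) : GPath B M TT 0 c c
  | head {n c c' c''} : Good B M c → (∀ a ∈ c.timer, a ≤ TT) → Program.step c = PMF.pure c' →
      GPath B M TT n c' c'' → GPath B M TT (n + 1) c c''

theorem GPath.trans {n m : ℕ} {a b c : P.Config} (h : GPath B M TT n a b)
    (h' : GPath B M TT m b c) : GPath B M TT (n + m) a c := by
  induction h with
  | refl => simpa using h'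
  | head h1 h2 h3 _ ih => rw [Nat.add_right_comm]; exact .head h1 h2 h3 (ih h')

theorem LPath.toGPath {n : ℕ} {c c' : P.Config} (h : LPath B M n c c')
    (ht : ∀ a ∈ c.timer, a + n ≤ TT) :
    GPath B M TT n c c' ∧ c'.timer = c.timer.map (· + n) := by
  induction h with
  | refl c => exact ⟨.refl _, by simp⟩
  | @head n c c' c'' h1 h2 h3 _ ih =>
    obtain ⟨h4, h5⟩ := ih (by
      intro a ha
      rw [h3, Option.mem_map] at ha
      obtain ⟨b, hb, rfl⟩ := ha
      have := ht b hb
      omega)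
    refine ⟨.head h1 (fun a ha => by have := ht a ha; omega) h2 h4, ?_⟩
    rw [h5, h3, Option.map_map]
    congr 1
    funext a
    simp
    omega

/-- The distribution of the configuration `T` steps after `c`. -/
noncomputable def after : ℕ → P.Config → PMF P.Config
  | 0, c => PMF.pure c
  | T + 1, c => (Program.step c).bind (after T)

/-- The run of a program appends new steps at the end, whereas `after` unfolds from the front. The
latter form lets deterministic prefixes be peeled off. -/
theorem after_succ (T : ℕ) (c : P.Config) : after (T + 1) c = (after T c).bind Program.step := by
  induction T generalizing c with
  | zero => simp [after, PMF.pure_bind]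
  | succ T ih =>
    rw [after, after, PMF.bind_bind]
    congr 1
    funext c'
    exact ih c'

theorem run_eq_after {n k : ℕ} {S : List (Insertion n)} (T : ℕ) :
    P.run k S T = after T (P.init k S) := by
  induction T with
  | zero => rfl
  | succ T ih => rw [after_succ, ← ih]; rfl

theorem GPath.after_add {n : ℕ} {c c' : P.Config} (h : GPath B M TT n c c') (T : ℕ) :
    after (n + T) c = after T c' := by
  induction h with
  | refl => rw [Nat.zero_add]
  | head _ _ h3 _ ih => rw [Nat.add_right_comm, after, h3, PMF.pure_bind, ih]

theorem GPath.good {n : ℕ} {c c' : P.Config} (h : GPath B M TT n c c') {T : ℕ} (hT : T < n)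
    {d : P.Config} (hd : d ∈ (after T c).support) : Good B M d ∧ ∀ a ∈ d.timer, a ≤ TT := by
  induction h generalizing T with
  | refl => omega
  | head h1 h2 h3 _ ih =>
    cases T with
    | zero =>
      rw [after, PMF.support_pure, Set.mem_singleton_iff] at hd
      subst hd
      exact ⟨h1, h2⟩
    | succ T =>
      rw [after, h3, PMF.pure_bind] at hd
      exact ih (by omega) hd

theorem after_fixed {c : P.Config} (h : Program.step c = PMF.pure c) (T : ℕ) :
    after T c = PMF.pure c := by
  induction T with
  | zero => rfl
  | succ T ih => rw [after, h, PMF.pure_bind, ih]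

theorem mem_support_uniformBelow {R z : ℕ} (hR : 0 < R) :
    z ∈ (Program.uniformBelow R).support ↔ z < R := by
  obtain ⟨R, rfl⟩ : ∃ m, R = m + 1 := ⟨R - 1, by omega⟩
  simp only [Program.uniformBelow, PMF.support_map, PMF.support_uniformOfFintype, Set.mem_image,
    Set.top_eq_univ, Set.mem_univ, true_and]
  constructor
  · rintro ⟨i, rfl⟩; exact i.2
  · intro h; exact ⟨⟨z, h⟩, rfl⟩

/-- The law of a program that draws only one random word and is deterministic otherwise. -/
theorem law_of_paths {n k : ℕ} {S : List (Insertion n)} {m0 R : ℕ} {c0 : P.Config}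
    {g : ℕ → P.Config} {ans : ℕ → Answer ℕ}
    (h0 : GPath B M TT m0 (P.init k S) c0) (hg0 : Good B M c0) (ht0 : ∀ a ∈ c0.timer, a ≤ TT)
    (hstep : Program.step c0 = (Program.uniformBelow R).map g) (hR : 0 < R)
    (hz : ∀ z < R, ∃ m cz, GPath B M TT m (g z) cz ∧ Good B M cz ∧ (∀ a ∈ cz.timer, a ≤ TT) ∧
      Program.step cz = PMF.pure cz ∧ cz.answer = some (ans z)) :
    (∀ c, P.Reachable k S c → Good B M c ∧ ∀ a ∈ c.timer, a ≤ TT) ∧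
    ∃ T, (P.run k S T).map Program.Config.answer =
      (Program.uniformBelow R).map fun z => some (ans z) := by
  have hafter : ∀ T, after (m0 + (T + 1)) (P.init k S) =
      (Program.uniformBelow R).bind fun z => after T (g z) := by
    intro T
    rw [h0.after_add, after, hstep, PMF.bind_map]
    rfl
  choose! m cz hz using hz
  constructor
  · rintro c ⟨T, hc⟩
    rw [run_eq_after] at hc
    rcases lt_trichotomy T m0 with hT | hT | hT
    · exact h0.good hT hc
    · have h1 : after T (P.init k S) = PMF.pure c0 := by
        rw [hT]; exact h0.after_add 0
      rw [h1, PMF.support_pure, Set.mem_singleton_iff] at hc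
      subst hc
      exact ⟨hg0, ht0⟩
    · obtain ⟨T', rfl⟩ : ∃ T', T = m0 + (T' + 1) := ⟨T - m0 - 1, by omega⟩
      rw [hafter, PMF.mem_support_bind_iff] at hc
      obtain ⟨z, hz1, hz2⟩ := hc
      rw [mem_support_uniformBelow hR] at hz1
      obtain ⟨h1, h2, h3, h4, -⟩ := hz z hz1
      rcases Nat.lt_or_ge T' (m z) with hlt | hge
      · exact h1.good hlt hz2
      · rw [show T' = m z + (T' - m z) by omega, h1.after_add, after_fixed h4, PMF.support_pure,
          Set.mem_singleton_iff] at hz2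
        subst hz2
        exact ⟨h2, h3⟩
  -- Halted configurations do not move, so waiting for the slowest of the finitely many outcomes
  -- gives one time that works for all of them.
  · set N := (Finset.range R).sup m with hN
    refine ⟨m0 + (N + 1), ?_⟩
    rw [run_eq_after, hafter, PMF.map_bind, ← PMF.bind_pure_comp]
    ext b
    simp only [PMF.bind_apply]
    refine tsum_congr fun z => ?_
    by_cases hzR : z < R
    · obtain ⟨h1, -, -, h4, h5⟩ := hz z hzR
      have : m z ≤ N := Finset.le_sup (f := m) (Finset.mem_range.2 hzR)
      rw [show N = m z + (N - m z) by omega, h1.after_add, after_fixed h4, PMF.pure_map, h5]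
      rfl
    · have : (Program.uniformBelow R) z = 0 := by
        rw [← mem_support_uniformBelow hR] at hzR
        simpa [PMF.mem_support_iff] using hzR
      rw [this, zero_mul, zero_mul]

end Law

/-! ### Deterministic runs with input and timer -/

section MPath

variable {X : Type} {code : X → MI X} {B M TT : ℕ}

/-- Deterministic runs of a control flow graph, with the input and the timer. -/
inductive MPath (code : X → MI X) (B M TT : ℕ) : X → St → List (ℕ × ℕ × ℝ) → Option ℕ →
    X → St → List (ℕ × ℕ × ℝ) → Option ℕ → Prop
  | steps {n x s y s' i tm} : Steps B M code n x s y s' → (∀ a ∈ tm, a + n ≤ TT) →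
      MPath code B M TT x s i tm y s' i (tm.map (· + n))
  | readNil {x s tm y e} : code x = .read y e → (∀ a ∈ tm, a ≤ TT) →
      MPath code B M TT x s [] tm e s [] none
  | readCons {x s tm y e a b w i} : code x = .read y e → (∀ a ∈ tm, a ≤ TT) →
      MPath code B M TT x s ((a, b, w) :: i) tm y (((s.setR .ru a).setR .rv b).setW .rw w) i (some 0)
  | trans {x s i tm y s' i' tm' z s'' i'' tm''} : MPath code B M TT x s i tm y s' i' tm' →
      MPath code B M TT y s' i' tm' z s'' i'' tm'' → MPath code B M TT x s i tm z s'' i'' tm''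

theorem MPath.steps_none {n : ℕ} {x y : X} {s s' : St} {i : List (ℕ × ℕ × ℝ)}
    (h : Steps B M code n x s y s') : MPath code B M TT x s i none y s' i none :=
  .steps h (by simp)

variable [Fintype X] {x0 : X}

/-- The timer of the machine stays within 15 times the timer of the graph, and reading resets both.
The relation `htl` also forces the machine's timer to be off whenever the other one is. -/
theorem MPath.sim {x y : X} {s s' : St} {i i' : List (ℕ × ℕ × ℝ)} {tm tm' : Option ℕ}
    (h : MPath code B M TT x s i tm y s' i' tm') (hs : Bdd B s) {τ : Fin 3 → ℕ} {ω : Bool → ℝ}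
    {tl : Option ℕ} (hτ : ∀ i, τ i ≤ B) (hB : 17 * M ≤ B) (hB' : 20 ≤ B)
    (hi : ∀ x ∈ i, x.1 ≤ B ∧ x.2.1 ≤ B) (htl : ∀ a ∈ tl, ∃ b ∈ tm, a ≤ 15 * b) :
    ∃ m τ' ω' tl', GPath B (17 * M) (15 * TT) m (conf code x0 (x, 0) s τ ω i tl)
      (conf code x0 (y, 0) s' τ' ω' i' tl') ∧ (∀ i, τ' i ≤ B) ∧ Bdd B s' ∧
      (∀ x ∈ i', x.1 ≤ B ∧ x.2.1 ≤ B) ∧ ∀ a ∈ tl', ∃ b ∈ tm', a ≤ 15 * b := by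
  induction h generalizing τ ω tl with
  | @steps n x s y s' i tm h1 h2 =>
    obtain ⟨m, τ', ω', tl', h3, h4, h5, h6⟩ := h1.sim (x0 := x0) (inp := i) (ω := ω) (tm := tl) hs hτ hB hB'
    obtain ⟨h7, h8⟩ := h4.toGPath (TT := 15 * TT) (by
      intro a ha
      obtain ⟨b, hb, hab⟩ := htl a ha
      have := h2 b hb
      omega)
    refine ⟨m, τ', ω', tl', h7, h5, h6, hi, ?_⟩
    intro a ha
    have h8 : tl' = tl.map (· + m) := h8
    rw [h8, Option.mem_map] at ha
    obtain ⟨c, hc, rfl⟩ := ha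
    obtain ⟨b, hb, hab⟩ := htl c hc
    exact ⟨b + n, Option.mem_map_of_mem _ hb, by omega⟩
  | @readNil x s tm y e h1 h2 =>
    have hpc : (flat code x0).code (conf code x0 (x, 0) s τ ω [] tl).pc =
        .read (.inl .ru) (.inl .rv) (.inl .rw) (y, 0) (e, 0) := by
      change micro x (code x) _ = _
      rw [h1]; rfl
    refine ⟨1, τ, ω, none, .head (good_conf hs hτ ?_ ?_) ?_ ?_ (.refl _), hτ, hs, hi, by simp⟩
    · simp [Program.Config.wordCell, hpc]
    · simp [Program.Config.weightCell, hpc]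
    · intro a ha
      obtain ⟨b, hb, hab⟩ := htl a ha
      have := h2 b hb
      omega
    · simp only [Program.step, hpc]
      rfl
  | @readCons x s tm y e a b w i h1 h2 =>
    have hpc : (flat code x0).code (conf code x0 (x, 0) s τ ω ((a, b, w) :: i) tl).pc =
        .read (.inl .ru) (.inl .rv) (.inl .rw) (y, 0) (e, 0) := by
      change micro x (code x) _ = _
      rw [h1]; rfl
    simp only [List.mem_cons, forall_eq_or_imp] at hi
    refine ⟨1, τ, ω, some 0, .head (good_conf hs hτ ?_ ?_) ?_ ?_ (.refl _), hτ, ?_, hi.2, ?_⟩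
    · simp [Program.Config.wordCell, hpc]
    · simp [Program.Config.weightCell, hpc]
    · intro a ha
      obtain ⟨b, hb, hab⟩ := htl a ha
      have := h2 b hb
      omega
    · simp only [Program.step, hpc]
      unfold Program.Config.readStream
      congr 1
      change Program.Config.mk _ _ _ _ _ _ _ _ = _
      rw [conf_setReg_inl, conf_setReg_inl, conf_setWReg_inl]
      rfl
    · exact ⟨((hs.setR hi.1.1).setR hi.1.2).reg, hs.arr⟩
    · rintro _ ⟨⟩
      exact ⟨0, rfl, by simp⟩
  | trans _ _ ih1 ih2 =>
    obtain ⟨m, τ1, ω1, tl1, a1, a2, a3, a4, a5⟩ := ih1 (ω := ω) hs hτ hi htl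
    obtain ⟨m', τ2, ω2, tl2, b1, b2, b3, b4, b5⟩ := ih2 (ω := ω1) a3 a2 a4 a5
    exact ⟨m + m', τ2, ω2, tl2, a1.trans b1, b2, b3, b4, b5⟩

/-- The initial data. -/
def St.start (n k : ℕ) : St where
  reg v := if v = .n then n else if v = .k then k else 0
  wreg _ := 0
  arr _ _ := 0
  warr _ _ := 0
  out := ∅

theorem init_flat {n : ℕ} (k : ℕ) (S : List (Insertion n)) : (flat code x0).init k S =
    conf code x0 (x0, 0) (St.start n k) (fun _ => 0) (fun _ => 0)
      (S.map fun x => (x.fst.val, x.snd.val, x.weight)) none := by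
  have h1 : Function.update (Function.update (fun _ : V ⊕ Fin 3 => 0) (.inl .n) n) (.inl .k) k =
      Sum.elim (St.start n k).reg (fun _ => 0) := by
    funext v
    rcases v with v | v
    · by_cases hk : v = .k
      · subst hk; simp [St.start]
      · by_cases hn : v = .n
        · subst hn; simp [St.start]
        · simp [St.start, hk, hn]
    · simp
  unfold Program.init conf
  congr 1
  funext v
  cases v <;> rfl

/-- The answer given by a control flow graph. -/
def MI.answer : MI X → Finset (Sym2 ℕ) → Option (Answer ℕ)
  | .halt, o => some (some o)
  | .haltNone, _ => some none
  | _, _ => none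

theorem law_flat {n k R : ℕ} {S : List (Insertion n)} {xr y : X} {s : St} {ans : ℕ → Answer ℕ}
    (hB : 17 * M ≤ B) (hB' : 20 ≤ B) (hn : n ≤ B) (hk : k ≤ B) (hR : 0 < R) (hRB : R ≤ B + 1)
    (hxr : code xr = .random y) (hzr : s.reg .zr = R)
    (h0 : MPath code B M TT x0 (St.start n k) (S.map fun x => (x.fst.val, x.snd.val, x.weight)) none
      xr s (S.map fun x => (x.fst.val, x.snd.val, x.weight)) none)
    (hz : ∀ z < R, ∃ x s', MPath code B M TT y (s.setR .z z)
      (S.map fun x => (x.fst.val, x.snd.val, x.weight)) none x s' [] none ∧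
      (code x).answer s'.out = some (ans z)) :
    (∀ c, (flat code x0).Reachable k S c → Good B (17 * M) c ∧ ∀ a ∈ c.timer, a ≤ 15 * TT) ∧
    ∃ T, ((flat code x0).run k S T).map Program.Config.answer =
      (Program.uniformBelow R).map fun z => some (ans z) := by
  have hbd : Bdd B (St.start n k) := by
    refine ⟨fun v => ?_, fun _ _ => Nat.zero_le _⟩
    unfold St.start
    dsimp only
    split_ifs <;> omega
  have hin : ∀ x ∈ (S.map fun x => (x.fst.val, x.snd.val, x.weight)), x.1 ≤ B ∧ x.2.1 ≤ B := by
    intro x hx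
    rw [List.mem_map] at hx
    obtain ⟨a, -, rfl⟩ := hx
    have := a.fst.2
    have := a.snd.2
    exact ⟨by simp only; omega, by simp only; omega⟩
  obtain ⟨m, τ, ω, tl, a1, a2, a3, a4, a5⟩ := h0.sim (x0 := x0) (τ := fun _ => 0) (ω := fun _ => 0)
    (tl := none) hbd (fun _ => Nat.zero_le _) hB hB' hin (by simp)
  -- Before the first edge the timer of the graph is off, hence so is that of the machine.
  obtain rfl : tl = none := by
    cases tl with
    | none => rfl
    | some a => simpa using a5 a rfl
  rw [← init_flat] at a1
  have hpc : (flat code x0).code (conf code x0 (xr, 0) s τ ω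
      (S.map fun x => (x.fst.val, x.snd.val, x.weight)) none).pc =
      .random (.inl .z) (.inl .zr) (y, 0) := by
    change micro xr (code xr) _ = _
    rw [hxr]; rfl
  refine law_of_paths (g := fun z => conf code x0 (y, 0) (s.setR .z z) τ ω
    (S.map fun x => (x.fst.val, x.snd.val, x.weight)) none) a1 (good_conf a3 a2 ?_ ?_) ?_ ?_ hR ?_
  · simp [Program.Config.wordCell, hpc]
  · simp [Program.Config.weightCell, hpc]
  · intro a ha
    cases ha
  · simp only [Program.step, hpc]
    have : (conf code x0 (xr, 0) s τ ω (S.map fun x => (x.fst.val, x.snd.val, x.weight)) none).reg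
        (.inl .zr) = R := hzr
    rw [this]
    congr 1
    funext a
    rw [conf_setReg_inl, conf_goto]
    rfl
  · intro z hzR
    obtain ⟨x, s', b1, b2⟩ := hz z hzR
    obtain ⟨m', τ', ω', tl', c1, c2, c3, c4, c5⟩ := b1.sim (x0 := x0) (τ := τ) (ω := ω)
      (tl := none) (a3.setR (by omega)) a2 hB hB' hin (by simp)
    obtain rfl : tl' = none := by
      cases tl' with
      | none => rfl
      | some a => simpa using c5 a rfl
    have hcode : (flat code x0).code (conf code x0 (x, 0) s' τ' ω' [] none).pc = micro x (code x) 0 := rfl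
    refine ⟨m', _, c1, good_conf c3 c2 ?_ ?_, (fun a ha => nomatch ha), ?_, ?_⟩
    all_goals
      cases hx : code x <;> rw [hx] at b2 hcode <;> simp only [MI.answer, reduceCtorEq] at b2
      all_goals
        simp only [micro] at hcode
    · simp [Program.Config.wordCell, hcode]
    · simp [Program.Config.wordCell, hcode]
    · simp [Program.Config.weightCell, hcode]
    · simp [Program.Config.weightCell, hcode]
    · simp [Program.step, hcode]
    · simp [Program.step, hcode]
    · simp only [Program.Config.answer, hcode]; exact b2
    · simp only [Program.Config.answer, hcode]; exact b2

end MPath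

open Cmd

/-! ## Search for the best matching -/

section
variable {B M : ℕ} {s : St} {Q : ℕ → St → Prop}

/-- Rule for loops without a bound on the number of steps. -/
theorem wp_while {b : Test} {a : Cmd} (I : ℕ → St → Prop) {m : ℕ} (hI : I m s)
    (hstep : ∀ m s', Fr (.loop b a) s s' → I m s' → b.ok M s' ∧
      (b.holds s' → wp B M a s' fun _ s'' => ∃ m' < m, I m' s''))
    (hQ : ∀ m s' t, Fr (.loop b a) s s' → I m s' → ¬ b.holds s' → Q t s') :
    wp B M (.loop b a) s Q := by
  have key : ∀ m s', Fr (.loop b a) s s' → I m s' → ∃ t m' s'', Ev B M (.loop b a) s' t s'' ∧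
      Fr (.loop b a) s s'' ∧ I m' s'' ∧ ¬ b.holds s'' := by
    intro m
    induction m using Nat.strong_induction_on with
    | _ m ih =>
      intro s' hf hi
      obtain ⟨hok, hw⟩ := hstep m s' hf hi
      by_cases hb : b.holds s'
      · obtain ⟨t, s'', hev, m', hm', hi'⟩ := hw hb
        obtain ⟨t', m3, s3, hev', hf', hi3, hb3⟩ := ih m' hm' s'' (hf.trans hev.frame.loop) hi'
        exact ⟨_, m3, _, .loopT hok hb hev hev', hf', hi3, hb3⟩
      · exact ⟨_, m, _, .loopF hok hb, hf, hi, hb⟩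
  obtain ⟨t, m', s', hev, hf, hi, hb⟩ := key m s (.refl _ _) hI
  exact ⟨t, s', hev, hQ m' s' t hf hi hb⟩

/-- Rule for `for` loops without a bound on the number of steps. -/
theorem wp_for {i : V} {n : Opd} {body : Cmd} (N : ℕ) (J : ℕ → St → Prop)
    (hi : body.wr i = false)
    (hn : ∀ x, n = .r x → x ≠ i ∧ body.wr x = false) (hN : n.val s = N) (hB : N ≤ B)
    (h0 : J 0 (s.setR i 0))
    (hstep : ∀ j s', j < N → s'.reg i = j → Fr (.forLt i n body) s s' → J j s' →
      wp B M body s' fun _ s'' => J (j + 1) (s''.setR i (j + 1)))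
    (hQ : ∀ s' t, J N s' → s'.reg i = N → Fr (.forLt i n body) s s' → Q t s') :
    wp B M (.forLt i n body) s Q := by
  refine wp_seq (wp_op trivial ?_)
  have hfr0 : Fr (.forLt i n body) s (s.setR i 0) := (Op.frame (.set i (.c 0)) s).seq_left
  have hnn : ∀ s', Fr (.forLt i n body) s s' → n.val s' = N := by
    intro s' hf
    cases n with
    | c a => simpa using hN
    | r x =>
      have h1 := hn x rfl
      have h2 := hf.reg x (by simp [Cmd.forLt, Cmd.wr, Op.wr, h1.1, h1.2])
      simpa [h2] using hN
  refine wp_while (fun m s' => m = N - s'.reg i ∧ s'.reg i ≤ N ∧ J (s'.reg i) s') (m := N)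
    ⟨by simp, by simp, by simpa using h0⟩ ?_ ?_
  · rintro _ s' hf ⟨rfl, hle, hJ⟩
    refine ⟨trivial, fun hb => ?_⟩
    have hf' := hfr0.trans (hf.seq_right (a := .op (.set i (.c 0))))
    have hlt : s'.reg i < N := by
      have h : s'.reg i < n.val s' := hb
      rwa [hnn s' hf'] at h
    refine wp_seq (wp_mono (hstep _ s' hlt rfl hf' hJ) ?_)
    rintro t s'' hfb hJ'
    have hi' : s''.reg i = s'.reg i := hfb.reg i hi
    refine wp_op ?_ ?_
    · simp [hi']; omega
    · have e : (Op.ar .add i (.r i) (.c 1)).eff s'' = s''.setR i (s'.reg i + 1) := by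
        simp [Arith.eval, hi']
      rw [e]
      refine ⟨_, ?_, rfl, by simpa using hlt, by simpa using hJ'⟩
      simp only [St.setR_reg, if_true]
      omega
  · rintro _ s' t hf ⟨rfl, hle, hJ⟩ hb
    have hf' := hfr0.trans (hf.seq_right (a := .op (.set i (.c 0))))
    have hge : s'.reg i = N := by
      have h : ¬ s'.reg i < n.val s' := hb
      rw [hnn s' hf'] at h
      omega
    exact hQ s' _ (hge ▸ hJ) hge hf'

end

/-- The edges with the codes `c` and `d` have no common endpoint. -/
def CodeDisj (n c d : ℕ) : Prop := c / n ≠ d / n ∧ c / n ≠ d % n ∧ c % n ≠ d / n ∧ c % n ≠ d % n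

/-- The set of the records of `l` with indices in `A` is a `k`-matching. -/
structure ValidSel (n k : ℕ) (l : List (ℕ × ℝ)) (A : Finset ℕ) : Prop where
  sub : A ⊆ Finset.range l.length
  card : A.card = k
  disj : ∀ i ∈ A, ∀ j ∈ A, j < i → CodeDisj n (l.getD i default).1 (l.getD j default).1

/-- The weight of the records of `l` with indices in `A`. -/
def selWeight (l : List (ℕ × ℝ)) (A : Finset ℕ) : ℝ := ∑ i ∈ A, (l.getD i default).2

/-- The codes of the records of `l` with indices in `A`. -/
def selCodes (l : List (ℕ × ℝ)) (A : Finset ℕ) (j : ℕ) : List ℕ :=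
  ((List.range j).filter (· ∈ A)).map fun i => (l.getD i default).1

/-- The array `sel` represents the set `A`. -/
def IsSel (s : St) (N : ℕ) (A : Finset ℕ) : Prop :=
  A ⊆ Finset.range N ∧ ∀ i < N, s.arr .sel i = if i ∈ A then 1 else 0

/-- Clear the flag `q` if the registers `u` and `v` agree. -/
def flagC (u v : V) : Cmd := .ite (.eq (.r u) (.r v)) (.op (.set .q (.c 0))) .skip

/-- Compare the edge at index `i`, with endpoints `ca` and `cb`, to the selected ones before. -/
def conflictC : Cmd := forLt .e (.r .i) (block [
  .op (.ld .f1 .sel .e),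
  .ite (.eq (.r .f1) (.c 1)) (block [
    .op (.ar .add .x (.r .goff) (.r .e)),
    .op (.ld .c .G .x),
    .op (.ar .div .sj (.r .c) (.r .n)),
    .op (.ar .mod .se (.r .c) (.r .n)),
    flagC .ca .sj,
    flagC .ca .se,
    flagC .cb .sj,
    flagC .cb .se]) .skip])

/-- Decide whether the selected edges form a `k`-matching, and compute their weight. -/
def checkC : Cmd := block [
  .op (.set .q (.c 1)),
  .op (.set .sn (.c 0)),
  .op (.wset .sum .zero),
  forLt .i (.r .gc) (block [
    .op (.ld .f0 .sel .i),
    .ite (.eq (.r .f0) (.c 1)) (block [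
      .op (.ar .add .sn (.r .sn) (.c 1)),
      .op (.ar .add .x (.r .goff) (.r .i)),
      .op (.wld .w .G .x),
      .op (.wadd .sum .sum .w),
      .op (.ld .c .G .x),
      .op (.ar .div .ca (.r .c) (.r .n)),
      .op (.ar .mod .cb (.r .c) (.r .n)),
      conflictC]) .skip]),
  .ite (.eq (.r .sn) (.r .k)) .skip (.op (.set .q (.c 0)))]

/-- Record the selected edges as the best matching found so far. -/
def recordC : Cmd := block [
  .op (.set .fin (.c 1)),
  .op (.wset .best .sum),
  .op (.set .sn (.c 0)),
  forLt .i (.r .gc) (block [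
    .op (.ld .f0 .sel .i),
    .ite (.eq (.r .f0) (.c 1)) (block [
      .op (.ar .add .x (.r .goff) (.r .i)),
      .op (.ld .c .G .x),
      .op (.st .res .sn (.r .c)),
      .op (.ar .add .sn (.r .sn) (.c 1))]) .skip])]

/-- Go to the next set of edges. -/
def nextC : Cmd := block [
  .op (.set .ye (.c 1)),
  forLt .i (.r .gc) (.ite (.eq (.r .ye) (.c 1)) (block [
    .op (.ld .f0 .sel .i),
    .ite (.eq (.r .f0) (.c 1)) (.op (.st .sel .i (.c 0)))
      (block [.op (.st .sel .i (.c 1)), .op (.set .ye (.c 0))])]) .skip),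
  .ite (.eq (.r .ye) (.c 1)) (.op (.set .go (.c 0))) .skip]

section
variable {B M : ℕ} {s : St} {Q : ℕ → St → Prop}

theorem f16_one : ((1 : Fin 16) : ℕ) = 1 := rfl
theorem f16_zero : ((0 : Fin 16) : ℕ) = 0 := rfl

theorem Recs.getD {a : Ar} {off : ℕ} {l : List (ℕ × ℝ)} (h : Recs s a off l) {i : ℕ}
    (hi : i < l.length) : s.arr a (off + i) = (l.getD i default).1 ∧
      s.warr a (off + i) = (l.getD i default).2 := by
  simpa [hi] using h i hi

theorem St.setR_self (s : St) (d : V) : s.setR d (s.reg d) = s := by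
  simp [St.setR]

/-- Both branches are merged into one state with a conditional value of `q`, so that a sequence of
flags leads to one state and not to a tree of runs. -/
theorem wp_flagC_iff {u v : V} {Q : St → Prop} : wp B M (flagC u v) s (fun _ s' => Q s') ↔
    Q (s.setR .q (if s.reg u = s.reg v then 0 else s.reg .q)) := by
  simp only [flagC, wp_ite_iff, wp_op_iff, wp_skip_iff, Op.ok, Op.eff, Test.ok, Test.holds,
    Opd.val_r, Opd.val_c, f16_zero]
  by_cases h : s.reg u = s.reg v
  · simp [h]
  · simp [h, St.setR_self]

theorem wp_conflictC {n i goff : ℕ} {A : Finset ℕ} {l : List (ℕ × ℝ)} (hn : s.reg .n = n)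
    (hi : s.reg .i = i) (hgoff : s.reg .goff = goff) (hA : IsSel s l.length A)
    (hG : Recs s .G goff l) (hil : i ≤ l.length) (hlM : goff + l.length ≤ M) (hMB : M ≤ B)
    (hq : s.reg .q ≤ 1)
    (hQ : ∀ s' t, Fr conflictC s s' → (s'.reg .q ≤ 1) →
      (s'.reg .q = 1 ↔ s.reg .q = 1 ∧ ∀ j ∈ A, j < i → s.reg .ca ≠ (l.getD j default).1 / n ∧
        s.reg .ca ≠ (l.getD j default).1 % n ∧ s.reg .cb ≠ (l.getD j default).1 / n ∧
        s.reg .cb ≠ (l.getD j default).1 % n) → Q t s') :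
    wp B M conflictC s Q := by
  refine wp_for i (fun j s' => s'.reg .q ≤ 1 ∧ (s'.reg .q = 1 ↔ s.reg .q = 1 ∧ ∀ j' ∈ A, j' < j →
      s.reg .ca ≠ (l.getD j' default).1 / n ∧
        s.reg .ca ≠ (l.getD j' default).1 % n ∧ s.reg .cb ≠ (l.getD j' default).1 / n ∧
        s.reg .cb ≠ (l.getD j' default).1 % n)) (by rfl)
    (by rintro x ⟨⟩; exact ⟨by decide, rfl⟩) hi (by omega) (by simpa using hq) ?_ ?_
  · rintro j s' hj hi' hf ⟨hJ0, hJ⟩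
    have e1 : s'.reg .n = n := (hf.reg _ rfl).trans hn
    have e2 : s'.reg .goff = goff := (hf.reg _ rfl).trans hgoff
    have e3 : s'.arr .sel = s.arr .sel := hf.arr _ rfl
    have e4 : s'.arr .G = s.arr .G := hf.arr _ rfl
    have e5 : s'.reg .ca = s.reg .ca := hf.reg _ rfl
    have e6 : s'.reg .cb = s.reg .cb := hf.reg _ rfl
    have hrec := hG.getD (show j < l.length by omega)
    have hsel := hA.2 j (by omega)
    have hsucc : ∀ p : ℕ → Prop, (∀ j' ∈ A, j' < j + 1 → p j') ↔
        (∀ j' ∈ A, j' < j → p j') ∧ (j ∈ A → p j) := by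
      intro p
      constructor
      · exact fun h => ⟨fun j' h1 h2 => h j' h1 (by omega), fun h1 => h j h1 (by omega)⟩
      · rintro ⟨h1, h2⟩ j' h3 h4
        rcases Nat.lt_succ_iff_lt_or_eq.1 h4 with h5 | rfl
        · exact h1 j' h3 h5
        · exact h2 h3
    rw [hsucc]
    generalize (∀ j' ∈ A, j' < j → s.reg .ca ≠ (l.getD j' default).1 / n ∧
        s.reg .ca ≠ (l.getD j' default).1 % n ∧ s.reg .cb ≠ (l.getD j' default).1 / n ∧
        s.reg .cb ≠ (l.getD j' default).1 % n) = old at hJ ⊢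
    obtain ⟨rj, hrj⟩ : ∃ rj, rj = l.getD j default := ⟨_, rfl⟩
    rw [← hrj] at hrec ⊢
    clear hQ hrj
    simp only [block, wp_seq_iff, wp_op_iff, wp_ite_iff, wp_skip_iff, wp_flagC_iff, Op.ok, Op.eff,
      Test.ok, Test.holds, St.setR_reg, St.setR_arr, Opd.val_r, Opd.val_c, reduceCtorEq, if_true,
      if_false, hi', e1, e2, e3, e4, e5, e6, hsel, hrec.1, Arith.eval, f16_one]
    refine ⟨by omega, trivial, fun h => ?_, fun h => ?_⟩
    · have hjA : j ∈ A := by by_contra hjA; simp [hjA] at h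
      refine ⟨by omega, by omega, trivial, trivial, ?_, ?_⟩
      · split_ifs <;> omega
      · simp only [hjA, true_implies]
        rw [← and_assoc, ← hJ]
        split_ifs <;> simp_all
    · have hjA : j ∉ A := by intro hjA; simp [hjA] at h
      simp only [hjA, false_implies, and_true]
      exact ⟨hJ0, hJ⟩
  · rintro s' t ⟨hJ0, hJ⟩ hi' hf
    exact hQ s' t hf hJ0 hJ

theorem selWeight_insert {l : List (ℕ × ℝ)} {A : Finset ℕ} {j : ℕ} (hj : j ∈ A) :
    selWeight l (A.filter (· < j + 1)) = selWeight l (A.filter (· < j)) + (l.getD j default).2 := by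
  have : A.filter (· < j + 1) = insert j (A.filter (· < j)) := by
    ext x
    simp only [Finset.mem_filter, Finset.mem_insert]
    constructor
    · rintro ⟨h1, h2⟩
      rcases Nat.lt_succ_iff_lt_or_eq.1 h2 with h | h
      · exact .inr ⟨h1, h⟩
      · exact .inl h
    · rintro (rfl | ⟨h1, h2⟩)
      · exact ⟨hj, by omega⟩
      · exact ⟨h1, by omega⟩
  rw [this, selWeight, Finset.sum_insert (by simp), add_comm]
  rfl

theorem filter_lt_succ_of_notMem {A : Finset ℕ} {j : ℕ} (hj : j ∉ A) :
    A.filter (· < j + 1) = A.filter (· < j) := by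
  ext x
  simp only [Finset.mem_filter, and_congr_right_iff]
  intro hx
  have : x ≠ j := by rintro rfl; exact hj hx
  omega

theorem filter_lt_succ_of_mem {A : Finset ℕ} {j : ℕ} (hj : j ∈ A) :
    A.filter (· < j + 1) = insert j (A.filter (· < j)) := by
  ext x
  simp only [Finset.mem_filter, Finset.mem_insert]
  constructor
  · rintro ⟨h1, h2⟩
    rcases Nat.lt_succ_iff_lt_or_eq.1 h2 with h | h
    · exact .inr ⟨h1, h⟩
    · exact .inl h
  · rintro (rfl | ⟨h1, h2⟩)
    · exact ⟨hj, by omega⟩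
    · exact ⟨h1, by omega⟩

theorem wp_checkC {n k goff : ℕ} {A : Finset ℕ} {l : List (ℕ × ℝ)} (hn : s.reg .n = n)
    (hk : s.reg .k = k) (hgc : s.reg .gc = l.length) (hzero : s.wreg .zero = 0)
    (hgoff : s.reg .goff = goff) (hA : IsSel s l.length A)
    (hG : Recs s .G goff l) (hlM : goff + l.length ≤ M) (hMB : M < B)
    (hQ : ∀ s' t, Fr checkC s s' → (s'.reg .q = 1 ↔ ValidSel n k l A) →
      s'.wreg .sum = selWeight l A → Q t s') :
    wp B M checkC s Q := by
  simp only [checkC, block]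
  refine wp_mono (Q := fun _ s' => (s'.reg .q = 1 ↔ ValidSel n k l A) ∧
    s'.wreg .sum = selWeight l A) ?_ (fun t s' hf h => hQ s' t hf h.1 h.2)
  refine wp_seq (wp_op trivial (wp_seq (wp_op trivial (wp_seq (wp_op trivial (wp_seq
    (wp_for l.length (fun j s' => s'.reg .q ≤ 1 ∧ (s'.reg .q = 1 ↔ ∀ i ∈ A, i < j → ∀ i' ∈ A, i' < i →
      CodeDisj n (l.getD i default).1 (l.getD i' default).1) ∧
      s'.reg .sn = (A.filter (· < j)).card ∧ s'.wreg .sum = selWeight l (A.filter (· < j))) (by rfl)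
    (by rintro x ⟨⟩; exact ⟨by decide, rfl⟩) (by simpa using hgc) (by omega) ?_ ?_ ?_)))))))
  · simp [selWeight, hzero]
  · rintro j s' hj hi hf ⟨hJ0, hJ1, hJ2, hJ3⟩
    have e1 : s'.reg .n = n := by rw [hf.reg _ rfl]; simpa using hn
    have e2 : s'.reg .goff = goff := by rw [hf.reg _ rfl]; simpa using hgoff
    have e3 : s'.arr .sel = s.arr .sel := by rw [hf.arr _ rfl]; simp
    have e4 : s'.arr .G = s.arr .G := by rw [hf.arr _ rfl]; simp
    have e5 : s'.warr .G = s.warr .G := by rw [hf.warr _ rfl]; simp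
    have hrec := hG.getD hj
    have hsel := hA.2 j hj
    have hcard : (A.filter (· < j)).card ≤ j := by
      have : A.filter (· < j) ⊆ Finset.range j := fun x hx => by simpa using (Finset.mem_filter.1 hx).2
      simpa using Finset.card_le_card this
    have hsucc : ∀ p : ℕ → Prop, (∀ j' ∈ A, j' < j + 1 → p j') ↔
        (∀ j' ∈ A, j' < j → p j') ∧ (j ∈ A → p j) := by
      intro p
      constructor
      · exact fun h => ⟨fun j' h1 h2 => h j' h1 (by omega), fun h1 => h j h1 (by omega)⟩
      · rintro ⟨h1, h2⟩ j' h3 h4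
        rcases Nat.lt_succ_iff_lt_or_eq.1 h4 with h5 | rfl
        · exact h1 j' h3 h5
        · exact h2 h3
    simp only [wp_seq_iff, wp_op_iff, wp_ite_iff, wp_skip_iff, Op.ok, Op.eff,
      Test.ok, Test.holds, St.setR_reg, St.setR_arr, St.setR_wreg, St.setR_warr, St.setW_reg,
      St.setW_arr, St.setW_wreg, Opd.val_r, Opd.val_c, reduceCtorEq, if_true,
      if_false, hi, e1, e2, e3, e4, e5, hsel, hrec.1, hrec.2, hJ2, hJ3, Arith.eval, f16_one]
    refine ⟨by omega, trivial, fun h => ?_, fun h => ?_⟩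
    · have hjA : j ∈ A := by by_contra hjA; simp [hjA] at h
      refine ⟨by omega, by omega, by omega, trivial, by omega, trivial, trivial, ?_⟩
      refine wp_conflictC (n := n) (i := j) (goff := goff) (A := A) (l := l) (by simpa using e1)
        (by simpa using hi) (by simpa using e2) ?_ ?_ hj.le hlM hMB.le (by simpa using hJ0) ?_
      · exact ⟨hA.1, fun i hi => by simpa [e3] using hA.2 i hi⟩
      · exact hG.congr (fun i _ _ => by simp [e4]) (fun i _ _ => by simp [e5])
      intro s2 t2 hf2 hq1 hq2
      refine ⟨by simpa using hq1, ?_, ?_, ?_⟩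
      · rw [hsucc]
        simp only [St.setR_reg, reduceCtorEq, if_false, hq2, St.setW_reg, hJ1]
        simp [CodeDisj, hjA]
      · rw [filter_lt_succ_of_mem hjA, Finset.card_insert_of_notMem (by simp)]
        rw [hf2.reg _ rfl]
        simp
      · rw [selWeight_insert hjA]
        rw [hf2.wreg _ rfl]
        simp
    · have hjA : j ∉ A := by intro hjA; simp [hjA] at h
      rw [hsucc, filter_lt_succ_of_notMem hjA]
      simp only [hjA, false_implies, and_true]
      exact ⟨hJ0, hJ1⟩
  · rintro s' t ⟨hJ0, hJ1, hJ2, hJ3⟩ hi hf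
    have e1 : s'.reg .k = k := by rw [hf.reg _ rfl]; simpa using hk
    have hall : A.filter (· < l.length) = A := by
      rw [Finset.filter_eq_self]
      intro x hx
      simpa using hA.1 hx
    rw [hall] at hJ2 hJ3
    have hd : (∀ i ∈ A, i < l.length → ∀ i' ∈ A, i' < i →
      CodeDisj n (l.getD i default).1 (l.getD i' default).1) ↔ (∀ i ∈ A, ∀ i' ∈ A, i' < i →
      CodeDisj n (l.getD i default).1 (l.getD i' default).1) :=
      forall₂_congr fun i hi => by simp [by simpa using hA.1 hi]
    rw [hd] at hJ1
    simp only [wp_op_iff, wp_ite_iff, wp_skip_iff, Op.ok, Op.eff, Test.ok, Test.holds, St.setR_reg,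
      St.setR_wreg, Opd.val_r, Opd.val_c, if_true, e1, hJ1, hJ2, hJ3, f16_zero]
    refine ⟨trivial, fun h => ⟨⟨fun h' => ⟨hA.1, h, h'⟩, fun h' => h'.disj⟩, trivial⟩,
      fun h => ⟨trivial, ⟨fun h' => by omega, fun h' => absurd h'.card h⟩, trivial⟩⟩

theorem wp_recordC {goff : ℕ} {A : Finset ℕ} {l : List (ℕ × ℝ)}
    (hgc : s.reg .gc = l.length)
    (hgoff : s.reg .goff = goff) (hA : IsSel s l.length A)
    (hG : Recs s .G goff l) (hlM : goff + l.length ≤ M) (hMB : M < B)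
    (hQ : ∀ s' t, Fr recordC s s' → s'.reg .fin = 1 → s'.wreg .best = s.wreg .sum →
      Holds (s'.arr .res) (selCodes l A l.length) → Q t s') :
    wp B M recordC s Q := by
  simp only [recordC, block]
  refine wp_mono (Q := fun _ s' => s'.reg .fin = 1 ∧ s'.wreg .best = s.wreg .sum ∧
    Holds (s'.arr .res) (selCodes l A l.length)) ?_ (fun t s' hf h => hQ s' t hf h.1 h.2.1 h.2.2)
  refine wp_seq (wp_op trivial (wp_seq (wp_op trivial (wp_seq (wp_op trivial (
    (wp_for l.length (fun j s' => s'.reg .sn = (selCodes l A j).length ∧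
      Holds (s'.arr .res) (selCodes l A j)) (by rfl)
    (by rintro x ⟨⟩; exact ⟨by decide, rfl⟩) (by simpa using hgc) (by omega) ?_ ?_ ?_)))))))
  · simp [selCodes, Holds.nil]
  · rintro j s' hj hi hf ⟨hJ1, hJ2⟩
    have e2 : s'.reg .goff = goff := by rw [hf.reg _ rfl]; simpa using hgoff
    have e3 : s'.arr .sel = s.arr .sel := by rw [hf.arr _ rfl]; simp
    have e4 : s'.arr .G = s.arr .G := by rw [hf.arr _ rfl]; simp
    have hrec := hG.getD hj
    have hsel := hA.2 j hj
    have hlen : (selCodes l A j).length ≤ j := by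
      rw [selCodes, List.length_map]
      exact (List.length_filter_le _ _).trans (by simp)
    simp only [wp_seq_iff, wp_op_iff, wp_ite_iff, wp_skip_iff, Op.ok, Op.eff,
      Test.ok, Test.holds, St.setR_reg, St.setR_arr, St.setA_arr, St.setA_reg,
      Opd.val_r, Opd.val_c, reduceCtorEq, if_true,
      if_false, hi, e2, e3, e4, hsel, hrec.1, hJ1, Arith.eval, f16_one]
    refine ⟨by omega, trivial, fun h => ?_, fun h => ?_⟩
    · have hjA : j ∈ A := by by_contra hjA; simp [hjA] at h
      have hstep : selCodes l A (j + 1) = selCodes l A j ++ [(l.getD j default).1] := by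
        simp [selCodes, List.range_succ, List.filter_append, hjA]
      rw [hstep]
      exact ⟨by omega, by omega, by omega, by omega, by simp, hJ2.concat rfl _⟩
    · have hjA : j ∉ A := by intro hjA; simp [hjA] at h
      have hstep : selCodes l A (j + 1) = selCodes l A j := by
        simp [selCodes, List.range_succ, List.filter_append, hjA]
      rw [hstep]
      exact ⟨rfl, hJ2⟩
  · rintro s' t ⟨hJ1, hJ2⟩ hi hf
    refine ⟨?_, ?_, hJ2⟩
    · rw [hf.reg _ rfl]; simp
    · rw [hf.wreg _ rfl]; simp

/-- The number with the binary digits given by `A`. -/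
def binVal (A : Finset ℕ) : ℕ := ∑ i ∈ A, 2 ^ i

theorem binVal_lt {A : Finset ℕ} {N : ℕ} (h : A ⊆ Finset.range N) : binVal A < 2 ^ N :=
  Nat.geomSum_lt le_rfl fun i hi => by simpa using h hi

theorem binVal_inj {A A' : Finset ℕ} (h : binVal A = binVal A') : A = A' :=
  Finset.geomSum_injective le_rfl h

/-- The index sets are enumerated as binary numbers, and this is the increment: `ye` is the carry,
and the invariant says that the digits together with the carry at position `j` represent the old
number plus one. A carry out of the last digit means that the set was full, hence the last one. -/
theorem wp_nextC {N : ℕ} {A : Finset ℕ} (hgc : s.reg .gc = N) (hA : IsSel s N A) (hNM : N ≤ M)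
    (hMB : M < B)
    (hQ : ∀ s' t, Fr nextC s s' → (s'.reg .go = 0 ∧ binVal A + 1 = 2 ^ N ∨ s'.reg .go = s.reg .go ∧
      ∃ A', IsSel s' N A' ∧ binVal A' = binVal A + 1) → Q t s') :
    wp B M nextC s Q := by
  simp only [nextC, block]
  refine wp_mono (Q := fun _ s' => s'.reg .go = 0 ∧ binVal A + 1 = 2 ^ N ∨ s'.reg .go = s.reg .go ∧
      ∃ A', IsSel s' N A' ∧ binVal A' = binVal A + 1) ?_ (fun t s' hf h => hQ s' t hf h)
  refine wp_seq (wp_op trivial (wp_seq (wp_for N (fun j s' => ∃ A', IsSel s' N A' ∧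
    s'.reg .ye ≤ 1 ∧ binVal A' + s'.reg .ye * 2 ^ j = binVal A + 1) (by rfl)
    (by rintro x ⟨⟩; exact ⟨by decide, rfl⟩) (by simpa using hgc) (by omega) ?_ ?_ ?_)))
  · exact ⟨A, ⟨hA.1, by simpa using hA.2⟩, by simp, by simp⟩
  · rintro j s' hj hi hf ⟨A', hA', hye, hval⟩
    have hsel := hA'.2 j hj
    have hupd : ∀ (b : ℕ) (A'' : Finset ℕ), (b = if j ∈ A'' then 1 else 0) →
        (∀ i, i ≠ j → (i ∈ A'' ↔ i ∈ A')) → ∀ i < N,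
          Function.update (s'.arr .sel) j b i = if i ∈ A'' then 1 else 0 := by
      intro b A'' hb hA'' i hi
      by_cases hij : i = j
      · subst hij; simpa using hb
      · rw [Function.update_of_ne hij, hA'.2 i hi]
        simp [hA'' i hij]
    simp only [wp_seq_iff, wp_op_iff, wp_ite_iff, wp_skip_iff, Op.ok, Op.eff,
      Test.ok, Test.holds, St.setR_reg, St.setA_reg,
      Opd.val_r, Opd.val_c, reduceCtorEq, if_true,
      if_false, hi, hsel, f16_one, f16_zero]
    refine ⟨trivial, fun h1 => ⟨by omega, trivial, fun h => ⟨by omega, ?_⟩, fun h => ⟨by omega, trivial, ?_⟩⟩, fun h1 => ?_⟩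
    · have hjA : j ∈ A' := by by_contra hjA; simp [hjA] at h
      refine ⟨A'.erase j, ⟨(Finset.erase_subset _ _).trans hA'.1, ?_⟩, hye, ?_⟩
      · simp only [St.setR_arr, St.setA_arr, if_true]
        exact hupd _ _ (by simp) (fun i hij => by simp [hij])
      · have : binVal A' = binVal (A'.erase j) + 2 ^ j := by
          rw [binVal, binVal, Finset.sum_erase_add _ _ hjA]
        rw [h1] at hval ⊢
        rw [pow_succ]
        omega
    · have hjA : j ∉ A' := by intro hjA; simp [hjA] at h
      refine ⟨insert j A', ⟨Finset.insert_subset (by simpa using hj) hA'.1, ?_⟩, by simp, ?_⟩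
      · simp only [St.setR_arr, St.setA_arr, if_true]
        exact hupd _ _ (by simp) (fun i hij => by simp [hij])
      · have : binVal (insert j A') = 2 ^ j + binVal A' := by
          rw [binVal, binVal, Finset.sum_insert hjA]
        rw [h1] at hval
        omega
    · refine ⟨A', ⟨hA'.1, hA'.2⟩, hye, ?_⟩
      have : s'.reg .ye = 0 := by omega
      rw [this] at hval ⊢
      simpa using hval
  · rintro s' t ⟨A', hA', hye, hval⟩ hi hf
    have e1 : s'.reg .go = s.reg .go := by rw [hf.reg _ rfl]; simp
    simp only [wp_op_iff, wp_ite_iff, wp_skip_iff, Op.ok, Op.eff, Test.ok, Test.holds, St.setR_reg,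
      Opd.val_r, Opd.val_c, if_true, f16_zero, f16_one]
    refine ⟨trivial, fun h => ⟨trivial, .inl ⟨trivial, ?_⟩⟩, fun h => .inr ⟨e1, A', hA', ?_⟩⟩
    · have := binVal_lt hA.1
      rw [h] at hval
      omega
    · have : s'.reg .ye = 0 := by omega
      rw [this] at hval
      omega

end

/-- Update the best matching found so far. -/
def tryC : Cmd := block [
  checkC,
  .ite (.eq (.r .q) (.c 1)) (.ite (.eq (.r .fin) (.c 0)) recordC
    (.ite (.wlt .best .sum) recordC .skip)) .skip]

/-- Search for a `k`-matching of largest weight in one of the graphs. -/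
def searchC : Cmd := block [
  .op (.set .fin (.c 0)),
  .op (.set .goff (.c 0)),
  forLt .h (.r .tt) (block [
    .op (.ld .gc .gc .h),
    forLt .i (.r .gc) (.op (.st .sel .i (.c 0))),
    .op (.set .go (.c 1)),
    .loop (.eq (.r .go) (.c 1)) (block [tryC, nextC]),
    .op (.ar .add .goff (.r .goff) (.r .r))])]

/-- Output the matching that was found. -/
def outputC : Cmd := .ite (.eq (.r .fin) (.c 1)) (forLt .i (.r .k) (block [
  .op (.ld .c .res .i),
  .op (.ar .div .ca (.r .c) (.r .n)),
  .op (.ar .mod .cb (.r .c) (.r .n)),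
  .op (.emit .ca .cb)])) .skip

/-- The state records a `k`-matching of largest weight among the candidates in `C`. -/
def BestI (n k : ℕ) (L : ℕ → List (ℕ × ℝ)) (C : ℕ → Finset ℕ → Prop) (s : St) : Prop :=
  (s.reg .fin = 0 ∧ ∀ h A, C h A → ¬ ValidSel n k (L h) A) ∨
  (s.reg .fin = 1 ∧ ∃ h A, C h A ∧ ValidSel n k (L h) A ∧ s.wreg .best = selWeight (L h) A ∧
    Holds (s.arr .res) (selCodes (L h) A (L h).length) ∧
    ∀ h' A', C h' A' → ValidSel n k (L h') A' → selWeight (L h') A' ≤ selWeight (L h) A)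

section
variable {B M : ℕ} {s : St} {Q : ℕ → St → Prop}

/-- The set of candidates matters only at valid selections, so it may be changed freely at all other
index sets. -/
theorem BestI.congr {n k : ℕ} {L : ℕ → List (ℕ × ℝ)} {C C' : ℕ → Finset ℕ → Prop} {s' : St}
    (h : BestI n k L C s) (hC : ∀ h A, ValidSel n k (L h) A → (C' h A ↔ C h A))
    (h1 : s'.reg .fin = s.reg .fin) (h2 : s'.wreg .best = s.wreg .best)
    (h3 : s'.arr .res = s.arr .res) : BestI n k L C' s' := by
  rw [BestI, h1, h2, h3]
  rcases h with ⟨h, h4⟩ | ⟨h, i, A, h4, h5, h6, h7, h8⟩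
  · exact .inl ⟨h, fun i A hi hv => h4 i A ((hC i A hv).1 hi) hv⟩
  · exact .inr ⟨h, i, A, (hC i A h5).2 h4, h5, h6, h7, fun i' A' hi hv => h8 i' A' ((hC i' A' hv).1 hi) hv⟩

theorem wp_tryC {n k h goff : ℕ} {A : Finset ℕ} {L : ℕ → List (ℕ × ℝ)} {C : ℕ → Finset ℕ → Prop}
    (hn : s.reg .n = n)
    (hk : s.reg .k = k) (hgc : s.reg .gc = (L h).length) (hzero : s.wreg .zero = 0)
    (hgoff : s.reg .goff = goff) (hA : IsSel s (L h).length A)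
    (hG : Recs s .G goff (L h)) (hlM : goff + (L h).length ≤ M) (hMB : M < B)
    (hbest : BestI n k L C s)
    (hQ : ∀ s' t, Fr tryC s s' → BestI n k L (fun h' A' => C h' A' ∨ h' = h ∧ A' = A) s' → Q t s') :
    wp B M tryC s Q := by
  refine wp_mono (Q := fun _ s' => BestI n k L (fun h' A' => C h' A' ∨ h' = h ∧ A' = A) s') ?_
    (fun t s' hf h => hQ s' t hf h)
  simp only [tryC, block]
  refine wp_seq (wp_checkC hn hk hgc hzero hgoff hA hG hlM hMB fun s1 t1 hf1 hq hsum => ?_)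
  have a1 : s1.reg .fin = s.reg .fin := hf1.reg _ rfl
  have a2 : s1.wreg .best = s.wreg .best := hf1.wreg _ rfl
  have a3 : s1.arr .res = s.arr .res := hf1.arr _ rfl
  have hrec : ∀ (s' : St) (t : ℕ), Fr recordC s1 s' → s'.reg .fin = 1 → s'.wreg .best = s1.wreg .sum →
      Holds (s'.arr .res) (selCodes (L h) A (L h).length) → ValidSel n k (L h) A →
      (∀ h' A', C h' A' → ValidSel n k (L h') A' → selWeight (L h') A' ≤ selWeight (L h) A) →
      BestI n k L (fun h' A' => C h' A' ∨ h' = h ∧ A' = A) s' := by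
    intro s' t hf h1 h2 h3 h4 h5
    refine .inr ⟨h1, h, A, .inr ⟨rfl, rfl⟩, h4, h2.trans hsum, h3, ?_⟩
    rintro h' A' (hC | ⟨rfl, rfl⟩) hv
    · exact h5 h' A' hC hv
    · exact le_rfl
  have hwp : ∀ Q : ℕ → St → Prop, (∀ s' t, Fr recordC s1 s' → s'.reg .fin = 1 →
      s'.wreg .best = s1.wreg .sum → Holds (s'.arr .res) (selCodes (L h) A (L h).length) → Q t s') →
      wp B M recordC s1 Q := fun Q => wp_recordC (goff := goff) ((hf1.reg _ rfl).trans hgc)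
      ((hf1.reg _ rfl).trans hgoff)
      ⟨hA.1, fun i hi => by rw [hf1.arr _ rfl]; exact hA.2 i hi⟩
      (hG.congr (fun i _ _ => by rw [hf1.arr _ rfl]) (fun i _ _ => by rw [hf1.warr _ rfl])) hlM hMB
  simp only [wp_ite_iff, wp_skip_iff, Test.ok, Test.holds, Opd.val_r, Opd.val_c, f16_one, f16_zero,
    hq, a1, a2, hsum]
  refine ⟨trivial, fun hv => ⟨trivial, fun h0 => ?_, fun h0 => ⟨trivial, fun hlt => ?_, fun hlt => ?_⟩⟩,
    fun hv => ?_⟩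
  · refine hwp _ fun s' t h1 h2 h3 h4 => hrec s' t h1 h2 h3 h4 hv ?_
    rcases hbest with ⟨-, h5⟩ | ⟨h5, -⟩
    · exact fun h' A' hC hv' => absurd hv' (h5 h' A' hC)
    · omega
  · refine hwp _ fun s' t h1 h2 h3 h4 => hrec s' t h1 h2 h3 h4 hv ?_
    rcases hbest with ⟨h5, -⟩ | ⟨h5, h', A', -, -, h6, -, h7⟩
    · omega
    · intro h2 A2 hC hv2
      rw [h6] at hlt
      exact (h7 h2 A2 hC hv2).trans hlt.le
  · rcases hbest with ⟨h5, -⟩ | ⟨h5, h', A', h8, h9, h6, h10, h7⟩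
    · omega
    · refine .inr ⟨a1.trans h5, h', A', .inl h8, h9, a2.trans h6, a3 ▸ h10, ?_⟩
      rintro h2 A2 (hC | ⟨rfl, rfl⟩) hv2
      · exact h7 h2 A2 hC hv2
      · rw [← h6]; exact not_lt.1 hlt
  · refine hbest.congr ?_ a1 a2 a3
    intro h' A' hv'
    constructor
    · rintro (h | ⟨rfl, rfl⟩)
      · exact h
      · exact absurd hv' hv
    · exact .inl

/-- The candidates treated so far are all index sets of the earlier graphs and those of the present
graph with a smaller binary number. The search is exponential in the size of the graphs, but it
starts only when the stream is over, so no step count is kept. -/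
theorem wp_searchC {n k t r : ℕ} {L : ℕ → List (ℕ × ℝ)}
    (hn : s.reg .n = n) (hk : s.reg .k = k) (ht : s.reg .tt = t) (hr : s.reg .r = r)
    (hzero : s.wreg .zero = 0) (hG : Graphs s t r L) (hr0 : 1 ≤ r) (hM : t * r + r ≤ M) (hMB : M < B)
    (hQ : ∀ s' t', Fr searchC s s' → BestI n k L (fun h _ => h < t) s' → Q t' s') :
    wp B M searchC s Q := by
  refine wp_mono (Q := fun _ s' => BestI n k L (fun h _ => h < t) s') ?_
    (fun t s' hf h => hQ s' t hf h)
  simp only [searchC, block]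
  have htr : t ≤ t * r := Nat.le_mul_of_pos_right _ hr0
  refine wp_seq (wp_op trivial (wp_seq (wp_op trivial (wp_for t (fun j s' => s'.reg .goff = j * r ∧
    BestI n k L (fun h _ => h < j) s') (by rfl)
    (by rintro x ⟨⟩; exact ⟨by decide, rfl⟩) (by simpa using ht) (by omega) ?_ ?_ ?_))))
  · refine ⟨by simp, .inl ⟨by simp, ?_⟩⟩
    intro h A hh
    omega
  · rintro j s1 hj hi1 hf1 ⟨hgoff1, hJ1⟩
    obtain ⟨g1, g2, g3⟩ := hG j hj
    have hjr : j * r + r ≤ t * r := by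
      have := Nat.mul_le_mul_right r (show j + 1 ≤ t by omega)
      linarith [Nat.add_mul j 1 r]
    have e1 : s1.reg .n = n := by rw [hf1.reg _ rfl]; simpa using hn
    have e2 : s1.reg .k = k := by rw [hf1.reg _ rfl]; simpa using hk
    have e3 : s1.reg .r = r := by rw [hf1.reg _ rfl]; simpa using hr
    have e4 : s1.wreg .zero = 0 := by rw [hf1.wreg _ rfl]; simpa using hzero
    have e5 : s1.arr .gc = s.arr .gc := by rw [hf1.arr _ rfl]; simp
    have e6 : s1.arr .G = s.arr .G := by rw [hf1.arr _ rfl]; simp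
    have e7 : s1.warr .G = s.warr .G := by rw [hf1.warr _ rfl]; simp
    clear hf1
    refine wp_seq (wp_op (by simp [hi1]; omega) (wp_seq (wp_for (L j).length
      (fun i s' => ∀ i' < i, s'.arr .sel i' = 0) (by rfl)
      (by rintro x ⟨⟩; exact ⟨by decide, rfl⟩) (by simp [hi1, e5, g1]) (by omega) (by simp) ?_ ?_)))
    · intro i s' hi hi' hf hJ
      refine wp_op (by simp [hi']; omega) ?_
      intro i' hi''
      simp [hi', Function.update_apply]
      intro h
      exact hJ i' (by omega)
    intro s2 t2 hJ2 hi2 hf2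
    have a1 : s2.reg .n = n := by rw [hf2.reg _ rfl]; simpa using e1
    have a2 : s2.reg .k = k := by rw [hf2.reg _ rfl]; simpa using e2
    have a3 : s2.reg .r = r := by rw [hf2.reg _ rfl]; simpa using e3
    have a4 : s2.wreg .zero = 0 := by rw [hf2.wreg _ rfl]; simpa using e4
    have a6 : s2.arr .G = s.arr .G := by rw [hf2.arr _ rfl]; simpa using e6
    have a7 : s2.warr .G = s.warr .G := by rw [hf2.warr _ rfl]; simpa using e7
    have a8 : s2.reg .goff = j * r := by rw [hf2.reg _ rfl]; simpa using hgoff1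
    have a9 : s2.reg .gc = (L j).length := by rw [hf2.reg _ rfl]; simp [hi1, e5, g1]
    have a10 : s2.reg .fin = s1.reg .fin := by rw [hf2.reg _ rfl]; simp
    have a11 : s2.wreg .best = s1.wreg .best := by rw [hf2.wreg _ rfl]; simp
    have a12 : s2.arr .res = s1.arr .res := by rw [hf2.arr _ rfl]; simp
    have hJ1 := hJ1.congr (C' := fun h _ => h < j) (fun _ _ _ => Iff.rfl) a10 a11 a12
    clear hf2
    refine wp_seq (wp_op trivial (wp_seq (wp_while (fun m s' =>
      (s'.reg .go = 0 ∧ BestI n k L (fun h _ => h < j + 1) s') ∨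
      (s'.reg .go = 1 ∧ ∃ A, IsSel s' (L j).length A ∧ m = 2 ^ (L j).length - binVal A ∧
        BestI n k L (fun h A' => h < j ∨ h = j ∧ binVal A' < binVal A) s')) (m := 2 ^ (L j).length)
        (.inr ⟨by simp, ∅, ⟨by simp, by simpa using hJ2⟩, by simp [binVal], ?_⟩) ?_ ?_)))
    · exact hJ1.congr (fun _ _ _ => by simp [binVal]) (by simp) (by simp) (by simp)
    · rintro m s3 hf3 (⟨hgo, hB⟩ | ⟨hgo, A, hA, hm, hB⟩)
      · refine ⟨trivial, fun h => ?_⟩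
        simp [hgo] at h
      refine ⟨trivial, fun _ => ?_⟩
      have b1 : s3.reg .n = n := by rw [hf3.reg _ rfl]; simpa using a1
      have b2 : s3.reg .k = k := by rw [hf3.reg _ rfl]; simpa using a2
      have b4 : s3.wreg .zero = 0 := by rw [hf3.wreg _ rfl]; simpa using a4
      have b6 : s3.arr .G = s.arr .G := by rw [hf3.arr _ rfl]; simpa using a6
      have b7 : s3.warr .G = s.warr .G := by rw [hf3.warr _ rfl]; simpa using a7
      have b8 : s3.reg .goff = j * r := by rw [hf3.reg _ rfl]; simpa using a8
      have b9 : s3.reg .gc = (L j).length := by rw [hf3.reg _ rfl]; simpa using a9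
      refine wp_seq (wp_tryC (h := j) b1 b2 b9 b4 b8 hA (g2.congr (fun i _ _ => by rw [b6])
        (fun i _ _ => by rw [b7])) (by omega) hMB hB ?_)
      intro s4 t4 hf4 hB4
      refine wp_nextC (N := (L j).length) (A := A) ((hf4.reg _ rfl).trans b9)
        ⟨hA.1, fun i hi => by rw [hf4.arr _ rfl]; exact hA.2 i hi⟩ (by omega) hMB ?_
      intro s5 t5 hf5 h5
      have hlt := binVal_lt hA.1
      rcases h5 with ⟨h5, h6⟩ | ⟨h5, A', h6, h7⟩
      -- After the overflow every valid selection of this graph has been tried: its number is below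
      -- `2 ^ N`, hence below that of `A` or equal to it, and in the latter case the sets agree.
      · refine ⟨0, by omega, .inl ⟨h5, hB4.congr ?_ (hf5.reg _ rfl) (hf5.wreg _ rfl) (hf5.arr _ rfl)⟩⟩
        intro h A' hv
        constructor
        · intro hh
          rcases Nat.lt_succ_iff_lt_or_eq.1 hh with hh | rfl
          · exact .inl (.inl hh)
          · have := binVal_lt hv.sub
            rcases Nat.lt_or_ge (binVal A') (binVal A) with h1 | h1
            · exact .inl (.inr ⟨rfl, h1⟩)
            · exact .inr ⟨rfl, binVal_inj (by omega)⟩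
        · rintro ((hh | ⟨rfl, -⟩) | ⟨rfl, -⟩) <;> omega
      · have hlt' := binVal_lt h6.1
        refine ⟨_, ?_, .inr ⟨h5.trans ((hf4.reg _ rfl).trans hgo), A', h6, rfl,
          hB4.congr ?_ (hf5.reg _ rfl) (hf5.wreg _ rfl) (hf5.arr _ rfl)⟩⟩
        · omega
        intro h A2 hv
        rw [h7]
        constructor
        · rintro (hh | ⟨rfl, hh⟩)
          · exact .inl (.inl hh)
          · rcases Nat.lt_succ_iff_lt_or_eq.1 hh with h1 | h1
            · exact .inl (.inr ⟨rfl, h1⟩)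
            · exact .inr ⟨rfl, binVal_inj h1⟩
        · rintro ((hh | ⟨rfl, hh⟩) | ⟨rfl, rfl⟩)
          · exact .inl hh
          · exact .inr ⟨rfl, by omega⟩
          · exact .inr ⟨rfl, by omega⟩
    · rintro m s3 t3 hf3 hI hgo
      have b3 : s3.reg .r = r := by rw [hf3.reg _ rfl]; simpa using a3
      have b8 : s3.reg .goff = j * r := by rw [hf3.reg _ rfl]; simpa using a8
      rcases hI with ⟨-, hB⟩ | ⟨hgo', -⟩
      · refine wp_op (by simp [b3, b8]; omega) ⟨?_, ?_⟩
        · simp [b3, b8, Arith.eval]; ring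
        · exact hB.congr (fun _ _ _ => Iff.rfl) (by simp) (by simp) (by simp)
      · exact absurd (by simpa using hgo') hgo
  · rintro s' t' ⟨-, h⟩ hi hf
    exact h

theorem length_selCodes {n k : ℕ} {l : List (ℕ × ℝ)} {A : Finset ℕ} (h : ValidSel n k l A) :
    (selCodes l A l.length).length = k := by
  rw [selCodes, List.length_map, ← h.card,
    ← List.toFinset_card_of_nodup (List.nodup_range.sublist List.filter_sublist)]
  congr 1
  ext x
  simp only [List.mem_toFinset, List.mem_filter, List.mem_range, decide_eq_true_eq]
  exact ⟨fun h => h.2, fun hx => ⟨by simpa using h.sub hx, hx⟩⟩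

theorem wp_outputC {n k : ℕ} {l : List ℕ} (hn : s.reg .n = n) (hk : s.reg .k = k)
    (hfin : s.reg .fin = 1) (hl : Holds (s.arr .res) l) (hlen : l.length = k) (hkM : k ≤ M)
    (hMB : M < B)
    (hQ : ∀ s' t, Fr outputC s s' →
      s'.out = s.out ∪ (l.map fun c => s(c / n, c % n)).toFinset → Q t s') :
    wp B M outputC s Q := by
  refine wp_ite trivial (fun _ => ?_) (fun h => absurd (by simpa using hfin) h)
  refine wp_mono (Q := fun _ s' => s'.out = s.out ∪ (l.map fun c => s(c / n, c % n)).toFinset) ?_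
    (fun t s' hf h => hQ s' _ hf.ite_left h)
  refine wp_for k (fun j s' => s'.out = s.out ∪ ((l.take j).map fun c => s(c / n, c % n)).toFinset)
    (by rfl) (by rintro x ⟨⟩; exact ⟨by decide, rfl⟩) hk (by omega) (by simp) ?_ ?_
  · intro j s' hj hi hf hJ
    have e1 : s'.reg .n = n := (hf.reg _ rfl).trans hn
    have e2 : s'.arr .res = s.arr .res := hf.arr _ rfl
    simp only [block, wp_seq_iff, wp_op_iff, Op.ok, Op.eff, St.setR_reg, St.setR_out,
      Opd.val_r, reduceCtorEq, if_true, if_false, hi, e1, e2, Arith.eval, hJ]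
    refine ⟨by omega, trivial, trivial, trivial, ?_⟩
    rw [hl.take_succ (by omega), List.map_append, List.toFinset_append]
    ext x
    simp only [List.map_cons, List.map_nil, Finset.mem_insert, Finset.mem_union, List.mem_toFinset,
      List.mem_singleton]
    tauto
  · intro s' t hJ hi hf
    rw [hJ, ← hlen, List.take_length]

end
open Cmd

/-! ## Parameters -/

/-- The least prime that is at least `n + 2`. -/
def hashPrime (n : ℕ) : ℕ := Nat.find (Nat.exists_infinite_primes (n + 2))

theorem hashPrime_prime (n : ℕ) : (hashPrime n).Prime :=
  (Nat.find_spec (Nat.exists_infinite_primes (n + 2))).2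

theorem le_hashPrime (n : ℕ) : n + 2 ≤ hashPrime n :=
  (Nat.find_spec (Nat.exists_infinite_primes (n + 2))).1

theorem hashPrime_le {n q : ℕ} (hq : q.Prime) (h : n + 2 ≤ q) : hashPrime n ≤ q :=
  Nat.find_min' (Nat.exists_infinite_primes (n + 2)) ⟨h, hq⟩

/-- Bertrand's postulate for `n + 1`. It keeps the prime, and with it all words used for hashing,
polynomial in `n`. -/
theorem hashPrime_le_two_mul (n : ℕ) : hashPrime n ≤ 2 * n + 2 := by
  obtain ⟨p, h1, h2, h3⟩ := Nat.exists_prime_lt_and_le_two_mul (n + 1) (by omega)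
  exact (hashPrime_le h1 (by omega)).trans (by omega)

/-- Set the flag `go` if `pp` is not prime. -/
def trialC : Cmd := forLt .i (.r .pp) (block [
  .op (.ar .mod .f0 (.r .pp) (.r .i)),
  .ite (.lt (.c 1) (.r .i)) (.ite (.eq (.r .f0) (.c 0)) (.op (.set .go (.c 1))) .skip) .skip])

/-- Compute the parameters. -/
def paramC (t : ℕ) : Cmd := block [
  .op (.ar .mul .r (.r .k) (.r .k)),
  .op (.ar .mul .r (.r .r) (.c 4)),
  .op (.ar .mul .k2 (.r .k) (.c 2)),
  .op (.big .tt t),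
  .op (.ar .add .pp (.r .n) (.c 2)),
  .op (.set .go (.c 1)),
  .loop (.eq (.r .go) (.c 1)) (block [
    .op (.set .go (.c 0)),
    trialC,
    .ite (.eq (.r .go) (.c 1)) (.op (.ar .add .pp (.r .pp) (.c 1))) .skip]),
  .op (.ar .sub .nn (.r .pp) (.c 1)),
  .op (.ar .mul .nn (.r .pp) (.r .nn)),
  .op (.set .zr (.c 1)),
  forLt .i (.r .tt) (.op (.ar .mul .zr (.r .zr) (.r .nn)))]

section
variable {B M : ℕ} {s : St} {Q : ℕ → St → Prop}

theorem wp_trialC {p : ℕ} (hp : s.reg .pp = p) (hgo : s.reg .go = 0) (hp2 : 2 ≤ p) (hpB : p ≤ B)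
    (hQ : ∀ s' t, Fr trialC s s' → s'.reg .go ≤ 1 → (s'.reg .go = 0 ↔ p.Prime) → Q t s') :
    wp B M trialC s Q := by
  refine wp_for p (fun j s' => s'.reg .go ≤ 1 ∧ (s'.reg .go = 0 ↔ ∀ m < j, m ∣ p → m ≤ 1)) (by rfl)
    (by rintro x ⟨⟩; exact ⟨by decide, rfl⟩) hp hpB (by simp [hgo]) ?_ ?_
  · rintro j s' hj hi hf ⟨hJ0, hJ⟩
    have e1 : s'.reg .pp = p := (hf.reg _ rfl).trans hp
    have hsucc : (∀ m < j + 1, m ∣ p → m ≤ 1) ↔ (∀ m < j, m ∣ p → m ≤ 1) ∧ (j ∣ p → j ≤ 1) := by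
      constructor
      · exact fun h => ⟨fun m h1 => h m (by omega), h j (by omega)⟩
      · rintro ⟨h1, h2⟩ m hm
        rcases Nat.lt_succ_iff_lt_or_eq.1 hm with h5 | rfl
        · exact h1 m h5
        · exact h2
    rw [hsucc, Nat.dvd_iff_mod_eq_zero]
    simp only [block, wp_seq_iff, wp_op_iff, wp_ite_iff, wp_skip_iff, Op.ok, Op.eff, Test.ok,
      Test.holds, St.setR_reg, Opd.val_r, Opd.val_c, reduceCtorEq, if_true, if_false, hi, e1,
      Arith.eval, f16_zero, f16_one]
    refine ⟨trivial, trivial, fun h => ⟨trivial, fun h' => ⟨trivial, by omega, ?_⟩, fun h' => ⟨hJ0, ?_⟩⟩,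
      fun h => ⟨hJ0, ?_⟩⟩
    · exact ⟨False.elim, fun h1 => absurd (h1.2 h') (by omega)⟩
    · rw [hJ]; simp [h']
    · rw [hJ]
      simp only [not_lt] at h
      simp [h]
  · rintro s' t ⟨hJ0, hJ⟩ hi hf
    refine hQ s' t hf hJ0 (hJ.trans ?_)
    rw [Nat.prime_def_lt]
    constructor
    · refine fun h => ⟨hp2, fun m hm hd => ?_⟩
      have h1 := h m hm hd
      have : m ≠ 0 := by rintro rfl; rw [zero_dvd_iff] at hd; omega
      omega
    · exact fun h m hm hd => (h.2 m hm hd).le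

theorem wp_paramC {n k t : ℕ} (hn : s.reg .n = n) (hk : s.reg .k = k)
    (hB1 : 4 * k ^ 2 + 2 * k + t + 4 ≤ B) (hB2 : hashPrime n * hashPrime n ≤ B)
    (hB3 : (hashPrime n * (hashPrime n - 1)) ^ t ≤ B)
    (hQ : ∀ s' t', Fr (paramC t) s s' → s'.reg .r = 4 * k ^ 2 → s'.reg .k2 = 2 * k →
      s'.reg .tt = t → s'.reg .pp = hashPrime n →
      s'.reg .nn = hashPrime n * (hashPrime n - 1) →
      s'.reg .zr = (hashPrime n * (hashPrime n - 1)) ^ t → Q t' s') :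
    wp B M (paramC t) s Q := by
  set p := hashPrime n with hp
  have hpn := le_hashPrime n
  rw [← hp] at hpn
  have hpB : p + 1 ≤ B := by nlinarith
  refine wp_mono (Q := fun _ s' => s'.reg .r = 4 * k ^ 2 ∧ s'.reg .k2 = 2 * k ∧
      s'.reg .tt = t ∧ s'.reg .pp = p ∧ s'.reg .nn = p * (p - 1) ∧
      s'.reg .zr = (p * (p - 1)) ^ t) ?_ (fun t s' hf h => hQ s' t hf h.1 h.2.1 h.2.2.1 h.2.2.2.1
        h.2.2.2.2.1 h.2.2.2.2.2)
  have f2 : ((2 : Fin 16) : ℕ) = 2 := rfl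
  have f4 : ((4 : Fin 16) : ℕ) = 4 := rfl
  have hkk : k * k = k ^ 2 := (pow_two k).symm
  simp only [paramC, block]
  refine wp_seq (wp_op (by simp [hk, Op.ok, hkk]; omega) ?_)
  refine wp_seq (wp_op (by simp [hk, Op.ok, hkk, Arith.eval]; omega) ?_)
  refine wp_seq (wp_op (by simp [hk, Op.ok, Arith.eval]; omega) ?_)
  refine wp_seq (wp_op (by simp [Op.ok]; omega) ?_)
  refine wp_seq (wp_op (by simp [hn, Op.ok, Arith.eval]; omega) ?_)
  refine wp_seq (wp_op (by simp [Op.ok]) ?_)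
  refine wp_seq ?_
  simp only [Op.eff, Arith.eval, Opd.val_r, Opd.val_c, f2, f4, St.setR_reg, reduceCtorEq, if_true,
    if_false, hn, hk, f16_one]
  -- The candidate `pp` climbs to the least prime. The summand for `go` makes the measure drop also
  -- in the round that recognizes the prime, where `pp` does not move. This happens before the first
  -- edge, so trial division is fast enough.
  refine wp_while (fun m s' => m = p - s'.reg .pp + (if s'.reg .go = 1 then 1 else 0) ∧
    s'.reg .go ≤ 1 ∧ n + 2 ≤ s'.reg .pp ∧ s'.reg .pp ≤ p ∧ (s'.reg .go = 0 → s'.reg .pp = p))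
    ⟨rfl, by simp, by simp, by simpa using hpn, by simp⟩ ?_ ?_
  · rintro _ s1 hf1 ⟨rfl, h1, h2, h3, h4⟩
    refine ⟨trivial, fun hgo => ?_⟩
    simp only [Test.holds, Opd.val_r, Opd.val_c, f16_one] at hgo
    refine wp_seq (wp_op trivial (wp_seq (wp_trialC (p := s1.reg .pp) (by simp) (by simp) (by omega)
      (by omega) ?_)))
    intro s2 t2 hf2 hg1 hg2
    have e1 : s2.reg .pp = s1.reg .pp := by rw [hf2.reg _ rfl]; simp
    simp only [wp_op_iff, wp_ite_iff, wp_skip_iff, Op.ok, Op.eff, Test.ok,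
      Test.holds, St.setR_reg, Opd.val_r, Opd.val_c, reduceCtorEq, if_true, if_false, e1,
      Arith.eval, f16_one, hgo]
    refine ⟨trivial, fun h => ⟨by omega, ?_⟩, fun h => ?_⟩
    · have hne : s1.reg .pp ≠ p := by
        intro h'
        have := hg2.2 (h' ▸ hp ▸ hashPrime_prime n)
        omega
      exact ⟨_, by rw [if_pos h]; omega, rfl, by omega, by omega, by omega, by omega⟩
    · have hg0 : s2.reg .go = 0 := by omega
      have := hashPrime_le (hg2.1 hg0) h2
      exact ⟨_, by rw [if_neg h]; omega, rfl, by omega, by omega, by omega, by omega⟩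
  rintro _ s1 t1 hf1 ⟨-, h1, h2, h3, h4⟩ hgo
  simp only [Test.holds, Opd.val_r, Opd.val_c, f16_one] at hgo
  have hpp := h4 (by omega)
  have e1 : s1.reg .r = 4 * k ^ 2 := by rw [hf1.reg _ rfl]; simp; ring
  have e2 : s1.reg .k2 = 2 * k := by rw [hf1.reg _ rfl]; simp; ring
  have e3 : s1.reg .tt = t := by rw [hf1.reg _ rfl]; simp
  have hpp1 : p * (p - 1) ≤ p * p := Nat.mul_le_mul_left _ (by omega)
  have hnn0 : 0 < p * (p - 1) := Nat.mul_pos (by omega) (by omega)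
  refine wp_seq (wp_op trivial (wp_seq (wp_op (by simp [hpp, Arith.eval]; omega) (wp_seq (wp_op trivial
    (wp_for t (fun j s' => s'.reg .zr = (p * (p - 1)) ^ j) (by rfl)
    (by rintro x ⟨⟩; exact ⟨by decide, rfl⟩) (by simp [e3]) (by omega) (by simp) ?_ ?_))))))
  · intro j s2 hj hi hf2 hJ
    have e4 : s2.reg .nn = p * (p - 1) := by rw [hf2.reg _ rfl]; simp [hpp, Arith.eval]
    have hpow : (p * (p - 1)) ^ (j + 1) ≤ (p * (p - 1)) ^ t := Nat.pow_le_pow_right hnn0 (by omega)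
    refine wp_op ?_ ?_
    · simp only [Op.ok, Opd.val_r, hJ, e4, ← pow_succ]; omega
    · simp [Arith.eval, hJ, e4, pow_succ]
  · intro s2 t2 hJ hi hf2
    refine ⟨?_, ?_, ?_, ?_, ?_, hJ⟩
    · rw [hf2.reg _ rfl]; simp [e1]
    · rw [hf2.reg _ rfl]; simp [e2]
    · rw [hf2.reg _ rfl]; simp [e3]
    · rw [hf2.reg _ rfl]; simp [hpp]
    · rw [hf2.reg _ rfl]; simp [hpp, Arith.eval]

end
open Cmd

/-! ## The parts of the program -/

/-- Through this the kept graphs inherit from the stream that codes are below `n * n` and pairwise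
distinct. -/
theorem IsRed.sublist {n k2 r : ℕ} {f : ℕ → ℕ} {rs rs' : List (ℕ × ℝ)} (h : IsRed n k2 r f rs rs') :
    rs'.Sublist rs := by
  obtain ⟨ca, cb, key, -, rfl⟩ := h
  have h1 : (finL ca cb key rs.length k2 r).Sublist (List.range rs.length) :=
    List.filter_sublist.trans List.filter_sublist
  have h2 : (List.range rs.length).map (fun i => rs.getD i default) = rs := by
    refine List.ext_getElem (by simp) fun i h1 h2 => ?_
    simp at h1
    simp [h1]
  rw [← h2, List.length_map, List.length_range, h2]
  conv_rhs => rw [← h2]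
  exact h1.map _

/-- A slice of a reduction may stop in the middle of a command, where `Ev.frame` says nothing; so
the frame is needed for single positions. -/
theorem Cmd.frame_at : (c : Cmd) → (q : c.Pos) → {o : Op} → {x : Option c.Pos} →
    c.at' q = .op o x → ∀ s, Fr c s (o.eff s)
  | .op o, _, _, _, h, s => by cases h; exact o.frame s
  | .seq a b, .inl q, o, x, h, s => by
    have h' : (a.at' q).map _ = .op o x := h
    cases h1 : a.at' q <;> rw [h1] at h' <;> cases h'
    exact (frame_at a q h1 s).seq_left
  | .seq a b, .inr q, o, x, h, s => by
    have h' : (b.at' q).map _ = .op o x := h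
    cases h1 : b.at' q <;> rw [h1] at h' <;> cases h'
    exact (frame_at b q h1 s).seq_right
  | .ite t a b, .inl q, o, x, h, s => by cases h
  | .ite t a b, .inr (.inl q), o, x, h, s => by
    have h' : (a.at' q).map _ = .op o x := h
    cases h1 : a.at' q <;> rw [h1] at h' <;> cases h'
    exact (frame_at a q h1 s).ite_left
  | .ite t a b, .inr (.inr q), o, x, h, s => by
    have h' : (b.at' q).map _ = .op o x := h
    cases h1 : b.at' q <;> rw [h1] at h' <;> cases h'
    exact (frame_at b q h1 s).ite_right
  | .loop t a, .inl q, o, x, h, s => by cases h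
  | .loop t a, .inr q, o, x, h, s => by
    have h' : (a.at' q).map _ = .op o x := h
    cases h1 : a.at' q <;> rw [h1] at h' <;> cases h'
    exact (frame_at a q h1 s).loop

theorem Steps.frame {B M : ℕ} {c : Cmd} {n : ℕ} {x y : Option c.Pos} {s s' : St}
    (h : Steps B M c.code n x s y s') : Fr c s s' := by
  induction h with
  | refl => exact .refl _ _
  | @op n x s o y z s' h1 _ _ ih =>
    cases x with
    | none => cases h1
    | some q => exact (c.frame_at q h1 s).trans ih
  | yes _ _ _ _ ih => exact ih
  | no _ _ _ _ ih => exact ih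

/-- The record of an element of the stream. -/
def recOf (n : ℕ) (x : ℕ × ℕ × ℝ) : ℕ × ℝ := (min x.1 x.2.1 * n + max x.1 x.2.1, x.2.2)

/-- Store the edge that was read in the buffer `p`. -/
def storeC (p : Bool) : Cmd := block [
  .ite (.lt (.r .ru) (.r .rv))
    (block [.op (.ar .mul .rc (.r .ru) (.r .n)), .op (.ar .add .rc (.r .rc) (.r .rv))])
    (block [.op (.ar .mul .rc (.r .rv) (.r .n)), .op (.ar .add .rc (.r .rc) (.r .ru))]),
  .op (.st (.buf p) .cnt (.r .rc)),
  .op (.wst (.buf p) .cnt .rw),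
  .op (.ar .add .cnt (.r .cnt) (.c 1))]

/-- Exchange the buffers. -/
def handoffC : Cmd := block [.op (.set .bn (.r .r)), .op (.set .cnt (.c 0))]

/-- Reduce the last batch, and search for a matching. -/
def endC (p : Bool) : Cmd := block [.op (.set .bn (.r .cnt)), batchC p, searchC, outputC]

/-- The parameters are set. -/
structure Param (s : St) (n k r k2 t pp z : ℕ) : Prop where
  h_n : s.reg .n = n
  h_k : s.reg .k = k
  h_r : s.reg .r = r
  h_k2 : s.reg .k2 = k2
  h_tt : s.reg .tt = t
  h_pp : s.reg .pp = pp
  h_nn : s.reg .nn = pp * (pp - 1)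
  h_z : s.reg .z = z
  h_zero : s.wreg .zero = 0
  h_out : s.out = ∅

theorem Param.of_fr {c : Cmd} {s s' : St} {n k r k2 t pp z : ℕ} (h : Param s n k r k2 t pp z)
    (hf : Fr c s s') (hr : ([V.n, .k, .r, .k2, .tt, .pp, .nn, .z].all fun x => !c.wr x) = true)
    (hw : c.ww .zero = false) (ho : c.we = false) : Param s' n k r k2 t pp z := by
  simp only [List.all_cons, List.all_nil, Bool.and_true, Bool.and_eq_true, Bool.not_eq_true'] at hr
  exact ⟨(hf.reg _ hr.1).trans h.h_n, (hf.reg _ hr.2.1).trans h.h_k, (hf.reg _ hr.2.2.1).trans h.h_r,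
    (hf.reg _ hr.2.2.2.1).trans h.h_k2, (hf.reg _ hr.2.2.2.2.1).trans h.h_tt,
    (hf.reg _ hr.2.2.2.2.2.1).trans h.h_pp, (hf.reg _ hr.2.2.2.2.2.2.1).trans h.h_nn,
    (hf.reg _ hr.2.2.2.2.2.2.2).trans h.h_z, (hf.wreg _ hw).trans h.h_zero, (hf.out ho).trans h.h_out⟩

/-- The bounds on words and indices are large enough for the parameters. -/
structure Enough (B M n k r k2 t pp : ℕ) : Prop where
  h_k2 : 1 ≤ k2
  h_r : 1 ≤ r
  h_pp : 2 ≤ pp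
  h_n : n ≤ pp
  h_k : k ≤ r
  h_B : pp * n + pp ≤ B
  h_M : (t + 5) * r ≤ M
  h_MB : 8 * M + 8 ≤ B

section
variable {B M : ℕ} {s : St} {Q : ℕ → St → Prop} {n k r k2 t pp z : ℕ}

theorem wp_storeC {p : Bool} {a b : ℕ} {w : ℝ} {rs : List (ℕ × ℝ)} (hn : s.reg .n = n)
    (ha : s.reg .ru = a) (hb : s.reg .rv = b) (hw : s.wreg .rw = w) (hc : s.reg .cnt = rs.length)
    (hbuf : Recs s (.buf p) 0 rs) (han : a < n) (hbn : b < n) (hB : n * n ≤ B) (hM : rs.length < M)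
    (hMB : M < B)
    (hQ : ∀ s' t, Fr (storeC p) s s' → s'.reg .cnt = rs.length + 1 →
      Recs s' (.buf p) 0 (rs ++ [recOf n (a, b, w)]) → t ≤ 6 → Q t s') :
    wp B M (storeC p) s Q := by
  refine wp_mono (Q := fun t s' => s'.reg .cnt = rs.length + 1 ∧
    Recs s' (.buf p) 0 (rs ++ [recOf n (a, b, w)]) ∧ t ≤ 6) ?_
    (fun t s' hf h => hQ s' t hf h.1 h.2.1 h.2.2)
  have h1 : a * n + n ≤ B := by nlinarith
  have h2 : b * n + n ≤ B := by nlinarith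
  simp only [storeC, block, wp_seq_iff, wp_op_iff, wp_ite_iff, Op.ok, Op.eff, Test.ok,
    Test.holds, St.setR_reg, Opd.val_r, Opd.val_c, St.setA_reg, St.setWA_reg, reduceCtorEq, if_true,
    if_false, hn, ha, hb, hc, Arith.eval, f16_one]
  refine ⟨trivial, fun h => ⟨by omega, by omega, hM, hM, by omega, trivial, ?_, by omega⟩,
    fun h => ⟨by omega, by omega, hM, hM, by omega, trivial, ?_, by omega⟩⟩
  · refine Recs.concat (s := s) hbuf ?_ ?_
    · simp [h.le]
    · simp [hw]
  · refine Recs.concat (s := s) hbuf ?_ ?_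
    · simp [not_lt.1 h]
    · simp [hw]

/-- The result of the search in the graphs given by `L`. -/
def Outcome (n k t : ℕ) (L : ℕ → List (ℕ × ℝ)) : Answer ℕ → Prop
  | none => ∀ h < t, ∀ A, ¬ ValidSel n k (L h) A
  | some O => ∃ h < t, ∃ A, ValidSel n k (L h) A ∧
      O = ((selCodes (L h) A (L h).length).map fun c => s(c / n, c % n)).toFinset ∧
      ∀ h' < t, ∀ A', ValidSel n k (L h') A' → selWeight (L h') A' ≤ selWeight (L h) A

theorem wp_endC {p : Bool} {L : ℕ → List (ℕ × ℝ)} {rs : List (ℕ × ℝ)}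
    (hP : Param s n k r k2 t pp z) (hE : Enough B M n k r k2 t pp)
    (hc : s.reg .cnt = rs.length) (hG : Graphs s t r L) (hbuf : Recs s (.buf p) 0 rs)
    (hl : rs.length ≤ r)
    (hcode : ∀ h < t, ∀ x ∈ L h ++ rs, x.1 < n * n)
    (hnd : ∀ h < t, ((L h ++ rs).map Prod.fst).Nodup)
    (hQ : ∀ s' t' L' O, Fr (endC p) s s' →
      (∀ h < t, IsRed n k2 r (digitFn pp r z h) (L h ++ rs) (L' h)) →
      Outcome n k t L' O → (if s'.reg .fin = 1 then some s'.out else none) = O → Q t' s') :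
    wp B M (endC p) s Q := by
  refine wp_mono (Q := fun _ s' => ∃ L' O,
      (∀ h < t, IsRed n k2 r (digitFn pp r z h) (L h ++ rs) (L' h)) ∧
      Outcome n k t L' O ∧ (if s'.reg .fin = 1 then some s'.out else none) = O) ?_
    (fun t s' hf ⟨L', O, h1, h2, h3⟩ => hQ s' t L' O hf h1 h2 h3)
  have hM := hE.h_M
  have hMB := hE.h_MB
  have hr := hE.h_r
  have hk := hE.h_k
  have htr : (t + 5) * r = t * r + 5 * r := Nat.add_mul _ _ _
  refine wp_seq (wp_op trivial (wp_seq (wp_batchC (z := z) (L := L) (rs := rs) (by simpa using hP.h_n)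
    (by simpa using hP.h_pp) (by simpa using hP.h_r) (by simpa using hP.h_k2) (by simpa using hP.h_tt)
    (by simpa using hP.h_z) (by simpa using hP.h_nn) (by simpa using hc) (by simpa [Graphs, Recs] using hG)
    (hbuf.congr (by simp) (by simp)) hl hE.h_k2 hr hE.h_pp hcode hnd hE.h_B hM hMB ?_)))
  intro s1 t1 L1 hf1 hG1 hred ht1
  have g1 : s1.reg .n = n := (hf1.reg _ (by cases p <;> rfl)).trans (by simpa using hP.h_n)
  have g2 : s1.reg .k = k := (hf1.reg _ (by cases p <;> rfl)).trans (by simpa using hP.h_k)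
  have g3 : s1.reg .tt = t := (hf1.reg _ (by cases p <;> rfl)).trans (by simpa using hP.h_tt)
  have g4 : s1.reg .r = r := (hf1.reg _ (by cases p <;> rfl)).trans (by simpa using hP.h_r)
  have g5 : s1.wreg .zero = 0 := (hf1.wreg _ (by cases p <;> rfl)).trans (by simpa using hP.h_zero)
  have g6 : s1.out = ∅ := (hf1.out (by cases p <;> rfl)).trans (by simpa using hP.h_out)
  refine wp_seq (wp_searchC g1 g2 g3 g4 g5 hG1 hr (by omega) (by omega) ?_)
  intro s2 t2 hf2 hbest
  have k1 : s2.reg .n = n := (hf2.reg _ rfl).trans g1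
  have k2 : s2.reg .k = k := (hf2.reg _ rfl).trans g2
  have k3 : s2.out = ∅ := (hf2.out rfl).trans g6
  rcases hbest with ⟨h1, h2⟩ | ⟨h1, h, A, hh, hA, -, hres, hmax⟩
  · refine wp_ite trivial (fun h => absurd h (by simp [h1])) (fun _ => wp_skip ?_)
    exact ⟨L1, none, hred, fun h hh A => h2 h A hh, by simp [h1]⟩
  · refine wp_outputC k1 k2 h1 hres (length_selCodes hA) (by omega) (by omega) ?_
    intro s3 t3 hf3 hout
    have : s3.reg .fin = 1 := (hf3.reg _ rfl).trans h1
    exact ⟨L1, some s3.out, hred, ⟨h, hh, A, hA, by rw [hout, k3, Finset.empty_union],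
      fun h' hh' A' => hmax h' A' hh'⟩, by simp [this]⟩

end
open Cmd

/-! ## The program -/

/-- The number of steps of a reduction that are made for each edge. -/
def slices (t : ℕ) : ℕ := 10000000 * (t + 1)

/-- The control labels of the program. In the labels `rd`, `chk`, `sto` and `sl`, the reduction of
the buffer `b` is in progress and the buffer `!b` is being filled. -/
inductive Lab (t : ℕ)
  | pre (x : (paramC t).Pos)
  | rnd
  | rd (b : Bool) (q : Option (batchC b).Pos)
  | chk (b : Bool) (q : Option (batchC b).Pos)
  | ho (b : Bool) (x : handoffC.Pos)
  | sto (b : Bool) (q : Option (batchC b).Pos) (x : (storeC (!b)).Pos)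
  | sl (b : Bool) (x : (batchC b).Pos) (j : Fin (slices t))
  | fl (b : Bool) (x : (batchC b).Pos)
  | en (b : Bool) (x : (endC (!b)).Pos)
  | tst
  | halt
  | haltNone

namespace Lab

variable {t : ℕ}

instance : Finite (Lab t) := by
  let f : ((((paramC t).Pos ⊕ (Σ b : Bool, Option (batchC b).Pos)) ⊕
      ((Σ b : Bool, Option (batchC b).Pos) ⊕ (Bool × handoffC.Pos))) ⊕
      (((Σ b : Bool, Option (batchC b).Pos × (storeC (!b)).Pos) ⊕
        (Σ b : Bool, (batchC b).Pos × Fin (slices t))) ⊕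
      ((Σ b : Bool, (batchC b).Pos) ⊕ (Σ b : Bool, (endC (!b)).Pos)))) ⊕ Fin 4 → Lab t := fun x =>
    match x with
    | .inl (.inl (.inl (.inl x))) => pre x
    | .inl (.inl (.inl (.inr ⟨b, q⟩))) => rd b q
    | .inl (.inl (.inr (.inl ⟨b, q⟩))) => chk b q
    | .inl (.inl (.inr (.inr (b, x)))) => ho b x
    | .inl (.inr (.inl (.inl ⟨b, q, x⟩))) => sto b q x
    | .inl (.inr (.inl (.inr ⟨b, x, j⟩))) => sl b x j
    | .inl (.inr (.inr (.inl ⟨b, x⟩))) => fl b x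
    | .inl (.inr (.inr (.inr ⟨b, x⟩))) => en b x
    | .inr 0 => rnd
    | .inr 1 => tst
    | .inr 2 => halt
    | .inr 3 => haltNone
  refine Finite.of_surjective f fun y => ?_
  cases y with
  | pre x => exact ⟨.inl (.inl (.inl (.inl x))), rfl⟩
  | rd b q => exact ⟨.inl (.inl (.inl (.inr ⟨b, q⟩))), rfl⟩
  | chk b q => exact ⟨.inl (.inl (.inr (.inl ⟨b, q⟩))), rfl⟩
  | ho b x => exact ⟨.inl (.inl (.inr (.inr (b, x)))), rfl⟩
  | sto b q x => exact ⟨.inl (.inr (.inl (.inl ⟨b, q, x⟩))), rfl⟩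
  | sl b x j => exact ⟨.inl (.inr (.inl (.inr ⟨b, x, j⟩))), rfl⟩
  | fl b x => exact ⟨.inl (.inr (.inr (.inl ⟨b, x⟩))), rfl⟩
  | en b x => exact ⟨.inl (.inr (.inr (.inr ⟨b, x⟩))), rfl⟩
  | rnd => exact ⟨.inr 0, rfl⟩
  | tst => exact ⟨.inr 1, rfl⟩
  | halt => exact ⟨.inr 2, rfl⟩
  | haltNone => exact ⟨.inr 3, rfl⟩

noncomputable instance : Fintype (Lab t) := Fintype.ofFinite _

/-- Go on with at most `j` steps of the reduction at the position `q`, then read. -/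
def nxt (b : Bool) : Option (batchC b).Pos → ℕ → Lab t
  | q, 0 => rd b q
  | none, _ + 1 => rd b none
  | some x, j + 1 => if h : j < slices t then sl b x ⟨j, h⟩ else rd b (some x)

def preL (x : Option (paramC t).Pos) : Lab t := x.elim rnd pre
def stoL (b : Bool) (q : Option (batchC b).Pos) (x : Option (storeC (!b)).Pos) : Lab t :=
  x.elim (nxt b q (slices t)) (sto b q)
-- After the exchange the full buffer `!b` is reduced from the start, and the edge just read, which
-- is still in the registers of the reader, goes into the buffer `b`.
def hoL (b : Bool) (x : Option handoffC.Pos) : Lab t :=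
  x.elim (stoL (!b) (batchC (!b)).entry (storeC (!!b)).entry) (ho b)
def enL (b : Bool) (x : Option (endC (!b)).Pos) : Lab t := x.elim tst (en b)
def flL (b : Bool) (x : Option (batchC b).Pos) : Lab t := x.elim (enL b (endC (!b)).entry) (fl b)

/-- The control flow graph of the program. -/
def code : Lab t → MI (Lab t)
  | pre x => ((paramC t).at' x).map preL
  | rnd => .random (rd false none)
  | rd b q => .read (chk b q) (flL b q)
  | chk b q => .test (.lt (.r .cnt) (.r .r)) (stoL b q (storeC (!b)).entry) (hoL b handoffC.entry)
  | ho b x => (handoffC.at' x).map (hoL b)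
  | sto b q x => ((storeC (!b)).at' x).map (stoL b q)
  | sl b x j => ((batchC b).at' x).map fun q => nxt b q j
  | fl b x => ((batchC b).at' x).map (flL b)
  | en b x => ((endC (!b)).at' x).map (enL b)
  | tst => .test (.eq (.r .fin) (.c 1)) halt haltNone
  | halt => .halt
  | haltNone => .haltNone

variable {B M : ℕ}

theorem steps_pre {m : ℕ} {x y : Option (paramC t).Pos} {s s' : St}
    (h : Steps B M (paramC t).code m x s y s') : Steps B M code m (preL x) s (preL y) s' :=
  h.map preL fun x hx => by cases x with
    | none => exact absurd rfl hx
    | some x => rfl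

theorem steps_sto {b : Bool} {q : Option (batchC b).Pos} {m : ℕ} {x y : Option (storeC (!b)).Pos}
    {s s' : St} (h : Steps B M (storeC (!b)).code m x s y s') :
    Steps B M (code (t := t)) m (stoL b q x) s (stoL b q y) s' :=
  h.map (stoL b q) fun x hx => by cases x with
    | none => exact absurd rfl hx
    | some x => rfl

theorem steps_ho {b : Bool} {m : ℕ} {x y : Option handoffC.Pos} {s s' : St}
    (h : Steps B M handoffC.code m x s y s') : Steps B M (code (t := t)) m (hoL b x) s (hoL b y) s' :=
  h.map (hoL b) fun x hx => by cases x with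
    | none => exact absurd rfl hx
    | some x => rfl

theorem steps_fl {b : Bool} {m : ℕ} {x y : Option (batchC b).Pos} {s s' : St}
    (h : Steps B M (batchC b).code m x s y s') : Steps B M (code (t := t)) m (flL b x) s (flL b y) s' :=
  h.map (flL b) fun x hx => by cases x with
    | none => exact absurd rfl hx
    | some x => rfl

theorem steps_en {b : Bool} {m : ℕ} {x y : Option (endC (!b)).Pos} {s s' : St}
    (h : Steps B M (endC (!b)).code m x s y s') : Steps B M (code (t := t)) m (enL b x) s (enL b y) s' :=
  h.map (enL b) fun x hx => by cases x with
    | none => exact absurd rfl hx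
    | some x => rfl

theorem stoL_none {b : Bool} {q : Option (batchC b).Pos} :
    stoL (t := t) b q none = nxt b q (slices t) := by rw [stoL, Option.elim_none]

/-- A slice of a reduction. -/
theorem steps_slice {b : Bool} {m j : ℕ} (hj : j ≤ slices t) {q : Option (batchC b).Pos} {s s' : St}
    (h : Steps B M (batchC b).code m q s none s') :
    ∃ i q1 s1 m1, Steps B M (code (t := t)) i (nxt b q j) s (rd b q1) s1 ∧ i ≤ j ∧
      Steps B M (batchC b).code m1 q1 s1 none s' ∧ m1 ≤ m - j ∧ Fr (batchC b) s s1 := by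
  induction j generalizing m q s with
  | zero => exact ⟨0, q, s, m, by cases q <;> exact .refl _ _, le_rfl, h, by omega, .refl _ _⟩
  | succ j ih =>
    cases q with
    | none =>
      have hm : m = 0 := by
        cases h with
        | refl => rfl
        | op h1 => cases h1
        | yes h1 => cases h1
        | no h1 => cases h1
      exact ⟨0, none, s, m, .refl _ _, by omega, h, by omega, .refl _ _⟩
    | some x =>
      have hn : nxt b (some x) (j + 1) = sl b x ⟨j, hj⟩ := dif_pos hj
      rw [hn]
      cases h with
      | op h1 h2 h3 =>
        obtain ⟨i, q1, s1, m1, a1, a2, a3, a4, a5⟩ := ih (by omega) h3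
        refine ⟨i + 1, q1, s1, m1, .op (o := _) (y := _) ?_ h2 a1, by omega, a3, by omega,
          ((batchC b).frame_at x h1 s).trans a5⟩
        change ((batchC b).at' x).map _ = _
        rw [show (batchC b).at' x = _ from h1]
        rfl
      | @yes _ _ _ bt y y' _ _ h1 h2 h3 h4 =>
        obtain ⟨i, q1, s1, m1, a1, a2, a3, a4, a5⟩ := ih (by omega) h4
        refine ⟨i + 1, q1, s1, m1, .yes (b := bt) (y' := nxt b y' j) ?_ h2 h3 a1, by omega, a3, by omega, a5⟩
        change ((batchC b).at' x).map _ = _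
        rw [show (batchC b).at' x = _ from h1]
        rfl
      | @no _ _ _ bt y y' _ _ h1 h2 h3 h4 =>
        obtain ⟨i, q1, s1, m1, a1, a2, a3, a4, a5⟩ := ih (by omega) h4
        refine ⟨i + 1, q1, s1, m1, .no (b := bt) (y := nxt b y j) ?_ h2 h3 a1, by omega, a3, by omega, a5⟩
        change ((batchC b).at' x).map _ = _
        rw [show (batchC b).at' x = _ from h1]
        rfl

end Lab

/-- The graphs `L h` result from processing the batches that make up the list. -/
inductive Batched (n k2 r pp t z : ℕ) : List (ℕ × ℝ) → (ℕ → List (ℕ × ℝ)) → Prop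
  | nil : Batched n k2 r pp t z [] fun _ => []
  | step {xs rs L L'} : Batched n k2 r pp t z xs L → rs.length = r →
      (∀ h < t, IsRed n k2 r (digitFn pp r z h) (L h ++ rs) (L' h)) →
      Batched n k2 r pp t z (xs ++ rs) L'

theorem Batched.sublist {n k2 r pp t z : ℕ} {xs : List (ℕ × ℝ)} {L : ℕ → List (ℕ × ℝ)}
    (h : Batched n k2 r pp t z xs L) : ∀ h < t, (L h).Sublist xs := by
  induction h with
  | nil => exact fun _ _ => List.Sublist.refl _
  | step _ _ h1 ih => exact fun h hh => (h1 h hh).sublist.trans ((ih h hh).append_right _)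

theorem recOf_lt {n : ℕ} {x : ℕ × ℕ × ℝ} (h1 : x.1 < n) (h2 : x.2.1 < n) : (recOf n x).1 < n * n := by
  have h3 : min x.1 x.2.1 < n := (min_le_left _ _).trans_lt h1
  have h4 : max x.1 x.2.1 < n := max_lt h1 h2
  simp only [recOf]
  nlinarith

open Lab

section
variable {B M n k r k2 t pp z : ℕ}

/-- The invariant of the program when the records `ys` have been processed. -/
def Inv (B M n k r k2 t pp z : ℕ) (b : Bool) (q : Option (batchC b).Pos) (s : St)
    (ys : List (ℕ × ℝ)) : Prop :=
  ∃ xs rs L m s', ys = xs ++ rs ∧ (xs = [] ∨ rs ≠ []) ∧ rs.length ≤ r ∧ s.reg .cnt = rs.length ∧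
    Param s n k r k2 t pp z ∧ Recs s (.buf !b) 0 rs ∧ Batched n k2 r pp t z xs L ∧
    Steps B M (batchC b).code m q s none s' ∧ Graphs s' t r L ∧ m ≤ slices t * (r - rs.length)

/-- The steps that the reduction still owes are at most `slices t` for every free cell of the buffer
being filled. Storing an edge uses up one cell and runs one slice, so this is preserved, and the
debt is zero when the buffer is full. -/
theorem steps_store {b : Bool} {q : Option (batchC b).Pos} {s s' : St} {xs rs : List (ℕ × ℝ)}
    {L : ℕ → List (ℕ × ℝ)} {m : ℕ} {x : ℕ × ℕ × ℝ} (hE : Enough B M n k r k2 t pp)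
    (h1 : x.1 < n) (h2 : x.2.1 < n) (hu : s.reg .ru = x.1) (hv : s.reg .rv = x.2.1)
    (hw : s.wreg .rw = x.2.2)
    (hlt : rs.length < r) (hc : s.reg .cnt = rs.length) (hP : Param s n k r k2 t pp z)
    (hbuf : Recs s (.buf !b) 0 rs) (hch : Batched n k2 r pp t z xs L)
    (hst : Steps B M (batchC b).code m q s none s') (hG : Graphs s' t r L)
    (hm : m ≤ slices t * (r - rs.length)) :
    ∃ i q1 s1, Steps B M (Lab.code (t := t)) i (stoL b q (storeC (!b)).entry) s (rd b q1) s1 ∧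
      i ≤ slices t + 6 ∧ Inv B M n k r k2 t pp z b q1 s1 (xs ++ rs ++ [recOf n x]) := by
  have hM := hE.h_M
  have hMB := hE.h_MB
  have htr : (t + 5) * r = t * r + 5 * r := Nat.add_mul _ _ _
  have hnn : n * n ≤ pp * n := Nat.mul_le_mul_right _ hE.h_n
  have hB := hE.h_B
  obtain ⟨i, s2, hev, hf, hcnt, hbuf2, hi⟩ : wp B M (storeC (!b)) s fun i s2 => Fr (storeC (!b)) s s2 ∧
      s2.reg .cnt = rs.length + 1 ∧ Recs s2 (.buf !b) 0 (rs ++ [recOf n x]) ∧ i ≤ 6 :=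
    wp_storeC hP.h_n hu hv hw hc hbuf h1 h2 (by omega) (by omega) (by omega)
      fun s' t hf a1 a2 a3 => ⟨hf, a1, a2, a3⟩
  have hag : Agree (!b) s s2 := by
    refine ⟨fun x hx => hf.reg x ?_, fun x _ => hf.wreg x ?_, fun x hx => hf.arr x ?_,
      fun x hx => hf.warr x ?_, hf.out ?_⟩
    · cases x <;> first | rfl | cases hx
    · rfl
    · simpa [storeC, block, Cmd.wa, Op.wa] using hx
    · simpa [storeC, block, Cmd.wwa, Op.wwa] using hx
    · rfl
  -- Storing changed only the reader's registers and the buffer `!b`, so the predicted rest of the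
  -- reduction carries over to the new state; a slice of it is executed next.
  obtain ⟨s3, hst2, hag2⟩ := hst.agree (by cases b <;> rfl) hag
  obtain ⟨j, q1, s4, m1, a1, a2, a3, a4, a5⟩ := steps_slice (t := t) le_rfl hst2
  rw [← stoL_none] at a1
  refine ⟨i + j, q1, s4, ((steps_sto hev.steps).trans a1), by omega, xs, rs ++ [recOf n x], L, m1, s3,
    by simp, .inr (by simp), by simpa using hlt, ?_, ?_, ?_, hch, a3, ?_, ?_⟩
  · rw [a5.reg _ (by cases b <;> rfl), hcnt]; simp
  · exact (hP.of_fr hf rfl rfl rfl).of_fr a5 (by cases b <;> rfl) (by cases b <;> rfl)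
      (by cases b <;> rfl)
  · exact hbuf2.congr (fun _ _ _ => by rw [a5.arr _ (by cases b <;> rfl)])
      (fun _ _ _ => by rw [a5.warr _ (by cases b <;> rfl)])
  · intro h hh
    obtain ⟨g1, g2, g3⟩ := hG h hh
    exact ⟨by rw [hag2.arr .gc nofun]; exact g1, g2.congr (fun _ _ _ => by rw [hag2.arr .G nofun])
      (fun _ _ _ => by rw [hag2.warr .G nofun]), g3⟩
  · rw [List.length_append, List.length_singleton]
    have : r - rs.length = r - (rs.length + 1) + 1 := by omega
    rw [this, Nat.mul_add, Nat.mul_one] at hm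
    omega

end
-- The main loop and the end of the stream
open Cmd Lab

section
variable {B M n k r k2 t pp z : ℕ}

theorem hoL_none {b : Bool} :
    hoL (t := t) b none = stoL (!b) (batchC (!b)).entry (storeC (!!b)).entry := by
  rw [hoL, Option.elim_none]

theorem Steps.of_none {c : Cmd} {m : ℕ} {s s' : St} {y : Option c.Pos}
    (h : Steps B M c.code m none s y s') : m = 0 ∧ y = none ∧ s' = s := by
  cases h with
  | refl => exact ⟨rfl, rfl, rfl⟩
  | op h1 => cases h1
  | yes h1 => cases h1
  | no h1 => cases h1

theorem Graphs.congr {s s' : St} {L : ℕ → List (ℕ × ℝ)} (hG : Graphs s t r L)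
    (h1 : s'.arr .gc = s.arr .gc) (h2 : s'.arr .G = s.arr .G) (h3 : s'.warr .G = s.warr .G) :
    Graphs s' t r L := fun h hh => by
  obtain ⟨g1, g2, g3⟩ := hG h hh
  exact ⟨by rw [h1]; exact g1, g2.congr (fun _ _ _ => by rw [h2]) (fun _ _ _ => by rw [h3]), g3⟩

/-- One round of the main loop, at the first label after the edge has been read. -/
theorem steps_round {b : Bool} {q : Option (batchC b).Pos} {s : St} {ys : List (ℕ × ℝ)}
    {x : ℕ × ℕ × ℝ} (hE : Enough B M n k r k2 t pp) (h1 : x.1 < n) (h2 : x.2.1 < n)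
    (hcode : ∀ y ∈ ys, y.1 < n * n) (hnd : (ys.map Prod.fst).Nodup)
    (hI : Inv B M n k r k2 t pp z b q s ys) :
    ∃ i b1 q1 s1, Steps B M (Lab.code (t := t)) i (chk b q)
      (((s.setR .ru x.1).setR .rv x.2.1).setW .rw x.2.2) (rd b1 q1) s1 ∧
      i ≤ slices t + 20 ∧ Inv B M n k r k2 t pp z b1 q1 s1 (ys ++ [recOf n x]) := by
  obtain ⟨xs, rs, L, m, s', rfl, -, hl, hc, hP, hbuf, hch, hst, hG, hm⟩ := hI
  have hr := hE.h_r
  set sr := ((s.setR .ru x.1).setR .rv x.2.1).setW .rw x.2.2 with hsr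
  have hag : Agree (!b) s sr := by
    refine ⟨fun x hx => ?_, fun x hx => ?_, fun x _ => rfl, fun x _ => rfl, rfl⟩
    · simp only [hsr, St.setW_reg, St.setR_reg]
      rw [if_neg (by rintro rfl; cases hx), if_neg (by rintro rfl; cases hx)]
    · simp [hsr, hx]
  have hPr : Param sr n k r k2 t pp z := by
    constructor <;> simp [hsr, hP.h_n, hP.h_k, hP.h_r, hP.h_k2, hP.h_tt, hP.h_pp, hP.h_nn, hP.h_z,
      hP.h_zero, hP.h_out]
  have hcr : sr.reg .cnt = rs.length := by simpa [hsr] using hc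
  obtain ⟨sr', hst', hag'⟩ := hst.agree (by cases b <;> rfl) hag
  have hG' : Graphs sr' t r L := hG.congr (hag'.arr .gc nofun) (hag'.arr .G nofun) (hag'.warr .G nofun)
  have htest : (Test.lt (.r .cnt) (.r .r)).holds sr ↔ rs.length < r := by simp [hcr, hPr.h_r]
  by_cases hlt : rs.length < r
  · obtain ⟨i, q1, s1, a1, a2, a3⟩ := steps_store (x := x) hE h1 h2 (by simp [hsr]) (by simp [hsr])
      (by simp [hsr]) hlt hcr hPr (hbuf.congr (fun _ _ _ => rfl) fun _ _ _ => rfl) hch hst' hG' hm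
    exact ⟨i + 1, b, q1, s1, .yes (b := .lt (.r .cnt) (.r .r)) rfl trivial (htest.2 hlt) a1, by omega, a3⟩
  -- The buffer is full, so nothing is owed: the previous reduction is complete, and the present
  -- graphs are those of the batches before the buffer.
  · obtain rfl : m = 0 := by
      rw [show r - rs.length = 0 by omega, Nat.mul_zero] at hm
      omega
    obtain rfl : q = none := by cases hst'; rfl
    obtain ⟨-, -, rfl⟩ := hst'.of_none
    obtain ⟨i, s2, hev, hi, e1, e2, hf2, e3⟩ : wp B M handoffC sr fun i s2 => i ≤ 2 ∧
        s2.reg .bn = rs.length ∧ s2.reg .cnt = 0 ∧ Fr handoffC sr s2 ∧ s2.wreg = sr.wreg := by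
      refine wp_mono (Q := fun i s2 => i ≤ 2 ∧ s2.reg .bn = rs.length ∧ s2.reg .cnt = 0 ∧
        s2.wreg = sr.wreg) ?_ (fun t s hf h => ⟨h.1, h.2.1, h.2.2.1, hf, h.2.2.2⟩)
      simp only [handoffC, block, wp_seq_iff, wp_op_iff, Op.ok, Op.eff, St.setR_reg, Opd.val_r,
        Opd.val_c, reduceCtorEq, if_true, if_false, hPr.h_r, f16_zero, St.setR_wreg]
      exact ⟨trivial, trivial, by omega, by omega, trivial, trivial⟩
    have hP2 : Param s2 n k r k2 t pp z := hPr.of_fr hf2 rfl rfl rfl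
    have hsub : ∀ h < t, (L h ++ rs).Sublist (xs ++ rs) := fun h hh => (hch.sublist h hh).append_right _
    -- The complete reduction of the full buffer is predicted here from the present state. It is
    -- then carried out in slices while the next batch arrives.
    obtain ⟨m, s3, hev3, L', hG3, hred, hm3⟩ : wp B M (batchC (!b)) s2 fun m s3 => ∃ L',
        Graphs s3 t r L' ∧ (∀ h < t, IsRed n k2 r (digitFn pp r z h) (L h ++ rs) (L' h)) ∧
        m ≤ 10000000 * (t + 1) * r :=
      wp_batchC hP2.h_n hP2.h_pp hP2.h_r hP2.h_k2 hP2.h_tt hP2.h_z hP2.h_nn e1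
        (hG'.congr (hf2.arr _ rfl) (hf2.arr _ rfl) (hf2.warr _ rfl))
        (hbuf.congr (fun _ _ _ => by rw [hf2.arr _ rfl]; rfl)
          fun _ _ _ => by rw [hf2.warr _ rfl]; rfl) hl hE.h_k2 hr hE.h_pp
        (fun h hh x hx => hcode x ((hsub h hh).subset hx))
        (fun h hh => hnd.sublist ((hsub h hh).map _)) hE.h_B hE.h_M hE.h_MB
        fun s' t' L' _ a1 a2 a3 => ⟨L', a1, a2, a3⟩
    obtain ⟨j, q1, s1, a1, a2, a3⟩ := steps_store (b := !b) (rs := []) (xs := xs ++ rs) (x := x) hE h1 h2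
      (by rw [hf2.reg _ rfl]; simp [hsr]) (by rw [hf2.reg _ rfl]; simp [hsr]) (by rw [e3]; simp [hsr])
      (by simpa using (show 0 < r from hr)) e2 hP2 (fun i hi => by simp at hi) (hch.step (by omega) hred) hev3.steps hG3
      (by simpa [slices] using hm3)
    have hho := steps_ho (t := t) (b := b) hev.steps
    rw [hoL_none] at hho
    refine ⟨i + j + 1, !b, q1, s1, .no (b := .lt (.r .cnt) (.r .r)) rfl trivial
      (fun h => hlt (htest.1 h)) (hho.trans a1), by omega, by simpa using a3⟩

theorem path_round {b : Bool} {q : Option (batchC b).Pos} {s : St} {ys : List (ℕ × ℝ)}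
    {x : ℕ × ℕ × ℝ} {inp : List (ℕ × ℕ × ℝ)} {tm : Option ℕ} (hE : Enough B M n k r k2 t pp)
    (h1 : x.1 < n) (h2 : x.2.1 < n)
    (hcode : ∀ y ∈ ys, y.1 < n * n) (hnd : (ys.map Prod.fst).Nodup)
    (hI : Inv B M n k r k2 t pp z b q s ys) (htm : ∀ a ∈ tm, a ≤ slices t + 20) :
    ∃ b1 q1 s1 tm1, MPath (Lab.code (t := t)) B M (slices t + 20) (rd b q) s (x :: inp) tm
      (rd b1 q1) s1 inp tm1 ∧ Inv B M n k r k2 t pp z b1 q1 s1 (ys ++ [recOf n x]) ∧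
      ∀ a ∈ tm1, a ≤ slices t + 20 := by
  obtain ⟨i, b1, q1, s1, a1, a2, a3⟩ := steps_round hE h1 h2 hcode hnd hI
  refine ⟨b1, q1, s1, _, .trans (.readCons (a := x.1) (b := x.2.1) (w := x.2.2) rfl htm)
    (.steps a1 ?_), a3, ?_⟩
  · rintro _ ⟨⟩; omega
  · rintro _ ⟨⟩
    change 0 + i ≤ _
    omega

/-- The specification of the result, for a stream with the given records. -/
def Spec (n k r k2 t pp z : ℕ) (ys : List (ℕ × ℝ)) (O : Answer ℕ) : Prop :=
  ∃ xs rs L L', ys = xs ++ rs ∧ (xs = [] ∨ rs ≠ []) ∧ rs.length ≤ r ∧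
    Batched n k2 r pp t z xs L ∧
    (∀ h < t, IsRed n k2 r (digitFn pp r z h) (L h ++ rs) (L' h)) ∧ Outcome n k t L' O

theorem path_end {b : Bool} {q : Option (batchC b).Pos} {s : St} {ys : List (ℕ × ℝ)} {tm : Option ℕ}
    (hE : Enough B M n k r k2 t pp) (hcode : ∀ y ∈ ys, y.1 < n * n) (hnd : (ys.map Prod.fst).Nodup)
    (hI : Inv B M n k r k2 t pp z b q s ys) (htm : ∀ a ∈ tm, a ≤ slices t + 20) :
    ∃ x s' O, MPath (Lab.code (t := t)) B M (slices t + 20) (rd b q) s [] tm x s' [] none ∧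
      (Lab.code x).answer s'.out = some O ∧ Spec n k r k2 t pp z ys O := by
  obtain ⟨xs, rs, L, m, s', rfl, hne, hl, hc, hP, hbuf, hch, hst, hG, hm⟩ := hI
  have hsub : ∀ h < t, (L h ++ rs).Sublist (xs ++ rs) := fun h hh => (hch.sublist h hh).append_right _
  have hf := hst.frame
  have hP' : Param s' n k r k2 t pp z := hP.of_fr hf (by cases b <;> rfl) (by cases b <;> rfl)
    (by cases b <;> rfl)
  obtain ⟨j, s2, hev, L', O, hred, hO, hfin⟩ : wp B M (endC (!b)) s' fun _ s2 => ∃ L' O,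
      (∀ h < t, IsRed n k2 r (digitFn pp r z h) (L h ++ rs) (L' h)) ∧
      Outcome n k t L' O ∧ (if s2.reg .fin = 1 then some s2.out else none) = O :=
    wp_endC hP' hE ((hf.reg _ (by cases b <;> rfl)).trans hc) hG
      (hbuf.congr (fun _ _ _ => by rw [hf.arr _ (by cases b <;> rfl)])
        fun _ _ _ => by rw [hf.warr _ (by cases b <;> rfl)]) hl
      (fun h hh x hx => hcode x ((hsub h hh).subset hx))
      (fun h hh => hnd.sublist ((hsub h hh).map _))
      fun s' t' L' O _ a1 a2 a3 => ⟨L', O, a1, a2, a3⟩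
  have h1 := steps_fl (t := t) hst
  have h2 := steps_en (t := t) hev.steps
  have h3 : flL (t := t) b none = enL b (endC (!b)).entry := by rw [flL, Option.elim_none]
  have h4 : enL (t := t) b none = tst := by rw [enL, Option.elim_none]
  rw [h3] at h1
  rw [h4] at h2
  -- Meeting the end of the stream switches the timer off, so finishing the reduction, reducing the
  -- last batch and searching are not charged to the update time.
  have h5 : MPath (Lab.code (t := t)) B M (slices t + 20) (rd b q) s [] tm tst s2 [] none :=
    .trans (.readNil rfl htm) (.steps_none (h1.trans h2))
  have hS : Spec n k r k2 t pp z (xs ++ rs) O := ⟨xs, rs, L, L', rfl, hne, hl, hch, hred, hO⟩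
  by_cases h6 : s2.reg .fin = 1
  · rw [if_pos h6] at hfin
    refine ⟨halt, s2, O, h5.trans (.steps_none (.yes (b := .eq (.r .fin) (.c 1)) rfl trivial ?_
      (.refl _ _))), congrArg some hfin, hS⟩
    simpa using h6
  · rw [if_neg h6] at hfin
    refine ⟨haltNone, s2, O, h5.trans (.steps_none (.no (b := .eq (.r .fin) (.c 1)) rfl trivial ?_
      (.refl _ _))), congrArg some hfin, hS⟩
    simpa using h6

theorem path_main {inp : List (ℕ × ℕ × ℝ)} (hE : Enough B M n k r k2 t pp)
    (hinp : ∀ x ∈ inp, x.1 < n ∧ x.2.1 < n) {b : Bool} {q : Option (batchC b).Pos} {s : St}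
    {ys : List (ℕ × ℝ)} {tm : Option ℕ} (hcode : ∀ y ∈ ys, y.1 < n * n)
    (hnd : ((ys ++ inp.map (recOf n)).map Prod.fst).Nodup)
    (hI : Inv B M n k r k2 t pp z b q s ys) (htm : ∀ a ∈ tm, a ≤ slices t + 20) :
    ∃ x s' O, MPath (Lab.code (t := t)) B M (slices t + 20) (rd b q) s inp tm x s' [] none ∧
      (Lab.code x).answer s'.out = some O ∧ Spec n k r k2 t pp z (ys ++ inp.map (recOf n)) O := by
  induction inp generalizing b q s ys tm with
  | nil => simpa using path_end hE hcode (by simpa using hnd) hI htm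
  | cons x inp ih =>
    obtain ⟨h1, h2⟩ := hinp x (by simp)
    have hnd' : (ys.map Prod.fst).Nodup := hnd.sublist ((List.sublist_append_left _ _).map _)
    obtain ⟨b1, q1, s1, tm1, a1, a2, a3⟩ := path_round (inp := inp) hE h1 h2 hcode hnd' hI htm
    obtain ⟨y, s', O, b2, b3, b4⟩ := ih (fun x hx => hinp x (by simp [hx])) (ys := ys ++ [recOf n x]) (by
      intro y hy
      rcases List.mem_append.1 hy with hy | hy
      · exact hcode y hy
      · rw [List.mem_singleton] at hy
        subst hy
        exact recOf_lt h1 h2) (by simpa using hnd) a2 a3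
    exact ⟨y, s', O, a1.trans b2, b3, by simpa using b4⟩

end
-- The law of the whole program
open Cmd Lab

/-- The entry point of the program. -/
def startL (t : ℕ) : Lab t := preL (paramC t).entry

/-- The records of a stream. -/
def recsOf {n : ℕ} (S : List (Insertion n)) : List (ℕ × ℝ) :=
  S.map fun x => recOf n (x.fst.val, x.snd.val, x.weight)

theorem law_program {B M n k t : ℕ} (hE : Enough B M n k (4 * k ^ 2) (2 * k) t (hashPrime n))
    (hB1 : 4 * k ^ 2 + 2 * k + t + 4 ≤ B) (hB2 : hashPrime n * hashPrime n ≤ B)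
    (hB3 : (hashPrime n * (hashPrime n - 1)) ^ t ≤ B) (hB4 : 17 * M ≤ B) (hB5 : 20 ≤ B)
    {S : List (Insertion n)} (hnd : ((recsOf S).map Prod.fst).Nodup) :
    (∀ c, (flat Lab.code (startL t)).Reachable k S c → Good B (17 * M) c ∧
      ∀ a ∈ c.timer, a ≤ 15 * (slices t + 20)) ∧
    ∃ ans : ℕ → Answer ℕ,
      (∀ z < (hashPrime n * (hashPrime n - 1)) ^ t,
        Spec n k (4 * k ^ 2) (2 * k) t (hashPrime n) z (recsOf S) (ans z)) ∧
      ∃ T, ((flat Lab.code (startL t)).run k S T).map Program.Config.answer =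
        (Program.uniformBelow ((hashPrime n * (hashPrime n - 1)) ^ t)).map fun z => some (ans z) := by
  set inp := S.map fun x => (x.fst.val, x.snd.val, x.weight) with hinp
  have hrec : inp.map (recOf n) = recsOf S := by simp [hinp, recsOf]
  have hpn := le_hashPrime n
  have hn0 : (St.start n k).reg .n = n := rfl
  have hk0 : (St.start n k).reg .k = k := rfl
  obtain ⟨m, s, hev, hf, e1, e2, e3, e4, e5, e6⟩ : wp B M (paramC t) (St.start n k) fun _ s =>
      Fr (paramC t) (St.start n k) s ∧ s.reg .r = 4 * k ^ 2 ∧ s.reg .k2 = 2 * k ∧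
      s.reg .tt = t ∧ s.reg .pp = hashPrime n ∧
      s.reg .nn = hashPrime n * (hashPrime n - 1) ∧
      s.reg .zr = (hashPrime n * (hashPrime n - 1)) ^ t :=
    wp_paramC hn0 hk0 hB1 hB2 hB3 fun s' t' a1 a2 a3 a4 a5 a6 a7 => ⟨a1, a2, a3, a4, a5, a6, a7⟩
  have hpre := steps_pre hev.steps
  have hrnd : preL (none : Option (paramC t).Pos) = rnd := by rw [preL, Option.elim_none]
  rw [hrnd] at hpre
  have hR : 0 < (hashPrime n * (hashPrime n - 1)) ^ t :=
    Nat.pow_pos (Nat.mul_pos (by omega) (by omega))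
  have hz : ∀ z, ∃ x s' O, MPath (Lab.code (t := t)) B M (slices t + 20) (rd false none) (s.setR .z z)
      inp none x s' [] none ∧ (Lab.code x).answer s'.out = some O ∧
      Spec n k (4 * k ^ 2) (2 * k) t (hashPrime n) z ([] ++ inp.map (recOf n)) O := by
    intro z
    -- The memory starts at zero and the computation of the parameters does not touch it, so all
    -- graphs are empty without any initialization, and no reduction is pending.
    have hg : ∀ h, s.arr .gc h = 0 := fun h => by rw [hf.arr _ rfl]; rfl
    refine path_main hE ?_ (by simp) (by simpa [hrec] using hnd)
      ⟨[], [], fun _ => [], 0, s.setR .z z, rfl, .inl rfl, by simp, ?_, ?_, fun i hi => by simp at hi,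
        .nil, .refl _ _, ?_, by simp⟩ (by simp)
    · intro x hx
      rw [hinp, List.mem_map] at hx
      obtain ⟨a, -, rfl⟩ := hx
      exact ⟨a.fst.2, a.snd.2⟩
    · simp only [St.setR_reg, reduceCtorEq, if_false]
      rw [hf.reg _ rfl]; rfl
    · constructor <;> simp only [St.setR_reg, reduceCtorEq, if_false, if_true, St.setR_wreg, St.setR_out]
      · exact hf.reg _ rfl
      · exact hf.reg _ rfl
      · exact e1
      · exact e2
      · exact e3
      · exact e4
      · exact e5
      · exact hf.wreg _ rfl
      · exact hf.out rfl
    · exact fun h _ => ⟨hg h, fun i hi => by simp at hi, by simp⟩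
  choose x s' ans h1 h2 h3 using hz
  rw [List.nil_append, hrec] at h3
  have hnB : n ≤ B := by nlinarith
  obtain ⟨h4, h5⟩ := law_flat (code := Lab.code (t := t)) (xr := rnd) (k := k) (x0 := startL t) (S := S) (y := rd false none) (ans := ans) (TT := slices t + 20)
    hB4 hB5 hnB (by omega) hR (by omega) rfl e6 (.steps_none hpre)
    (fun z hz => ⟨x z, s' z, h1 z, h2 z⟩)
  exact ⟨h4, ans, fun z _ => h3 z, h5⟩


/-! ## The graphs computed by the program -/

section
open Classical
variable {n r : ℕ} {wt : Sym2 (Fin n) → ℝ}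

theorem mk_inf_sup (e : Sym2 (Fin n)) : s(e.inf, e.sup) = e := by
  induction e using Sym2.ind with
  | _ a b =>
    rcases le_total a b with h | h
    · simp [h]
    · simp [h, Sym2.eq_swap]

theorem map_eq_mk (F : Fin n → Fin r) (e : Sym2 (Fin n)) : e.map F = s(F e.inf, F e.sup) := by
  conv_lhs => rw [← mk_inf_sup e]
  rfl

/-- The code of an edge. -/
def ecode (e : Sym2 (Fin n)) : ℕ := e.inf.val * n + e.sup.val

theorem ecode_div (e : Sym2 (Fin n)) : ecode e / n = e.inf.val := by
  have hn : 0 < n := e.inf.pos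
  rw [ecode, Nat.mul_comm, Nat.mul_add_div hn, Nat.div_eq_of_lt e.sup.2, Nat.add_zero]

theorem ecode_mod (e : Sym2 (Fin n)) : ecode e % n = e.sup.val := by
  rw [ecode, Nat.mul_comm, Nat.mul_add_mod, Nat.mod_eq_of_lt e.sup.2]

theorem ecode_inj {e e' : Sym2 (Fin n)} (h : ecode e = ecode e') : e = e' := by
  rw [← mk_inf_sup e, ← mk_inf_sup e', Fin.ext (by rw [← ecode_div, h, ecode_div] : e.inf.val = e'.inf.val),
    Fin.ext (by rw [← ecode_mod, h, ecode_mod] : e.sup.val = e'.sup.val)]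

/-- A code is a two-digit number in base `n`, so codes are ordered lexicographically by the
endpoints. Hence the keys of the program compare like the `β`-values. -/
theorem ecode_lt_iff {e e' : Sym2 (Fin n)} :
    ecode e < ecode e' ↔ e.inf < e'.inf ∨ e.inf = e'.inf ∧ e.sup < e'.sup := by
  have h1 := e.sup.2
  have h2 := e'.sup.2
  simp only [ecode, Fin.lt_def, Fin.ext_iff]
  rcases lt_trichotomy e.inf.val e'.inf.val with h | h | h
  · have : (e.inf.val + 1) * n ≤ e'.inf.val * n := Nat.mul_le_mul_right _ h
    rw [Nat.add_mul, Nat.one_mul] at this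
    omega
  · rw [h]; omega
  · have : (e'.inf.val + 1) * n ≤ e.inf.val * n := Nat.mul_le_mul_right _ h
    rw [Nat.add_mul, Nat.one_mul] at this
    omega

theorem beta_lt_iff {e e' : Sym2 (Fin n)} :
    beta wt e < beta wt e' ↔ (toLex (wt e, ecode e) : ℝ ×ₗ ℕ) < toLex (wt e', ecode e') := by
  simp only [beta, Prod.Lex.toLex_lt_toLex, ecode_lt_iff]

theorem beta_injective : Function.Injective (beta wt) := by
  intro e e' h
  rw [← mk_inf_sup e, ← mk_inf_sup e']
  have h1 : (e.inf, e.sup) = (e'.inf, e'.sup) := congrArg (fun x => ofLex (ofLex x).2) h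
  rw [Prod.mk.injEq] at h1
  rw [h1.1, h1.2]

/-- The record of an edge. -/
def erec (wt : Sym2 (Fin n) → ℝ) (e : Sym2 (Fin n)) : ℕ × ℝ := (ecode e, wt e)

/-- The list `l` of indices represents the set `T` of edges, where `g i` is the edge at index `i`. -/
structure Corr (g : ℕ → Sym2 (Fin n)) (N : ℕ) (l : List ℕ) (T : Finset (Sym2 (Fin n))) : Prop where
  nodup : l.Nodup
  lt : ∀ i ∈ l, i < N
  mem : ∀ i < N, i ∈ l ↔ g i ∈ T
  ex : ∀ x ∈ T, ∃ i < N, g i = x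

section
variable {g : ℕ → Sym2 (Fin n)} {N : ℕ} {l : List ℕ} {T : Finset (Sym2 (Fin n))}
  {key : ℕ → ℝ ×ₗ ℕ}

theorem Corr.filter (h : Corr g N l T) {p : ℕ → Prop} {q : Sym2 (Fin n) → Prop} [DecidablePred p]
    [DecidablePred q] (hpq : ∀ i ∈ l, p i ↔ q (g i)) :
    Corr g N (l.filter fun i => decide (p i)) (T.filter q) where
  nodup := h.nodup.filter _
  lt i hi := h.lt i (List.mem_of_mem_filter hi)
  mem i hi := by
    rw [List.mem_filter, Finset.mem_filter, ← h.mem i hi, decide_eq_true_iff]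
    exact and_congr_right fun hl => hpq i hl
  ex x hx := h.ex x (Finset.mem_filter.1 hx).1

theorem Corr.card (h : Corr g N l T) (hg : Set.InjOn g (Set.Iio N)) : T.card = l.length := by
  rw [← List.toFinset_card_of_nodup h.nodup, ← Finset.card_image_of_injOn (s := l.toFinset) (f := g)]
  · congr 1
    ext x
    simp only [Finset.mem_image, List.mem_toFinset]
    constructor
    · intro hx
      obtain ⟨i, hi, rfl⟩ := h.ex x hx
      exact ⟨i, (h.mem i hi).2 hx, rfl⟩
    · rintro ⟨i, hi, rfl⟩
      exact (h.mem i (h.lt i hi)).1 hi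
  · intro i hi j hj
    simp only [List.coe_toFinset, Set.mem_ofPred_eq] at hi hj
    exact hg (h.lt i hi) (h.lt j hj)

theorem Corr.amongHeaviest (h : Corr g N l T) (hg : Set.InjOn g (Set.Iio N))
    (hkey : ∀ i < N, key i = toLex (wt (g i), ecode (g i))) {m i : ℕ} (hi : i < N) :
    i ∈ topL key m l ↔ AmongHeaviest wt m T (g i) := by
  have h1 := (h.filter (p := fun j => key i < key j) (q := fun y => beta wt (g i) < beta wt y)
    (fun j hj => by rw [hkey i hi, hkey j (h.lt j hj), beta_lt_iff])).card hg
  rw [AmongHeaviest, topL, List.mem_filter, h.mem i hi, decide_eq_true_iff, gtCount,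
    List.countP_eq_length_filter]
  refine and_congr_right fun _ => ?_
  rw [← h1]

theorem Corr.topL (h : Corr g N l T) (hg : Set.InjOn g (Set.Iio N))
    (hkey : ∀ i < N, key i = toLex (wt (g i), ecode (g i))) {m : ℕ} {T' : Finset (Sym2 (Fin n))}
    (hT : ∀ x, x ∈ T' ↔ AmongHeaviest wt m T x) : Corr g N (topL key m l) T' where
  nodup := h.nodup.filter _
  lt i hi := h.lt i (List.mem_of_mem_filter hi)
  mem i hi := by rw [h.amongHeaviest hg hkey hi, hT]
  ex x hx := h.ex x ((hT x).1 hx).1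

end

section
variable {g : ℕ → Sym2 (Fin n)} {N k : ℕ} {H : Finset (Sym2 (Fin n))} {F : Fin n → Fin r}
  {ca cb : ℕ → ℕ} {key : ℕ → ℝ ×ₗ ℕ}

/-- Among the edges incident to one class, two edges join the same pair of classes precisely when
their other classes agree. So being best for the other class means being heaviest between the two
classes, and the compact subgraph can be computed class by class. -/
theorem corr_compact (hH : ∀ x, x ∈ H ↔ ∃ i < N, g i = x)
    (hkey : ∀ i < N, key i = toLex (wt (g i), ecode (g i))) (hca : ∀ i < N, ca i = F (g i).inf)
    (hcb : ∀ i < N, cb i = F (g i).sup) (c : Fin r) :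
    Corr g N ((incEdges ca cb N c).filter (BestP ca cb key (incEdges ca cb N c) c))
      ((compactSubgraph wt F H).filter fun e' => c ∈ e'.map F) := by
  have hinc : ∀ i < N, i ∈ incEdges ca cb N c ↔ ¬ ((g i).map F).IsDiag ∧ c ∈ (g i).map F := by
    intro i hi
    rw [mem_incEdges, hca i hi, hcb i hi, map_eq_mk]
    simp only [hi, true_and, Sym2.mk_isDiag_iff, Sym2.mem_iff, Fin.ext_iff, ne_eq]
    tauto
  have hoth : ∀ i < N, ∀ j < N, c ∈ (g i).map F → c ∈ (g j).map F →
      (oth ca cb c j = oth ca cb c i ↔ (g j).map F = (g i).map F) := by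
    intro i hi j hj h1 h2
    rw [map_eq_mk] at *
    simp only [Sym2.mem_iff] at h1 h2
    rw [map_eq_mk, oth, oth, hca i hi, hcb i hi, hca j hj, hcb j hj]
    simp only [Sym2.eq_iff, Fin.ext_iff] at *
    omega
  constructor
  · exact (nodup_incEdges _ _).filter _
  · exact fun i hi => (mem_incEdges.1 (List.mem_of_mem_filter hi)).1
  · intro i hi
    rw [List.mem_filter, decide_eq_true_iff, hinc i hi, Finset.mem_filter, compactSubgraph,
      Finset.mem_filter]
    constructor
    · rintro ⟨⟨h1, h2⟩, h3⟩
      refine ⟨⟨(hH _).2 ⟨i, hi, rfl⟩, h1, ?_⟩, h2⟩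
      intro e' he' hm
      obtain ⟨j, hj, rfl⟩ := (hH _).1 he'
      have h4 : c ∈ (g j).map F := hm ▸ h2
      have := h3 j ((hinc j hj).2 ⟨hm ▸ h1, h4⟩) ((hoth i hi j hj h2 h4).2 hm)
      rw [hkey i hi, hkey j hj] at this
      exact not_lt.1 fun h => not_lt.2 this (beta_lt_iff.1 h)
    · rintro ⟨⟨-, h1, h3⟩, h2⟩
      refine ⟨⟨h1, h2⟩, fun j hj ho => ?_⟩
      have hjN := (mem_incEdges.1 hj).1
      have h4 := ((hinc j hjN).1 hj).2
      have := h3 (g j) ((hH _).2 ⟨j, hjN, rfl⟩) ((hoth i hi j hjN h2 h4).1 ho)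
      rw [hkey i hi, hkey j hjN]
      exact not_lt.1 fun h => not_lt.2 this (beta_lt_iff.2 h)
  · intro x hx
    simp only [compactSubgraph, Finset.mem_filter] at hx
    exact (hH x).1 hx.1.1

theorem corr_degreeReduced (hg : Set.InjOn g (Set.Iio N)) (hH : ∀ x, x ∈ H ↔ ∃ i < N, g i = x)
    (hkey : ∀ i < N, key i = toLex (wt (g i), ecode (g i))) (hca : ∀ i < N, ca i = F (g i).inf)
    (hcb : ∀ i < N, cb i = F (g i).sup) :
    Corr g N (degL ca cb key N (2 * k)) (degreeReduced wt k F H) := by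
  have hsel : ∀ c : Fin r, ∀ i < N, i ∈ selL ca cb key N (2 * k) c ↔ AmongHeaviest wt (2 * k)
      ((compactSubgraph wt F H).filter fun e' => c ∈ e'.map F) (g i) := fun c i hi =>
    (corr_compact hH hkey hca hcb c).amongHeaviest hg hkey hi
  constructor
  · exact (List.nodup_range).filter _
  · exact fun i hi => List.mem_range.1 (List.mem_of_mem_filter hi)
  · intro i hi
    simp only [degL, List.mem_filter, List.mem_range, hi, true_and, decide_eq_true_iff, degreeReduced,
      Finset.mem_filter]
    rw [hca i hi, hcb i hi, hsel _ i hi, hsel _ i hi]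
    constructor
    · rintro ⟨h1, h2, h3⟩
      refine ⟨(Finset.mem_filter.1 h2.1).1, fun c hc => ?_⟩
      rw [map_eq_mk, Sym2.mem_iff] at hc
      rcases hc with rfl | rfl
      · exact h2
      · exact h3
    · rintro ⟨h1, h2⟩
      refine ⟨?_, h2 _ (by rw [map_eq_mk]; simp), h2 _ (by rw [map_eq_mk]; simp)⟩
      have h3 := (Finset.mem_filter.1 h1).2.1
      rw [map_eq_mk, Sym2.mk_isDiag_iff] at h3
      exact fun h => h3 (Fin.ext h)
  · intro x hx
    rw [degreeReduced, Finset.mem_filter, compactSubgraph, Finset.mem_filter] at hx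
    exact (hH x).1 hx.1.1

theorem corr_reducedCompact (hg : Set.InjOn g (Set.Iio N)) (hH : ∀ x, x ∈ H ↔ ∃ i < N, g i = x)
    (hkey : ∀ i < N, key i = toLex (wt (g i), ecode (g i))) (hca : ∀ i < N, ca i = F (g i).inf)
    (hcb : ∀ i < N, cb i = F (g i).sup) :
    Corr g N (finL ca cb key N (2 * k) (4 * k ^ 2)) (reducedCompact wt k F H) :=
  (corr_degreeReduced hg hH hkey hca hcb).topL hg hkey fun x => by
    rw [reducedCompact, Finset.mem_filter]
    exact ⟨fun h => h.2, fun h => ⟨h.1, h⟩⟩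

end

theorem IsRed.reducedCompact {k : ℕ} {f : ℕ → ℕ} {F : Fin n → Fin r} (hf : ∀ x : Fin n, f x = F x)
    {es : List (Sym2 (Fin n))} (hnd : es.Nodup) {rs' : List (ℕ × ℝ)}
    (h : IsRed n (2 * k) (4 * k ^ 2) f (es.map (erec wt)) rs') :
    ∃ es' : List (Sym2 (Fin n)), rs' = es'.map (erec wt) ∧ es'.Nodup ∧
      es'.toFinset = reducedCompact wt k F es.toFinset := by
  obtain ⟨ca, cb, key, hk, rfl⟩ := h
  -- Passing from a list to a function on indices needs some edge as a default value, and there is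
  -- none if `n = 0`; so the empty list is treated apart.
  rcases es.eq_nil_or_concat with rfl | ⟨l0, e0, he⟩
  · exact ⟨[], by simp [finL, topL, degL], by simp, by simp [KMatch.reducedCompact, degreeReduced, compactSubgraph]⟩
  clear he
  rw [List.length_map]
  simp only [List.length_map] at hk
  set g : ℕ → Sym2 (Fin n) := fun i => es.getD i e0 with hg
  have hge : ∀ i (h : i < es.length), g i = es[i] := fun i h => by simp [hg, h]
  have hinj : Set.InjOn g (Set.Iio es.length) := by
    intro i hi j hj hij
    rw [hge i hi, hge j hj] at hij
    exact (hnd.getElem_inj_iff).1 hij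
  have hc := corr_reducedCompact (wt := wt) (k := k) (F := F) (ca := ca) (cb := cb) (key := key)
    (H := es.toFinset) hinj (fun x => by
      rw [List.mem_toFinset, List.mem_iff_getElem]
      exact ⟨fun ⟨i, hi, h⟩ => ⟨i, hi, (hge i hi).trans h⟩, fun ⟨i, hi, h⟩ => ⟨i, hi, (hge i hi).symm.trans h⟩⟩)
    (fun i hi => by rw [(hk i hi).2.2]; simp [erec, hge i hi])
    (fun i hi => by rw [(hk i hi).1]; simp [erec, hge i hi, ecode_div, hf])
    (fun i hi => by rw [(hk i hi).2.1]; simp [erec, hge i hi, ecode_mod, hf])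
  refine ⟨(finL ca cb key es.length (2 * k) (4 * k ^ 2)).map g, ?_, ?_, ?_⟩
  · rw [List.map_map]
    refine List.map_congr_left fun i hi => ?_
    have := hc.lt i hi
    simp [this, hge]
  · exact hc.nodup.map_on fun i hi j hj h => hinj (hc.lt i hi) (hc.lt j hj) h
  · ext x
    simp only [List.mem_toFinset, List.mem_map]
    constructor
    · rintro ⟨i, hi, rfl⟩
      exact (hc.mem i (hc.lt i hi)).1 hi
    · intro hx
      obtain ⟨i, hi, rfl⟩ := hc.ex x hx
      exact ⟨i, (hc.mem i hi).2 hx, rfl⟩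

end

/-! ### Index sets found by the search and matchings in the kept graphs -/

section
open Classical
variable {n : ℕ} {wt : Sym2 (Fin n) → ℝ}

theorem codeDisj_iff {e e' : Sym2 (Fin n)} :
    CodeDisj n (ecode e) (ecode e') ↔ ∀ v, ¬ (v ∈ e ∧ v ∈ e') := by
  have h1 : ∀ v, v ∈ e ↔ v = e.inf ∨ v = e.sup := fun v => by
    conv_lhs => rw [← mk_inf_sup e]
    exact Sym2.mem_iff
  have h2 : ∀ v, v ∈ e' ↔ v = e'.inf ∨ v = e'.sup := fun v => by
    conv_lhs => rw [← mk_inf_sup e']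
    exact Sym2.mem_iff
  simp only [CodeDisj, ecode_div, ecode_mod, h1, h2, ne_eq, ← Fin.ext_iff]
  constructor
  · rintro ⟨a, b, c, d⟩ v ⟨rfl | rfl, h | h⟩
    · exact a h
    · exact b h
    · exact c h
    · exact d h
  · intro h
    exact ⟨fun h' => h e.inf ⟨.inl rfl, .inl h'⟩, fun h' => h e.inf ⟨.inl rfl, .inr h'⟩,
      fun h' => h e.sup ⟨.inr rfl, .inl h'⟩, fun h' => h e.sup ⟨.inr rfl, .inr h'⟩⟩

theorem CodeDisj.symm {c d : ℕ} (h : CodeDisj n c d) : CodeDisj n d c :=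
  ⟨h.1.symm, h.2.2.1.symm, h.2.1.symm, h.2.2.2.symm⟩

section
variable {es : List (Sym2 (Fin n))} {e0 : Sym2 (Fin n)} {k : ℕ}

theorem getD_map_erec {i : ℕ} (hi : i < es.length) :
    (es.map (erec wt)).getD i default = erec wt (es.getD i e0) := by
  simp [hi]

theorem getD_injOn (hnd : es.Nodup) : Set.InjOn (fun i => es.getD i e0) (Set.Iio es.length) := by
  intro i hi j hj hij
  simp only [Set.mem_Iio] at hi hj
  simp only [List.getD_eq_getElem _ _ hi, List.getD_eq_getElem _ _ hj] at hij
  exact hnd.getElem_inj_iff.1 hij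

theorem selWeight_eq (hnd : es.Nodup) {A : Finset ℕ} (hA : A ⊆ Finset.range es.length) :
    selWeight (es.map (erec wt)) A = weight wt (A.image fun i => es.getD i e0) := by
  rw [selWeight, weight, Finset.sum_image]
  · refine Finset.sum_congr rfl fun i hi => ?_
    rw [getD_map_erec (e0 := e0) (Finset.mem_range.1 (hA hi))]
    rfl
  · exact fun i hi j hj h => getD_injOn hnd (Finset.mem_range.1 (hA hi)) (Finset.mem_range.1 (hA hj)) h

/-- The program compares an edge only with earlier ones; this covers all pairs since disjointness is
symmetric. As the list has no duplicates, index sets and sets of edges have the same size. -/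
theorem validSel_iff (hnd : es.Nodup) {A : Finset ℕ} (hA : A ⊆ Finset.range es.length) :
    ValidSel n k (es.map (erec wt)) A ↔
      IsKMatching (es.toFinset : Set (Sym2 (Fin n))) k (A.image fun i => es.getD i e0) := by
  have hinj : Set.InjOn (fun i => es.getD i e0) A := fun i hi j hj h =>
    getD_injOn hnd (Finset.mem_range.1 (hA hi)) (Finset.mem_range.1 (hA hj)) h
  have hcard : (A.image fun i => es.getD i e0).card = A.card := Finset.card_image_of_injOn hinj
  have hcode : ∀ i ∈ A, ((es.map (erec wt)).getD i default).1 = ecode (es.getD i e0) := fun i hi => by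
    rw [getD_map_erec (e0 := e0) (Finset.mem_range.1 (hA hi))]; rfl
  constructor
  · intro h
    refine ⟨?_, ?_, hcard.trans h.card⟩
    · intro e he
      obtain ⟨i, hi, rfl⟩ := Finset.mem_image.1 he
      have := Finset.mem_range.1 (hA hi)
      simp only [List.getD_eq_getElem _ _ this, List.coe_toFinset, Set.mem_ofPred_eq]
      exact List.getElem_mem _
    · intro e he e' he' hne
      obtain ⟨i, hi, rfl⟩ := Finset.mem_image.1 he
      obtain ⟨j, hj, rfl⟩ := Finset.mem_image.1 he'
      rw [← codeDisj_iff]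
      rcases lt_trichotomy i j with hij | rfl | hij
      · have := h.disj j hj i hi hij
        rw [hcode i hi, hcode j hj] at this
        exact this.symm
      · exact absurd rfl hne
      · have := h.disj i hi j hj hij
        rwa [hcode i hi, hcode j hj] at this
  · rintro ⟨-, h2, h3⟩
    refine ⟨by simpa using hA, by rw [← hcard, h3], fun i hi j hj hij => ?_⟩
    rw [hcode i hi, hcode j hj, codeDisj_iff]
    exact h2 _ (Finset.mem_image_of_mem _ hi) _ (Finset.mem_image_of_mem _ hj)
      fun h => hij.ne' (hinj hi hj h)

theorem selCodes_eq {A : Finset ℕ} (hA : A ⊆ Finset.range es.length) :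
    ((selCodes (es.map (erec wt)) A es.length).map fun c => s(c / n, c % n)).toFinset =
      (A.image fun i => es.getD i e0).image (Sym2.map Fin.val) := by
  ext x
  simp only [selCodes, List.mem_toFinset, List.mem_map, List.mem_filter, List.mem_range,
    decide_eq_true_iff, Finset.mem_image, exists_exists_and_eq_and]
  have h : ∀ i, i < es.length → s(((es.map (erec wt)).getD i default).1 / n,
      ((es.map (erec wt)).getD i default).1 % n) = Sym2.map Fin.val (es.getD i e0) := by
    intro i hi
    rw [getD_map_erec (e0 := e0) hi, erec, ecode_div, ecode_mod]
    conv_rhs => rw [← mk_inf_sup (es.getD i e0)]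
    rfl
  constructor
  · rintro ⟨i, ⟨h1, h2⟩, rfl⟩
    exact ⟨i, h2, (h i h1).symm⟩
  · rintro ⟨i, h2, rfl⟩
    have h1 := Finset.mem_range.1 (hA h2)
    exact ⟨i, ⟨h1, h2⟩, h i h1⟩

theorem exists_image_eq {M : Finset (Sym2 (Fin n))} (hM : ∀ e ∈ M, e ∈ es) :
    ∃ A ⊆ Finset.range es.length, (A.image fun i => es.getD i e0) = M := by
  refine ⟨(Finset.range es.length).filter fun i => es.getD i e0 ∈ M, Finset.filter_subset _ _, ?_⟩
  ext x
  simp only [Finset.mem_image, Finset.mem_filter, Finset.mem_range]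
  constructor
  · rintro ⟨i, ⟨-, h⟩, rfl⟩
    exact h
  · intro hx
    obtain ⟨i, hi, rfl⟩ := List.mem_iff_getElem.1 (hM x hx)
    exact ⟨i, ⟨hi, by simpa [hi] using hx⟩, by simp [hi]⟩

theorem ValidSel.isKMatching (hk : 1 ≤ k) (hnd : es.Nodup) {A : Finset ℕ}
    (h : ValidSel n k (es.map (erec wt)) A) :
    ∃ M, IsKMatching (es.toFinset : Set (Sym2 (Fin n))) k M ∧
      weight wt M = selWeight (es.map (erec wt)) A ∧
      ((selCodes (es.map (erec wt)) A (es.map (erec wt)).length).map fun c => s(c / n, c % n)).toFinset =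
        M.image (Sym2.map Fin.val) := by
  have hA : A ⊆ Finset.range es.length := by simpa using h.sub
  rcases es.eq_nil_or_concat with rfl | ⟨l0, e0, -⟩
  · simp only [List.length_nil, Finset.range_zero, Finset.subset_empty] at hA
    have := h.card
    simp [hA] at this
    omega
  · refine ⟨A.image fun i => es.getD i e0, (validSel_iff hnd hA).1 h, (selWeight_eq hnd hA).symm, ?_⟩
    rw [List.length_map, selCodes_eq hA]

theorem IsKMatching.exists_validSel (hk : 1 ≤ k) (hnd : es.Nodup) {M : Finset (Sym2 (Fin n))}
    (h : IsKMatching (es.toFinset : Set (Sym2 (Fin n))) k M) :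
    ∃ A, ValidSel n k (es.map (erec wt)) A ∧ selWeight (es.map (erec wt)) A = weight wt M := by
  have hM : ∀ e ∈ M, e ∈ es := fun e he => by simpa using h.1 e he
  rcases es.eq_nil_or_concat with rfl | ⟨l0, e0, -⟩
  · have : M = ∅ := Finset.eq_empty_of_forall_notMem fun e he => by simpa using hM e he
    have h3 := h.2.2
    rw [this, Finset.card_empty] at h3
    omega
  · obtain ⟨A, hA, rfl⟩ := exists_image_eq (e0 := e0) hM
    exact ⟨A, (validSel_iff hnd hA).2 h, selWeight_eq hnd hA⟩

end

/-- The answer found in the graphs with the edges `l h`. -/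
theorem Outcome.returns {k t : ℕ} (hk : 1 ≤ k) {L : ℕ → List (ℕ × ℝ)} {O : Answer ℕ}
    (hO : Outcome n k t L O) {l : ℕ → List (Sym2 (Fin n))}
    (hl : ∀ h < t, L h = (l h).map (erec wt) ∧ (l h).Nodup) {r : ℕ} {S : List (Insertion n)}
    {fs : Fin t → Fin n → Fin r}
    (hs : ∀ h : Fin t, (l h).toFinset = sketch wt k (fs h) (S.map Insertion.edge) S.length) :
    ∃ a : Answer (Fin n), WMatchInsReturns wt k S fs a ∧
      O = a.map fun M => M.image (Sym2.map Fin.val) := by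
  cases O with
  | none =>
    refine ⟨none, fun i M hM => ?_, rfl⟩
    obtain ⟨h1, h2⟩ := hl i i.2
    rw [← hs i] at hM
    obtain ⟨A, hA, -⟩ := hM.exists_validSel (wt := wt) hk h2
    exact hO i i.2 A (h1 ▸ hA)
  | some O =>
    obtain ⟨h, hh, A, hA, hO1, hmax⟩ := hO
    obtain ⟨h1, h2⟩ := hl h hh
    rw [h1] at hA hO1 hmax
    obtain ⟨M, hM, hw, himg⟩ := hA.isKMatching hk h2
    have key : ∀ (i : Fin t) (M' : Finset (Sym2 (Fin n))),
        IsKMatching ((sketch wt k (fs i) (S.map Insertion.edge) S.length : Finset (Sym2 (Fin n))) :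
          Set (Sym2 (Fin n))) k M' → weight wt M' ≤ weight wt M := by
      intro i M' hM'
      obtain ⟨g1, g2⟩ := hl i i.2
      rw [← hs i] at hM'
      obtain ⟨A', hA', hw'⟩ := hM'.exists_validSel (wt := wt) hk g2
      rw [hw, ← hw', ← g1]
      exact hmax i i.2 A' (by rw [g1]; exact hA')
    refine ⟨some M, ⟨⟨⟨h, hh⟩, ?_, fun M' hM' => key _ M' hM'⟩, fun i M' hM' => key i M' hM'.1⟩, ?_⟩
    · rw [← hs ⟨h, hh⟩]; exact hM
    · rw [hO1, himg]; rfl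

/-- The value `b = 4 * k ^ 2` is included: a batch that has just become full still counts as the
current one until another edge arrives. This matches the program, which exchanges the buffers only
when it has read the next edge. -/
theorem lastBatch_eq {k a b : ℕ} (h : 4 * k ^ 2 ∣ a) (h1 : 1 ≤ b) (h2 : b ≤ 4 * k ^ 2) :
    lastBatch k (a + b) = a := by
  obtain ⟨c, rfl⟩ := h
  rw [lastBatch, show 4 * k ^ 2 * c + b - 1 = 4 * k ^ 2 * c + (b - 1) by omega,
    Nat.mul_add_div (by omega), Nat.div_eq_of_lt (by omega), Nat.add_zero]

theorem sketch_step {r k : ℕ} {F : Fin n → Fin r} {es : List (Sym2 (Fin n))} {a b : ℕ}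
    (h : 4 * k ^ 2 ∣ a) (h1 : 1 ≤ b) (h2 : b ≤ 4 * k ^ 2) :
    sketch wt k F es (a + b) =
      reducedCompact wt k F (sketch wt k F es a ∪ ((es.take (a + b)).drop a).toFinset) := by
  rw [sketch, dif_neg (by omega), lastBatch_eq h h1 h2]

theorem IsRed.sketch {r k : ℕ} {F : Fin n → Fin r} {f : ℕ → ℕ} (hf : ∀ x : Fin n, f x = F x)
    {es1 es2 es3 l : List (Sym2 (Fin n))} (hnd : (l ++ es2).Nodup)
    (hl : l.toFinset = sketch wt k F (es1 ++ (es2 ++ es3)) es1.length)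
    (h : 4 * k ^ 2 ∣ es1.length) (h1 : 1 ≤ es2.length) (h2 : es2.length ≤ 4 * k ^ 2)
    {rs' : List (ℕ × ℝ)}
    (hred : IsRed n (2 * k) (4 * k ^ 2) f (l.map (erec wt) ++ es2.map (erec wt)) rs') :
    ∃ l' : List (Sym2 (Fin n)), rs' = l'.map (erec wt) ∧ l'.Nodup ∧
      l'.toFinset = KMatch.sketch wt k F (es1 ++ (es2 ++ es3)) (es1.length + es2.length) := by
  rw [← List.map_append] at hred
  obtain ⟨l', a1, a2, a3⟩ := hred.reducedCompact hf hnd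
  refine ⟨l', a1, a2, ?_⟩
  rw [a3, sketch_step h h1 h2, List.toFinset_append, hl]
  congr 3
  rw [List.take_length_add_append, List.drop_left, List.take_left]

theorem nodup_of_sublist {l es : List (Sym2 (Fin n))} (hnd : es.Nodup)
    (h : (l.map (erec wt)).Sublist (es.map (erec wt))) : l.Nodup := by
  refine List.Nodup.of_map (erec wt) ((hnd.map ?_).sublist h)
  exact fun e e' h => ecode_inj (congrArg Prod.fst h)

/-- The continuation `es2` is arbitrary so that the induction can move a batch from the prefix to
the rest of the stream. -/
theorem Batched.sketch {k pp t z : ℕ} (hk : 1 ≤ k) {xs : List (ℕ × ℝ)} {L : ℕ → List (ℕ × ℝ)}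
    (hB : Batched n (2 * k) (4 * k ^ 2) pp t z xs L) {es1 es2 : List (Sym2 (Fin n))}
    (hxs : xs = es1.map (erec wt)) (hnd : es1.Nodup) {h : ℕ} (hh : h < t) {r : ℕ} {F : Fin n → Fin r}
    (hF : ∀ x : Fin n, digitFn pp (4 * k ^ 2) z h x = F x) :
    4 * k ^ 2 ∣ es1.length ∧ ∃ l : List (Sym2 (Fin n)), L h = l.map (erec wt) ∧
      l.toFinset = KMatch.sketch wt k F (es1 ++ es2) es1.length := by
  induction hB generalizing es1 es2 with
  | nil =>
    obtain rfl : es1 = [] := by simpa using hxs.symm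
    exact ⟨by simp, [], rfl, by simp [KMatch.sketch]⟩
  | @step xs rs L L' hB1 hrs hred ih =>
    obtain ⟨es3, es4, rfl, rfl, rfl⟩ := List.map_eq_append_iff.1 hxs.symm
    have hnd' := hnd.of_append_left
    obtain ⟨h1, l, h2, h3⟩ := ih (es1 := es3) (es2 := es4 ++ es2) rfl hnd'
    rw [List.length_map] at hrs
    have hk2 : 1 ≤ k ^ 2 := Nat.one_le_pow _ _ hk
    have hr := hred h hh
    rw [h2] at hr
    have hsub := (hB1.sublist h hh).append_right (es4.map (erec wt))
    rw [h2, ← List.map_append, ← List.map_append] at hsub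
    obtain ⟨l', a1, a2, a3⟩ := hr.sketch hF (nodup_of_sublist hnd hsub) h3 h1 (by omega) (by omega)
    rw [List.append_assoc, List.length_append]
    exact ⟨(Nat.dvd_add_right h1).2 (by rw [hrs]), l', a1, a3⟩

theorem recsOf_eq {S : List (Insertion n)} {G : SimpleGraph (Fin n)} (hS : IsInsertStream S G wt) :
    recsOf S = (S.map Insertion.edge).map (erec wt) := by
  rw [recsOf, List.map_map]
  refine List.map_congr_left fun x hx => ?_
  simp only [recOf, Function.comp, erec, ecode, Insertion.edge, hS.weight_eq x hx, Sym2.inf_mk,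
    Sym2.sup_mk]
  simp

theorem Spec.returns {k pp t z : ℕ} (hk : 1 ≤ k) {S : List (Insertion n)} {G : SimpleGraph (Fin n)}
    (hS : IsInsertStream S G wt) {O : Answer ℕ}
    (hO : Spec n k (4 * k ^ 2) (2 * k) t pp z (recsOf S) O) {r : ℕ} {fs : Fin t → Fin n → Fin r}
    (hF : ∀ (h : Fin t) (x : Fin n), digitFn pp (4 * k ^ 2) z h x = fs h x) :
    ∃ a : Answer (Fin n), WMatchInsReturns wt k S fs a ∧
      O = a.map fun M => M.image (Sym2.map Fin.val) := by
  obtain ⟨xs, rs, L, L', hx, hne, hl, hB, hred, hout⟩ := hO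
  rw [recsOf_eq hS] at hx
  obtain ⟨es1, es2, hes, rfl, rfl⟩ := List.map_eq_append_iff.1 hx
  have hnd : (es1 ++ es2).Nodup := hes ▸ hS.nodup
  have hlen : S.length = es1.length + es2.length := by
    rw [← List.length_append, ← hes, List.length_map]
  have key : ∀ h : Fin t, ∃ l : List (Sym2 (Fin n)), L' h = l.map (erec wt) ∧ l.Nodup ∧
      l.toFinset = sketch wt k (fs h) (S.map Insertion.edge) S.length := by
    intro h
    obtain ⟨h1, l, h2, h3⟩ := hB.sketch hk (es2 := es2) rfl hnd.of_append_left h.2 (hF h)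
    have hr := hred h h.2
    rw [h2] at hr
    have hsub := (hB.sublist h h.2).append_right (es2.map (erec wt))
    rw [h2, ← List.map_append, ← List.map_append] at hsub
    rw [List.length_map] at hl
    rw [hes, hlen]
    -- The last batch is empty only if the whole stream is. Then the program reduces an empty graph
    -- to an empty graph, while the sketch at time 0 is empty by definition.
    rcases Nat.eq_zero_or_pos es2.length with h0 | h0
    · obtain rfl := List.eq_nil_of_length_eq_zero h0
      have : es1 = [] := by simpa using hne
      subst this
      have hl0 : L' h = [] := by
        have := hr.sublist
        have hl1 : l = [] := by simpa using hsub
        subst hl1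
        simpa using this
      exact ⟨[], hl0, by simp, by simp [sketch]⟩
    · have := hr.sketch (es3 := []) (hF h) (nodup_of_sublist hnd hsub) (by simpa using h3) h1 h0 hl
      simpa using this
  choose l a1 a2 a3 using key
  refine hout.returns hk (l := fun h => if hh : h < t then l ⟨h, hh⟩ else []) (fun h hh => ?_) (fun h => ?_)
  · simp only [hh, dif_pos]
    exact ⟨a1 ⟨h, hh⟩, a2 ⟨h, hh⟩⟩
  · simp only [h.2, dif_pos]
    exact a3 h

end

/-! ## The graphs maintained by the algorithm contain heavy matchings -/

section
open Classical
variable {n r : ℕ} {wt : Sym2 (Fin n) → ℝ} {k : ℕ} {F : Fin n → Fin r}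

/-- The edges of `M` join distinct classes, and no class meets two of them. -/
def Rainbow (F : Fin n → Fin r) (M : Finset (Sym2 (Fin n))) : Prop :=
  (∀ e ∈ M, ¬ (e.map F).IsDiag) ∧
    ∀ e ∈ M, ∀ e' ∈ M, e ≠ e' → ∀ i, ¬ (i ∈ e.map F ∧ i ∈ e'.map F)

theorem Rainbow.isKMatching {M : Finset (Sym2 (Fin n))} (h : Rainbow F M) (hk : M.card = k)
    {E : Set (Sym2 (Fin n))} (hE : ∀ e ∈ M, e ∈ E) : IsKMatching E k M :=
  ⟨hE, fun e he e' he' hne v hv => h.2 e he e' he' hne (F v)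
    ⟨Sym2.mem_map.2 ⟨v, hv.1, rfl⟩, Sym2.mem_map.2 ⟨v, hv.2, rfl⟩⟩, hk⟩

/-- The lightest of these edges has all the others above it, so there are fewer than `m` others. -/
theorem card_amongHeaviest_le (m : ℕ) (E : Finset (Sym2 (Fin n))) :
    (E.filter fun e => AmongHeaviest wt m E e).card ≤ m := by
  set T := E.filter fun e => AmongHeaviest wt m E e with hT
  rcases T.eq_empty_or_nonempty with h | h
  · simp [h]
  · obtain ⟨x, hx, hmin⟩ := T.exists_min_image (beta wt) h
    have h1 := (Finset.mem_filter.1 hx).2.2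
    have h2 : T.erase x ⊆ E.filter fun e' => beta wt x < beta wt e' := by
      intro y hy
      rw [Finset.mem_erase] at hy
      rw [Finset.mem_filter]
      exact ⟨(Finset.mem_filter.1 hy.2).1, lt_of_le_of_ne (hmin y hy.2)
        fun h => hy.1 (beta_injective h).symm⟩
    have h3 := Finset.card_le_card h2
    rw [Finset.card_erase_of_mem hx] at h3
    omega

theorem compact_inj {H : Finset (Sym2 (Fin n))} {e e' : Sym2 (Fin n)}
    (he : e ∈ compactSubgraph wt F H) (he' : e' ∈ compactSubgraph wt F H) (h : e.map F = e'.map F) :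
    e = e' := by
  rw [compactSubgraph, Finset.mem_filter] at he he'
  exact beta_injective (le_antisymm (he'.2.2 e he.1 h) (he.2.2 e' he'.1 h.symm))

theorem exists_compact {H : Finset (Sym2 (Fin n))} {e : Sym2 (Fin n)} (he : e ∈ H)
    (hd : ¬ (e.map F).IsDiag) :
    ∃ e' ∈ compactSubgraph wt F H, e'.map F = e.map F ∧ beta wt e ≤ beta wt e' := by
  obtain ⟨x, hx, hmax⟩ := (H.filter fun e' => e'.map F = e.map F).exists_max_image (beta wt)
    ⟨e, by simp [he]⟩
  rw [Finset.mem_filter] at hx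
  refine ⟨x, ?_, hx.2, hmax e (by simp [he])⟩
  rw [compactSubgraph, Finset.mem_filter]
  refine ⟨hx.1, by rwa [hx.2], fun y hy h => hmax y ?_⟩
  rw [Finset.mem_filter]
  exact ⟨hy, h.trans hx.2⟩

theorem reducedCompact_subset (H : Finset (Sym2 (Fin n))) : reducedCompact wt k F H ⊆ H :=
  ((Finset.filter_subset _ _).trans (Finset.filter_subset _ _)).trans (Finset.filter_subset _ _)

/-- An edge of `H` has a replacement in the reduced compact subgraph that avoids a small set of
classes. -/
theorem exists_reducedCompact {H : Finset (Sym2 (Fin n))} {e : Sym2 (Fin n)} (he : e ∈ H)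
    (hd : ¬ (e.map F).IsDiag) {U : Finset (Fin r)} (hU : U.card + 2 ≤ 2 * k)
    (hdisj : ∀ i ∈ e.map F, i ∉ U) :
    ∃ e' ∈ reducedCompact wt k F H, (∀ i ∈ e'.map F, i ∉ U) ∧ wt e ≤ wt e' := by
  obtain ⟨e1, he1, hm1, hb1⟩ := exists_compact (wt := wt) he hd
  -- The replacement is the heaviest edge of the compact subgraph that avoids `U`. The set is
  -- nonempty because it contains the heaviest edge between the two classes of `e`. By maximality
  -- every heavier edge meets `U`.
  obtain ⟨x, hx, hmax⟩ := ((compactSubgraph wt F H).filter fun e' => ∀ i ∈ e'.map F, i ∉ U).exists_max_image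
    (beta wt) ⟨e1, Finset.mem_filter.2 ⟨he1, by rwa [hm1]⟩⟩
  obtain ⟨hxC, hxU⟩ := Finset.mem_filter.1 hx
  have hhit : ∀ y ∈ compactSubgraph wt F H, beta wt x < beta wt y → ∃ j ∈ U, j ∈ y.map F := by
    intro y hy hlt
    by_contra! h
    exact not_lt.2 (hmax y (Finset.mem_filter.2 ⟨hy, fun i hi hiU => h i hiU hi⟩)) hlt
  have hdeg : x ∈ degreeReduced wt k F H := by
    rw [degreeReduced, Finset.mem_filter]
    refine ⟨hxC, fun i hi => ⟨Finset.mem_filter.2 ⟨hxC, hi⟩, ?_⟩⟩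
    -- At a class `i` outside `U` each heavier edge leads into `U`, and different edges lead to
    -- different classes because the compact subgraph has one edge per pair of classes. So there are
    -- at most `U.card < 2k` of them.
    have : ((((compactSubgraph wt F H).filter fun e' => i ∈ e'.map F).filter
        fun e' => beta wt x < beta wt e').image (Sym2.map F)) ⊆ U.image fun j => s(i, j) := by
      intro p hp
      obtain ⟨y, hy, rfl⟩ := Finset.mem_image.1 hp
      rw [Finset.mem_filter, Finset.mem_filter] at hy
      obtain ⟨j, hj, hjy⟩ := hhit y hy.1.1 hy.2
      have hij : i ≠ j := fun h => hxU i hi (h ▸ hj)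
      exact Finset.mem_image.2 ⟨j, hj, ((Sym2.mem_and_mem_iff hij).1 ⟨hy.1.2, hjy⟩).symm⟩
    have h1 := (Finset.card_le_card this).trans Finset.card_image_le
    rw [Finset.card_image_of_injOn] at h1
    · omega
    · intro y hy y' hy' h
      simp only [Finset.coe_filter, Set.mem_ofPred_eq, Finset.mem_filter] at hy hy'
      exact compact_inj hy.1.1 hy'.1.1 h
  refine ⟨x, ?_, hxU, ?_⟩
  · rw [reducedCompact, Finset.mem_filter]
    refine ⟨hdeg, hdeg, ?_⟩
    -- Each heavier survivor meets a class of `U`, and after the first reduction a class meets at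
    -- most `2k` edges. This leaves at most `(2k - 2) * 2k < 4k²` heavier survivors.
    have : ((degreeReduced wt k F H).filter fun e' => beta wt x < beta wt e') ⊆
        U.biUnion fun i => ((compactSubgraph wt F H).filter fun e' => i ∈ e'.map F).filter
          fun y => AmongHeaviest wt (2 * k) ((compactSubgraph wt F H).filter fun e' => i ∈ e'.map F) y := by
      intro y hy
      rw [Finset.mem_filter, degreeReduced, Finset.mem_filter] at hy
      obtain ⟨j, hj, hjy⟩ := hhit y hy.1.1 hy.2
      rw [Finset.mem_biUnion]
      exact ⟨j, hj, Finset.mem_filter.2 ⟨Finset.mem_filter.2 ⟨hy.1.1, hjy⟩, hy.1.2 j hjy⟩⟩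
    have h1 := (Finset.card_le_card this).trans
      (Finset.card_biUnion_le_card_mul _ _ (2 * k) fun i _ => card_amongHeaviest_le _ _)
    have h2 : U.card * (2 * k) ≤ (2 * k - 2) * (2 * k) := Nat.mul_le_mul_right _ (by omega)
    obtain ⟨j, rfl⟩ : ∃ j, k = j + 1 := ⟨k - 1, by omega⟩
    have h3 : (2 * (j + 1) - 2) * (2 * (j + 1)) + 4 * (j + 1) = 4 * (j + 1) ^ 2 := by
      rw [show 2 * (j + 1) - 2 = 2 * j by omega]; ring
    omega
  · have h1 := hb1.trans (hmax e1 (Finset.mem_filter.2 ⟨he1, by rwa [hm1]⟩))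
    rw [beta, beta, Prod.Lex.toLex_le_toLex] at h1
    rcases h1 with h | h
    · exact h.le
    · exact h.1.le

/-- A rainbow matching can be moved into the reduced compact subgraph. -/
theorem Rainbow.exchange {H X M : Finset (Sym2 (Fin n))} (hM : Rainbow F M) (hk : M.card = k)
    (hsub : M ⊆ H ∪ X) : ∃ M', Rainbow F M' ∧ M'.card = k ∧ weight wt M ≤ weight wt M' ∧
      M' ⊆ reducedCompact wt k F H ∪ X := by
  set R := reducedCompact wt k F H with hR
  -- The edges outside the reduced graph are replaced one at a time. The set `X` stands for the
  -- edges that the stream has yet to deliver; they are left alone.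
  induction hc : (M \ (R ∪ X)).card using Nat.strong_induction_on generalizing M with
  | _ c ih =>
    rcases (M \ (R ∪ X)).eq_empty_or_nonempty with h | ⟨e, he⟩
    · exact ⟨M, hM, hk, le_rfl, Finset.sdiff_eq_empty_iff_subset.1 h⟩
    · obtain ⟨heM, heRX⟩ := Finset.mem_sdiff.1 he
      rw [Finset.mem_union, not_or] at heRX
      have heH : e ∈ H := (Finset.mem_union.1 (hsub heM)).resolve_right heRX.2
      -- These are the classes met by the other `k - 1` edges, at most `2k - 2` of them. Avoiding
      -- them keeps the new set rainbow and ensures that the replacement is a new edge.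
      set U := (M.erase e).biUnion fun e' => Finset.univ.filter fun i => i ∈ e'.map F with hU
      have hcard : U.card ≤ (M.erase e).card * 2 := by
        refine Finset.card_biUnion_le_card_mul _ _ _ fun y _ => ?_
        have : (Finset.univ.filter fun i => i ∈ y.map F) ⊆ {F y.inf, F y.sup} := by
          intro i hi
          rw [Finset.mem_filter, map_eq_mk, Sym2.mem_iff] at hi
          simpa using hi.2
        exact (Finset.card_le_card this).trans Finset.card_le_two
      have hpos := Finset.card_pos.2 ⟨e, heM⟩
      rw [Finset.card_erase_of_mem heM] at hcard
      have hUmem : ∀ i, i ∈ U ↔ ∃ y ∈ M, y ≠ e ∧ i ∈ y.map F := by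
        intro i
        simp only [hU, Finset.mem_biUnion, Finset.mem_erase, Finset.mem_filter, Finset.mem_univ, true_and]
        exact ⟨fun ⟨y, h, h'⟩ => ⟨y, h.2, h.1, h'⟩, fun ⟨y, h, h1, h'⟩ => ⟨y, ⟨h1, h⟩, h'⟩⟩
      obtain ⟨e', he', hdisj, hw⟩ := exists_reducedCompact (wt := wt) (k := k) heH (hM.1 e heM) (U := U)
        (by omega) (fun i hi hiU => by
          obtain ⟨y, hy, hne, hiy⟩ := (hUmem i).1 hiU
          exact hM.2 y hy e heM hne i ⟨hiy, hi⟩)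
      have hd' : ¬ (e'.map F).IsDiag := by
        have h1 := he'
        rw [reducedCompact, Finset.mem_filter, degreeReduced, Finset.mem_filter, compactSubgraph,
          Finset.mem_filter] at h1
        exact h1.1.1.2.1
      have hnot : e' ∉ M.erase e := by
        intro h
        rw [Finset.mem_erase] at h
        have h1 : F e'.inf ∈ e'.map F := by rw [map_eq_mk]; simp
        exact hdisj _ h1 ((hUmem _).2 ⟨e', h.2, h.1, h1⟩)
      have hM' : Rainbow F (insert e' (M.erase e)) := by
        constructor
        · intro y hy
          rcases Finset.mem_insert.1 hy with rfl | hy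
          · exact hd'
          · exact hM.1 y (Finset.mem_of_mem_erase hy)
        · intro y hy y' hy' hne i hi
          rcases Finset.mem_insert.1 hy with h1 | hy <;> rcases Finset.mem_insert.1 hy' with h2 | hy'
          · exact hne (h1.trans h2.symm)
          · rw [Finset.mem_erase] at hy'
            exact hdisj i (h1 ▸ hi.1) ((hUmem i).2 ⟨y', hy'.2, hy'.1, hi.2⟩)
          · rw [Finset.mem_erase] at hy
            exact hdisj i (h2 ▸ hi.2) ((hUmem i).2 ⟨y, hy.2, hy.1, hi.1⟩)
          · exact hM.2 y (Finset.mem_of_mem_erase hy) y' (Finset.mem_of_mem_erase hy') hne i hi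
      have hsub' : insert e' (M.erase e) ⊆ H ∪ X := by
        intro y hy
        rcases Finset.mem_insert.1 hy with rfl | hy
        · exact Finset.mem_union_left _ (reducedCompact_subset H he')
        · exact hsub (Finset.mem_of_mem_erase hy)
      have hss : insert e' (M.erase e) \ (R ∪ X) ⊂ M \ (R ∪ X) := by
        refine (Finset.ssubset_iff_of_subset ?_).2 ⟨e, he, ?_⟩
        · intro y hy
          obtain ⟨h1, h2⟩ := Finset.mem_sdiff.1 hy
          rcases Finset.mem_insert.1 h1 with rfl | h1
          · exact absurd (Finset.mem_union_left _ he') h2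
          · exact Finset.mem_sdiff.2 ⟨Finset.mem_of_mem_erase h1, h2⟩
        · intro h
          rcases Finset.mem_insert.1 (Finset.mem_sdiff.1 h).1 with rfl | h1
          · exact heRX.1 he'
          · exact Finset.notMem_erase _ _ h1
      obtain ⟨M', a1, a2, a3, a4⟩ := ih _ (hc ▸ Finset.card_lt_card hss) hM'
        (by rw [Finset.card_insert_of_notMem hnot, Finset.card_erase_of_mem heM]; omega) hsub' rfl
      refine ⟨M', a1, a2, le_trans ?_ a3, a4⟩
      rw [weight, weight, Finset.sum_insert hnot, ← Finset.add_sum_erase M wt heM]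
      linarith

theorem sketch_subset (es : List (Sym2 (Fin n))) (s : ℕ) : sketch wt k F es s ⊆ es.toFinset := by
  induction s using Nat.strong_induction_on with
  | _ s ih =>
    rw [sketch]
    split_ifs with hs
    · exact Finset.empty_subset _
    · refine (reducedCompact_subset _).trans (Finset.union_subset (ih _ (lastBatch_lt hs)) ?_)
      intro x hx
      rw [List.mem_toFinset] at *
      exact List.mem_of_mem_take (List.mem_of_mem_drop hx)

/-- At any time the matching can be taken from the kept graph together with the edges still to come.
The graph at time `s` is built from the one at the last batch end, so the induction jumps back to
that time instead of going edge by edge, and one exchange covers all edges in between. -/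
theorem Rainbow.sketch {es : List (Sym2 (Fin n))} {M : Finset (Sym2 (Fin n))} (hM : Rainbow F M)
    (hk : M.card = k) (hsub : M ⊆ es.toFinset) (s : ℕ) :
    ∃ M', Rainbow F M' ∧ M'.card = k ∧ weight wt M ≤ weight wt M' ∧
      M' ⊆ KMatch.sketch wt k F es s ∪ (es.drop s).toFinset := by
  induction s using Nat.strong_induction_on with
  | _ s ih =>
    rw [KMatch.sketch]
    split_ifs with hs
    · subst hs
      exact ⟨M, hM, hk, le_rfl, by simpa using hsub⟩
    · obtain ⟨M1, a1, a2, a3, a4⟩ := ih _ (lastBatch_lt hs)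
      have h1 : es.drop (lastBatch k s) = (es.take s).drop (lastBatch k s) ++ es.drop s := by
        conv_lhs => rw [← List.take_append_drop s es]
        rw [List.drop_append]
        congr 1
        rw [List.length_take]
        rcases le_total s es.length with h | h
        · rw [min_eq_left h, Nat.sub_eq_zero_of_le (lastBatch_lt hs).le, List.drop_zero]
        · rw [List.drop_eq_nil_of_le h, List.drop_nil]
      rw [h1, List.toFinset_append, ← Finset.union_assoc] at a4
      obtain ⟨M2, b1, b2, b3, b4⟩ := a1.exchange (wt := wt) a2 a4
      exact ⟨M2, b1, b2, a3.trans b3, b4⟩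

/-- A function that is injective on the endpoints of `M` makes `M` rainbow. When the stream is over
no edges are still to come, so the moved matching lies in the kept graph itself. -/
theorem IsMaxWeightedKMatching.exists_sketch {S : List (Insertion n)} {G : SimpleGraph (Fin n)}
    (hS : IsInsertStream S G wt) {M : Finset (Sym2 (Fin n))}
    (hM : IsMaxWeightedKMatching G.edgeSet wt k M)
    (hF : ∀ e ∈ M, ∀ e' ∈ M, ∀ u ∈ e, ∀ v ∈ e', F u = F v → u = v) :
    ∃ M', IsKMatching (sketch wt k F (S.map Insertion.edge) S.length : Set (Sym2 (Fin n))) k M' ∧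
      weight wt M ≤ weight wt M' := by
  have hR : Rainbow F M := by
    constructor
    · intro e he hd
      rw [map_eq_mk, Sym2.mk_isDiag_iff] at hd
      have h1 : e.inf ∈ s(e.inf, e.sup) := Sym2.mem_mk_left _ _
      have h2 : e.sup ∈ s(e.inf, e.sup) := Sym2.mem_mk_right _ _
      rw [mk_inf_sup] at h1 h2
      have := hF e he e he _ h1 _ h2 hd
      refine G.not_isDiag_of_mem_edgeSet (hM.1.1 e he) ?_
      rw [← mk_inf_sup e, Sym2.mk_isDiag_iff]
      exact this
    · rintro e he e' he' hne i ⟨h1, h2⟩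
      obtain ⟨u, hu, rfl⟩ := Sym2.mem_map.1 h1
      obtain ⟨v, hv, huv⟩ := Sym2.mem_map.1 h2
      obtain rfl := hF e' he' e he v hv u hu huv
      exact hM.1.2.1 e he e' he' hne v ⟨hu, hv⟩
  obtain ⟨M', a1, a2, a3, a4⟩ := hR.sketch (wt := wt) (es := S.map Insertion.edge) hM.1.2.2
    (fun e he => List.mem_toFinset.2 ((hS.mem_iff e).2 (hM.1.1 e he))) S.length
  refine ⟨M', a1.isKMatching a2 fun e he => ?_, a3⟩
  have := a4 he
  rwa [List.drop_of_length_le (by simp), List.toFinset_nil, Finset.union_empty] at this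

theorem sketch_subset_edgeSet {S : List (Insertion n)} {G : SimpleGraph (Fin n)}
    (hS : IsInsertStream S G wt) {e : Sym2 (Fin n)} {s : ℕ}
    (he : e ∈ sketch wt k F (S.map Insertion.edge) s) : e ∈ G.edgeSet :=
  (hS.mem_iff e).1 (List.mem_toFinset.1 (sketch_subset _ _ he))

theorem IsKMatching.mono {E E' : Set (Sym2 (Fin n))} {M : Finset (Sym2 (Fin n))}
    (h : IsKMatching E k M) (hE : ∀ e ∈ E, e ∈ E') : IsKMatching E' k M :=
  ⟨fun e he => hE e (h.1 e he), h.2⟩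

theorem WMatchInsReturns.eq_none {t : ℕ} {S : List (Insertion n)} {G : SimpleGraph (Fin n)}
    (hS : IsInsertStream S G wt) {fs : Fin t → Fin n → Fin r} {a : Answer (Fin n)}
    (ha : WMatchInsReturns wt k S fs a) (hG : ¬ ∃ M, IsKMatching G.edgeSet k M) : a = none := by
  cases a with
  | none => rfl
  | some M =>
    obtain ⟨⟨i, hi⟩, -⟩ := ha
    exact absurd ⟨M, hi.1.mono fun e he => sketch_subset_edgeSet hS (Finset.mem_coe.1 he)⟩ hG

/-- One good hash function is enough: its graph contains a matching as heavy as `M`, the answer is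
at least as heavy as that, and the answer is a matching of `G` because all kept graphs are subgraphs
of `G`. -/
theorem WMatchInsReturns.isMax {t : ℕ} {S : List (Insertion n)} {G : SimpleGraph (Fin n)}
    (hS : IsInsertStream S G wt) {fs : Fin t → Fin n → Fin r} {a : Answer (Fin n)}
    (ha : WMatchInsReturns wt k S fs a) {M : Finset (Sym2 (Fin n))}
    (hM : IsMaxWeightedKMatching G.edgeSet wt k M) {i : Fin t}
    (hi : ∀ e ∈ M, ∀ e' ∈ M, ∀ u ∈ e, ∀ v ∈ e', fs i u = fs i v → u = v) :
    ∃ M', a = some M' ∧ IsMaxWeightedKMatching G.edgeSet wt k M' := by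
  obtain ⟨M1, h1, h2⟩ := hM.exists_sketch hS hi
  have hG : ∀ (j : Fin t) (M' : Finset (Sym2 (Fin n))), IsKMatching
      (sketch wt k (fs j) (S.map Insertion.edge) S.length : Set (Sym2 (Fin n))) k M' →
      IsKMatching G.edgeSet k M' := fun j M' h =>
    h.mono fun e he => sketch_subset_edgeSet hS (Finset.mem_coe.1 he)
  cases a with
  | none => exact absurd h1 (ha i M1)
  | some M' =>
    obtain ⟨⟨j, hj⟩, hmax⟩ := ha
    refine ⟨M', rfl, hG j M' hj.1, fun M2 hM2 => ?_⟩
    -- The answer is compared only with maximum matchings of the kept graphs; `M1` is one, since no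
    -- matching of `G` is heavier than `M`.
    exact (hM.2 M2 hM2).trans (h2.trans (hmax i M1 ⟨h1, fun M3 hM3 => (hM.2 M3 (hG i M3 hM3)).trans h2⟩))

end

/-! ## A universal family of hash functions -/

/-- The hash function with index `z`. -/
def hashIdx (p r z : ℕ) : ℕ → ℕ := hashFn p r (z / p + 1) (z % p)

theorem digitFn_eq (p r z h : ℕ) :
    digitFn p r z h = hashIdx p r (z / (p * (p - 1)) ^ h % (p * (p - 1))) := rfl

section
open Classical

/-- A residue class modulo `r` has at most `⌈p / r⌉` elements below `p`. Without `u` itself at most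
`⌈p / r⌉ - 1 ≤ (p - 1) / r` remain. -/
theorem card_congruent_le {p r u : ℕ} (hr : 0 < r) (hu : u < p) :
    r * ((Finset.range p).filter fun v => u ≠ v ∧ u % r = v % r).card ≤ p - 1 := by
  have h1 : ((Finset.range p).filter fun v => u ≠ v ∧ u % r = v % r) =
      ((Finset.range p).filter fun v => v ≡ u [MOD r]).erase u := by
    ext v
    rw [Finset.mem_filter, Finset.mem_erase, Finset.mem_filter]
    constructor
    · rintro ⟨a, b, c⟩; exact ⟨b.symm, a, c.symm⟩
    · rintro ⟨a, b, c⟩; exact ⟨b, a.symm, c.symm⟩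
  have h2 := Nat.count_modEq_card p hr u
  rw [Nat.count_eq_card_filter_range] at h2
  rw [h1, Finset.card_erase_of_mem (by simp [hu, Nat.ModEq.refl])]
  have h4 : r * (p / r) + p % r = p := Nat.div_add_mod p r
  have h3 : ((Finset.range p).filter fun v => v ≡ u [MOD r]).card =
      p / r + if u % r < p % r then 1 else 0 := by
    rw [← h2]
  rw [h3]
  split_ifs with h
  · rw [Nat.add_sub_cancel]; omega
  · rcases Nat.eq_zero_or_pos (p / r) with h0 | h0
    · rw [h0]; simp
    · have : r * (p / r + 0 - 1) + r = r * (p / r) := by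
        rw [← Nat.mul_add_one]; congr 1; omega
      omega

theorem card_congruent_pairs_le {p r : ℕ} (hr : 0 < r) :
    r * ((Finset.range p ×ˢ Finset.range p).filter fun q => q.1 ≠ q.2 ∧ q.1 % r = q.2 % r).card ≤
      p * (p - 1) := by
  rw [Finset.card_filter, Finset.sum_product, Finset.mul_sum]
  refine (Finset.sum_le_card_nsmul _ _ (p - 1) fun u hu => ?_).trans (by simp)
  rw [← Finset.card_filter]
  exact card_congruent_le hr (Finset.mem_range.1 hu)

/-- The affine functions with different indices take different values at two points. -/
theorem affine_inj {p a b a' b' x y : ℕ} (hp : p.Prime) (hx : x < p) (hy : y < p) (hxy : x ≠ y)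
    (ha : a < p) (ha' : a' < p) (hb : b < p) (hb' : b' < p)
    (h1 : (a * x + b) % p = (a' * x + b') % p) (h2 : (a * y + b) % p = (a' * y + b') % p) :
    a = a' ∧ b = b' := by
  have := Fact.mk hp
  have h1 := (ZMod.natCast_eq_natCast_iff _ _ p).2 h1
  have h2 := (ZMod.natCast_eq_natCast_iff _ _ p).2 h2
  push_cast at h1 h2
  have hne : (x : ZMod p) - y ≠ 0 := by
    intro h
    rw [sub_eq_zero, ZMod.natCast_eq_natCast_iff, Nat.ModEq, Nat.mod_eq_of_lt hx, Nat.mod_eq_of_lt hy] at h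
    exact hxy h
  have h3 : ((a : ZMod p) - a') * (x - y) = 0 := by linear_combination h1 - h2
  have h4 : (a : ZMod p) = a' := sub_eq_zero.1 ((mul_eq_zero.1 h3).resolve_right hne)
  have h5 : (b : ZMod p) = b' := by rw [h4] at h1; exact add_left_cancel h1
  rw [ZMod.natCast_eq_natCast_iff, Nat.ModEq, Nat.mod_eq_of_lt ha, Nat.mod_eq_of_lt ha'] at h4
  rw [ZMod.natCast_eq_natCast_iff, Nat.ModEq, Nat.mod_eq_of_lt hb, Nat.mod_eq_of_lt hb'] at h5
  exact ⟨h4, h5⟩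

/-- The argument of Carter and Wegman. The values of `a x + b` and `a y + b` modulo `p` differ
because `a ≠ 0`, and together they determine `a` and `b`. So the colliding indices inject into the
pairs of distinct residues below `p` that are congruent modulo `r`. -/
theorem card_collisions_le {p r x y : ℕ} (hp : p.Prime) (hr : 0 < r) (hx : x < p) (hy : y < p)
    (hxy : x ≠ y) :
    r * ((Finset.range (p * (p - 1))).filter fun z => hashIdx p r z x = hashIdx p r z y).card ≤
      p * (p - 1) := by
  refine le_trans (Nat.mul_le_mul_left _ ?_) (card_congruent_pairs_le (p := p) hr)
  have hp0 := hp.pos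
  have ha : ∀ z < p * (p - 1), z / p + 1 < p := fun z hz => by
    have := Nat.div_lt_of_lt_mul hz
    omega
  have hb : ∀ z, z % p < p := fun z => Nat.mod_lt _ hp0
  refine Finset.card_le_card_of_injOn
    (fun z => (((z / p + 1) * x + z % p) % p, ((z / p + 1) * y + z % p) % p)) ?_ ?_
  · intro z hz
    simp only [Finset.coe_filter, Finset.mem_range, Set.mem_ofPred_eq, Finset.mem_product] at hz ⊢
    refine ⟨⟨Nat.mod_lt _ hp0, Nat.mod_lt _ hp0⟩, fun h => ?_, hz.2⟩
    have := Fact.mk hp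
    have h1 := (ZMod.natCast_eq_natCast_iff _ _ p).2 h
    push_cast at h1
    have h2 : (((z / p + 1 : ℕ) : ZMod p)) * (x - y) = 0 := by push_cast; linear_combination h1
    rcases mul_eq_zero.1 h2 with h3 | h3
    · rw [ZMod.natCast_eq_zero_iff] at h3
      exact absurd (Nat.le_of_dvd (Nat.succ_pos _) h3) (not_le.2 (ha z hz.1))
    · rw [sub_eq_zero, ZMod.natCast_eq_natCast_iff, Nat.ModEq, Nat.mod_eq_of_lt hx,
        Nat.mod_eq_of_lt hy] at h3
      exact hxy h3
  · intro z hz z' hz' h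
    simp only [Finset.coe_filter, Finset.mem_range, Set.mem_ofPred_eq] at hz hz'
    rw [Prod.mk.injEq] at h
    obtain ⟨h1, h2⟩ := affine_inj hp hx hy hxy (ha z hz.1) (ha z' hz'.1) (hb z) (hb z') h.1 h.2
    rw [← Nat.div_add_mod z p, ← Nat.div_add_mod z' p, h2, Nat.succ_injective h1]

end

/-- The universal family. -/
def hashFamily (n r : ℕ) (hr : 0 < r) :
    Fin (hashPrime n * (hashPrime n - 1)) → Fin n → Fin r :=
  fun z x => ⟨hashIdx (hashPrime n) r z x, Nat.mod_lt _ hr⟩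

section
open Classical
variable {n r : ℕ} {hr : 0 < r}

theorem card_hashFamily_le {x y : Fin n} (hxy : x ≠ y) :
    r * (Finset.univ.filter fun z => hashFamily n r hr z x = hashFamily n r hr z y).card ≤
      hashPrime n * (hashPrime n - 1) := by
  have hn := le_hashPrime n
  have h := card_collisions_le (hashPrime_prime n) hr (x := x) (y := y) (by have := x.2; omega)
    (by have := y.2; omega) (fun h => hxy (Fin.ext h))
  refine le_trans (Nat.mul_le_mul_left _ ?_) h
  refine Finset.card_le_card_of_injOn Fin.val ?_ (Fin.val_injective.injOn)
  intro z hz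
  rw [Finset.mem_coe, Finset.mem_filter] at hz ⊢
  exact ⟨Finset.mem_range.2 z.2, congrArg Fin.val hz.2⟩

theorem isUniversal_hashFamily : IsUniversal (hashFamily n r hr) := by
  intro x y hxy
  have h := card_hashFamily_le (hr := hr) hxy
  rw [Nat.card_eq_fintype_card, Fintype.card_subtype, le_div_iff₀ (by exact_mod_cast hr), Fintype.card_fin,
    mul_comm]
  exact_mod_cast h

/-- At most half of the functions have a collision in a set of at most `2k` vertices. -/
theorem two_mul_card_bad_le {k : ℕ} {hr : 0 < 4 * k ^ 2} {U : Finset (Fin n)} (hU : U.card ≤ 2 * k) :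
    2 * (Finset.univ.filter fun z => ∃ x ∈ U, ∃ y ∈ U,
      hashFamily n (4 * k ^ 2) hr z x = hashFamily n (4 * k ^ 2) hr z y ∧ x ≠ y).card ≤
      hashPrime n * (hashPrime n - 1) := by
  set N := hashPrime n * (hashPrime n - 1) with hN
  have hsub : (Finset.univ.filter fun z => ∃ x ∈ U, ∃ y ∈ U,
      hashFamily n (4 * k ^ 2) hr z x = hashFamily n (4 * k ^ 2) hr z y ∧ x ≠ y) ⊆
      (U.offDiag.image Sym2.mk.uncurry).biUnion fun e => Finset.univ.filter fun z =>
        hashFamily n (4 * k ^ 2) hr z e.inf = hashFamily n (4 * k ^ 2) hr z e.sup := by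
    intro z hz
    simp only [Finset.mem_filter, Finset.mem_univ, true_and] at hz
    obtain ⟨x, hx, y, hy, h, hne⟩ := hz
    rw [Finset.mem_biUnion]
    refine ⟨s(x, y), Finset.mem_image.2 ⟨(x, y), by simp [hx, hy, hne], rfl⟩, ?_⟩
    rw [Finset.mem_filter]
    refine ⟨Finset.mem_univ _, ?_⟩
    simp only [Sym2.inf_mk, Sym2.sup_mk]
    rcases le_total x y with hxy | hxy
    · simpa [hxy] using h
    · simpa [hxy] using h.symm
  have hcard : ∀ e ∈ U.offDiag.image Sym2.mk.uncurry, 4 * k ^ 2 * (Finset.univ.filter fun z =>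
      hashFamily n (4 * k ^ 2) hr z e.inf = hashFamily n (4 * k ^ 2) hr z e.sup).card ≤ N := by
    intro e he
    obtain ⟨⟨x, y⟩, hxy, rfl⟩ := Finset.mem_image.1 he
    refine card_hashFamily_le ?_
    simp only [Finset.mem_offDiag] at hxy
    simp only [Function.uncurry, Sym2.inf_mk, Sym2.sup_mk]
    intro h
    exact hxy.2.2 (inf_eq_sup.1 h)
  have h1 := Nat.mul_le_mul_left (4 * k ^ 2) ((Finset.card_le_card hsub).trans Finset.card_biUnion_le)
  rw [Finset.mul_sum] at h1
  have h2 := h1.trans (Finset.sum_le_card_nsmul _ _ N hcard)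
  rw [Sym2.card_image_offDiag, smul_eq_mul] at h2
  -- There are at most `2k²` unordered pairs, and each is identified by at most `N / (4k²)` of the
  -- functions, which gives one half. Summing over ordered pairs would lose a factor 2 and prove
  -- nothing.
  have h3 : U.card.choose 2 ≤ 2 * k ^ 2 := by
    refine (Nat.choose_le_choose 2 hU).trans ?_
    rw [Nat.choose_two_right, Nat.div_le_iff_le_mul_add_pred (by norm_num)]
    have : 2 * k * (2 * k - 1) ≤ 2 * k * (2 * k) := Nat.mul_le_mul_left _ (by omega)
    nlinarith
  have h4 := h2.trans (Nat.mul_le_mul_right N h3)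
  have h5 : 0 < 2 * k ^ 2 := by omega
  refine Nat.le_of_mul_le_mul_left ?_ h5
  calc _ = 4 * k ^ 2 * _ := by rw [← mul_assoc]; congr 1; ring
    _ ≤ _ := h4

end


/-! ### The success probability and the bounds on words and space -/

section
open Classical

theorem one_le_mul_two_pow_numHash {ε : ℝ} (hε : 0 < ε) : 1 ≤ ε * 2 ^ numHash ε := by
  have h1 : Real.logb 2 (1 / ε) ≤ numHash ε := Nat.le_ceil _
  rw [Real.logb_le_iff_le_rpow (by norm_num) (by positivity), Real.rpow_natCast,
    div_le_iff₀ hε] at h1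
  linarith

/-- Failure requires all `t` coordinates to be bad, which happens for at most `(N / 2) ^ t ≤ ε * N ^
t` tuples. The argument is a count and so covers `t = 0` as well, where `ε ≥ 1` and the bound is
trivial. -/
theorem uniform_ge {ε : ℝ} (hε : 0 < ε) {t N : ℕ} (ht : 1 ≤ ε * 2 ^ t) [Nonempty (Fin N)] {bad : Finset (Fin N)}
    (hbad : 2 * bad.card ≤ N) {T : Set (Fin (t) → Fin N)}
    (hT : ∀ hs, (∃ i, hs i ∉ bad) → hs ∈ T) :
    ENNReal.ofReal (1 - ε) ≤ (PMF.uniformOfFintype (Fin (t) → Fin N)).toOuterMeasure T := by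
  have hN : 0 < N := Fin.pos_iff_nonempty.2 inferInstance
  have hNt : (0 : ℝ) < (N : ℝ) ^ t := by positivity
  have h1 : N ^ t ≤ Fintype.card T + bad.card ^ t := by
    have h2 : (Finset.univ : Finset (Fin t → Fin N)) ⊆ T.toFinset ∪ Fintype.piFinset fun _ => bad := by
      intro hs _
      rw [Finset.mem_union, Set.mem_toFinset, Fintype.mem_piFinset]
      by_cases h : ∃ i, hs i ∉ bad
      · exact .inl (hT hs h)
      · exact .inr fun i => not_not.1 fun hi => h ⟨i, hi⟩
    have h3 := (Finset.card_le_card h2).trans (Finset.card_union_le _ _)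
    simpa [Fintype.card_piFinset, Set.toFinset_card] using h3
  have h2 : (N : ℝ) ^ t ≤ Fintype.card T + (bad.card : ℝ) ^ t := by exact_mod_cast h1
  have h3 : (2 : ℝ) ^ t * (bad.card : ℝ) ^ t ≤ (N : ℝ) ^ t := by
    rw [← mul_pow]
    exact pow_le_pow_left₀ (by positivity) (by exact_mod_cast hbad) _
  have h5 : (bad.card : ℝ) ^ t ≤ ε * (N : ℝ) ^ t := by
    calc (bad.card : ℝ) ^ t ≤ (ε * 2 ^ t) * (bad.card : ℝ) ^ t :=
          le_mul_of_one_le_left (by positivity) ht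
      _ = ε * (2 ^ t * (bad.card : ℝ) ^ t) := by ring
      _ ≤ _ := mul_le_mul_of_nonneg_left h3 hε.le
  rw [PMF.toOuterMeasure_uniformOfFintype_apply]
  have h6 : (Fintype.card (Fin t → Fin N) : ENNReal) = ENNReal.ofReal ((N : ℝ) ^ t) := by
    rw [← Nat.cast_pow, ENNReal.ofReal_natCast]; simp
  have h7 : (Fintype.card T : ENNReal) = ENNReal.ofReal (Fintype.card T : ℝ) := by
    rw [ENNReal.ofReal_natCast]
  rw [h6, h7, ← ENNReal.ofReal_div_of_pos hNt]
  refine ENNReal.ofReal_le_ofReal ?_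
  rw [le_div_iff₀ hNt]
  linarith

/-- With `α` the set of tuples of indices, this turns the single random word into independent
uniform choices of the hash functions. -/
theorem uniformBelow_eq {α : Type} [Fintype α] [Nonempty α] {R : ℕ} (e : α ≃ Fin R) :
    Program.uniformBelow R = (PMF.uniformOfFintype α).map fun a => (e a).val := by
  cases R with
  | zero => exact (e (Classical.arbitrary α)).elim0
  | succ m =>
    rw [Program.uniformBelow]
    have : PMF.uniformOfFintype (Fin (m + 1)) = (PMF.uniformOfFintype α).map e := by
      ext z
      rw [PMF.map_apply, tsum_eq_single (e.symm z)]
      · simp [Fintype.card_congr e]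
      · intro a ha
        rw [if_neg]
        rintro rfl
        exact ha (by simp)
    rw [this, PMF.map_comp]
    rfl

end

section
variable {ε : ℝ} {n k : ℕ} {wt : Sym2 (Fin n) → ℝ} {S : List (Insertion n)} {G : SimpleGraph (Fin n)}

theorem four_mul_sq_pos (hk : 1 ≤ k) : 0 < 4 * k ^ 2 := by positivity

/-- The bounds needed by the program. -/
theorem bounds {t C : ℕ} (hk : 1 ≤ k) (hC : 4 * t + 14 ≤ C) :
    Enough ((n + k + 1) ^ C) ((t + 5) * (4 * k ^ 2)) n k (4 * k ^ 2) (2 * k) t (hashPrime n) ∧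
    4 * k ^ 2 + 2 * k + t + 4 ≤ (n + k + 1) ^ C ∧
    hashPrime n * hashPrime n ≤ (n + k + 1) ^ C ∧
    (hashPrime n * (hashPrime n - 1)) ^ t ≤ (n + k + 1) ^ C ∧
    17 * ((t + 5) * (4 * k ^ 2)) ≤ (n + k + 1) ^ C ∧ 20 ≤ (n + k + 1) ^ C := by
  set T := n + k + 1 with hT
  have hT2 : 2 ≤ T := by omega
  have hp1 := le_hashPrime n
  have hp2 : hashPrime n ≤ 2 * T := (hashPrime_le_two_mul n).trans (by omega)
  have hkT : k ≤ T := by omega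
  have hk2 : 1 ≤ k ^ 2 := Nat.one_le_pow _ _ hk
  have hkk : k ≤ k ^ 2 := Nat.le_self_pow (by norm_num) k
  -- All bounds except the one on the number of tuples of hash functions follow from this one. The
  -- constants are absorbed by powers of `T`, which is at least 2.
  have hmain : 80 * (t + 5) * T ^ 2 ≤ T ^ C := by
    have h1 : 80 * (t + 5) ≤ T ^ (t + 12) := by
      have h2 : t + 5 < 2 ^ (t + 5) := Nat.lt_two_pow_self
      calc 80 * (t + 5) ≤ 2 ^ 7 * 2 ^ (t + 5) := by omega
        _ = 2 ^ (t + 12) := by rw [← pow_add]; congr 1; omega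
        _ ≤ _ := Nat.pow_le_pow_left hT2 _
    calc _ ≤ T ^ (t + 12) * T ^ 2 := Nat.mul_le_mul_right _ h1
      _ = T ^ (t + 14) := by rw [← pow_add]
      _ ≤ _ := Nat.pow_le_pow_right (by omega) (by omega)
  have hkT2 : k ^ 2 ≤ T ^ 2 := Nat.pow_le_pow_left hkT _
  have hT4 : 4 ≤ T ^ 2 := by nlinarith
  have ht1 : (t + 5) * k ^ 2 ≤ (t + 5) * T ^ 2 := Nat.mul_le_mul_left _ hkT2
  have ht2 : (t + 5) * 1 ≤ (t + 5) * T ^ 2 := Nat.mul_le_mul_left _ (by omega)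
  have ht3 : 5 * T ^ 2 ≤ (t + 5) * T ^ 2 := Nat.mul_le_mul_right _ (by omega)
  have hM : (t + 5) * (4 * k ^ 2) = 4 * ((t + 5) * k ^ 2) := by ring
  have hmain' : 80 * ((t + 5) * T ^ 2) ≤ T ^ C := by rw [← mul_assoc]; exact hmain
  have hpp : hashPrime n * hashPrime n ≤ 4 * T ^ 2 := by nlinarith
  refine ⟨⟨by omega, by omega, by omega, by omega, by omega, ?_, le_rfl, ?_⟩, ?_, ?_, ?_, ?_, ?_⟩
  · have : hashPrime n * n + hashPrime n ≤ hashPrime n * hashPrime n := by nlinarith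
    omega
  · omega
  · omega
  · omega
  · have h1 : hashPrime n * (hashPrime n - 1) ≤ T ^ 4 := by
      have h2 : hashPrime n * (hashPrime n - 1) ≤ hashPrime n * hashPrime n :=
        Nat.mul_le_mul_left _ (by omega)
      have h3 : 4 * T ^ 2 ≤ T ^ 2 * T ^ 2 := Nat.mul_le_mul_right _ hT4
      have h4 : T ^ 2 * T ^ 2 = T ^ 4 := by ring
      omega
    calc _ ≤ (T ^ 4) ^ t := Nat.pow_le_pow_left h1 _
      _ = T ^ (4 * t) := by rw [← pow_mul]
      _ ≤ _ := Nat.pow_le_pow_right (by omega) (by omega)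
  · omega
  · omega

/-- One maximum matching is fixed before the random choice, so the hash functions need to separate
only one set of at most `2k` vertices. -/
theorem prob_isMax (hε : 0 < ε) (hr : 0 < 4 * k ^ 2) (hS : IsInsertStream S G wt)
    [Nonempty (Fin (hashPrime n * (hashPrime n - 1)))]
    {ret : (Fin (numHash ε) → Fin (hashPrime n * (hashPrime n - 1))) → Answer (Fin n)}
    (hret : ∀ h, WMatchInsReturns wt k S (fun i => hashFamily n (4 * k ^ 2) hr (h i)) (ret h))
    (hG : ∃ M, IsKMatching G.edgeSet k M) :
    ENNReal.ofReal (1 - ε) ≤ ((PMF.uniformOfFintype (Fin (numHash ε) →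
      Fin (hashPrime n * (hashPrime n - 1)))).map ret).toOuterMeasure
        {a | ∃ M, a = some M ∧ IsMaxWeightedKMatching G.edgeSet wt k M} := by
  classical
  obtain ⟨M, hM, hmax⟩ : ∃ M, IsMaxWeightedKMatching G.edgeSet wt k M := by
    obtain ⟨M0, h0⟩ := hG
    obtain ⟨M, hM, h⟩ := ((Finset.univ : Finset (Finset (Sym2 (Fin n)))).filter
      fun M => IsKMatching G.edgeSet k M).exists_max_image (weight wt) ⟨M0, by simpa using h0⟩
    exact ⟨M, (Finset.mem_filter.1 hM).2, fun M' hM' => h M' (by simpa using hM')⟩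
  set U := M.biUnion fun e => e.toFinset with hU
  have hUk : U.card ≤ 2 * k := by
    rw [mul_comm, ← hM.2.2]
    refine Finset.card_biUnion_le_card_mul _ _ 2 fun e _ => ?_
    rw [← mk_inf_sup e, Sym2.toFinset_mk_eq]
    exact Finset.card_le_two
  rw [PMF.toOuterMeasure_map_apply]
  refine uniform_ge hε (one_le_mul_two_pow_numHash hε) (two_mul_card_bad_le (n := n) (hr := hr) hUk) fun hs ⟨i, hi⟩ => ?_
  simp only [Finset.mem_filter, Finset.mem_univ, true_and, not_exists, not_and, not_not] at hi
  obtain ⟨M', h1, h2⟩ := (hret hs).isMax hS ⟨hM, hmax⟩ (i := i) fun e he e' he' u hu v hv huv =>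
    hi u (Finset.mem_biUnion.2 ⟨e, he, Sym2.mem_toFinset.2 hu⟩) v
      (Finset.mem_biUnion.2 ⟨e', he', Sym2.mem_toFinset.2 hv⟩) huv
  exact ⟨M', h1, h2⟩

end

end KMatch

open KMatch
theorem theorem3p5 (ε : ℝ) (hε : 0 < ε) :
    ∃ (P : Program) (C : ℕ), ∀ n k : ℕ, 1 ≤ k →
      ∃ (ι : Type) (_ : Fintype ι) (_ : Nonempty ι) (H : ι → Fin n → Fin (4 * k ^ 2)),
        IsUniversal H ∧
        ∀ (G : SimpleGraph (Fin n)) (wt : Sym2 (Fin n) → ℝ) (S : List (Insertion n)),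
          IsInsertStream S G wt →
          P.SpaceAtMost k S (C * k ^ 2) ∧
          P.UpdateTimeAtMost k S C ∧
          P.WordsAtMost k S ((n + k + 1) ^ C) ∧
          ∃ ret : (Fin (numHash ε) → ι) → Answer (Fin n),
            (∀ h, WMatchInsReturns wt k S (fun i => H (h i)) (ret h)) ∧
            ∃ μ : PMF (Answer (Fin n)),
              μ = (PMF.uniformOfFintype (Fin (numHash ε) → ι)).map ret ∧
              P.HasAnswerLaw k S μ ∧
              ((∃ M, IsKMatching G.edgeSet k M) →
                ENNReal.ofReal (1 - ε) ≤
                  μ.toOuterMeasure {a | ∃ M, a = some M ∧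
                    IsMaxWeightedKMatching G.edgeSet wt k M}) ∧
              ((¬ ∃ M, IsKMatching G.edgeSet k M) → μ = PMF.pure none) := by
  set t := numHash ε with ht
  set P := flat Lab.code (startL t) with hP
  -- The summands serve the registers, the two memories with `17 * 4 * (t + 5) * k ^ 2` cells each,
  -- the update time, and the exponent in the bound on words.
  set C := Fintype.card P.Reg + Fintype.card P.WReg + 136 * (t + 5) + 15 * (slices t + 20) +
    (4 * t + 14) with hC
  refine ⟨P, C, fun n k hk => ?_⟩
  have hr := four_mul_sq_pos hk
  have hp := le_hashPrime n
  have hN : 0 < hashPrime n * (hashPrime n - 1) := Nat.mul_pos (by omega) (by omega)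
  have hne : Nonempty (Fin (hashPrime n * (hashPrime n - 1))) := ⟨⟨0, hN⟩⟩
  refine ⟨Fin (hashPrime n * (hashPrime n - 1)), inferInstance, hne, hashFamily n (4 * k ^ 2) hr,
    isUniversal_hashFamily, fun G wt S hS => ?_⟩
  obtain ⟨b0, b1, b2, b3, b4, b5⟩ := bounds (n := n) (t := t) (C := C) hk (by omega)
  have hnd : ((recsOf S).map Prod.fst).Nodup := by
    rw [recsOf_eq hS, List.map_map]
    exact hS.nodup.map fun e e' h => ecode_inj h
  obtain ⟨hreach, ans, hspec, T, hlaw⟩ := law_program b0 b1 b2 b3 b4 b5 hnd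
  -- The equivalence encodes a tuple by its digits in base `p * (p - 1)`, the same digits that the
  -- program extracts, so the word for `hs` selects the functions with the indices `hs h`.
  have hdig : ∀ (hs : Fin t → Fin (hashPrime n * (hashPrime n - 1))) (h : Fin t) (x : Fin n),
      digitFn (hashPrime n) (4 * k ^ 2) (finFunctionFinEquiv hs).val h x =
        hashFamily n (4 * k ^ 2) hr (hs h) x := by
    intro hs h x
    have h1 : finFunctionFinEquiv.symm (finFunctionFinEquiv hs) h = hs h := by simp
    have h2 : (finFunctionFinEquiv hs).val / (hashPrime n * (hashPrime n - 1)) ^ h.val %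
        (hashPrime n * (hashPrime n - 1)) = (hs h).val := by
      rw [← h1]; rfl
    rw [digitFn_eq, h2]
    rfl
  have hex := fun hs : Fin t → Fin (hashPrime n * (hashPrime n - 1)) =>
    (hspec _ (finFunctionFinEquiv hs).2).returns hk hS (hdig hs)
  choose ret hret hans using hex
  refine ⟨⟨17 * ((t + 5) * (4 * k ^ 2)), 17 * ((t + 5) * (4 * k ^ 2)), ?_, fun c hc =>
    ⟨(hreach c hc).1.wordCell, (hreach c hc).1.weightCell⟩⟩, fun c hc a ha => ?_, fun c hc =>
    ⟨(hreach c hc).1.reg, (hreach c hc).1.mem⟩, ret, hret, _, rfl, ⟨T, ?_⟩,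
    fun hG => prob_isMax hε hr hS hret hG, fun hG => ?_⟩
  · have h1 : Fintype.card P.Reg + Fintype.card P.WReg ≤
        (Fintype.card P.Reg + Fintype.card P.WReg) * k ^ 2 :=
      Nat.le_mul_of_pos_right _ (Nat.pow_pos hk)
    calc _ ≤ (Fintype.card P.Reg + Fintype.card P.WReg) * k ^ 2 + 17 * ((t + 5) * (4 * k ^ 2)) +
          17 * ((t + 5) * (4 * k ^ 2)) := by omega
      _ = (Fintype.card P.Reg + Fintype.card P.WReg + 136 * (t + 5)) * k ^ 2 := by ring
      _ ≤ _ := Nat.mul_le_mul_right _ (by omega)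
  · exact ((hreach c hc).2 a ha).trans (by omega)
  · rw [hlaw, uniformBelow_eq (finFunctionFinEquiv (m := hashPrime n * (hashPrime n - 1)) (n := t)),
      PMF.map_comp, PMF.map_comp]
    congr 1
    funext hs
    exact congrArg some (hans hs)
  · have : ret = fun _ => none := funext fun h => (hret h).eq_none hS hG
    rw [this]
    exact PMF.map_const _ _
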